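/- Let $n\ge 2$ and write $x=(x',x_n)\in\mathbb R^{n-1}\times\mathbb R$, $\mathbb R^n_+=\{x_n>0\}$. Let $\psi$ be such that $y'\mapsto\psi(|y'|)$ belongs to $C_c^\infty(B'_1)$ (with $B'_r$ the ball of radius $r$ about $0$ in $\mathbb R^{n-1}$), $\psi\ge 0$, and $\psi(|y'|)>1$ for $|y'|<\tfrac12$. Let $\phi\in C^{\frac12+\frac\alpha2}([0,2))$ for some $0<\alpha<1$, with $\phi(0)=0$, $\phi$ nondecreasing on $(0,1)$ and nonincreasing on $(1,2)$, and set $\phi(s)=0$ for $s<0$. Put $$M(t)=\int_{-\infty}^t\frac{\phi(t)-\phi(s)}{(t-s)^{3/2}}\,ds ,\qquad g(y',s)=a\,\psi(|y'|)\,\phi(s)\,\mathbf e_n,\quad a>0 .$$ A solution of the Stokes system $w_t-\Delta w+\nabla p=0$, $\operatorname{div}w=0$ in $\mathbb R^n_+\times(0,2)$ with $w|_{t=0}=0$, $w|_{x_n=0}=g$ means the following. The field $w$ is continuous on $\overline{\mathbb R^n_+}\times[0,2)$ with these initial and boundary values, is Lipschitz in $x$ on $\overline{\mathbb R^n_+}$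 uniformly in $t$, is differentiable in $x$ and divergence free in $\mathbb R^n_+$, and $\int_0^t w(\cdot,s)\,ds\in C^2(\mathbb R^n_+)$ for each $t$; the momentum equation holds in the time-integrated form $$w(x,t)-\Delta\int_0^t w(x,s)\,ds+\nabla q(x,t)=0,\qquad x\in\mathbb R^n_+,\ 0\le t<2,$$ for some $q$ that is $C^1$ in $x$ (so $p=\partial_t q$ in the sense of distributions); and $|w(x,t)|+|\nabla q(x,t)|\le C(1+|x|)^{1-n}$ for a constant $C$. For a velocity component $w_i$, say that $(x',t)$ satisfies $\mathcal P^i_+$ (respectively $\mathcal P^i_-$) if there is $\epsilon>0$ with $w_i(x',x_n,t)>0$ (respectively $<0$) for all $0<x_n<\epsilon$. A point $(x',t^*)$ with $t^*>0$ is a boundary layer separation point of $w_i$ if $(x',t)$ satisfies $\mathcal P^i_+$ for all $0<t<t^*$ and there is a sequence $t_k>t^*$, $t_k\to t^*$, such that every $(x',t_k)$ satisfies $\mathcal P^i_-$. For every $a>0$ a solution $w$ exists. Moreover: (i) Suppose that $\phi>0$ on $(0,1)$ and that there are $1<t_0<t_1<2$ with $M(t)<0$ for all $t_0<t<t_1$.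 Then for every $\kappa>1$ there is a constant $c_*>0$, independent of $a$ and $w$, such that for every $a>0$, every solution $w$, every $1\le i\le n-1$ and every $x'$ with $c_*<|x'|<\kappa x_i$ there exists $t_i^*(x')\in(1,t_0)$ such that $(x',t_i^*(x'))$ is a boundary layer separation point of $w_i$; furthermore $(x',t_i^*(x'))$ satisfies $\mathcal P^i_+$. (ii) Suppose that there is $c_0>0$ with $M(t)>c_0$ for all $1<t<2$. Then for every $\kappa>1$ there is a constant $c_*>0$, independent of $a$ and $w$, such that for every $a>0$, every solution $w$, every $1\le i\le n-1$, every $x'$ with $c_*<|x'|<\kappa x_i$ and every $t\in(0,2)$, the point $(x',t)$ is not a boundary layer separation point of $w_i$. -/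

import Mathlib

open Set Filter Topology MeasureTheory
open scoped ContDiff

namespace HalfSpaceStokes

/-- The boundary space `ℝ^{n-1}`, where `n = d + 1`, with its Euclidean norm. -/
abbrev Bdry (d : ℕ) : Type := EuclideanSpace ℝ (Fin d)

/-- The space `ℝ^n = ℝ^{n-1} × ℝ`, `n = d + 1`; a point is `x = (x', x_n)`.
It is also the space in which the velocity `w = (w', w_n)` takes its values. -/
abbrev Space (d : ℕ) : Type := Bdry d × ℝ

/-- The open half-space `ℝ^n_+`. -/
def halfSpace (d : ℕ) : Set (Space d) := {x | 0 < x.2}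

/-- The closed half-space. -/
def closedHalfSpace (d : ℕ) : Set (Space d) := {x | 0 ≤ x.2}

/-- The tangential unit vector `e_i`, `1 ≤ i ≤ n - 1`. -/
noncomputable def tangent {d : ℕ} (i : Fin d) : Space d := (EuclideanSpace.single i 1, 0)

/-- The normal unit vector `e_n`. -/
def normal (d : ℕ) : Space d := (0, 1)

/-- `div u = ∑_{i<n} ∂_i u_i + ∂_n u_n`. -/
noncomputable def divergence {d : ℕ} (u : Space d → Space d) (x : Space d) : ℝ :=
  (∑ i : Fin d, (fderiv ℝ u x (tangent i)).1 i) + (fderiv ℝ u x (normal d)).2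

/-- `Δ u = ∑_{i<n} ∂_i² u + ∂_n² u`, for a vector field `u`. -/
noncomputable def vectorLaplacian {d : ℕ} (u : Space d → Space d) (x : Space d) : Space d :=
  (∑ i : Fin d, iteratedFDeriv ℝ 2 u x ![tangent i, tangent i]) +
    iteratedFDeriv ℝ 2 u x ![normal d, normal d]

/-- `∇ q = (∂_1 q, …, ∂_{n-1} q, ∂_n q)`. -/
noncomputable def grad {d : ℕ} (q : Space d → ℝ) (x : Space d) : Space d :=
  (WithLp.toLp 2 fun i : Fin d => fderiv ℝ q x (tangent i), fderiv ℝ q x (normal d))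

/-- `∫_0^t w(x, s) ds`. -/
noncomputable def timePrimitive {d : ℕ} (w : ℝ → Space d → Space d) (t : ℝ) (x : Space d) :
    Space d :=
  ∫ s in (0 : ℝ)..t, w s x

/-- `w` (with `w t x` the velocity at time `t` and position `x`) solves the Stokes system
`w_t - Δ w + ∇ p = 0`, `div w = 0` in `ℝ^n_+ × (0, T)` with `w|_{t=0} = 0` and `w|_{x_n=0} = g`.

For boundary data that are merely Hölder continuous in time, `w_t` and the pressure `p` exist only
as distributions in time, so the momentum equation is integrated over `(0, t)`:
`w(x,t) - Δ ∫_0^t w(x,s) ds + ∇ q(x,t) = 0`, where `q(x,t)` is the time primitive of the pressure,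
`p = ∂_t q`.  The solution is Lipschitz in space up to the boundary, uniformly in time; and, as the
Stokes system in the half-space with given data has further, nondecaying solutions (shear flows
driven by a pressure that is affine in `x`), the velocity and `∇ q` decay like `|x|^{1-n}`. -/
structure IsStokesSolution {d : ℕ} (T : ℝ) (g : ℝ → Bdry d → Space d)
    (w : ℝ → Space d → Space d) : Prop where
  continuousOn :
    ContinuousOn (fun z : ℝ × Space d => w z.1 z.2) (Ico 0 T ×ˢ closedHalfSpace d)
  lipschitzOn : ∃ K : NNReal, ∀ t ∈ Ico 0 T, LipschitzOnWith K (w t) (closedHalfSpace d)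
  differentiableOn : ∀ t ∈ Ico 0 T, DifferentiableOn ℝ (w t) (halfSpace d)
  contDiffOn_timePrimitive : ∀ t ∈ Ico 0 T, ContDiffOn ℝ 2 (timePrimitive w t) (halfSpace d)
  momentum : ∃ q : ℝ → Space d → ℝ,
    (∀ t ∈ Ico 0 T, ContDiffOn ℝ 1 (q t) (halfSpace d)) ∧
    (∃ C : ℝ, ∀ t ∈ Ico 0 T, ∀ x ∈ halfSpace d, ‖grad (q t) x‖ ≤ C / (1 + ‖x‖) ^ d) ∧
    ∀ t ∈ Ico 0 T, ∀ x ∈ halfSpace d,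
      w t x - vectorLaplacian (timePrimitive w t) x + grad (q t) x = 0
  div_eq_zero : ∀ t ∈ Ico 0 T, ∀ x ∈ halfSpace d, divergence (w t) x = 0
  initial : ∀ x ∈ closedHalfSpace d, w 0 x = 0
  boundary : ∀ t ∈ Ico 0 T, ∀ x' : Bdry d, w t (x', 0) = g t x'
  decay : ∃ C : ℝ, ∀ t ∈ Ico 0 T, ∀ x ∈ closedHalfSpace d, ‖w t x‖ ≤ C / (1 + ‖x‖) ^ d

/-- The boundary data `g(y', s) = a ψ(|y'|) φ(s) e_n`. -/
noncomputable def boundaryData {d : ℕ} (a : ℝ) (ψ φ : ℝ → ℝ) (s : ℝ) (y' : Bdry d) : Space d :=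
  (a * ψ ‖y'‖ * φ s) • normal d

/-- `y' ↦ ψ(|y'|)` is in `C_c^∞(B'_1)`, is nonnegative, and exceeds `1` in `B'_{1/2}`. -/
structure IsSpatialProfile (d : ℕ) (ψ : ℝ → ℝ) : Prop where
  contDiff : ContDiff ℝ ∞ fun y' : Bdry d => ψ ‖y'‖
  tsupport_subset : tsupport (fun y' : Bdry d => ψ ‖y'‖) ⊆ Metric.ball 0 1
  nonneg : ∀ y' : Bdry d, 0 ≤ ψ ‖y'‖
  one_lt : ∀ y' ∈ Metric.ball (0 : Bdry d) (1 / 2), 1 < ψ ‖y'‖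

/-- `φ ∈ C^{1/2 + α/2}([0,2))` for some `0 < α < 1`, `φ(0) = 0`, `φ` is increasing on `(0,1)` and
decreasing on `(1,2)` (not necessarily strictly); `φ` is extended by zero to negative times. -/
structure IsTemporalProfile (φ : ℝ → ℝ) : Prop where
  holder : ∃ α : ℝ, 0 < α ∧ α < 1 ∧ ∃ C : ℝ, ∀ s ∈ Ico (0 : ℝ) 2, ∀ t ∈ Ico (0 : ℝ) 2,
    |φ s - φ t| ≤ C * |s - t| ^ (1 / 2 + α / 2)
  monotoneOn : MonotoneOn φ (Ioo 0 1)
  antitoneOn : AntitoneOn φ (Ioo 1 2)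
  zero : φ 0 = 0
  eq_zero_of_neg : ∀ s < 0, φ s = 0

/-- `M(t) = ∫_{-∞}^t (φ(t) - φ(s)) / (t - s)^{3/2} ds`. -/
noncomputable def M (φ : ℝ → ℝ) (t : ℝ) : ℝ :=
  ∫ s in Iio t, (φ t - φ s) / (t - s) ^ (3 / 2 : ℝ)

/-- The tangential velocity component `w_i`, `1 ≤ i ≤ n - 1`. -/
def tangentialComponent {d : ℕ} (w : ℝ → Space d → Space d) (i : Fin d) (t : ℝ) (x : Space d) :
    ℝ :=
  (w t x).1 i

/-- Condition `P_+` at `(x', t)` for a scalar function `f` (a velocity component). -/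
def PPlus {d : ℕ} (f : ℝ → Space d → ℝ) (x' : Bdry d) (t : ℝ) : Prop :=
  ∃ ε > 0, ∀ xn : ℝ, 0 < xn → xn < ε → 0 < f t (x', xn)

/-- Condition `P_-` at `(x', t)`. -/
def PMinus {d : ℕ} (f : ℝ → Space d → ℝ) (x' : Bdry d) (t : ℝ) : Prop :=
  ∃ ε > 0, ∀ xn : ℝ, 0 < xn → xn < ε → f t (x', xn) < 0

/-- `(x', tstar)` is a boundary layer separation point of `f`. -/
def IsSeparationPoint {d : ℕ} (f : ℝ → Space d → ℝ) (x' : Bdry d) (tstar : ℝ) : Prop :=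
  0 < tstar ∧ (∀ t, 0 < t → t < tstar → PPlus f x' t) ∧
    ∃ τ : ℕ → ℝ, (∀ k, tstar < τ k) ∧ Tendsto τ atTop (𝓝 tstar) ∧ ∀ k, PMinus f x' (τ k)

end HalfSpaceStokes

open HalfSpaceStokes

/-! Explicit solution. Extend `φ` to a continuous `θ`, and write `L = |∇'|`, `H = (∂_t - Δ')^{1/2}`
and `x = x_n`. In Fourier–Laplace variables the decaying solution with data `θψ e_n` is `w_i = ∂_i
H/(L(H-L)) (e^{-Hx} - e^{-Lx}) θψ` and `w_n = (H e^{-Lx} - L e^{-Hx})/(H-L) θψ`. Since `∂_t = H² -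
L²`, the factor `H/(L(H-L))` equals `∂_t^{-1} H² (L^{-1} + H^{-1})`, and `∂_t^{-1} H²` turns `θψ`
into `θψ - Θ Δ'ψ` with `Θ = ∫_0^t θ`. This is why every block of `tang` and `nrm` pairs `θ` with `f`
and `Θ` with `Δ'f`. In the variable `v = √τ` the remaining multipliers are integrals of a
one-dimensional Gaussian `ker` against `e^{v²Δ'}`: `potA` is `L^{-1} e^{-Lx}`, `potC` is `H^{-1}
e^{-Hx}`, `potP` is `L^{-1} H^{-1} e^{-Lx}` and `potD` is `L^{-1} H^{-1} e^{-Hx}`, the index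
counting normal derivatives. The blocks in `e^{-Lx}` are harmonic and form `-∇q`. The blocks in
`e^{-Hx}` are caloric. This yields the momentum equation.

Uniqueness. The time primitive `U` of the difference of two solutions satisfies `∂_t U - ΔU + ∇q =
0` and `div U = 0`, and vanishes on the wall. A local energy inequality with a cutoff at radius `R`
has a boundary error that stays bounded as `R → ∞`, because velocity and `∇q` decay like `|x|^{-d}`
and `R^{d+1} ≤ (1+R)^{2d}` for `d ≥ 1`. Hence `U` is square integrable, uniformly in time. Summing
the inequality over `n²` disjoint dyadic shells, with weight `n` in the Cauchy–Schwarz step, gives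
`n² ∫|U|² = O(n)`, so `U = 0` (`NullFlow.integral_innerBall_eq_zero`). Every solution is therefore
the explicit one, and the constant `c_*` depends neither on `a` nor on the solution.

Wall shear. Away from the support of `ψ`, only one block of `∂_n w_i` survives at the wall, and its
limit is `π^{-1/2} ∫_0^∞ v^{-2} (θ(t) r(0) - θ(t-v²) r(v)) dv` with `r(v) = -∂_i L^{-1} e^{v²Δ'} ψ`
(`tendsto_potD_two`, `wallShear_eq`). This integral is `r(0) M(t)/2` minus the lag `∫ v^{-2} θ(t-v²)
(r(v) - r(0)) dv`. In the cone `|x'| < κ x_i`, far out, `r(0)` is positive and at least of order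
`|x'|^{-d}`, while `r(v) - r(0)` lies between `c v² |x'|^{-d-2}` and `C v² |x'|^{-d-1}`
(`exists_halfInt_bounds`, `abs_halfInt_sub_le`). The lag is thus small compared with `r(0)`, but
positive as long as `θ(t) > 0`.

Signs. For `t ≤ 1` with `θ(t) > 0` the shear is positive. On `[1, t_0]` it is negative whenever
`M(t) ≤ 0`: either `θ(t) > 0` and the lag is strictly positive, or `θ(t) ≤ 0` and then `M(t)` is
bounded away from zero. The separation time is the first time at which the shear turns negative. If
the shear vanishes there, the sign of `w_i` comes from the next order: `∂_n w_i` grows at least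
linearly in `x_n`, with a slope of order `θ(t) |x'|^{-d-2}`, which dominates the `|x'|^{-d-3}` error
(`exists_solT_pos_of_nonneg`). In case (ii) the term `r(0) M(t)/2` dominates the lag, so `w_i` is
nonnegative near the wall at all times other than `t = 1`. That is enough, because a sequence
decreasing to `t^*` eventually avoids `1`. -/

namespace HalfSpaceStokes

/-! ### Smooth functions supported in the unit ball and Gaussian averages -/

/-- The unit vector `e_i` of the boundary space. -/
noncomputable abbrev unitVec {d : ℕ} (i : Fin d) : Bdry d := EuclideanSpace.single i 1

/-- The partial derivative `∂_i f`. -/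
noncomputable def pd {d : ℕ} (i : Fin d) (f : Bdry d → ℝ) (x : Bdry d) : ℝ :=
  fderiv ℝ f x (unitVec i)

/-- The Laplacian of a scalar function on the boundary space. -/
noncomputable def lap {d : ℕ} (f : Bdry d → ℝ) (x : Bdry d) : ℝ := ∑ i, pd i (pd i f) x

/-- `f ∈ C_c^∞(B'_1)`. -/
structure IsBump {d : ℕ} (f : Bdry d → ℝ) : Prop where
  contDiff : ContDiff ℝ ∞ f
  tsupport_subset : tsupport f ⊆ Metric.ball 0 1

namespace IsBump

variable {d : ℕ} {f g : Bdry d → ℝ}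

theorem eq_zero (hf : IsBump f) {x : Bdry d} (hx : 1 ≤ ‖x‖) : f x = 0 := by
  apply image_eq_zero_of_notMem_tsupport
  intro h
  have := hf.tsupport_subset h
  rw [mem_ball_zero_iff] at this
  linarith

theorem hasCompactSupport (hf : IsBump f) : HasCompactSupport f :=
  (isCompact_closedBall (0 : Bdry d) 1).of_isClosed_subset (isClosed_tsupport f)
    (hf.tsupport_subset.trans Metric.ball_subset_closedBall)

theorem continuous (hf : IsBump f) : Continuous f := hf.contDiff.continuous

theorem differentiable (hf : IsBump f) : Differentiable ℝ f :=
  hf.contDiff.differentiable (by simp)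

theorem exists_bound (hf : IsBump f) : ∃ B, 0 ≤ B ∧ ∀ x, |f x| ≤ B := by
  obtain ⟨C, hC⟩ := hf.hasCompactSupport.exists_bound_of_continuous hf.continuous
  exact ⟨C, (norm_nonneg _).trans (hC 0), fun x => hC x⟩

theorem pd (hf : IsBump f) (i : Fin d) : IsBump (pd i f) where
  contDiff := (hf.contDiff.fderiv_right (m := ∞) (by simp)).clm_apply contDiff_const
  tsupport_subset := (tsupport_fderiv_apply_subset ℝ _).trans hf.tsupport_subset

theorem add (hf : IsBump f) (hg : IsBump g) : IsBump (fun x => f x + g x) where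
  contDiff := hf.contDiff.add hg.contDiff
  tsupport_subset := (tsupport_add f g).trans (union_subset hf.tsupport_subset hg.tsupport_subset)

theorem zero : IsBump (fun _ : Bdry d => (0 : ℝ)) where
  contDiff := contDiff_const
  tsupport_subset := by simp [tsupport]

theorem sum {ι : Type*} (s : Finset ι) {F : ι → Bdry d → ℝ} (hF : ∀ i, IsBump (F i)) :
    IsBump (fun x => ∑ i ∈ s, F i x) := by
  classical
  induction s using Finset.induction_on with
  | empty => simpa using zero
  | insert a s ha ih => simpa [Finset.sum_insert ha] using (hF a).add ih

theorem lap (hf : IsBump f) : IsBump (lap f) := sum _ fun i => (hf.pd i).pd i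

end IsBump

theorem fderiv_eq_sum_pd {d : ℕ} (f : Bdry d → ℝ) (x : Bdry d) :
    fderiv ℝ f x = ∑ i, pd i f x • (EuclideanSpace.proj i : Bdry d →L[ℝ] ℝ) := by
  ext v
  have hv : v = ∑ i, v i • unitVec i := by
    ext j
    simp [unitVec, Pi.single_apply]
  conv_lhs => rw [hv]
  simp only [map_sum, map_smul, sum_apply, smul_apply,
    smul_eq_mul, pd]
  exact Finset.sum_congr rfl fun i _ => by simp [mul_comm]

theorem pd_comm {d : ℕ} (i j : Fin d) {f : Bdry d → ℝ} (hf : ContDiff ℝ ∞ f) :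
    pd i (pd j f) = pd j (pd i f) := by
  funext x
  have h2 : DifferentiableAt ℝ (fderiv ℝ f) x :=
    ((hf.fderiv_right (m := ∞) (by simp)).differentiable (by simp)) x
  have hs : IsSymmSndFDerivAt ℝ f x := hf.contDiffAt.isSymmSndFDerivAt (by
    simp only [minSmoothness_of_isRCLikeNormedField]; exact WithTop.coe_le_coe.2 le_top)
  have key : ∀ k l : Fin d, pd k (pd l f) x
      = fderiv ℝ (fderiv ℝ f) x (unitVec k) (unitVec l) := by
    intro k l
    have : HasFDerivAt (pd l f) ((ContinuousLinearMap.apply ℝ ℝ (unitVec l)).comp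
        (fderiv ℝ (fderiv ℝ f) x)) x :=
      (ContinuousLinearMap.apply ℝ ℝ (unitVec l)).hasFDerivAt.comp x h2.hasFDerivAt
    rw [pd, this.fderiv]
    simp
  rw [key, key]
  exact hs.eq _ _

theorem pd_lap {d : ℕ} (i : Fin d) {f : Bdry d → ℝ} (hf : IsBump f) :
    pd i (lap f) = lap (pd i f) := by
  funext x
  have h : HasFDerivAt (lap f) (∑ j, fderiv ℝ (pd j (pd j f)) x) x :=
    HasFDerivAt.fun_sum fun j _ => (((hf.pd j).pd j).differentiable x).hasFDerivAt
  rw [pd, h.fderiv, sum_apply]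
  refine Finset.sum_congr rfl fun j _ => ?_
  change pd i (pd j (pd j f)) x = pd j (pd j (pd i f)) x
  rw [pd_comm i j (hf.pd j).contDiff, pd_comm i j hf.contDiff]

theorem pow_mul_exp_neg_sq_le (k : ℕ) {c : ℝ} (hc : 0 < c) :
    ∃ C, 0 < C ∧ ∀ y : ℝ, 0 ≤ y → (1 + y) ^ k * Real.exp (-c * y ^ 2) ≤ C := by
  refine ⟨k.factorial * Real.exp (1 + 1 / (4 * c)), by positivity, fun y hy => ?_⟩
  have h1 : (1 + y) ^ k ≤ k.factorial * Real.exp (1 + y) := by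
    have := Real.pow_div_factorial_le_exp (1 + y) (by linarith) k
    rw [div_le_iff₀ (by positivity)] at this
    linarith
  have h2 : 1 + y + -c * y ^ 2 ≤ 1 + 1 / (4 * c) := by
    have : 0 ≤ c * (y - 1 / (2 * c)) ^ 2 := by positivity
    have e : c * (y - 1 / (2 * c)) ^ 2 = c * y ^ 2 - y + 1 / (4 * c) := by field_simp; ring
    linarith
  calc (1 + y) ^ k * Real.exp (-c * y ^ 2)
      ≤ k.factorial * Real.exp (1 + y) * Real.exp (-c * y ^ 2) := by gcongr
    _ = k.factorial * Real.exp (1 + y + -c * y ^ 2) := by rw [Real.exp_add (1 + y)]; ring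
    _ ≤ _ := by gcongr

/-- `e^{-c(r/v)²}` is bounded by every power of `v / (v + r)`. -/
theorem exp_neg_div_sq_le (k : ℕ) {c : ℝ} (hc : 0 < c) :
    ∃ C, 0 < C ∧ ∀ v r : ℝ, 0 < v → 0 ≤ r →
      Real.exp (-c * (r / v) ^ 2) ≤ C * (v / (v + r)) ^ k := by
  obtain ⟨C, hC, h⟩ := pow_mul_exp_neg_sq_le k hc
  refine ⟨C, hC, fun v r hv hr => ?_⟩
  have h1 := h (r / v) (by positivity)
  have h2 : (v / (v + r)) ^ k = ((1 + r / v) ^ k)⁻¹ := by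
    rw [← inv_pow]; congr 1; field_simp
  rw [h2, ← div_eq_mul_inv, le_div_iff₀ (by positivity)]
  linarith

section Gauss

variable {d : ℕ}

theorem integrable_exp_neg_sq_norm {c : ℝ} (hc : 0 < c) :
    Integrable fun z : Bdry d => Real.exp (-c * ‖z‖ ^ 2) := by
  by_contra h
  have h1 := GaussianFourier.integral_rexp_neg_mul_sq_norm (V := Bdry d) hc
  rw [integral_undef h] at h1
  have : 0 < (Real.pi / c) ^ (Module.finrank ℝ (Bdry d) / 2 : ℝ) := by positivity
  linarith

/-- The total mass of `e^{-|z|²/4}`. -/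
noncomputable def gaussMass (d : ℕ) : ℝ := ∫ z : Bdry d, Real.exp (-(1 / 4) * ‖z‖ ^ 2)

theorem gaussMass_pos : 0 < gaussMass d := by
  rw [gaussMass, GaussianFourier.integral_rexp_neg_mul_sq_norm (by norm_num)]
  positivity

/-- The heat kernel of the boundary space at time `1`. -/
noncomputable def gauss (z : Bdry d) : ℝ := Real.exp (-(1 / 4) * ‖z‖ ^ 2) / gaussMass d

theorem integral_gauss : ∫ z : Bdry d, gauss z = 1 := by
  simp only [gauss]
  rw [integral_div]
  exact div_self gaussMass_pos.ne'

theorem gauss_pos (z : Bdry d) : 0 < gauss z := div_pos (Real.exp_pos _) gaussMass_pos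

theorem contDiff_gauss : ContDiff ℝ ∞ (gauss : Bdry d → ℝ) := by
  unfold gauss
  exact ((contDiff_const.mul (contDiff_norm_sq ℝ)).exp).div_const _

/-- A continuous function with Gaussian decay. -/
structure GaussBound (κ : Bdry d → ℝ) : Prop where
  continuous : Continuous κ
  bound : ∃ A, 0 ≤ A ∧ ∀ z, |κ z| ≤ A * Real.exp (-(1 / 8) * ‖z‖ ^ 2)

theorem gaussBound_of_poly {κ : Bdry d → ℝ} (h : Continuous κ) {A : ℝ} (k : ℕ) (hA : 0 ≤ A)
    (hκ : ∀ z, |κ z| ≤ A * (1 + ‖z‖) ^ k * gauss z) : GaussBound κ := by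
  obtain ⟨C, hC, hk⟩ := pow_mul_exp_neg_sq_le k (c := 1 / 8) (by norm_num)
  refine ⟨h, A * C / gaussMass d, by have := gaussMass_pos (d := d); positivity, fun z => ?_⟩
  refine (hκ z).trans ?_
  have h1 := hk ‖z‖ (norm_nonneg _)
  have e : gauss z = Real.exp (-(1 / 8) * ‖z‖ ^ 2) * Real.exp (-(1 / 8) * ‖z‖ ^ 2) / gaussMass d := by
    rw [gauss, ← Real.exp_add]; congr 2; ring
  rw [e]
  have hm := gaussMass_pos (d := d)
  calc A * (1 + ‖z‖) ^ k * (Real.exp (-(1 / 8) * ‖z‖ ^ 2) * Real.exp (-(1 / 8) * ‖z‖ ^ 2) / gaussMass d)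
      = (A / gaussMass d * Real.exp (-(1 / 8) * ‖z‖ ^ 2)) *
        ((1 + ‖z‖) ^ k * Real.exp (-(1 / 8) * ‖z‖ ^ 2)) := by ring
    _ ≤ (A / gaussMass d * Real.exp (-(1 / 8) * ‖z‖ ^ 2)) * C := by gcongr
    _ = _ := by ring

theorem GaussBound.integrable {κ : Bdry d → ℝ} (h : GaussBound κ) : Integrable κ := by
  obtain ⟨A, _, hA⟩ := h.bound
  exact ((integrable_exp_neg_sq_norm (by norm_num : (0 : ℝ) < 1 / 8)).const_mul A).mono'
    h.continuous.aestronglyMeasurable (ae_of_all _ hA)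

/-- The average `∫ κ(z) f(x - v z) dz`. -/
noncomputable def avg (κ f : Bdry d → ℝ) (v : ℝ) (x : Bdry d) : ℝ := ∫ z, κ z * f (x - v • z)

theorem integrable_avg {κ f : Bdry d → ℝ} (hκ : GaussBound κ) (hf : Continuous f) {B : ℝ}
    (hB : ∀ x, |f x| ≤ B) (v : ℝ) (x : Bdry d) : Integrable fun z => κ z * f (x - v • z) :=
  hκ.integrable.mul_bdd (c := B)
    (hf.comp (continuous_const.sub (continuous_id.const_smul v))).aestronglyMeasurable
    (ae_of_all _ fun _ => hB _)

theorem abs_avg_le {κ : Bdry d → ℝ} (hκ : GaussBound κ) :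
    ∃ C, 0 ≤ C ∧ ∀ f : Bdry d → ℝ, Continuous f → ∀ B, (∀ x, |f x| ≤ B) → ∀ v x,
      |avg κ f v x| ≤ C * B := by
  refine ⟨∫ z : Bdry d, |κ z|, integral_nonneg fun _ => abs_nonneg _, fun f hf B hB v x => ?_⟩
  have e : (∫ z : Bdry d, |κ z|) * B = ∫ z : Bdry d, |κ z| * B := (integral_mul_const _ _).symm
  rw [avg, e, ← Real.norm_eq_abs]
  refine norm_integral_le_of_norm_le (hκ.integrable.abs.mul_const B) (ae_of_all _ fun z => ?_)
  rw [Real.norm_eq_abs, abs_mul]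
  gcongr
  exact hB _

/-- As a function of `z`, the factor `f (x - v z)` lives in the ball of radius `1/v` about `x/v`,
whose volume is of order `v^{-d}`. When `|x| ≥ 2` this ball lies in `|z| ≥ |x|/(2v)`, where the
Gaussian bound of `κ` is at most `e^{-(|x|/v)²/32}`. -/
theorem abs_avg_le_pow {κ : Bdry d → ℝ} (hκ : GaussBound κ) :
    ∃ C, 0 ≤ C ∧ ∀ f : Bdry d → ℝ, Continuous f → (∀ x, 1 ≤ ‖x‖ → f x = 0) →
      ∀ B, (∀ x, |f x| ≤ B) → ∀ v x, 0 < v →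
      |avg κ f v x| ≤ C * B / v ^ d ∧
      (2 ≤ ‖x‖ → |avg κ f v x| ≤ C * B / v ^ d * Real.exp (-(1 / 32) * (‖x‖ / v) ^ 2)) := by
  obtain ⟨A, hA0, hA⟩ := hκ.bound
  set V := volume.real (Metric.ball (0 : Bdry d) 1) with hV
  have hV0 : 0 ≤ V := measureReal_nonneg
  refine ⟨A * V, by positivity, fun f hf hf0 B hB v x hv => ?_⟩
  have hB0 : 0 ≤ B := (abs_nonneg _).trans (hB 0)
  set S := Metric.ball (v⁻¹ • x) v⁻¹ with hS
  have hvol : volume.real S = V / v ^ d := by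
    rw [hS, measureReal_def, Measure.addHaar_ball_of_pos _ _ (by positivity), ENNReal.toReal_mul,
      ENNReal.toReal_ofReal (by positivity)]
    simp [hV, measureReal_def]
    field_simp
  have hout : ∀ z, z ∉ S → f (x - v • z) = 0 := by
    intro z hz
    apply hf0
    rw [hS, Metric.mem_ball, dist_eq_norm, not_lt] at hz
    have : x - v • z = -(v • (z - v⁻¹ • x)) := by
      rw [smul_sub, smul_smul, mul_inv_cancel₀ hv.ne', one_smul]; abel
    rw [this, norm_neg, norm_smul, Real.norm_of_nonneg hv.le]
    calc (1 : ℝ) = v * v⁻¹ := by field_simp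
      _ ≤ _ := by gcongr
  have main : ∀ b, 0 ≤ b → (∀ z ∈ S, Real.exp (-(1 / 8) * ‖z‖ ^ 2) ≤ b) →
      |avg κ f v x| ≤ A * V * B / v ^ d * b := by
    intro b hb hbS
    have e : avg κ f v x = ∫ z in S, κ z * f (x - v • z) := by
      rw [avg, ← integral_indicator Metric.isOpen_ball.measurableSet]
      congr 1
      funext z
      by_cases hz : z ∈ S
      · rw [indicator_of_mem hz]
      · rw [indicator_of_notMem hz, hout z hz, mul_zero]
    rw [e]
    have := norm_setIntegral_le_of_norm_le_const (μ := volume) (s := S)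
      (f := fun z => κ z * f (x - v • z)) (C := A * b * B) measure_ball_lt_top (fun z hz => by
        rw [norm_mul]
        have h1 : ‖κ z‖ ≤ A * b := (hA z).trans (by gcongr; exact hbS z hz)
        have h2 : ‖f (x - v • z)‖ ≤ B := hB _
        gcongr)
    rw [Real.norm_eq_abs, hvol] at this
    refine this.trans (le_of_eq ?_)
    ring
  refine ⟨?_, fun hx => main _ (Real.exp_pos _).le fun z hz => ?_⟩
  · have := main 1 zero_le_one fun z _ => by
      rw [Real.exp_le_one_iff]; nlinarith [sq_nonneg ‖z‖]
    simpa using this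
  · apply Real.exp_le_exp.2
    rw [hS, Metric.mem_ball, dist_eq_norm] at hz
    have h1 : ‖x‖ / v ≤ ‖z‖ + v⁻¹ := by
      have e1 : ‖v⁻¹ • x‖ = ‖x‖ / v := by
        rw [norm_smul, norm_inv, Real.norm_of_nonneg hv.le]; field_simp
      have h3 := norm_sub_norm_le (v⁻¹ • x) z
      have h4 := norm_sub_rev z (v⁻¹ • x)
      rw [e1] at h3
      linarith
    have h2 : v⁻¹ ≤ ‖x‖ / v / 2 := by
      rw [div_div, inv_eq_one_div, div_le_div_iff₀ hv (by positivity)]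
      nlinarith
    have h3 : ‖x‖ / v / 2 ≤ ‖z‖ := by linarith
    have h5 : (‖x‖ / v / 2) ^ 2 ≤ ‖z‖ ^ 2 := by gcongr
    nlinarith

/-- Far from the support, averages decay faster than any power of `v`. -/
theorem abs_avg_le_far {κ f : Bdry d → ℝ} (hκ : GaussBound κ) (hf : IsBump f) (k : ℕ) :
    ∃ C, 0 ≤ C ∧ ∀ v x, 0 < v → 2 ≤ ‖x‖ → |avg κ f v x| ≤ C * v ^ k / (v + ‖x‖) ^ (d + k) := by
  obtain ⟨C, hC, h⟩ := abs_avg_le_pow hκ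
  obtain ⟨B, hB0, hB⟩ := hf.exists_bound
  obtain ⟨C', hC', h'⟩ := exp_neg_div_sq_le (d + k) (c := 1 / 32) (by norm_num)
  refine ⟨C * B * C', by positivity, fun v x hv hx => ?_⟩
  refine ((h f hf.continuous (fun _ => hf.eq_zero) B hB v x hv).2 hx).trans ?_
  have h1 := h' v ‖x‖ hv (norm_nonneg x)
  calc _ ≤ C * B / v ^ d * (C' * (v / (v + ‖x‖)) ^ (d + k)) := by gcongr
    _ = _ := by rw [div_pow, pow_add v]; field_simp

/-- Integration by parts in `z` moves the derivative from the bump to the kernel. The chain rule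
costs one factor `v⁻¹`, and this is the source of the extra decay at large times. -/
theorem avg_pd {κ f : Bdry d → ℝ} (i : Fin d) (hκd : ContDiff ℝ ∞ κ) (hκ : GaussBound κ)
    (hκ' : GaussBound (pd i κ)) (hf : IsBump f) {v : ℝ} (hv : 0 < v) (x : Bdry d) :
    avg κ (pd i f) v x = v⁻¹ * avg (pd i κ) f v x := by
  obtain ⟨B, _, hB⟩ := hf.exists_bound
  obtain ⟨B', _, hB'⟩ := (hf.pd i).exists_bound
  have hF : ∀ z, HasFDerivAt (fun z => f (x - v • z)) (-(v • fderiv ℝ f (x - v • z))) z := by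
    intro z
    have h1 : HasFDerivAt (fun z : Bdry d => x - v • z)
        (-(v • ContinuousLinearMap.id ℝ (Bdry d))) z := by
      simpa using ((hasFDerivAt_id z).const_smul v).const_sub x
    have := (hf.differentiable (x - v • z)).hasFDerivAt.comp z h1
    refine this.congr_fderiv ?_
    ext; simp
  have e : ∀ z, fderiv ℝ (fun z => f (x - v • z)) z (unitVec i) = -(v * pd i f (x - v • z)) := by
    intro z; rw [(hF z).fderiv]; simp [pd]
  have key := integral_mul_fderiv_eq_neg_fderiv_mul_of_integrable (μ := (volume : Measure (Bdry d)))
    (f := κ) (g := fun z => f (x - v • z)) (v := unitVec i)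
    (integrable_avg hκ' hf.continuous hB v x)
    (by
      simp only [e]
      have := (integrable_avg hκ (hf.pd i).continuous hB' v x).const_mul (-v)
      refine this.congr (ae_of_all _ fun z => ?_)
      simp only; ring)
    (integrable_avg hκ hf.continuous hB v x)
    (fun z _ => hκd.differentiable (by simp) z) (fun z _ => (hF z).differentiableAt)
  simp only [e] at key
  have e2 : ∫ z, κ z * -(v * pd i f (x - v • z)) = -(v * avg κ (pd i f) v x) := by
    rw [avg, ← integral_const_mul, ← integral_neg]
    congr 1; funext z; ring
  rw [e2] at key
  have e3 : ∫ z, fderiv ℝ κ z (unitVec i) * f (x - v • z) = avg (pd i κ) f v x := rfl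
  rw [e3] at key
  field_simp
  linarith

theorem pd_gauss (i : Fin d) (z : Bdry d) : pd i gauss z = -(1 / 2) * z i * gauss z := by
  have h : HasFDerivAt (fun z : Bdry d => -(1 / 4) * ‖z‖ ^ 2)
      (-(1 / 4 : ℝ) • (2 • (innerSL ℝ z))) z :=
    ((hasStrictFDerivAt_norm_sq z).hasFDerivAt).const_mul _
  have h2 := (h.exp).mul_const (gaussMass d)⁻¹
  have e : (gauss : Bdry d → ℝ) = fun z => Real.exp (-(1 / 4) * ‖z‖ ^ 2) * (gaussMass d)⁻¹ := by
    funext z; rw [gauss, div_eq_mul_inv]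
  rw [pd, e, h2.fderiv]
  have h3 : inner ℝ z (unitVec i) = z i := by simp [unitVec, EuclideanSpace.inner_single_right]
  simp only [smul_apply, smul_eq_mul, innerSL_apply_apply, h3, nsmul_eq_mul]
  push_cast
  ring

theorem pd_pd_gauss (i j : Fin d) (z : Bdry d) :
    pd j (pd i gauss) z = (-(1 / 2) * (unitVec j : Bdry d) i + 1 / 4 * z i * z j) * gauss z := by
  have e : pd i (gauss : Bdry d → ℝ) = fun z => -(1 / 2) * z i * gauss z := by
    funext z; exact pd_gauss i z
  have h1 : HasFDerivAt (fun z : Bdry d => -(1 / 2) * z i)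
      (-(1 / 2 : ℝ) • (EuclideanSpace.proj i : Bdry d →L[ℝ] ℝ)) z :=
    ((EuclideanSpace.proj i : Bdry d →L[ℝ] ℝ).hasFDerivAt).const_mul _
  have h2 := h1.fun_mul (contDiff_gauss.differentiable (by simp) z).hasFDerivAt
  have h3 := pd_gauss j z
  rw [pd] at h3
  rw [pd, e, h2.fderiv]
  simp only [add_apply, smul_apply, smul_eq_mul, h3]
  have h4 : (EuclideanSpace.proj i : Bdry d →L[ℝ] ℝ) (unitVec j) = (unitVec j : Bdry d) i := rfl
  rw [h4]
  ring

theorem gaussBound_gauss : GaussBound (gauss : Bdry d → ℝ) :=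
  gaussBound_of_poly contDiff_gauss.continuous 0 zero_le_one fun z => by
    simp [abs_of_pos (gauss_pos z)]

theorem abs_coord_le (z : Bdry d) (i : Fin d) : |z i| ≤ ‖z‖ := PiLp.norm_apply_le z i

theorem contDiff_pd {κ : Bdry d → ℝ} (h : ContDiff ℝ ∞ κ) (i : Fin d) : ContDiff ℝ ∞ (pd i κ) :=
  (h.fderiv_right (m := ∞) (by simp)).clm_apply contDiff_const

theorem gaussBound_pd_gauss (i : Fin d) : GaussBound (pd i (gauss : Bdry d → ℝ)) :=
  gaussBound_of_poly (contDiff_pd contDiff_gauss i).continuous 1 zero_le_one fun z => by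
    rw [pd_gauss, abs_mul, abs_mul, abs_of_pos (gauss_pos z)]
    have := abs_coord_le z i
    have hg := (gauss_pos z).le
    have h2 : |(-(1 / 2) : ℝ)| = 1 / 2 := by norm_num
    rw [h2]
    rw [pow_one]
    gcongr ?_ * _
    linarith [abs_nonneg (z i)]

theorem gaussBound_pd_pd_gauss (i j : Fin d) : GaussBound (pd j (pd i (gauss : Bdry d → ℝ))) :=
  gaussBound_of_poly (contDiff_pd (contDiff_pd contDiff_gauss i) j).continuous 2 zero_le_one
    fun z => by
      rw [pd_pd_gauss, abs_mul, abs_of_pos (gauss_pos z)]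
      have h1 := abs_coord_le z i
      have h2 := abs_coord_le z j
      have h3 : |(unitVec j : Bdry d) i| ≤ 1 := (abs_coord_le _ i).trans (by simp [unitVec])
      have hg := (gauss_pos z).le
      gcongr
      refine (abs_add_le _ _).trans ?_
      rw [abs_mul, abs_mul, abs_mul]
      have e1 : |(-(1 / 2) : ℝ)| = 1 / 2 := by norm_num
      have e2 : |(1 / 4 : ℝ)| = 1 / 4 := by norm_num
      rw [e1, e2]
      have h4 : |z i| * |z j| ≤ ‖z‖ * ‖z‖ := by gcongr
      nlinarith [norm_nonneg z]

/-! ### The heat semigroup -/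

/-- The heat semigroup of the boundary space applied to `f`, at time `v²`. -/
noncomputable def heat (f : Bdry d → ℝ) (v : ℝ) (x : Bdry d) : ℝ := avg gauss f v x

theorem heat_zero (f : Bdry d → ℝ) (x : Bdry d) : heat f 0 x = f x := by
  simp only [heat, avg, zero_smul, sub_zero]
  rw [integral_mul_const, integral_gauss, one_mul]

theorem continuous_avg {κ f : Bdry d → ℝ} (hκ : GaussBound κ) (hf : IsBump f) :
    Continuous fun p : ℝ × Bdry d => avg κ f p.1 p.2 := by
  obtain ⟨B, _, hB⟩ := hf.exists_bound
  unfold avg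
  refine continuous_of_dominated (bound := fun z => |κ z| * B) (fun p => ?_) (fun p => ?_)
    (hκ.integrable.abs.mul_const B) ?_
  · exact (integrable_avg hκ hf.continuous hB _ _).aestronglyMeasurable
  · refine ae_of_all _ fun z => ?_
    rw [Real.norm_eq_abs, abs_mul]
    gcongr
    exact hB _
  · refine ae_of_all _ fun z => ?_
    exact continuous_const.mul (hf.continuous.comp
      (continuous_snd.sub (continuous_fst.smul continuous_const)))

theorem continuous_heat {f : Bdry d → ℝ} (hf : IsBump f) :
    Continuous fun p : ℝ × Bdry d => heat f p.1 p.2 := continuous_avg gaussBound_gauss hf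

theorem abs_heat_le {f : Bdry d → ℝ} (hf : IsBump f) : ∃ C, 0 ≤ C ∧ ∀ v x, |heat f v x| ≤ C := by
  obtain ⟨C, hC, h⟩ := abs_avg_le (d := d) gaussBound_gauss
  obtain ⟨B, hB0, hB⟩ := hf.exists_bound
  exact ⟨C * B, by positivity, fun v x => h f hf.continuous B hB v x⟩

theorem avg_sum {ι : Type*} (s : Finset ι) (κ : Bdry d → ℝ) (hκ : GaussBound κ)
    {F : ι → Bdry d → ℝ} (hF : ∀ i, IsBump (F i)) (v : ℝ) (x : Bdry d) :
    avg κ (fun y => ∑ i ∈ s, F i y) v x = ∑ i ∈ s, avg κ (F i) v x := by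
  unfold avg
  simp only [Finset.mul_sum]
  refine integral_finsetSum _ fun i _ => ?_
  obtain ⟨B, _, hB⟩ := (hF i).exists_bound
  exact integrable_avg hκ (hF i).continuous hB v x

theorem heat_lap {f : Bdry d → ℝ} (hf : IsBump f) (v : ℝ) (x : Bdry d) :
    heat (lap f) v x = ∑ i, heat (pd i (pd i f)) v x :=
  avg_sum _ _ gaussBound_gauss (fun i => (hf.pd i).pd i) v x

theorem hasFDerivAt_heat {f : Bdry d → ℝ} (hf : IsBump f) (v : ℝ) (x : Bdry d) :
    HasFDerivAt (heat f v) (∑ i, heat (pd i f) v x • (EuclideanSpace.proj i : Bdry d →L[ℝ] ℝ)) x := by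
  obtain ⟨B, _, hB⟩ := hf.exists_bound
  have hc : Continuous (fderiv ℝ f) := (hf.contDiff.continuous_fderiv (by simp))
  obtain ⟨B', hB'⟩ := (hf.hasCompactSupport.fderiv ℝ).exists_bound_of_continuous hc
  have key := hasFDerivAt_integral_of_dominated_of_fderiv_le (μ := (volume : Measure (Bdry d)))
    (F := fun x z => gauss z * f (x - v • z))
    (F' := fun x z => gauss z • fderiv ℝ f (x - v • z)) (x₀ := x) (s := univ)
    (bound := fun z => gauss z * B') univ_mem
    (Eventually.of_forall fun y =>
      (integrable_avg gaussBound_gauss hf.continuous hB v y).aestronglyMeasurable)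
    (integrable_avg gaussBound_gauss hf.continuous hB v x)
    ((contDiff_gauss.continuous.smul (hc.comp (continuous_const.sub
      (continuous_id.const_smul v)))).aestronglyMeasurable)
    (ae_of_all _ fun z y _ => by
      rw [norm_smul, Real.norm_of_nonneg (gauss_pos z).le]
      have := (gauss_pos z).le
      gcongr
      exact hB' _)
    (gaussBound_gauss.integrable.mul_const _)
    (ae_of_all _ fun z y _ => by
      have h1 := (hf.differentiable (y - v • z)).hasFDerivAt.comp y
        ((hasFDerivAt_id y).sub_const (v • z))
      exact h1.const_mul (gauss z))
  refine key.congr_fderiv ?_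
  have hi : Integrable fun z => gauss z • fderiv ℝ f (x - v • z) :=
    (gaussBound_gauss.integrable.mul_const B').mono'
      ((contDiff_gauss.continuous.smul (hc.comp (continuous_const.sub
        (continuous_id.const_smul v)))).aestronglyMeasurable)
      (ae_of_all _ fun z => by
        rw [norm_smul, Real.norm_of_nonneg (gauss_pos z).le]
        have := (gauss_pos z).le
        gcongr
        exact hB' _)
  simp only [fderiv_eq_sum_pd, Finset.smul_sum, smul_smul]
  rw [integral_finsetSum]
  · refine Finset.sum_congr rfl fun i _ => ?_
    rw [integral_smul_const]
    rfl
  · intro i _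
    obtain ⟨B, _, hB⟩ := (hf.pd i).exists_bound
    exact (integrable_avg gaussBound_gauss (hf.pd i).continuous hB v x).smul_const _

/-- The heat equation in the variable `v = √τ`. Differentiating in `v` produces `-z · ∇f` against
the Gaussian; since `-z_i G = 2 ∂_i G`, this is `2 Σ ∂_i G ∂_i f`, which an integration by parts
turns into the Laplacian. -/
theorem hasDerivAt_heat {f : Bdry d → ℝ} (hf : IsBump f) {v : ℝ} (hv : 0 < v) (x : Bdry d) :
    HasDerivAt (fun v => heat f v x) (2 * v * heat (lap f) v x) v := by
  obtain ⟨B, _, hB⟩ := hf.exists_bound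
  choose B' hB0' hB' using fun i => (hf.pd i).exists_bound
  have hint : ∀ (w : ℝ) (i : Fin d),
      Integrable fun z => pd i gauss z * pd i f (x - w • z) := fun w i =>
    integrable_avg (gaussBound_pd_gauss i) (hf.pd i).continuous (hB' i) w x
  have key := (hasDerivAt_integral_of_dominated_loc_of_deriv_le (μ := (volume : Measure (Bdry d)))
    (F := fun v z => gauss z * f (x - v • z))
    (F' := fun v z => ∑ i, 2 * (pd i gauss z * pd i f (x - v • z))) (x₀ := v) (s := univ)
    (bound := fun z => ∑ i, 2 * (|pd i gauss z| * B' i)) univ_mem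
    (Eventually.of_forall fun w =>
      (integrable_avg gaussBound_gauss hf.continuous hB w x).aestronglyMeasurable)
    (integrable_avg gaussBound_gauss hf.continuous hB v x)
    (integrable_finsetSum _ fun i _ => (hint v i).const_mul 2).aestronglyMeasurable
    (ae_of_all _ fun z w _ => by
      refine (norm_sum_le _ _).trans (Finset.sum_le_sum fun i _ => ?_)
      rw [norm_mul, norm_mul, Real.norm_ofNat, Real.norm_eq_abs, Real.norm_eq_abs]
      gcongr
      exact hB' i _)
    (integrable_finsetSum _ fun i _ =>
      (((gaussBound_pd_gauss i).integrable.abs).mul_const _).const_mul 2)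
    (ae_of_all _ fun z w _ => by
      have h0 : HasDerivAt (fun w : ℝ => x - w • z) (-z) w := by
        simpa using ((hasDerivAt_id w).smul_const z).const_sub x
      have h1 := ((hf.differentiable (x - w • z)).hasFDerivAt.comp_hasDerivAt w h0).const_mul
        (gauss z)
      refine h1.congr_deriv ?_
      rw [fderiv_eq_sum_pd, sum_apply, Finset.mul_sum]
      refine Finset.sum_congr rfl fun i _ => ?_
      rw [pd_gauss]
      simp
      ring)).2
  refine key.congr_deriv ?_
  rw [integral_finsetSum _ fun i _ => (hint v i).const_mul 2, heat_lap hf, Finset.mul_sum]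
  refine Finset.sum_congr rfl fun i _ => ?_
  rw [heat, avg_pd i contDiff_gauss gaussBound_gauss (gaussBound_pd_gauss i) (hf.pd i) hv,
    integral_const_mul, avg]
  field_simp

/-! ### Power decay of the heat evolution of a bump and its derivatives. -/

theorem heat_pd {f : Bdry d → ℝ} (hf : IsBump f) (i : Fin d) {v : ℝ} (hv : 0 < v) (x : Bdry d) :
    heat (pd i f) v x = v⁻¹ * avg (pd i gauss) f v x :=
  avg_pd i contDiff_gauss gaussBound_gauss (gaussBound_pd_gauss i) hf hv x

/-- `f` is a bump whose heat evolution decays like the power `-e` of the parabolic distance. -/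
structure HeatDecay (e : ℕ) (f : Bdry d → ℝ) : Prop extends IsBump f where
  decay : ∃ C, 0 ≤ C ∧ ∀ v x, 0 ≤ v → |heat f v x| ≤ C / (1 + v + ‖x‖) ^ e

/-- Three regimes: for `|x| ≥ 2` the Gaussian tail pays for any power, for `|x| < 2` and `v ≥ 1` the
volume factor `v^{-d}` is combined with `v^{-k}`, and for `|x| < 2` and `v < 1` the evolution is
merely bounded. Time zero follows by continuity. Each derivative that falls on the Gaussian thus
gains one power. -/
theorem heatDecay_of_avg {f f₀ κ : Bdry d → ℝ} (k : ℕ) (hκ : GaussBound κ) (hf : IsBump f)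
    (hf₀ : IsBump f₀) (h : ∀ v x, 0 < v → heat f v x = (v ^ k)⁻¹ * avg κ f₀ v x) :
    HeatDecay (d + k) f := by
  obtain ⟨C₁, hC₁, h₁⟩ := abs_heat_le hf
  obtain ⟨C₂, hC₂, h₂⟩ := abs_avg_le_far hκ hf₀ k
  obtain ⟨C₃, hC₃, h₃⟩ := abs_avg_le_pow hκ
  obtain ⟨B, hB0, hB⟩ := hf₀.exists_bound
  set C := (C₁ + C₂ + C₃ * B) * 4 ^ (d + k) with hC
  have hC0 : 0 ≤ C := by positivity
  have hpos : ∀ v x, 0 < v → |heat f v x| ≤ C / (1 + v + ‖x‖) ^ (d + k) := by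
    intro v x hv
    have hx := norm_nonneg x
    rw [le_div_iff₀ (by positivity)]
    -- In each regime the dominant one of `v + |x|`, `v` and `1` is comparable, up to the factor 4,
    -- to `1 + v + |x|`.
    have h4 : ∀ (r : ℝ) , 0 ≤ r → 1 + v + ‖x‖ ≤ 4 * r → ∀ c, 0 ≤ c → c ≤ C₁ + C₂ + C₃ * B →
        |heat f v x| * r ^ (d + k) ≤ c → |heat f v x| * (1 + v + ‖x‖) ^ (d + k) ≤ C := by
      intro r hr hr' c hc hc' hh
      calc |heat f v x| * (1 + v + ‖x‖) ^ (d + k) ≤ |heat f v x| * (4 * r) ^ (d + k) := by gcongr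
        _ = |heat f v x| * r ^ (d + k) * 4 ^ (d + k) := by rw [mul_pow]; ring
        _ ≤ C := by rw [hC]; gcongr; exact hh.trans hc'
    have hCB : 0 ≤ C₃ * B := by positivity
    rcases le_or_gt 2 ‖x‖ with hx2 | hx2
    · refine h4 (v + ‖x‖) (by positivity) (by linarith) C₂ hC₂ (by linarith) ?_
      rw [h v x hv, abs_mul, abs_of_pos (by positivity : 0 < (v ^ k)⁻¹)]
      have := h₂ v x hv hx2
      rw [le_div_iff₀ (by positivity)] at this
      calc _ = (v ^ k)⁻¹ * (|avg κ f₀ v x| * (v + ‖x‖) ^ (d + k)) := by ring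
        _ ≤ (v ^ k)⁻¹ * (C₂ * v ^ k) := by gcongr
        _ = C₂ := by field_simp
    · rcases le_or_gt 1 v with hv1 | hv1
      · refine h4 v hv.le (by linarith) (C₃ * B) (by positivity) (by linarith) ?_
        rw [h v x hv, abs_mul, abs_of_pos (by positivity : 0 < (v ^ k)⁻¹)]
        have := (h₃ f₀ hf₀.continuous (fun _ => hf₀.eq_zero) B hB v x hv).1
        rw [le_div_iff₀ (by positivity)] at this
        calc _ = (v ^ k)⁻¹ * (|avg κ f₀ v x| * v ^ d) * v ^ k := by ring
          _ ≤ (v ^ k)⁻¹ * (C₃ * B) * v ^ k := by gcongr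
          _ = C₃ * B := by field_simp
      · refine h4 1 zero_le_one (by linarith) C₁ hC₁ (by linarith) ?_
        simpa using h₁ v x
  refine ⟨hf, C, hC0, fun v x hv => ?_⟩
  rcases hv.eq_or_lt with rfl | hv
  · have t1 : Tendsto (fun v => |heat f v x|) (𝓝[>] 0) (𝓝 |heat f 0 x|) :=
      ((((continuous_heat hf).comp (Continuous.prodMk_left x)).abs.tendsto 0)).mono_left
        nhdsWithin_le_nhds
    have t2 : Tendsto (fun v => C / (1 + v + ‖x‖) ^ (d + k)) (𝓝[>] 0)
        (𝓝 (C / (1 + 0 + ‖x‖) ^ (d + k))) := by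
      have : ContinuousAt (fun v => C / (1 + v + ‖x‖) ^ (d + k)) (0 : ℝ) := by
        have : (1 + 0 + ‖x‖) ^ (d + k) ≠ 0 := by positivity
        fun_prop (disch := assumption)
      exact this.tendsto.mono_left nhdsWithin_le_nhds
    exact le_of_tendsto_of_tendsto t1 t2
      (eventually_nhdsWithin_of_forall fun v hv => hpos v x hv)
  · exact hpos v x hv

theorem IsBump.heatDecay {f : Bdry d → ℝ} (hf : IsBump f) : HeatDecay d f :=
  heatDecay_of_avg (k := 0) gaussBound_gauss hf hf fun v x _ => by simp [heat]

theorem IsBump.heatDecay_pd {f : Bdry d → ℝ} (hf : IsBump f) (i : Fin d) :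
    HeatDecay (d + 1) (HalfSpaceStokes.pd i f) :=
  heatDecay_of_avg 1 (gaussBound_pd_gauss i) (hf.pd i) hf fun v x hv => by
    rw [heat_pd hf i hv, pow_one]

theorem IsBump.heatDecay_pd_pd {f : Bdry d → ℝ} (hf : IsBump f) (i j : Fin d) :
    HeatDecay (d + 2) (HalfSpaceStokes.pd j (HalfSpaceStokes.pd i f)) :=
  heatDecay_of_avg 2 (gaussBound_pd_pd_gauss j i) ((hf.pd i).pd j) hf fun v x hv => by
    rw [heat_pd (hf.pd i) j hv, avg_pd i (contDiff_pd contDiff_gauss j) (gaussBound_pd_gauss j)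
      (gaussBound_pd_pd_gauss j i) hf hv, ← mul_assoc, ← mul_inv, sq]

theorem HeatDecay.mono {e e' : ℕ} {f : Bdry d → ℝ} (hf : HeatDecay e f) (h : e' ≤ e) :
    HeatDecay e' f := by
  obtain ⟨C, hC, hd⟩ := hf.decay
  refine ⟨hf.toIsBump, C, hC, fun v x hv => (hd v x hv).trans ?_⟩
  have := norm_nonneg x
  gcongr
  linarith

theorem HeatDecay.sum {ι : Type*} (s : Finset ι) {e : ℕ} {F : ι → Bdry d → ℝ}
    (hF : ∀ i, HeatDecay e (F i)) : HeatDecay e (fun x => ∑ i ∈ s, F i x) := by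
  choose C hC hd using fun i => (hF i).decay
  refine ⟨IsBump.sum s fun i => (hF i).toIsBump, ∑ i ∈ s, C i,
    Finset.sum_nonneg fun i _ => hC i, fun v x hv => ?_⟩
  rw [heat, avg_sum s _ gaussBound_gauss (fun i => (hF i).toIsBump), Finset.sum_div]
  exact (Finset.abs_sum_le_sum_abs _ _).trans (Finset.sum_le_sum fun i _ => hd i v x hv)

theorem IsBump.heatDecay_lap {f : Bdry d → ℝ} (hf : IsBump f) :
    HeatDecay (d + 2) (HalfSpaceStokes.lap f) :=
  HeatDecay.sum _ fun i => hf.heatDecay_pd_pd i i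

end Gauss

end HalfSpaceStokes

namespace HalfSpaceStokes

/-! ### The one-dimensional heat kernel and its normal derivatives -/

/-- The `j`-th derivative in `x` of `(2/√π) e^{-x²/(4v²)}`. -/
noncomputable def ker : ℕ → ℝ → ℝ → ℝ
  | 0, x, v => 2 / √Real.pi * Real.exp (-(1 / 4) * (x / v) ^ 2)
  | 1, x, v => -(x / (2 * v ^ 2)) * (2 / √Real.pi * Real.exp (-(1 / 4) * (x / v) ^ 2))
  | j + 2, x, v => -(x / (2 * v ^ 2)) * ker (j + 1) x v - ((j + 1) / (2 * v ^ 2)) * ker j x v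

theorem ker_zero (x v : ℝ) : ker 0 x v = 2 / √Real.pi * Real.exp (-(1 / 4) * (x / v) ^ 2) := by
  rw [ker]

theorem ker_one (x v : ℝ) : ker 1 x v = -(x / (2 * v ^ 2)) * ker 0 x v := by
  rw [ker, ker]

theorem ker_add_two (j : ℕ) (x v : ℝ) : ker (j + 2) x v =
    -(x / (2 * v ^ 2)) * ker (j + 1) x v - ((j + 1) / (2 * v ^ 2)) * ker j x v := by
  rw [ker]

theorem ker_two (x v : ℝ) :
    ker 2 x v = (x ^ 2 / (4 * v ^ 4) - 1 / (2 * v ^ 2)) * ker 0 x v := by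
  rw [ker_add_two, ker_one]
  rcases eq_or_ne v 0 with rfl | hv
  · simp
  · push_cast; field_simp; ring

theorem hasDerivAt_ker_zero (x v : ℝ) : HasDerivAt (fun x => ker 0 x v) (ker 1 x v) x := by
  have h1 : HasDerivAt (fun x : ℝ => -(1 / 4) * (x / v) ^ 2) (-(1 / 4) * (2 * (x / v) * (1 / v))) x := by
    have := (((hasDerivAt_id x).div_const v).pow 2).const_mul (-(1 / 4))
    simpa using this
  have h2 := h1.exp.const_mul (2 / √Real.pi)
  simp only [ker_one, ker_zero]
  refine h2.congr_deriv ?_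
  have : -(x / (2 * v ^ 2)) = -(1 / 4) * (2 * (x / v) * (1 / v)) := by
    rcases eq_or_ne v 0 with rfl | hv
    · simp
    · field_simp; ring
  rw [this]; ring

theorem hasDerivAt_ker (j : ℕ) (x v : ℝ) : HasDerivAt (fun x => ker j x v) (ker (j + 1) x v) x := by
  induction j using Nat.twoStepInduction with
  | zero => exact hasDerivAt_ker_zero x v
  | one =>
    simp only [ker_one]
    have h := ((hasDerivAt_id x).div_const (2 * v ^ 2)).neg.mul (hasDerivAt_ker_zero x v)
    refine h.congr_deriv ?_
    rw [ker_add_two]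
    simp
    ring
  | more j h0 h1 =>
    simp only [ker_add_two j]
    have h := (((hasDerivAt_id x).div_const (2 * v ^ 2)).neg.mul h1).sub
      (h0.const_mul (((j : ℝ) + 1) / (2 * v ^ 2)))
    refine h.congr_deriv ?_
    rw [ker_add_two (j + 1)]
    simp
    ring

theorem hasDerivAt_ker_zero_right (x : ℝ) {v : ℝ} (hv : 0 < v) :
    HasDerivAt (fun v => ker 0 x v) (x ^ 2 / (2 * v ^ 3) * ker 0 x v) v := by
  have h1 : HasDerivAt (fun v : ℝ => -(1 / 4) * (x / v) ^ 2)
      (-(1 / 4) * (2 * (x / v) * (-x / v ^ 2))) v := by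
    have h0 : HasDerivAt (fun v : ℝ => x / v) (-x / v ^ 2) v := by
      have := (hasDerivAt_inv hv.ne').const_mul x
      simpa [div_eq_mul_inv] using this
    have := (h0.pow 2).const_mul (-(1 / 4))
    simpa using this
  have h2 := h1.exp.const_mul (2 / √Real.pi)
  simp only [ker_zero]
  refine h2.congr_deriv ?_
  field_simp
  ring

/-- The heat equation for the kernel, in the variable `v = √τ`. -/
theorem hasDerivAt_ker_div {j : ℕ} (hj : j ≤ 1) (x : ℝ) {v : ℝ} (hv : 0 < v) :
    HasDerivAt (fun v => ker j x v / (2 * v)) (ker (j + 2) x v) v := by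
  have h0 := hasDerivAt_ker_zero_right x hv
  have h2 : HasDerivAt (fun v : ℝ => 2 * v) 2 v := by simpa using (hasDerivAt_id v).const_mul 2
  interval_cases j
  · have := h0.div h2 (by positivity)
    refine this.congr_deriv ?_
    rw [zero_add, ker_two]
    field_simp
    ring
  · have h3 : HasDerivAt (fun v : ℝ => -(x / (2 * v ^ 2))) (x / v ^ 3) v := by
      have h4 : HasDerivAt (fun v : ℝ => 2 * v ^ 2) (4 * v) v := by
        have := ((hasDerivAt_id v).pow 2).const_mul 2
        refine this.congr_deriv ?_
        simp; ring
      have := ((hasDerivAt_const v x).div h4 (by positivity)).neg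
      refine this.congr_deriv ?_
      field_simp
      ring
    have h5 := (h3.mul h0).div h2 (by positivity)
    have e : (fun v => ker 1 x v / (2 * v)) =
        ((fun v : ℝ => -(x / (2 * v ^ 2))) * fun v => ker 0 x v) / fun v => 2 * v := by
      funext v; simp [ker_one]
    rw [e]
    refine h5.congr_deriv ?_
    rw [ker_add_two, ker_two, ker_one]
    simp only [Pi.mul_apply]
    push_cast
    field_simp
    ring

theorem measurable_ker (j : ℕ) : Measurable fun p : ℝ × ℝ => ker j p.1 p.2 := by
  induction j using Nat.twoStepInduction with
  | zero => simp only [ker_zero]; fun_prop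
  | one => simp only [ker_one, ker_zero]; fun_prop
  | more j h0 h1 => simp only [ker_add_two]; fun_prop

theorem abs_ker_le_exp (j : ℕ) : ∃ C, 0 ≤ C ∧ ∀ x v : ℝ, 0 < v →
    |ker j x v| ≤ C * (v ^ j)⁻¹ * (1 + |x| / v) ^ j * Real.exp (-(1 / 4) * (|x| / v) ^ 2) := by
  have hsq : ∀ x v : ℝ, (|x| / v) ^ 2 = (x / v) ^ 2 := fun x v => by
    rw [div_pow, div_pow, sq_abs]
  induction j using Nat.twoStepInduction with
  | zero =>
    refine ⟨2 / √Real.pi, by positivity, fun x v hv => ?_⟩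
    rw [ker_zero, abs_of_nonneg (by positivity), hsq]
    simp
  | one =>
    refine ⟨2 / √Real.pi, by positivity, fun x v hv => ?_⟩
    rw [ker_one, ker_zero, abs_mul, abs_of_nonneg (by positivity : 0 ≤ 2 / √Real.pi * _), hsq,
      abs_neg, abs_div, abs_of_pos (by positivity : 0 < 2 * v ^ 2), pow_one, pow_one]
    have : |x| / (2 * v ^ 2) ≤ v⁻¹ * (1 + |x| / v) := by
      rw [div_le_iff₀ (by positivity)]
      have : v⁻¹ * (1 + |x| / v) * (2 * v ^ 2) = 2 * v + 2 * |x| := by field_simp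
      rw [this]; have := abs_nonneg x; linarith
    calc _ ≤ (v⁻¹ * (1 + |x| / v)) * (2 / √Real.pi * Real.exp (-(1 / 4) * (x / v) ^ 2)) := by gcongr
      _ = _ := by ring
  | more j h0 h1 =>
    obtain ⟨C0, hC0, h0⟩ := h0
    obtain ⟨C1, hC1, h1⟩ := h1
    refine ⟨C1 + (j + 1) * C0, by positivity, fun x v hv => ?_⟩
    have a0 := h0 x v hv
    have a1 := h1 x v hv
    set E := Real.exp (-(1 / 4) * (|x| / v) ^ 2)
    have hE : 0 < E := Real.exp_pos _
    set y := |x| / v with hy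
    have hy0 : 0 ≤ y := by positivity
    have hxy : |x| = y * v := by rw [hy]; field_simp
    rw [ker_add_two]
    refine (abs_sub _ _).trans ?_
    rw [abs_mul, abs_mul, abs_neg, abs_div, abs_div, abs_of_pos (by positivity : 0 < 2 * v ^ 2),
      abs_of_pos (by positivity : (0 : ℝ) < j + 1), hxy]
    calc y * v / (2 * v ^ 2) * |ker (j + 1) x v| + (↑j + 1) / (2 * v ^ 2) * |ker j x v|
        ≤ y * v / (2 * v ^ 2) * (C1 * (v ^ (j + 1))⁻¹ * (1 + y) ^ (j + 1) * E)
          + (↑j + 1) / (2 * v ^ 2) * (C0 * (v ^ j)⁻¹ * (1 + y) ^ j * E) := by gcongr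
      _ = (v ^ (j + 2))⁻¹ * E * (1 + y) ^ j * (y / 2 * C1 * (1 + y) + (↑j + 1) / 2 * C0) := by
          rw [pow_succ (1 + y) j]; field_simp; ring
      _ ≤ (v ^ (j + 2))⁻¹ * E * (1 + y) ^ j * ((C1 + (j + 1) * C0) * (1 + y) ^ 2) := by
          gcongr
          have k1 : y / 2 * C1 * (1 + y) ≤ C1 * (1 + y) ^ 2 := by
            have : y / 2 * (1 + y) ≤ (1 + y) ^ 2 := by nlinarith
            nlinarith
          have k2 : (↑j + 1) / 2 * C0 ≤ (j + 1) * C0 * (1 + y) ^ 2 := by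
            have e1 : (1 : ℝ) ≤ (1 + y) ^ 2 := by nlinarith
            have e2 : 0 ≤ ((j : ℝ) + 1) * C0 := by positivity
            nlinarith
          linarith
      _ = _ := by rw [pow_add (1 + y)]; ring

/-- The Gaussian factor is traded for powers: `m` is at the caller's disposal and measures how
strongly the kernel vanishes as `v → 0` away from the wall. -/
theorem abs_ker_le (j m : ℕ) : ∃ C, 0 ≤ C ∧ ∀ x v : ℝ, 0 < v →
    |ker j x v| ≤ C * v ^ m / (v + |x|) ^ (m + j) := by
  obtain ⟨C, hC, h⟩ := abs_ker_le_exp j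
  obtain ⟨C', hC', h'⟩ := pow_mul_exp_neg_sq_le (j + (m + j)) (c := 1 / 4) (by norm_num)
  refine ⟨C * C', by positivity, fun x v hv => (h x v hv).trans ?_⟩
  have hx := abs_nonneg x
  have h2 := h' (|x| / v) (by positivity)
  rw [pow_add] at h2
  have e : v + |x| = v * (1 + |x| / v) := by field_simp
  rw [e]
  set y := |x| / v
  have hy : 0 ≤ y := by positivity
  rw [le_div_iff₀ (by positivity), mul_pow]
  calc C * (v ^ j)⁻¹ * (1 + y) ^ j * Real.exp (-(1 / 4) * y ^ 2) *
        (v ^ (m + j) * (1 + y) ^ (m + j))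
      = C * v ^ m * ((1 + y) ^ j * (1 + y) ^ (m + j) * Real.exp (-(1 / 4) * y ^ 2)) := by
        rw [pow_add v]; field_simp
    _ ≤ C * v ^ m * C' := by gcongr
    _ = _ := by ring

/-- The first normal derivative carries a factor `x`. Keeping it makes the bound an approximate
identity, with `∫ x/(v+x)² dv = 1`, where the general estimate would only give a logarithmically
divergent bound. -/
theorem abs_ker_one_le (m : ℕ) : ∃ C, 0 ≤ C ∧ ∀ x v : ℝ, 0 < v →
    |ker 1 x v| ≤ C * (|x| * v ^ m / (v + |x|) ^ (m + 2)) := by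
  obtain ⟨C, hC, h⟩ := abs_ker_le 0 (m + 2)
  refine ⟨C, hC, fun x v hv => ?_⟩
  have hx := abs_nonneg x
  rw [ker_one, abs_mul, abs_neg, abs_div, abs_of_pos (by positivity : 0 < 2 * v ^ 2)]
  calc |x| / (2 * v ^ 2) * |ker 0 x v| ≤ |x| / (2 * v ^ 2) * (C * v ^ (m + 2) / (v + |x|) ^ (m + 2)) := by
        gcongr; exact h x v hv
    _ = C * (|x| * v ^ m / (v + |x|) ^ (m + 2)) / 2 := by
        rw [pow_add v]; field_simp
    _ ≤ _ := by
        have : 0 ≤ C * (|x| * v ^ m / (v + |x|) ^ (m + 2)) := by positivity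
        linarith

theorem ker_zero_nonneg (x v : ℝ) : 0 ≤ ker 0 x v := by rw [ker_zero]; positivity

theorem ker_zero_le (x v : ℝ) : ker 0 x v ≤ 2 / √Real.pi := by
  rw [ker_zero]
  have : Real.exp (-(1 / 4) * (x / v) ^ 2) ≤ 1 := by
    rw [Real.exp_le_one_iff]; nlinarith [sq_nonneg (x / v)]
  calc _ ≤ 2 / √Real.pi * 1 := by gcongr
    _ = _ := mul_one _

/-- Substitution `v = x / (2s)` in the Poisson-type integral against `∂_x` of the kernel. -/
theorem integral_ker_one (F : ℝ → ℝ) {x : ℝ} (hx : 0 < x) :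
    ∫ v in Ioi 0, ker 1 x v * F v =
      -∫ s in Ioi 0, 2 / √Real.pi * Real.exp (-s ^ 2) * F (x / 2 * s⁻¹) := by
  have h1 := integral_comp_mul_left_Ioi (fun v => ker 1 x v * F v) 0 (b := x / 2) (by positivity)
  rw [mul_zero] at h1
  have h2 := integral_comp_rpow_Ioi (fun y => ker 1 x (x / 2 * y) * F (x / 2 * y)) (p := -1)
    (by norm_num)
  have h3 : ∫ v in Ioi 0, ker 1 x v * F v =
      (x / 2) * ∫ y in Ioi 0, ker 1 x (x / 2 * y) * F (x / 2 * y) := by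
    rw [h1, smul_eq_mul]; field_simp
  rw [h3, ← h2, ← integral_const_mul, ← integral_neg]
  refine setIntegral_congr_fun measurableSet_Ioi fun s hs => ?_
  have hs : 0 < s := hs
  have e1 : s ^ (-1 : ℝ) = s⁻¹ := Real.rpow_neg_one s
  have e2 : s ^ (-1 - 1 : ℝ) = (s ^ 2)⁻¹ := by
    rw [show (-1 - 1 : ℝ) = -(2 : ℕ) by norm_num, Real.rpow_neg hs.le, Real.rpow_natCast]
  simp only [e1, e2, smul_eq_mul, abs_neg, abs_one, ker_one, ker_zero]
  have e3 : -(1 / 4) * (x / (x / 2 * s⁻¹)) ^ 2 = -s ^ 2 := by field_simp; ring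
  rw [e3]
  field_simp

theorem integrable_exp_neg_sq_Ioi : IntegrableOn (fun s : ℝ => 2 / √Real.pi * Real.exp (-s ^ 2))
    (Ioi 0) := by
  have := (integrable_exp_neg_mul_sq (b := 1) one_pos).const_mul (2 / √Real.pi)
  refine IntegrableOn.congr_fun this.integrableOn (fun s _ => ?_) measurableSet_Ioi
  simp

theorem integral_exp_neg_sq_Ioi :
    ∫ s in Ioi (0 : ℝ), 2 / √Real.pi * Real.exp (-s ^ 2) = 1 := by
  rw [integral_const_mul]
  have := integral_gaussian_Ioi 1
  simp only [neg_mul, one_mul, div_one] at this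
  rw [this]
  have : √Real.pi ≠ 0 := by positivity
  field_simp

/-- `∂_x` of the kernel is minus an approximate identity. -/
theorem tendsto_integral_ker_one {F : ℝ → ℝ} {L B : ℝ}
    (hF : ContinuousOn F (Ioi 0)) (hB : ∀ v, 0 < v → |F v| ≤ B)
    (hL : Tendsto F (𝓝[>] 0) (𝓝 L)) :
    Tendsto (fun x => ∫ v in Ioi 0, ker 1 x v * F v) (𝓝[>] 0) (𝓝 (-L)) := by
  have hmeas : ∀ x : ℝ, 0 < x → AEStronglyMeasurable
      (fun s : ℝ => 2 / √Real.pi * Real.exp (-s ^ 2) * F (x / 2 * s⁻¹))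
      (volume.restrict (Ioi 0)) := by
    intro x hx
    refine ContinuousOn.aestronglyMeasurable (ContinuousOn.mul (by fun_prop) ?_) measurableSet_Ioi
    refine hF.comp (continuousOn_const.mul (continuousOn_inv₀.mono fun s hs => ne_of_gt hs)) ?_
    intro s hs
    have hs : 0 < s := hs
    exact mem_Ioi.2 (by positivity)
  have e : (fun x => -∫ s in Ioi 0, 2 / √Real.pi * Real.exp (-s ^ 2) * F (x / 2 * s⁻¹))
      =ᶠ[𝓝[>] 0] fun x => ∫ v in Ioi 0, ker 1 x v * F v :=
    eventually_nhdsWithin_of_forall fun x hx => (integral_ker_one F hx).symm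
  refine Tendsto.congr' e (Tendsto.neg ?_)
  have : L = ∫ s in Ioi (0 : ℝ), 2 / √Real.pi * Real.exp (-s ^ 2) * L := by
    rw [integral_mul_const, integral_exp_neg_sq_Ioi, one_mul]
  rw [this]
  refine tendsto_integral_filter_of_dominated_convergence
    (fun s => 2 / √Real.pi * Real.exp (-s ^ 2) * B)
    (eventually_nhdsWithin_of_forall hmeas) ?_ (integrable_exp_neg_sq_Ioi.mul_const B) ?_
  · refine eventually_nhdsWithin_of_forall fun x hx => ?_
    refine (ae_restrict_iff' measurableSet_Ioi).2 (ae_of_all _ fun s hs => ?_)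
    rw [norm_mul, Real.norm_of_nonneg (by positivity)]
    gcongr
    have hx : 0 < x := hx
    have hs : 0 < s := hs
    exact hB _ (by positivity)
  · refine (ae_restrict_iff' measurableSet_Ioi).2 (ae_of_all _ fun s hs => ?_)
    refine Tendsto.const_mul _ (hL.comp ?_)
    have hs : 0 < s := hs
    refine tendsto_nhdsWithin_iff.2 ⟨?_, eventually_nhdsWithin_of_forall fun x hx => ?_⟩
    · have : Tendsto (fun x : ℝ => x / 2 * s⁻¹) (𝓝 0) (𝓝 (0 / 2 * s⁻¹)) :=
        Continuous.tendsto (by fun_prop) 0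
      simp only [zero_div, zero_mul] at this
      exact this.mono_left nhdsWithin_le_nhds
    · have hx : 0 < x := hx
      exact mem_Ioi.2 (by positivity)

theorem tendsto_ker_div_zero {j : ℕ} {x : ℝ} (hx : 0 < x) :
    Tendsto (fun v => ker j x v / (2 * v)) (𝓝[>] 0) (𝓝 0) := by
  obtain ⟨C, hC, h⟩ := abs_ker_le j 2
  have : Tendsto (fun v : ℝ => C / x ^ (2 + j) * v) (𝓝[>] 0) (𝓝 0) := by
    have : Tendsto (fun v : ℝ => C / x ^ (2 + j) * v) (𝓝 0) (𝓝 (C / x ^ (2 + j) * 0)) :=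
      Continuous.tendsto (by fun_prop) 0
    rw [mul_zero] at this
    exact this.mono_left nhdsWithin_le_nhds
  refine squeeze_zero_norm' (eventually_nhdsWithin_of_forall fun v hv => ?_) this
  have hv : 0 < v := hv
  rw [norm_div, Real.norm_eq_abs, Real.norm_of_nonneg (by positivity : 0 ≤ 2 * v),
    div_le_iff₀ (by positivity)]
  refine (h x v hv).trans ?_
  rw [abs_of_pos hx]
  calc C * v ^ 2 / (v + x) ^ (2 + j) ≤ C * v ^ 2 / x ^ (2 + j) := by gcongr; linarith
    _ ≤ 2 * (C * v ^ 2 / x ^ (2 + j)) := by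
      have : 0 ≤ C * v ^ 2 / x ^ (2 + j) := by positivity
      linarith
    _ = _ := by ring

theorem tendsto_ker_div_atTop {j : ℕ} {x : ℝ} (hx : 0 < x) :
    Tendsto (fun v => ker j x v / (2 * v)) atTop (𝓝 0) := by
  obtain ⟨C, hC, h⟩ := abs_ker_le j 0
  have : Tendsto (fun v : ℝ => C / x ^ j * v⁻¹) atTop (𝓝 0) := by
    simpa using tendsto_inv_atTop_zero.const_mul (C / x ^ j)
  refine squeeze_zero_norm' ?_ this
  filter_upwards [eventually_gt_atTop 0] with v hv
  rw [norm_div, Real.norm_eq_abs, Real.norm_of_nonneg (by positivity : 0 ≤ 2 * v)]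
  have h1 := h x v hv
  rw [abs_of_pos hx, pow_zero, mul_one, zero_add] at h1
  calc |ker j x v| / (2 * v) ≤ C / (v + x) ^ j / (2 * v) := by gcongr
    _ ≤ C / x ^ j / v := by gcongr <;> linarith
    _ = _ := by rw [div_eq_mul_inv (C / x ^ j)]

/-! ### Potentials -/

/-- The covector with tangential entries `a` and normal entry `b`. -/
noncomputable def gradL {d : ℕ} (a : Fin d → ℝ) (b : ℝ) : Space d →L[ℝ] ℝ :=
  (∑ i, a i • (EuclideanSpace.proj i : Bdry d →L[ℝ] ℝ)).comp (ContinuousLinearMap.fst ℝ _ _) +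
    b • ContinuousLinearMap.snd ℝ _ _

section Potentials

variable {d : ℕ}

theorem gradL_apply (a : Fin d → ℝ) (b : ℝ) (v : Space d) :
    gradL a b v = ∑ i, a i * v.1 i + b * v.2 := by
  simp [gradL, sum_apply]

theorem gradL_tangent (a : Fin d → ℝ) (b : ℝ) (i : Fin d) : gradL a b (tangent i) = a i := by
  rw [gradL_apply]; simp [tangent]

theorem gradL_normal (a : Fin d → ℝ) (b : ℝ) : gradL a b (normal d) = b := by
  rw [gradL_apply]; simp [normal]

theorem norm_gradL_le (a : Fin d → ℝ) (b : ℝ) : ‖gradL a b‖ ≤ ∑ i, |a i| + |b| := by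
  refine ContinuousLinearMap.opNorm_le_bound _
    (add_nonneg (Finset.sum_nonneg fun _ _ => abs_nonneg _) (abs_nonneg _)) fun v => ?_
  rw [gradL_apply, Real.norm_eq_abs, add_mul, Finset.sum_mul]
  refine (abs_add_le _ _).trans (add_le_add ((Finset.abs_sum_le_sum_abs _ _).trans
    (Finset.sum_le_sum fun i _ => ?_)) ?_)
  · rw [abs_mul]
    gcongr
    exact (abs_coord_le v.1 i).trans (norm_fst_le v)
  · rw [abs_mul]
    gcongr
    exact norm_snd_le v

theorem gradL_add (a a' : Fin d → ℝ) (b b' : ℝ) :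
    gradL a b + gradL a' b' = gradL (fun i => a i + a' i) (b + b') := by
  ext <;> simp [gradL_apply, add_mul, Finset.sum_add_distrib]

theorem gradL_smul (r : ℝ) (a : Fin d → ℝ) (b : ℝ) :
    r • gradL a b = gradL (fun i => r * a i) (r * b) := by
  ext <;> simp [gradL_apply, mul_assoc, Finset.mul_sum]

theorem isOpen_halfSpace : IsOpen (halfSpace d) := isOpen_lt continuous_const continuous_snd

/-- The integrand of a potential. -/
noncomputable def potInt {Ω : Type*} (c α β : Ω → ℝ) (j : ℕ) (f : Bdry d → ℝ) (p : Space d) (o : Ω) : ℝ :=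
  c o * ker j p.2 (α o) * heat f (β o) p.1

/-- Differentiation stays inside the family: a tangential derivative acts on `f`, a normal one
raises the index of the kernel. All regularity of the potentials rests on this. -/
theorem hasFDerivAt_potInt {Ω : Type*} {c α β : Ω → ℝ} {j : ℕ} {f : Bdry d → ℝ} (hf : IsBump f) (o : Ω) (p : Space d) :
    HasFDerivAt (fun p => potInt c α β j f p o)
      (gradL (fun i => potInt c α β j (pd i f) p o) (potInt c α β (j + 1) f p o)) p := by
  have h1 : HasFDerivAt (fun p : Space d => c o * ker j p.2 (α o))
      ((c o * ker (j + 1) p.2 (α o)) • ContinuousLinearMap.snd ℝ (Bdry d) ℝ) p := by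
    have := ((hasDerivAt_ker j p.2 (α o)).const_mul (c o)).comp_hasFDerivAt p
      (hasFDerivAt_snd (𝕜 := ℝ) (p := p))
    exact this
  have h2 : HasFDerivAt (fun p : Space d => heat f (β o) p.1)
      ((∑ i, heat (pd i f) (β o) p.1 • (EuclideanSpace.proj i : Bdry d →L[ℝ] ℝ)).comp
        (ContinuousLinearMap.fst ℝ (Bdry d) ℝ)) p :=
    (hasFDerivAt_heat hf (β o) p.1).comp p hasFDerivAt_fst
  refine (h1.fun_mul h2).congr_fderiv ?_
  ext v
  · simp [gradL_apply, potInt, Finset.mul_sum, sum_apply]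
    exact Finset.sum_congr rfl fun i _ => by ring
  · simp [gradL_apply, potInt, sum_apply]
    ring

variable {Ω : Type*} [MeasurableSpace Ω]

/-- A superposition of products of one-dimensional and tangential heat kernels. -/
noncomputable def pot (μ : Measure Ω) (c α β : Ω → ℝ) (j : ℕ) (f : Bdry d → ℝ) (p : Space d) : ℝ :=
  ∫ o, potInt c α β j f p o ∂μ

theorem gradL_eq (a : Fin d → ℝ) (b : ℝ) : gradL a b =
    ∑ i, a i • ((EuclideanSpace.proj i : Bdry d →L[ℝ] ℝ).comp (ContinuousLinearMap.fst ℝ (Bdry d) ℝ))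
      + b • ContinuousLinearMap.snd ℝ (Bdry d) ℝ := by
  ext <;> simp [gradL, sum_apply]

theorem continuous_gradL : Continuous fun q : (Fin d → ℝ) × ℝ => gradL q.1 q.2 := by
  simp only [gradL_eq]
  refine Continuous.add (continuous_finsetSum _ fun i _ => ?_) ?_
  · exact ((continuous_apply i).comp continuous_fst).smul continuous_const
  · exact continuous_snd.smul continuous_const

theorem integrable_gradL {μ : Measure Ω} {a : Fin d → Ω → ℝ} {b : Ω → ℝ}
    (ha : ∀ i, Integrable (a i) μ) (hb : Integrable b μ) :
    Integrable (fun o => gradL (fun i => a i o) (b o)) μ := by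
  have hm : AEStronglyMeasurable (fun o => ((fun i => a i o), b o)) μ :=
    ((aemeasurable_pi_iff.2 fun i => (ha i).aestronglyMeasurable.aemeasurable).prodMk
      hb.aestronglyMeasurable.aemeasurable).aestronglyMeasurable
  have hm' := continuous_gradL.comp_aestronglyMeasurable hm
  have hi : Integrable (fun o => ∑ i, |a i o| + |b o|) μ :=
    (integrable_finsetSum Finset.univ fun i _ => (ha i).abs).add hb.abs
  exact hi.mono' hm' (ae_of_all _ fun o => norm_gradL_le _ _)

/-- Integrability of a superposition, locally uniformly in the half-space, for the `j`-th normal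
derivative and functions whose heat evolution decays with exponent `e`. -/
structure Adm (μ : Measure Ω) (c α β : Ω → ℝ) (j e : ℕ) : Prop where
  measurable_c : Measurable c
  measurable_α : Measurable α
  measurable_β : Measurable β
  pos : ∀ᵐ o ∂μ, 0 < α o ∧ 0 ≤ β o
  integrable : ∀ δ : ℝ, 0 < δ →
    Integrable (fun o => |c o| * ((α o + δ) ^ j)⁻¹ * ((1 + β o) ^ e)⁻¹) μ

variable {μ : Measure Ω} {c α β : Ω → ℝ} {j e : ℕ} {f : Bdry d → ℝ}

theorem Adm.measurable_potInt (h : Adm μ c α β j e) (k : ℕ) (hf : IsBump f) (p : Space d) :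
    Measurable (potInt c α β k f p) := by
  unfold potInt
  refine (h.measurable_c.mul ((measurable_ker k).comp
    (measurable_const.prodMk h.measurable_α))).mul ?_
  exact ((continuous_heat hf).measurable).comp (h.measurable_β.prodMk measurable_const)

theorem Adm.succ (h : Adm μ c α β j e) : Adm μ c α β (j + 1) e where
  measurable_c := h.measurable_c
  measurable_α := h.measurable_α
  measurable_β := h.measurable_β
  pos := h.pos
  integrable δ hδ := by
    refine ((h.integrable δ hδ).const_mul δ⁻¹).mono' ?_ ?_
    · have := h.measurable_c
      have := h.measurable_α
      have := h.measurable_β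
      exact Measurable.aestronglyMeasurable (by fun_prop)
    · filter_upwards [h.pos] with o ho
      have h1 := ho.1
      have h2 := ho.2
      rw [Real.norm_of_nonneg (by positivity), pow_succ, mul_inv]
      calc |c o| * (((α o + δ) ^ j)⁻¹ * (α o + δ)⁻¹) * ((1 + β o) ^ e)⁻¹
          ≤ |c o| * (((α o + δ) ^ j)⁻¹ * δ⁻¹) * ((1 + β o) ^ e)⁻¹ := by gcongr; linarith
        _ = _ := by ring

/-- The dominating function is uniform over `x_n ≥ δ`, which is what differentiation under the
integral and continuity need. Only the decay of the heat evolution in `β` is used, not its decay in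
the tangential position. -/
theorem Adm.dominated (h : Adm μ c α β j e) (hf : HeatDecay e f) {δ : ℝ} (hδ : 0 < δ) :
    ∃ b : Ω → ℝ, Integrable b μ ∧
      ∀ᵐ o ∂μ, ∀ p : Space d, δ ≤ p.2 → |potInt c α β j f p o| ≤ b o := by
  obtain ⟨C, hC, hk⟩ := abs_ker_le j 0
  obtain ⟨C', hC', hd⟩ := hf.decay
  refine ⟨_, (h.integrable δ hδ).const_mul (C * C'), ?_⟩
  filter_upwards [h.pos] with o ho p hp
  obtain ⟨h1, h2⟩ := ho
  have h3 := hk p.2 (α o) h1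
  have h4 := hd (β o) p.1 h2
  rw [pow_zero, mul_one, zero_add, abs_of_pos (hδ.trans_le hp)] at h3
  rw [potInt, abs_mul, abs_mul]
  have h3' : |ker j p.2 (α o)| ≤ C * ((α o + δ) ^ j)⁻¹ := h3.trans (by
    rw [div_eq_mul_inv]; gcongr)
  have h4' : |heat f (β o) p.1| ≤ C' * ((1 + β o) ^ e)⁻¹ := h4.trans (by
    rw [div_eq_mul_inv]
    have := norm_nonneg p.1
    have h5 : 1 + β o ≤ 1 + β o + ‖p.1‖ := by linarith
    gcongr)
  calc _ ≤ |c o| * (C * ((α o + δ) ^ j)⁻¹) * (C' * ((1 + β o) ^ e)⁻¹) := by gcongr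
    _ = _ := by ring

theorem Adm.integrable_potInt (h : Adm μ c α β j e) (hf : HeatDecay e f) {p : Space d}
    (hp : p ∈ halfSpace d) : Integrable (potInt c α β j f p) μ := by
  obtain ⟨b, hb, hd⟩ := h.dominated hf (δ := p.2) hp
  refine hb.mono' (h.measurable_potInt j hf.toIsBump p).aestronglyMeasurable ?_
  filter_upwards [hd] with o ho
  exact ho p le_rfl

theorem HeatDecay.pd (hf : HeatDecay e f) (he : e ≤ d + 1) (i : Fin d) :
    HeatDecay e (HalfSpaceStokes.pd i f) := (hf.toIsBump.heatDecay_pd i).mono he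

/-- Differentiation of a potential, normalized by a function of `o` alone. -/
theorem hasFDerivAt_pot_sub {e e' : ℕ} (h1 : Adm μ c α β j e) (h2 : Adm μ c α β (j + 1) e')
    (hf1 : ∀ i, HeatDecay e (pd i f)) (hf2 : HeatDecay e' f) (k : Ω → ℝ) {p : Space d}
    (hk : AEStronglyMeasurable k μ)
    (hp : p ∈ halfSpace d) (hint : Integrable (fun o => potInt c α β j f p o - k o) μ) :
    HasFDerivAt (fun p => ∫ o, (potInt c α β j f p o - k o) ∂μ)
      (gradL (fun i => pot μ c α β j (pd i f) p) (pot μ c α β (j + 1) f p)) p := by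
  have hp' : 0 < p.2 := hp
  set δ := p.2 / 2 with hδ
  have hδ0 : 0 < δ := by positivity
  choose b hb hd using fun i => h1.dominated (hf1 i) hδ0
  obtain ⟨b', hb', hd'⟩ := h2.dominated hf2 hδ0
  have hs : {x : Space d | δ < x.2} ∈ 𝓝 p :=
    (isOpen_lt continuous_const continuous_snd).mem_nhds (by
      change δ < p.2; rw [hδ]; linarith)
  have hgi : Integrable (fun o => gradL (fun i => potInt c α β j (pd i f) p o)
      (potInt c α β (j + 1) f p o)) μ := 
    integrable_gradL (fun i => h1.integrable_potInt (hf1 i) hp) (h2.integrable_potInt hf2 hp)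
  have key := hasFDerivAt_integral_of_dominated_of_fderiv_le (μ := μ)
    (F := fun p o => potInt c α β j f p o - k o)
    (F' := fun p o => gradL (fun i => potInt c α β j (pd i f) p o) (potInt c α β (j + 1) f p o))
    (x₀ := p) (bound := fun o => ∑ i, b i o + b' o) hs
    (Eventually.of_forall fun x =>
      (h1.measurable_potInt j hf2.toIsBump x).aestronglyMeasurable.sub hk)
    hint hgi.aestronglyMeasurable
    (by
      filter_upwards [ae_all_iff.2 hd, hd'] with o h3 h4 x hx
      refine (norm_gradL_le _ _).trans (add_le_add (Finset.sum_le_sum fun i _ => ?_) ?_)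
      · exact h3 i x (le_of_lt hx)
      · exact h4 x (le_of_lt hx))
    ((integrable_finsetSum _ fun i _ => hb i).add hb')
    (ae_of_all _ fun o x _ => (hasFDerivAt_potInt hf2.toIsBump o x).sub_const (k o))
  refine key.congr_fderiv ?_
  ext v
  · have := ContinuousLinearMap.integral_apply hgi (v, (0 : ℝ))
    rw [ContinuousLinearMap.comp_apply, ContinuousLinearMap.comp_apply,
      ContinuousLinearMap.inl_apply, this]
    simp only [gradL_apply, mul_zero, add_zero]
    rw [integral_finsetSum _ fun i _ => (h1.integrable_potInt (hf1 i) hp).mul_const _]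
    exact Finset.sum_congr rfl fun i _ => by rw [integral_mul_const]; rfl
  · have := ContinuousLinearMap.integral_apply hgi ((0 : Bdry d), (1 : ℝ))
    rw [ContinuousLinearMap.comp_apply, ContinuousLinearMap.comp_apply,
      ContinuousLinearMap.inr_apply, this]
    simp [gradL_apply, pot]

theorem hasFDerivAt_pot (h : Adm μ c α β j e) (hf : HeatDecay e f) (he : e ≤ d + 1) {p : Space d}
    (hp : p ∈ halfSpace d) : HasFDerivAt (pot μ c α β j f)
      (gradL (fun i => pot μ c α β j (pd i f) p) (pot μ c α β (j + 1) f p)) p := by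
  have := hasFDerivAt_pot_sub (f := f) h h.succ (hf.pd he) hf (fun _ => 0)
    aestronglyMeasurable_const hp (by simpa using h.integrable_potInt hf hp)
  simp only [sub_zero] at this
  exact this

theorem contDiffOn_gradL {n : ℕ} {a : Fin d → Space d → ℝ} {b : Space d → ℝ} {S : Set (Space d)}
    (ha : ∀ i, ContDiffOn ℝ n (a i) S) (hb : ContDiffOn ℝ n b S) :
    ContDiffOn ℝ n (fun p => gradL (fun i => a i p) (b p)) S := by
  unfold gradL
  refine ContDiffOn.add ?_ (hb.smul contDiffOn_const)
  have : ContDiffOn ℝ n (fun p => ∑ i, a i p • ((EuclideanSpace.proj i : Bdry d →L[ℝ] ℝ).comp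
      (ContinuousLinearMap.fst ℝ (Bdry d) ℝ))) S :=
    ContDiffOn.sum fun i _ => (ha i).smul contDiffOn_const
  refine this.congr fun p _ => ?_
  ext <;> simp [sum_apply]

theorem contDiffOn_succ_of_gradL {n : ℕ} {F : Space d → ℝ} {a : Fin d → Space d → ℝ}
    {b : Space d → ℝ} (ha : ∀ i, ContDiffOn ℝ n (a i) (halfSpace d))
    (hb : ContDiffOn ℝ n b (halfSpace d))
    (hF : ∀ p ∈ halfSpace d, HasFDerivAt F (gradL (fun i => a i p) (b p)) p) :
    ContDiffOn ℝ (n + 1 : ℕ) F (halfSpace d) := by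
  rw [Nat.cast_add, Nat.cast_one, contDiffOn_succ_iff_hasFDerivWithinAt (by simp)]
  intro x hx
  refine ⟨halfSpace d, ?_, by simp, fun p => gradL (fun i => a i p) (b p), fun p hp =>
    (hF p hp).hasFDerivWithinAt, contDiffOn_gradL ha hb⟩
  rw [insert_eq_of_mem hx]
  exact self_mem_nhdsWithin

theorem contDiffOn_pot (he : e ≤ d + 1) (n : ℕ) : ∀ {j : ℕ} {f : Bdry d → ℝ},
    Adm μ c α β j e → HeatDecay e f → ContDiffOn ℝ n (pot μ c α β j f) (halfSpace d) := by
  induction n with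
  | zero =>
    intro j f h hf
    rw [Nat.cast_zero, contDiffOn_zero]
    exact fun p hp => (hasFDerivAt_pot h hf he hp).continuousAt.continuousWithinAt
  | succ n ih =>
    intro j f h hf
    exact contDiffOn_succ_of_gradL (fun i => ih h (hf.pd he i)) (ih h.succ hf)
      fun p hp => hasFDerivAt_pot h hf he hp

theorem pot_lap (h : Adm μ c α β j e) (hf : IsBump f)
    (hf' : ∀ i, HeatDecay e (pd i (pd i f))) {p : Space d} (hp : p ∈ halfSpace d) :
    pot μ c α β j (lap f) p = ∑ i, pot μ c α β j (pd i (pd i f)) p := by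
  simp only [pot, potInt, heat_lap hf, Finset.mul_sum]
  exact integral_finsetSum _ fun i _ => h.integrable_potInt (hf' i) hp

/-! ### The scalar Laplacian -/

/-- The Laplacian of a scalar function of `n` variables. -/
noncomputable def slap (F : Space d → ℝ) (p : Space d) : ℝ :=
  (∑ i : Fin d, iteratedFDeriv ℝ 2 F p ![tangent i, tangent i]) +
    iteratedFDeriv ℝ 2 F p ![normal d, normal d]

/-- `F` is twice continuously differentiable in the half-space and `Δ F = G` there. -/
structure HasLap (F G : Space d → ℝ) : Prop where
  contDiffOn : ContDiffOn ℝ 2 F (halfSpace d)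
  slap_eq : ∀ p ∈ halfSpace d, slap F p = G p

theorem HasLap.congr {F F' G G' : Space d → ℝ} (h : HasLap F G)
    (hF : ∀ p ∈ halfSpace d, F' p = F p) (hG : ∀ p ∈ halfSpace d, G p = G' p) : HasLap F' G' := by
  refine ⟨h.contDiffOn.congr hF, fun p hp => ?_⟩
  have he : F' =ᶠ[𝓝 p] F := eventually_of_mem (isOpen_halfSpace.mem_nhds hp) hF
  rw [slap, ← hG p hp, ← h.slap_eq p hp, slap, he.iteratedFDeriv ℝ 2 |>.eq_of_nhds]

theorem HasLap.add {F F' G G' : Space d → ℝ} (h : HasLap F G) (h' : HasLap F' G') :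
    HasLap (fun p => F p + F' p) (fun p => G p + G' p) := by
  refine ⟨h.contDiffOn.add h'.contDiffOn, fun p hp => ?_⟩
  have e := iteratedFDeriv_add_apply
    (h.contDiffOn.contDiffAt (isOpen_halfSpace.mem_nhds hp))
    (h'.contDiffOn.contDiffAt (isOpen_halfSpace.mem_nhds hp))
  change slap (F + F') p = _
  rw [← h.slap_eq p hp, ← h'.slap_eq p hp, slap, slap, slap]
  simp only [e, add_apply, Finset.sum_add_distrib]
  ring

theorem HasLap.const_mul {F G : Space d → ℝ} (h : HasLap F G) (r : ℝ) :
    HasLap (fun p => r * F p) (fun p => r * G p) := by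
  refine ⟨contDiffOn_const.mul h.contDiffOn, fun p hp => ?_⟩
  have e := iteratedFDeriv_const_smul_apply (a := r)
    (h.contDiffOn.contDiffAt (isOpen_halfSpace.mem_nhds hp))
  change slap (r • F) p = _
  rw [← h.slap_eq p hp, slap, slap]
  simp only [e, smul_apply, smul_eq_mul, mul_add, Finset.mul_sum]

theorem HasLap.neg {F G : Space d → ℝ} (h : HasLap F G) :
    HasLap (fun p => -F p) (fun p => -G p) := by
  simpa using h.const_mul (-1)

theorem HasLap.sub {F F' G G' : Space d → ℝ} (h : HasLap F G) (h' : HasLap F' G') :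
    HasLap (fun p => F p - F' p) (fun p => G p - G' p) := by
  simpa [sub_eq_add_neg] using h.add h'.neg

theorem iteratedFDeriv_two_eq {F G : Space d → ℝ} {G' : Space d →L[ℝ] ℝ} {p v : Space d}
    (hF : ContDiffAt ℝ 2 F p) (h1 : ∀ᶠ x in 𝓝 p, fderiv ℝ F x v = G x)
    (h2 : HasFDerivAt G G' p) : iteratedFDeriv ℝ 2 F p ![v, v] = G' v := by
  rw [iteratedFDeriv_two_apply]
  have h3 : DifferentiableAt ℝ (fderiv ℝ F) p :=
    (hF.fderiv_right (m := 1) (by norm_num)).differentiableAt (by simp)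
  have h4 : HasFDerivAt (fun x => fderiv ℝ F x v)
      ((ContinuousLinearMap.apply ℝ ℝ v).comp (fderiv ℝ (fderiv ℝ F) p)) p :=
    (ContinuousLinearMap.apply ℝ ℝ v).hasFDerivAt.comp p h3.hasFDerivAt
  have h5 := (h4.congr_of_eventuallyEq (EventuallyEq.symm h1)).unique h2
  rw [← h5]
  simp

/-- No equation has been used yet: this only identifies the Laplacian as a sum of two potentials.
The harmonic or caloric cancellation between them is supplied by integration by parts in `v`. -/
theorem hasLap_pot (h : Adm μ c α β j e) (hf : HeatDecay e f) (he : e ≤ d + 1) :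
    HasLap (pot μ c α β j f)
      (fun p => pot μ c α β (j + 2) f p + pot μ c α β j (lap f) p) := by
  have hC : ContDiffOn ℝ 2 (pot μ c α β j f) (halfSpace d) := contDiffOn_pot he 2 h hf
  refine ⟨hC, fun p hp => ?_⟩
  have hn := isOpen_halfSpace.mem_nhds hp
  have hc := hC.contDiffAt hn
  rw [slap, pot_lap h hf.toIsBump (fun i => (hf.pd he i).pd he i) hp, add_comm]
  congr 1
  · rw [iteratedFDeriv_two_eq (v := normal d) hc (G := pot μ c α β (j + 1) f) _
      (hasFDerivAt_pot h.succ hf he hp), gradL_normal]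
    filter_upwards [hn] with x hx
    rw [(hasFDerivAt_pot h hf he hx).fderiv, gradL_normal]
  · refine Finset.sum_congr rfl fun i _ => ?_
    rw [iteratedFDeriv_two_eq (v := tangent i) hc (G := pot μ c α β j (pd i f)) _
      (hasFDerivAt_pot h (hf.pd he i) he hp), gradL_tangent]
    filter_upwards [hn] with x hx
    rw [(hasFDerivAt_pot h hf he hx).fderiv, gradL_tangent]

end Potentials

end HalfSpaceStokes

namespace HalfSpaceStokes

/-! ### Time profiles -/

/-- A continuous function of time that vanishes for nonpositive times. -/
structure TimeProfile (θ : ℝ → ℝ) : Prop where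
  continuous : Continuous θ
  eq_zero : ∀ s ≤ 0, θ s = 0

/-- The primitive `∫_0^t θ`. -/
noncomputable def prim (θ : ℝ → ℝ) (t : ℝ) : ℝ := ∫ s in (0 : ℝ)..t, θ s

theorem TimeProfile.hasDerivAt_prim {θ : ℝ → ℝ} (h : TimeProfile θ) (t : ℝ) :
    HasDerivAt (prim θ) (θ t) t :=
  intervalIntegral.integral_hasDerivAt_right (h.continuous.intervalIntegrable _ _)
    (h.continuous.stronglyMeasurableAtFilter _ _) h.continuous.continuousAt

theorem TimeProfile.prim {θ : ℝ → ℝ} (h : TimeProfile θ) : TimeProfile (prim θ) where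
  continuous := continuous_iff_continuousAt.2 fun t => (h.hasDerivAt_prim t).continuousAt
  eq_zero s hs := by
    rw [HalfSpaceStokes.prim, intervalIntegral.integral_symm,
      intervalIntegral.integral_of_le hs, neg_eq_zero]
    refine setIntegral_eq_zero_of_forall_eq_zero fun r hr => h.eq_zero r hr.2

theorem TimeProfile.exists_bound {θ : ℝ → ℝ} (h : TimeProfile θ) (T : ℝ) :
    ∃ B, 0 ≤ B ∧ ∀ s ≤ T, |θ s| ≤ B := by
  obtain ⟨B, hB⟩ := isCompact_Icc.exists_bound_of_continuousOn
    (h.continuous.continuousOn (s := Icc 0 T))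
  refine ⟨max B 0, le_max_right _ _, fun s hs => ?_⟩
  rcases le_or_gt s 0 with h0 | h0
  · rw [h.eq_zero s h0, abs_zero]; exact le_max_right _ _
  · exact (hB s ⟨h0.le, hs⟩).trans (le_max_left _ _)

/-! ### Potentials with a time profile -/

section TimePotentials

variable {d : ℕ} {Ω : Type*} [MeasurableSpace Ω]

/-- The weight `c(o) θ(t - T(o))`. -/
def timeWeight {Ω : Type*} (c T : Ω → ℝ) (θ : ℝ → ℝ) (t : ℝ) (o : Ω) : ℝ := c o * θ (t - T o)

variable {μ : Measure Ω} {c T α β : Ω → ℝ} {j e : ℕ} {f : Bdry d → ℝ} {θ : ℝ → ℝ}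

theorem Adm.timeWeight (h : Adm μ c α β j e) (hT : Measurable T) (hT0 : ∀ᵐ o ∂μ, 0 ≤ T o)
    (hθ : TimeProfile θ) (t : ℝ) : Adm μ (timeWeight c T θ t) α β j e where
  measurable_c := h.measurable_c.mul (hθ.continuous.measurable.comp (measurable_const.sub hT))
  measurable_α := h.measurable_α
  measurable_β := h.measurable_β
  pos := h.pos
  integrable δ hδ := by
    obtain ⟨B, hB0, hB⟩ := hθ.exists_bound t
    have hm : Measurable (HalfSpaceStokes.timeWeight c T θ t) :=
      h.measurable_c.mul (hθ.continuous.measurable.comp (measurable_const.sub hT))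
    refine ((h.integrable δ hδ).const_mul B).mono' ?_ ?_
    · have := h.measurable_α
      have := h.measurable_β
      exact Measurable.aestronglyMeasurable (by fun_prop)
    · filter_upwards [h.pos, hT0] with o ho ho2
      have h1 := ho.1
      have h2 := ho.2
      rw [Real.norm_of_nonneg (by positivity), HalfSpaceStokes.timeWeight, abs_mul]
      have h3 := hB (t - T o) (by linarith)
      calc |c o| * |θ (t - T o)| * ((α o + δ) ^ j)⁻¹ * ((1 + β o) ^ e)⁻¹
          ≤ |c o| * B * ((α o + δ) ^ j)⁻¹ * ((1 + β o) ^ e)⁻¹ := by gcongr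
        _ = _ := by ring

theorem continuous_pot_time (h : Adm μ c α β j e) (hT : Measurable T) (hT0 : ∀ᵐ o ∂μ, 0 ≤ T o)
    (hθ : TimeProfile θ) (hf : HeatDecay e f) {p : Space d} (hp : p ∈ halfSpace d) :
    Continuous fun t => pot μ (timeWeight c T θ t) α β j f p := by
  refine continuous_iff_continuousAt.2 fun t => ?_
  obtain ⟨B, hB0, hB⟩ := hθ.exists_bound (t + 1)
  have hi := h.integrable_potInt hf hp
  refine continuousAt_of_dominated (bound := fun o => B * |potInt c α β j f p o|)
    (Eventually.of_forall fun s =>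
      ((h.timeWeight hT hT0 hθ s).measurable_potInt j hf.toIsBump p).aestronglyMeasurable) ?_
    (hi.abs.const_mul B) ?_
  · filter_upwards [Iio_mem_nhds (lt_add_one t)] with s hs
    filter_upwards [hT0] with o ho
    have hs : s < t + 1 := hs
    have h3 := hB (s - T o) (by linarith)
    have e : potInt (timeWeight c T θ s) α β j f p o = θ (s - T o) * potInt c α β j f p o := by
      simp only [potInt, timeWeight]; ring
    rw [e, norm_mul]
    gcongr
    · exact h3
    · rfl
  · refine ae_of_all _ fun o => ?_
    have := hθ.continuous
    unfold potInt timeWeight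
    fun_prop

theorem hasDerivAt_pot_time (h : Adm μ c α β j e) (hT : Measurable T) (hT0 : ∀ᵐ o ∂μ, 0 ≤ T o)
    (hθ : TimeProfile θ) (hf : HeatDecay e f) {p : Space d} (hp : p ∈ halfSpace d) (t : ℝ) :
    HasDerivAt (fun t => pot μ (timeWeight c T (prim θ) t) α β j f p)
      (pot μ (timeWeight c T θ t) α β j f p) t := by
  obtain ⟨B, hB0, hB⟩ := hθ.exists_bound (t + 1)
  have hi := h.integrable_potInt hf hp
  refine (hasDerivAt_integral_of_dominated_loc_of_deriv_le (s := Iio (t + 1))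
    (F := fun s o => potInt (timeWeight c T (prim θ) s) α β j f p o)
    (F' := fun s o => potInt (timeWeight c T θ s) α β j f p o)
    (bound := fun o => B * |potInt c α β j f p o|) (Iio_mem_nhds (lt_add_one t))
    (Eventually.of_forall fun s =>
      ((h.timeWeight hT hT0 hθ.prim s).measurable_potInt j hf.toIsBump p).aestronglyMeasurable)
    ((h.timeWeight hT hT0 hθ.prim t).integrable_potInt hf hp)
    ((h.timeWeight hT hT0 hθ t).integrable_potInt hf hp).aestronglyMeasurable ?_
    (hi.abs.const_mul B) ?_).2
  · filter_upwards [hT0] with o ho s hs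
    have hs : s < t + 1 := hs
    have h3 := hB (s - T o) (by linarith)
    have e : potInt (timeWeight c T θ s) α β j f p o = θ (s - T o) * potInt c α β j f p o := by
      simp only [potInt, timeWeight]; ring
    rw [e, norm_mul]
    gcongr
    · exact h3
    · rfl
  · refine ae_of_all _ fun o s _ => ?_
    have h1 := ((hθ.hasDerivAt_prim (s - T o)).comp_sub_const s (T o))
    have h2 := (((h1.const_mul (c o)).mul_const (ker j p.2 (α o))).mul_const (heat f (β o) p.1))
    exact h2

/-- If `θ` vanishes up to time `t`, so does every potential. -/
theorem pot_time_eq_zero (hT0 : ∀ᵐ o ∂μ, 0 ≤ T o) {t : ℝ} (ht : ∀ s ≤ t, θ s = 0)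
    (p : Space d) : pot μ (timeWeight c T θ t) α β j f p = 0 := by
  refine integral_eq_zero_of_ae ?_
  filter_upwards [hT0] with o ho
  simp [potInt, timeWeight, ht (t - T o) (by linarith)]

end TimePotentials

/-! ### Integration by parts in the variable `v = √τ` -/

section Parts

theorem hasDerivAt_parts {j : ℕ} (hj : j ≤ 1) (x : ℝ) {h h₁ : ℝ → ℝ}
    (hd : ∀ v, 0 < v → HasDerivAt h (2 * v * h₁ v) v) {v : ℝ} (hv : 0 < v) :
    HasDerivAt (fun v => ker j x v / (2 * v) * h v)
      (ker (j + 2) x v * h v + ker j x v * h₁ v) v := by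
  refine ((hasDerivAt_ker_div hj x hv).mul (hd v hv)).congr_deriv ?_
  field_simp

/-- The integrand is the exact `v`-derivative of `ker_j h/(2v)`, because both the kernel and `h`
satisfy the heat equation in `v`; the boundary terms vanish at both ends. The statement is for
abstract `h` so that it covers `e^{v²Δ'}f` as well as `e^{(v²+η²)Δ'}f`. -/
theorem integral_ker_harmonic {j : ℕ} (hj : j ≤ 1) {x : ℝ} (hx : 0 < x) {h h₁ : ℝ → ℝ}
    (hd : ∀ v, 0 < v → HasDerivAt h (2 * v * h₁ v) v) {B : ℝ} (hB : ∀ v, |h v| ≤ B)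
    (hi : IntegrableOn (fun v => ker (j + 2) x v * h v + ker j x v * h₁ v) (Ioi 0)) :
    ∫ v in Ioi 0, (ker (j + 2) x v * h v + ker j x v * h₁ v) = 0 := by
  have hlim : ∀ {l : Filter ℝ}, Tendsto (fun v => ker j x v / (2 * v)) l (𝓝 0) →
      Tendsto (fun v => ker j x v / (2 * v) * h v) l (𝓝 0) := fun hl =>
    hl.zero_mul_isBoundedUnder_le ⟨B, by simpa using Eventually.of_forall hB⟩
  have := integral_Ioi_of_hasDerivAt_of_tendsto (a := 0) (m := 0)
    (f := fun v => ker j x v / (2 * v) * h v) ?_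
    (fun v hv => hasDerivAt_parts hj x hd hv) hi (hlim (tendsto_ker_div_atTop hx))
  · simpa using this
  · rw [← continuousWithinAt_Ioi_iff_Ici]
    -- Division by zero gives the value 0 at `v = 0`, which agrees with the limit there, so no
    -- modification is needed for continuity.
    have : ker j x 0 / (2 * 0) * h 0 = 0 := by simp
    rw [ContinuousWithinAt, this]
    exact hlim (tendsto_ker_div_zero hx)

/-- The same integration by parts with the weight `Θ(t - v²)`. Its derivative `-2v θ(t - v²)`
cancels the denominator `2v` and produces the right-hand side; the upper boundary term vanishes
because the profile vanishes at `t - 4`. -/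
theorem integral_ker_heat {j : ℕ} (hj : j ≤ 1) {x : ℝ} (hx : 0 < x) {h h₁ θ Θ : ℝ → ℝ}
    (hd : ∀ v, 0 < v → HasDerivAt h (2 * v * h₁ v) v) {B : ℝ} (hB : ∀ v, |h v| ≤ B)
    (hΘ : ∀ s, HasDerivAt Θ (θ s) s) {t : ℝ} (ht : Θ (t - 2 ^ 2) = 0)
    (hi₁ : IntegrableOn (fun v => Θ (t - v ^ 2) * (ker (j + 2) x v * h v + ker j x v * h₁ v))
      (Ioo 0 2))
    (hi₂ : IntegrableOn (fun v => θ (t - v ^ 2) * (ker j x v * h v)) (Ioo 0 2)) :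
    ∫ v in Ioo 0 2, Θ (t - v ^ 2) * (ker (j + 2) x v * h v + ker j x v * h₁ v) =
      ∫ v in Ioo 0 2, θ (t - v ^ 2) * (ker j x v * h v) := by
  set G := fun v => ker j x v / (2 * v) * h v with hG
  have hlim : Tendsto G (𝓝[>] 0) (𝓝 0) :=
    (tendsto_ker_div_zero hx).zero_mul_isBoundedUnder_le
      ⟨B, by simpa using Eventually.of_forall hB⟩
  have hF : ∀ v, 0 < v → HasDerivAt (fun v => Θ (t - v ^ 2) * G v)
      (Θ (t - v ^ 2) * (ker (j + 2) x v * h v + ker j x v * h₁ v)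
        - θ (t - v ^ 2) * (ker j x v * h v)) v := by
    intro v hv
    have h1 : HasDerivAt (fun v : ℝ => t - v ^ 2) (-(2 * v)) v := by
      simpa using ((hasDerivAt_id v).pow 2).const_sub t
    refine (((hΘ (t - v ^ 2)).comp v h1).mul (hasDerivAt_parts hj x hd hv)).congr_deriv ?_
    simp only [Function.comp]
    field_simp
    ring
  have hΘc : Continuous Θ := continuous_iff_continuousAt.2 fun s => (hΘ s).continuousAt
  have hcont : ContinuousOn (fun v => Θ (t - v ^ 2) * G v) (Icc 0 2) := by
    intro v hv
    rcases hv.1.eq_or_lt with rfl | h0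
    -- The left endpoint again uses that division by zero returns 0, the correct limit.
    · refine ContinuousWithinAt.mono ?_ Icc_subset_Ici_self
      rw [← continuousWithinAt_Ioi_iff_Ici]
      have e : Θ (t - 0 ^ 2) * G 0 = Θ (t - 0 ^ 2) * 0 := by simp [hG]
      rw [ContinuousWithinAt, e]
      refine Tendsto.mul ?_ hlim
      exact (Continuous.tendsto (by fun_prop) 0).mono_left nhdsWithin_le_nhds
    · exact (hF v h0).continuousAt.continuousWithinAt
  have key := intervalIntegral.integral_eq_sub_of_hasDerivAt_of_le (by norm_num : (0 : ℝ) ≤ 2)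
    hcont (fun v hv => hF v hv.1) (by
      rw [intervalIntegrable_iff_integrableOn_Ioo_of_le (by norm_num)]
      exact hi₁.sub hi₂)
  rw [intervalIntegral.integral_of_le (by norm_num), integral_Ioc_eq_integral_Ioo,
    integral_sub hi₁ hi₂, ht] at key
  have e : Θ (t - 0 ^ 2) * G 0 = 0 := by simp [hG]
  rw [e] at key
  linarith

end Parts

/-! ### The four potentials -/

section Concrete

variable {d : ℕ}

/-- Lebesgue measure on `(0, ∞)`. -/
noncomputable abbrev volPos : Measure ℝ := volume.restrict (Ioi 0)

/-- Lebesgue measure on `(0, 2)`. -/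
noncomputable abbrev volTwo : Measure ℝ := volume.restrict (Ioo 0 2)

/-- Lebesgue measure on `(0, 2) × (0, ∞)`. -/
noncomputable abbrev volStrip : Measure (ℝ × ℝ) := volTwo.prod volPos

/-- The radial variable on `ℝ²`. -/
noncomputable def rad (o : ℝ × ℝ) : ℝ := √(o.1 ^ 2 + o.2 ^ 2)

theorem measurable_rad : Measurable rad := by unfold rad; fun_prop

theorem continuous_rad : Continuous rad := by unfold rad; fun_prop

theorem snd_le_rad (o : ℝ × ℝ) : o.2 ≤ rad o :=
  Real.le_sqrt_of_sq_le (by nlinarith [sq_nonneg o.1])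

theorem fst_le_rad (o : ℝ × ℝ) : o.1 ≤ rad o :=
  Real.le_sqrt_of_sq_le (by nlinarith [sq_nonneg o.2])

theorem rad_nonneg (o : ℝ × ℝ) : 0 ≤ rad o := Real.sqrt_nonneg _

theorem ae_volStrip : ∀ᵐ o ∂volStrip, (0 < o.1 ∧ o.1 < 2) ∧ 0 < o.2 := by
  rw [volStrip, Measure.prod_restrict, ae_restrict_iff' (measurableSet_Ioo.prod measurableSet_Ioi)]
  exact ae_of_all _ fun o ho => ⟨⟨ho.1.1, ho.1.2⟩, ho.2⟩

theorem ae_volTwo : ∀ᵐ v ∂volTwo, 0 < v ∧ v < 2 :=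
  (ae_restrict_iff' measurableSet_Ioo).2 (ae_of_all _ fun _ hv => hv)

theorem ae_volPos : ∀ᵐ v ∂volPos, 0 < v :=
  (ae_restrict_iff' measurableSet_Ioi).2 (ae_of_all _ fun _ hv => hv)

instance : IsFiniteMeasure volTwo := ⟨by simp [volTwo]⟩

theorem integrable_inv_sq_volPos : Integrable (fun v : ℝ => ((1 + v) ^ 2)⁻¹) volPos := by
  refine (integrable_inv_one_add_sq.integrableOn (s := Ioi 0)).mono' ?_ ?_
  · exact Measurable.aestronglyMeasurable (by fun_prop)
  · filter_upwards [ae_volPos] with v hv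
    rw [Real.norm_of_nonneg (by positivity)]
    gcongr
    nlinarith

/-- Without a normal derivative the kernel does not decay in `v`, so the heat evolution must supply
`v^{-2}`. The exponent `d + 1`, available for first derivatives of a bump, suffices exactly because
`d ≥ 1`. -/
theorem adm_harm_zero (hd : 1 ≤ d) : Adm volPos (fun _ => 1) id id 0 (d + 1) where
  measurable_c := measurable_const
  measurable_α := measurable_id
  measurable_β := measurable_id
  pos := by filter_upwards [ae_volPos] with v hv using ⟨hv, hv.le⟩
  integrable δ hδ := by
    refine integrable_inv_sq_volPos.mono' (Measurable.aestronglyMeasurable (by fun_prop)) ?_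
    filter_upwards [ae_volPos] with v hv
    have hv' : (1 : ℝ) ≤ 1 + v := by linarith
    rw [Real.norm_of_nonneg (by simp only [id]; positivity)]
    simp only [abs_one, pow_zero, inv_one, one_mul, id]
    gcongr
    omega

/-- One normal derivative contributes a factor `1/v`, so the basic exponent `d ≥ 1` of a bump is
enough. -/
theorem adm_harm_one (hd : 1 ≤ d) : Adm volPos (fun _ => 1) id id 1 d where
  measurable_c := measurable_const
  measurable_α := measurable_id
  measurable_β := measurable_id
  pos := by filter_upwards [ae_volPos] with v hv using ⟨hv, hv.le⟩
  integrable δ hδ := by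
    refine (integrable_inv_sq_volPos.const_mul (min 1 δ)⁻¹).mono'
      (Measurable.aestronglyMeasurable (by fun_prop)) ?_
    filter_upwards [ae_volPos] with v hv
    have hv' : (1 : ℝ) ≤ 1 + v := by linarith
    have hm : 0 < min 1 δ := lt_min one_pos hδ
    rw [Real.norm_of_nonneg (by simp only [id]; positivity)]
    simp only [abs_one, pow_one, one_mul, id]
    have h1 : min 1 δ * (1 + v) ≤ v + δ := by
      have := min_le_left 1 δ
      have := min_le_right 1 δ
      nlinarith
    have h2 : 1 + v ≤ (1 + v) ^ d := le_self_pow₀ hv' (by omega)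
    calc (v + δ)⁻¹ * ((1 + v) ^ d)⁻¹ ≤ (min 1 δ * (1 + v))⁻¹ * (1 + v)⁻¹ := by gcongr
      _ = _ := by rw [mul_inv, sq, mul_inv]; ring

theorem adm_two (j e : ℕ) : Adm volTwo (fun _ => 1) id id j e where
  measurable_c := measurable_const
  measurable_α := measurable_id
  measurable_β := measurable_id
  pos := by filter_upwards [ae_volTwo] with v hv using ⟨hv.1, hv.1.le⟩
  integrable δ hδ := by
    refine (integrable_const ((δ ^ j)⁻¹)).mono' (Measurable.aestronglyMeasurable (by fun_prop)) ?_
    filter_upwards [ae_volTwo] with v hv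
    have h1 := hv.1
    rw [Real.norm_of_nonneg (by simp only [id]; positivity)]
    simp only [abs_one, one_mul, id]
    calc ((v + δ) ^ j)⁻¹ * ((1 + v) ^ e)⁻¹ ≤ (δ ^ j)⁻¹ * 1 := by
          gcongr
          · linarith
          · exact inv_le_one_of_one_le₀ (one_le_pow₀ (by linarith))
      _ = _ := mul_one _

/-- A weight on the strip whose kernel variable is the second coordinate. -/
theorem adm_strip_snd {j e : ℕ} (h : Adm volPos (fun _ => 1) id id j e) :
    Adm volStrip (fun _ => 2 / √Real.pi) Prod.snd rad j e where
  measurable_c := measurable_const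
  measurable_α := measurable_snd
  measurable_β := measurable_rad
  pos := by filter_upwards [ae_volStrip] with o ho using ⟨ho.2, rad_nonneg o⟩
  integrable δ hδ := by
    have := measurable_rad
    refine (((h.integrable δ hδ).comp_snd volTwo).const_mul (2 / √Real.pi)).mono'
      (Measurable.aestronglyMeasurable (by fun_prop)) ?_
    filter_upwards [ae_volStrip] with o ho
    have h2 := ho.2
    have h3 := snd_le_rad o
    have h4 := rad_nonneg o
    rw [Real.norm_of_nonneg (by positivity), abs_of_nonneg (by positivity)]
    simp only [abs_one, one_mul, id]
    rw [mul_assoc]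
    gcongr

/-- A weight on the strip whose kernel variable is the first coordinate. -/
theorem adm_strip_fst {e : ℕ} (h : Adm volPos (fun _ => 1) id id 0 e) :
    Adm volStrip (fun _ => 2 / √Real.pi) Prod.fst rad 0 e where
  measurable_c := measurable_const
  measurable_α := measurable_fst
  measurable_β := measurable_rad
  pos := by filter_upwards [ae_volStrip] with o ho using ⟨ho.1.1, rad_nonneg o⟩
  integrable δ hδ := by simpa using (adm_strip_snd h).integrable δ hδ

/-- The harmonic potential `∫_0^∞ ∂_x^j k(x,v) e^{v²Δ'} f dv`. -/
noncomputable def potA (j : ℕ) (f : Bdry d → ℝ) (p : Space d) : ℝ :=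
  pot volPos (fun _ => 1) id id j f p

/-- The caloric potential with the heat evolution of `f`. -/
noncomputable def potC (θ : ℝ → ℝ) (t : ℝ) (j : ℕ) (f : Bdry d → ℝ) (p : Space d) : ℝ :=
  pot volTwo (timeWeight (fun _ => 1) (fun v => v ^ 2) θ t) id id j f p

/-- The harmonic potential of the half-integral in time. -/
noncomputable def potP (θ : ℝ → ℝ) (t : ℝ) (j : ℕ) (f : Bdry d → ℝ) (p : Space d) : ℝ :=
  pot volStrip (timeWeight (fun _ => 2 / √Real.pi) (fun o => o.1 ^ 2) θ t) Prod.snd rad j f p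

/-- The caloric potential with the heat evolution of the half-integral of `f`. -/
noncomputable def potD (θ : ℝ → ℝ) (t : ℝ) (j : ℕ) (f : Bdry d → ℝ) (p : Space d) : ℝ :=
  pot volStrip (timeWeight (fun _ => 2 / √Real.pi) (fun o => o.1 ^ 2) θ t) Prod.fst rad j f p

/-- Shifting the heat time `v²` by a constant `η²` leaves the evolution equation in `v` unchanged.
This transfers the one-dimensional integrations by parts to the potentials over the strip. -/
theorem hasDerivAt_heat_rad {f : Bdry d → ℝ} (hf : IsBump f) (η : ℝ) (x : Bdry d) {v : ℝ}
    (hv : 0 < v) : HasDerivAt (fun v => heat f (rad (v, η)) x)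
      (2 * v * heat (lap f) (rad (v, η)) x) v := by
  have hr : 0 < rad (v, η) := lt_of_lt_of_le hv (fst_le_rad (v, η))
  have h1 : HasDerivAt (fun v => rad (v, η)) (v / rad (v, η)) v := by
    have h2 : HasDerivAt (fun v : ℝ => v ^ 2 + η ^ 2) (2 * v) v := by
      simpa using ((hasDerivAt_id v).pow 2).add_const (η ^ 2)
    refine (h2.sqrt (by positivity)).congr_deriv ?_
    simp only [rad]
    field_simp
  refine ((hasDerivAt_heat hf hr x).comp v h1).congr_deriv ?_
  field_simp

theorem rad_swap (a b : ℝ) : rad (a, b) = rad (b, a) := by simp [rad, add_comm]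

variable {f : Bdry d → ℝ} {j e : ℕ}

theorem potA_harmonic {e' : ℕ} (hj : j ≤ 1) (h : Adm volPos (fun _ => 1) id id (j + 2) e)
    (hf : HeatDecay e f) (h' : Adm volPos (fun _ => 1) id id j e') (hf' : HeatDecay e' (lap f)) {p : Space d} (hp : p ∈ halfSpace d) :
    potA (j + 2) f p + potA j (lap f) p = 0 := by
  have h1 := h.integrable_potInt hf hp
  have h2 := h'.integrable_potInt hf' hp
  obtain ⟨B, _, hB⟩ := abs_heat_le hf.toIsBump
  rw [potA, potA, pot, pot, ← integral_add h1 h2]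
  have e : ∀ v, potInt (fun _ : ℝ => (1 : ℝ)) id id (j + 2) f p v +
      potInt (fun _ : ℝ => (1 : ℝ)) id id j (lap f) p v =
      ker (j + 2) p.2 v * heat f v p.1 + ker j p.2 v * heat (lap f) v p.1 := by
    intro v; simp [potInt]
  simp only [e]
  refine integral_ker_harmonic hj hp (fun v hv => hasDerivAt_heat hf.toIsBump hv p.1)
    (fun v => hB v p.1) ?_
  have := h1.add h2
  refine this.congr (ae_of_all _ fun v => ?_)
  exact e v

theorem potC_heat (hj : j ≤ 1) (hf : IsBump f) {θ : ℝ → ℝ} (hθ : TimeProfile θ) {t : ℝ}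
    (ht : t ≤ 2) {p : Space d} (hp : p ∈ halfSpace d) :
    potC (prim θ) t (j + 2) f p + potC (prim θ) t j (lap f) p = potC θ t j f p := by
  have hT : Measurable fun v : ℝ => v ^ 2 := by fun_prop
  have hT0 : ∀ᵐ v ∂volTwo, 0 ≤ v ^ 2 := ae_of_all _ fun v => sq_nonneg v
  have h1 := ((adm_two (j + 2) d).timeWeight hT hT0 hθ.prim t).integrable_potInt hf.heatDecay hp
  have h2 := ((adm_two j d).timeWeight hT hT0 hθ.prim t).integrable_potInt hf.lap.heatDecay hp
  have h3 := ((adm_two j d).timeWeight hT hT0 hθ t).integrable_potInt hf.heatDecay hp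
  obtain ⟨B, _, hB⟩ := abs_heat_le hf
  have e : ∀ v, potInt (timeWeight (fun _ => 1) (fun v => v ^ 2) (prim θ) t) id id (j + 2) f p v +
      potInt (timeWeight (fun _ => 1) (fun v => v ^ 2) (prim θ) t) id id j (lap f) p v =
      prim θ (t - v ^ 2) *
        (ker (j + 2) p.2 v * heat f v p.1 + ker j p.2 v * heat (lap f) v p.1) := by
    intro v; simp only [potInt, timeWeight, id]; ring
  have e' : ∀ v, potInt (timeWeight (fun _ => 1) (fun v => v ^ 2) θ t) id id j f p v =
      θ (t - v ^ 2) * (ker j p.2 v * heat f v p.1) := by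
    intro v; simp only [potInt, timeWeight, id]; ring
  rw [potC, potC, potC, pot, pot, pot, ← integral_add h1 h2]
  simp only [e, e']
  refine integral_ker_heat hj hp (fun v hv => hasDerivAt_heat hf hv p.1)
    (fun v => hB v p.1) hθ.hasDerivAt_prim (hθ.prim.eq_zero _ (by linarith)) ?_ ?_
  · exact (h1.add h2).congr (ae_of_all _ e)
  · exact h3.congr (ae_of_all _ e')

theorem potP_harmonic {e' : ℕ} (hj : j ≤ 1) (h : Adm volPos (fun _ => 1) id id (j + 2) e)
    (hf : HeatDecay e f) (h' : Adm volPos (fun _ => 1) id id j e') (hf' : HeatDecay e' (lap f)) {θ : ℝ → ℝ} (hθ : TimeProfile θ) (t : ℝ) {p : Space d}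
    (hp : p ∈ halfSpace d) :
    potP θ t (j + 2) f p + potP θ t j (lap f) p = 0 := by
  have hT : Measurable fun o : ℝ × ℝ => o.1 ^ 2 := by fun_prop
  have hT0 : ∀ᵐ o ∂volStrip, 0 ≤ o.1 ^ 2 := ae_of_all _ fun o => sq_nonneg o.1
  have h1 := ((adm_strip_snd h).timeWeight hT hT0 hθ t).integrable_potInt hf hp
  have h2 := ((adm_strip_snd h').timeWeight hT hT0 hθ t).integrable_potInt hf' hp
  obtain ⟨B, _, hB⟩ := abs_heat_le hf.toIsBump
  rw [potP, potP, pot, pot, ← integral_add h1 h2]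
  have e1 : ∀ o : ℝ × ℝ, potInt (timeWeight (fun _ => 2 / √Real.pi) (fun o => o.1 ^ 2) θ t)
        Prod.snd rad (j + 2) f p o +
      potInt (timeWeight (fun _ => 2 / √Real.pi) (fun o => o.1 ^ 2) θ t) Prod.snd rad j (lap f) p o =
      (2 / √Real.pi * θ (t - o.1 ^ 2)) * (ker (j + 2) p.2 o.2 * heat f (rad (o.2, o.1)) p.1 +
        ker j p.2 o.2 * heat (lap f) (rad (o.2, o.1)) p.1) := by
    intro o
    simp only [potInt, timeWeight, rad_swap o.2 o.1]; ring
  have hi := (h1.add h2).congr (ae_of_all _ e1)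
  simp only [e1]
  rw [integral_prod _ hi]
  refine integral_eq_zero_of_ae ?_
  filter_upwards [hi.prod_right_ae] with η hη
  rw [integral_const_mul]
  -- Fubini gives integrability of the slice only with the time weight attached. Where the weight is
  -- nonzero it can be divided out; where it vanishes the slice contributes nothing.
  rcases eq_or_ne (2 / √Real.pi * θ (t - η ^ 2)) 0 with h0 | h0
  · rw [h0]; simp
  · rw [integral_ker_harmonic hj hp
      (fun v hv => hasDerivAt_heat_rad hf.toIsBump η p.1 hv) (fun v => hB _ p.1), mul_zero]
    · rfl
    · refine (hη.const_mul (2 / √Real.pi * θ (t - η ^ 2))⁻¹).congr (ae_of_all _ fun v => ?_)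
      simp only
      rw [← mul_assoc, inv_mul_cancel₀ h0, one_mul]

/-- Here the kernel variable is the first coordinate, which also carries the time shift, so the
slices are taken at fixed second coordinate and the caloric identity is used in place of the
harmonic one. -/
theorem potD_heat (hd : 1 ≤ d) (hj : j ≤ 1) (hf : HeatDecay (d + 1) f) {θ : ℝ → ℝ}
    (hθ : TimeProfile θ) {t : ℝ} (ht : t ≤ 2) {p : Space d} (hp : p ∈ halfSpace d) :
    potD (prim θ) t (j + 2) f p + potD (prim θ) t j (lap f) p = potD θ t j f p := by
  have hT : Measurable fun o : ℝ × ℝ => o.1 ^ 2 := by fun_prop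
  have hT0 : ∀ᵐ o ∂volStrip, 0 ≤ o.1 ^ 2 := ae_of_all _ fun o => sq_nonneg o.1
  have hA0 : Adm volStrip (fun _ => 2 / √Real.pi) Prod.fst rad j (d + 1) := by
    have := adm_strip_fst (adm_harm_zero hd)
    interval_cases j
    exacts [this, this.succ]
  have hA := hA0.timeWeight hT hT0 hθ t
  have hA' := hA0.timeWeight hT hT0 hθ.prim t
  have h1 := hA'.succ.succ.integrable_potInt hf hp
  have h2 := hA'.integrable_potInt (hf.toIsBump.heatDecay_lap.mono (by omega : d + 1 ≤ d + 2)) hp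
  have h3 := hA.integrable_potInt hf hp
  obtain ⟨B, _, hB⟩ := abs_heat_le hf.toIsBump
  have e1 : ∀ o : ℝ × ℝ, potInt (timeWeight (fun _ => 2 / √Real.pi) (fun o => o.1 ^ 2) (prim θ) t)
        Prod.fst rad (j + 1 + 1) f p o +
      potInt (timeWeight (fun _ => 2 / √Real.pi) (fun o => o.1 ^ 2) (prim θ) t)
        Prod.fst rad j (lap f) p o =
      2 / √Real.pi * (prim θ (t - o.1 ^ 2) * (ker (j + 2) p.2 o.1 * heat f (rad (o.1, o.2)) p.1 +
        ker j p.2 o.1 * heat (lap f) (rad (o.1, o.2)) p.1)) := by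
    intro o
    simp only [potInt, timeWeight]; ring
  have e2 : ∀ o : ℝ × ℝ, potInt (timeWeight (fun _ => 2 / √Real.pi) (fun o => o.1 ^ 2) θ t)
        Prod.fst rad j f p o =
      2 / √Real.pi * (θ (t - o.1 ^ 2) * (ker j p.2 o.1 * heat f (rad (o.1, o.2)) p.1)) := by
    intro o
    simp only [potInt, timeWeight]; ring
  have hi1 := (h1.add h2).congr (ae_of_all _ e1)
  have hi2 := h3.congr (ae_of_all _ e2)
  rw [potD, potD, potD, pot, pot, pot, ← integral_add h1 h2]
  simp only [e1, e2]
  rw [integral_prod_symm _ hi1, integral_prod_symm _ hi2]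
  have hπ : 2 / √Real.pi ≠ 0 := by positivity
  refine integral_congr_ae ?_
  filter_upwards [hi1.prod_left_ae, hi2.prod_left_ae] with η hη1 hη2
  rw [integral_const_mul, integral_const_mul]
  congr 1
  refine integral_ker_heat hj hp (fun v hv => hasDerivAt_heat_rad hf.toIsBump η p.1 hv)
    (fun v => hB _ p.1) hθ.hasDerivAt_prim (hθ.prim.eq_zero _ (by linarith)) ?_ ?_
  · refine (hη1.const_mul (2 / √Real.pi)⁻¹).congr (ae_of_all _ fun v => ?_)
    simp only
    rw [← mul_assoc, inv_mul_cancel₀ hπ, one_mul]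
  · refine (hη2.const_mul (2 / √Real.pi)⁻¹).congr (ae_of_all _ fun v => ?_)
    simp only
    rw [← mul_assoc, inv_mul_cancel₀ hπ, one_mul]

end Concrete

end HalfSpaceStokes

namespace HalfSpaceStokes

/-! ### Gradients in the half-space -/

section Field

variable {d : ℕ}

/-- `F` is differentiable in the half-space with tangential derivatives `a` and normal
derivative `b`. -/
def HasGrad (F : Space d → ℝ) (a : Fin d → Space d → ℝ) (b : Space d → ℝ) : Prop :=
  ∀ p ∈ halfSpace d, HasFDerivAt F (gradL (fun i => a i p) (b p)) p

theorem HasGrad.add {F F' : Space d → ℝ} {a a' : Fin d → Space d → ℝ} {b b' : Space d → ℝ}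
    (h : HasGrad F a b) (h' : HasGrad F' a' b') :
    HasGrad (fun p => F p + F' p) (fun i p => a i p + a' i p) (fun p => b p + b' p) := fun p hp => by
  have := (h p hp).fun_add (h' p hp)
  rwa [gradL_add] at this

theorem HasGrad.const_mul {F : Space d → ℝ} {a : Fin d → Space d → ℝ} {b : Space d → ℝ}
    (h : HasGrad F a b) (r : ℝ) :
    HasGrad (fun p => r * F p) (fun i p => r * a i p) (fun p => r * b p) := fun p hp => by
  have := (h p hp).const_mul r
  rwa [gradL_smul] at this

theorem HasGrad.neg {F : Space d → ℝ} {a : Fin d → Space d → ℝ} {b : Space d → ℝ}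
    (h : HasGrad F a b) : HasGrad (fun p => -F p) (fun i p => -a i p) (fun p => -b p) := by
  simpa using h.const_mul (-1)

theorem HasGrad.sub {F F' : Space d → ℝ} {a a' : Fin d → Space d → ℝ} {b b' : Space d → ℝ}
    (h : HasGrad F a b) (h' : HasGrad F' a' b') :
    HasGrad (fun p => F p - F' p) (fun i p => a i p - a' i p) (fun p => b p - b' p) := by
  simpa [sub_eq_add_neg] using h.add h'.neg

theorem sq_measurable : Measurable fun v : ℝ => v ^ 2 := by fun_prop

theorem fst_sq_measurable : Measurable fun o : ℝ × ℝ => o.1 ^ 2 := by fun_prop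

theorem sq_nonneg_ae (μ : Measure ℝ) : ∀ᵐ v ∂μ, 0 ≤ v ^ 2 := ae_of_all _ fun v => sq_nonneg v

theorem fst_sq_nonneg_ae (μ : Measure (ℝ × ℝ)) : ∀ᵐ o ∂μ, 0 ≤ o.1 ^ 2 :=
  ae_of_all _ fun o => sq_nonneg o.1

/-- The weight of `potC`. -/
noncomputable abbrev wC (θ : ℝ → ℝ) (t : ℝ) : ℝ → ℝ := timeWeight (fun _ => 1) (fun v => v ^ 2) θ t

/-- The weight of `potP` and `potD`. -/
noncomputable abbrev wS (θ : ℝ → ℝ) (t : ℝ) : ℝ × ℝ → ℝ :=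
  timeWeight (fun _ => 2 / √Real.pi) (fun o => o.1 ^ 2) θ t

variable {θ Θ : ℝ → ℝ} {t : ℝ} {f g : Bdry d → ℝ}

theorem Adm.le {Ω : Type*} [MeasurableSpace Ω] {μ : Measure Ω} {c α β : Ω → ℝ} {j e : ℕ}
    (h : Adm μ c α β j e) (k : ℕ) : Adm μ c α β (j + k) e := by
  induction k with
  | zero => exact h
  | succ k ih => exact ih.succ

theorem admA (hd : 1 ≤ d) (j : ℕ) : Adm volPos (fun _ => 1) id id j (d + 1) := by
  simpa using (adm_harm_zero hd).le j

theorem admA' (hd : 1 ≤ d) (j : ℕ) : Adm volPos (fun _ => 1) id id (j + 1) d := by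
  simpa [add_comm] using (adm_harm_one hd).le j

theorem admC (hθ : TimeProfile θ) (t : ℝ) (j e : ℕ) : Adm volTwo (wC θ t) id id j e :=
  (adm_two j e).timeWeight sq_measurable (sq_nonneg_ae _) hθ t

theorem admP (hd : 1 ≤ d) (hθ : TimeProfile θ) (t : ℝ) (j : ℕ) :
    Adm volStrip (wS θ t) Prod.snd rad j (d + 1) :=
  (adm_strip_snd (admA hd j)).timeWeight fst_sq_measurable (fst_sq_nonneg_ae _) hθ t

theorem admP' (hd : 1 ≤ d) (hθ : TimeProfile θ) (t : ℝ) (j : ℕ) :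
    Adm volStrip (wS θ t) Prod.snd rad (j + 1) d :=
  (adm_strip_snd (admA' hd j)).timeWeight fst_sq_measurable (fst_sq_nonneg_ae _) hθ t

theorem admD (hd : 1 ≤ d) (hθ : TimeProfile θ) (t : ℝ) (j : ℕ) :
    Adm volStrip (wS θ t) Prod.fst rad j (d + 1) := by
  have := (adm_strip_fst (adm_harm_zero hd)).le j
  rw [zero_add] at this
  exact this.timeWeight fst_sq_measurable (fst_sq_nonneg_ae _) hθ t

theorem hasGrad_potA (hd : 1 ≤ d) (hf : HeatDecay (d + 1) f) (j : ℕ) :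
    HasGrad (potA j f) (fun i => potA j (pd i f)) (potA (j + 1) f) :=
  fun _ hp => hasFDerivAt_pot (admA hd j) hf le_rfl hp

theorem hasGrad_potA' (hd : 1 ≤ d) (hf : IsBump f) (j : ℕ) :
    HasGrad (potA (j + 1) f) (fun i => potA (j + 1) (pd i f)) (potA (j + 2) f) :=
  fun _ hp => hasFDerivAt_pot (admA' hd j) hf.heatDecay (by omega) hp

theorem hasGrad_potC (hθ : TimeProfile θ) (hf : IsBump f) (j : ℕ) :
    HasGrad (potC θ t j f) (fun i => potC θ t j (pd i f)) (potC θ t (j + 1) f) :=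
  fun _ hp => hasFDerivAt_pot (admC hθ t j d) hf.heatDecay (by omega) hp

theorem hasGrad_potP (hd : 1 ≤ d) (hθ : TimeProfile θ) (hf : HeatDecay (d + 1) f) (j : ℕ) :
    HasGrad (potP θ t j f) (fun i => potP θ t j (pd i f)) (potP θ t (j + 1) f) :=
  fun _ hp => hasFDerivAt_pot (admP hd hθ t j) hf le_rfl hp

theorem hasGrad_potP' (hd : 1 ≤ d) (hθ : TimeProfile θ) (hf : IsBump f) (j : ℕ) :
    HasGrad (potP θ t (j + 1) f) (fun i => potP θ t (j + 1) (pd i f)) (potP θ t (j + 2) f) :=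
  fun _ hp => hasFDerivAt_pot (admP' hd hθ t j) hf.heatDecay (by omega) hp

theorem hasGrad_potD (hd : 1 ≤ d) (hθ : TimeProfile θ) (hf : HeatDecay (d + 1) f) (j : ℕ) :
    HasGrad (potD θ t j f) (fun i => potD θ t j (pd i f)) (potD θ t (j + 1) f) :=
  fun _ hp => hasFDerivAt_pot (admD hd hθ t j) hf le_rfl hp

/-! ### The velocity field -/

/-- The tangential block: `n`-th normal derivative. -/
noncomputable def tang (θ Θ : ℝ → ℝ) (t : ℝ) (n : ℕ) (f g : Bdry d → ℝ) (p : Space d) : ℝ :=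
  -(θ t * potA n f p - Θ t * potA n g p) + (potP θ t (n + 1) f p - potP Θ t (n + 1) g p)
    - (potD θ t (n + 1) f p - potD Θ t (n + 1) g p) + (potC θ t n f p - potC Θ t n g p)

/-- The normal block: `n`-th normal derivative. -/
noncomputable def nrm (θ Θ : ℝ → ℝ) (t : ℝ) (n : ℕ) (f₀ f₁ f₂ : Bdry d → ℝ) (p : Space d) : ℝ :=
  -(θ t * potA (n + 1) f₀ p - Θ t * potA (n + 1) f₁ p) - (potP θ t n f₁ p - potP Θ t n f₂ p)
    + (potD θ t n f₁ p - potD Θ t n f₂ p) - potC Θ t (n + 1) f₁ p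

theorem hasGrad_tang (hd : 1 ≤ d) (hθ : TimeProfile θ) (hΘ : TimeProfile Θ)
    (hf : HeatDecay (d + 1) f) (hg : HeatDecay (d + 1) g) (n : ℕ) :
    HasGrad (tang θ Θ t n f g) (fun i => tang θ Θ t n (pd i f) (pd i g))
      (tang θ Θ t (n + 1) f g) :=
  (((((hasGrad_potA hd hf n).const_mul (θ t)).sub ((hasGrad_potA hd hg n).const_mul (Θ t))).neg.add
    ((hasGrad_potP hd hθ hf (n + 1)).sub (hasGrad_potP hd hΘ hg (n + 1)))).sub
    ((hasGrad_potD hd hθ hf (n + 1)).sub (hasGrad_potD hd hΘ hg (n + 1)))).add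
    ((hasGrad_potC hθ hf.toIsBump n).sub (hasGrad_potC hΘ hg.toIsBump n))

theorem hasGrad_nrm (hd : 1 ≤ d) (hθ : TimeProfile θ) (hΘ : TimeProfile Θ) {f₀ f₁ f₂ : Bdry d → ℝ}
    (hf₀ : IsBump f₀) (hf₁ : HeatDecay (d + 1) f₁) (hf₂ : HeatDecay (d + 1) f₂) (n : ℕ) :
    HasGrad (nrm θ Θ t n f₀ f₁ f₂) (fun i => nrm θ Θ t n (pd i f₀) (pd i f₁) (pd i f₂))
      (nrm θ Θ t (n + 1) f₀ f₁ f₂) :=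
  (((((hasGrad_potA' hd hf₀ n).const_mul (θ t)).sub
    ((hasGrad_potA' hd hf₁.toIsBump n).const_mul (Θ t))).neg.sub
    ((hasGrad_potP hd hθ hf₁ n).sub (hasGrad_potP hd hΘ hf₂ n))).add
    ((hasGrad_potD hd hθ hf₁ n).sub (hasGrad_potD hd hΘ hf₂ n))).sub
    (hasGrad_potC hΘ hf₁.toIsBump (n + 1))

theorem lap_heatDecay (hf : IsBump f) : HeatDecay (d + 1) (lap f) :=
  hf.heatDecay_lap.mono (by omega)

theorem sum_tang (hd : 1 ≤ d) (hθ : TimeProfile θ) (hΘ : TimeProfile Θ) (n : ℕ)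
    (hf : IsBump f) (hg : IsBump g) {p : Space d} (hp : p ∈ halfSpace d) :
    ∑ i, tang θ Θ t n (pd i (pd i f)) (pd i (pd i g)) p = tang θ Θ t n (lap f) (lap g) p := by
  have hf' : ∀ i, HeatDecay (d + 1) (pd i (pd i f)) := fun i => (hf.pd i).heatDecay_pd i
  have hg' : ∀ i, HeatDecay (d + 1) (pd i (pd i g)) := fun i => (hg.pd i).heatDecay_pd i
  simp only [tang, Finset.sum_add_distrib, Finset.sum_sub_distrib, Finset.sum_neg_distrib,
    ← Finset.mul_sum]
  simp only [potA, potC, potP, potD]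
  rw [pot_lap (admA hd n) hf hf' hp, pot_lap (admA hd n) hg hg' hp,
    pot_lap (admP hd hθ t (n + 1)) hf hf' hp, pot_lap (admP hd hΘ t (n + 1)) hg hg' hp,
    pot_lap (admD hd hθ t (n + 1)) hf hf' hp, pot_lap (admD hd hΘ t (n + 1)) hg hg' hp,
    pot_lap (admC hθ t n (d + 1)) hf hf' hp, pot_lap (admC hΘ t n (d + 1)) hg hg' hp]

/-- The field is divergence free. -/
theorem tang_add_nrm (hd : 1 ≤ d) (hθ : TimeProfile θ) (ht : t ≤ 2) (hf : IsBump f)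
    {p : Space d} (hp : p ∈ halfSpace d) :
    tang θ (prim θ) t 0 (lap f) (lap (lap f)) p
      + nrm θ (prim θ) t 1 f (lap f) (lap (lap f)) p = 0 := by
  have h1 := potA_harmonic (j := 0) (by omega) (admA' hd 1) hf.heatDecay (admA hd 0)
    (lap_heatDecay hf) hp
  have h2 := potA_harmonic (j := 0) (by omega) (admA' hd 1) hf.lap.heatDecay (admA hd 0)
    (lap_heatDecay hf.lap) hp
  have h3 := potC_heat (j := 0) (by omega) hf.lap hθ ht hp
  simp only [tang, nrm]
  simp only [zero_add, Nat.reduceAdd] at h1 h2 h3 ⊢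
  linear_combination -(θ t) * h1 + prim θ t * h2 - h3

/-- The tangential velocity `w_i / a`. -/
noncomputable def solT (θ : ℝ → ℝ) (ψ : Bdry d → ℝ) (i : Fin d) (t : ℝ) (p : Space d) : ℝ :=
  tang θ (prim θ) t 0 (pd i ψ) (pd i (lap ψ)) p

/-- The normal velocity `w_n / a`. -/
noncomputable def solN (θ : ℝ → ℝ) (ψ : Bdry d → ℝ) (t : ℝ) (p : Space d) : ℝ :=
  nrm θ (prim θ) t 0 ψ (lap ψ) (lap (lap ψ)) p

/-- The Newtonian potential of `f`, normalized to vanish at `e_n`. -/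
noncomputable def potR (f : Bdry d → ℝ) (p : Space d) : ℝ :=
  ∫ v, (potInt (fun _ => 1) id id 0 f p v - potInt (fun _ => 1) id id 0 f (normal d) v) ∂volPos

/-- The time primitive of the pressure divided by `a`. -/
noncomputable def prs (θ : ℝ → ℝ) (ψ : Bdry d → ℝ) (t : ℝ) (p : Space d) : ℝ :=
  θ t * potR ψ p - prim θ t * potA 0 (lap ψ) p - (potP θ t 1 ψ p - potP (prim θ) t 1 (lap ψ) p)

/-- For `d = 1` the potential of a bump itself diverges logarithmically at large `v`. Differences
between two points converge, since by the mean value inequality they are controlled by first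
derivatives, which decay one power faster. This gives a meaning to the pressure primitive. -/
theorem integrable_potInt_sub {Ω : Type*} [MeasurableSpace Ω] {μ : Measure Ω} {c α β : Ω → ℝ}
    {j e e' : ℕ} (h1 : Adm μ c α β j e) (h2 : Adm μ c α β (j + 1) e')
    (hf1 : ∀ i, HeatDecay e (pd i f)) (hf2 : HeatDecay e' f) {p p₀ : Space d}
    (hp : p ∈ halfSpace d) (hp₀ : p₀ ∈ halfSpace d) :
    Integrable (fun o => potInt c α β j f p o - potInt c α β j f p₀ o) μ := by
  have hp : 0 < p.2 := hp
  have hp₀ : 0 < p₀.2 := hp₀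
  set δ := min p.2 p₀.2 with hδ
  have hδ0 : 0 < δ := lt_min hp hp₀
  choose b hb hdb using fun i => h1.dominated (hf1 i) hδ0
  obtain ⟨b', hb', hdb'⟩ := h2.dominated hf2 hδ0
  have hi : Integrable (fun o => (∑ i, b i o + b' o) * ‖p - p₀‖) μ :=
    ((integrable_finsetSum Finset.univ fun i _ => hb i).add hb').mul_const _
  refine hi.mono' ((h1.measurable_potInt j hf2.toIsBump p).sub
    (h1.measurable_potInt j hf2.toIsBump p₀)).aestronglyMeasurable ?_
  filter_upwards [ae_all_iff.2 hdb, hdb'] with o h3 h4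
  have hconv : Convex ℝ {x : Space d | δ ≤ x.2} :=
    convex_halfSpace_ge (LinearMap.snd ℝ (Bdry d) ℝ).isLinear δ
  refine Convex.norm_image_sub_le_of_norm_hasFDerivWithin_le
    (f := fun p => potInt c α β j f p o)
    (fun x _ => (hasFDerivAt_potInt hf2.toIsBump o x).hasFDerivWithinAt) (fun x hx => ?_)
    hconv (show δ ≤ p₀.2 from min_le_right _ _) (show δ ≤ p.2 from min_le_left _ _)
  exact (norm_gradL_le _ _).trans
    (add_le_add (Finset.sum_le_sum fun i _ => h3 i x hx) (h4 x hx))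

theorem normal_mem : normal d ∈ halfSpace d := by
  change (0 : ℝ) < 1
  norm_num

theorem hasGrad_potR (hd : 1 ≤ d) (hf : IsBump f) :
    HasGrad (potR f) (fun i => potA 0 (pd i f)) (potA 1 f) := fun _ hp =>
  hasFDerivAt_pot_sub (admA hd 0) (admA' hd 0) hf.heatDecay_pd hf.heatDecay _
    ((admA hd 0).measurable_potInt 0 hf (normal d)).aestronglyMeasurable hp
    (integrable_potInt_sub (admA hd 0) (admA' hd 0) hf.heatDecay_pd hf.heatDecay hp normal_mem)

theorem hasGrad_prs (hd : 1 ≤ d) (hθ : TimeProfile θ) (hf : IsBump f) :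
    HasGrad (prs θ f t)
      (fun i p => θ t * potA 0 (pd i f) p - prim θ t * potA 0 (pd i (lap f)) p
        - (potP θ t 1 (pd i f) p - potP (prim θ) t 1 (pd i (lap f)) p))
      (fun p => θ t * potA 1 f p - prim θ t * potA 1 (lap f) p
        - (potP θ t 2 f p - potP (prim θ) t 2 (lap f) p)) :=
  (((hasGrad_potR hd hf).const_mul (θ t)).sub
    ((hasGrad_potA hd (lap_heatDecay hf) 0).const_mul (prim θ t))).sub
    ((hasGrad_potP' hd hθ hf 0).sub (hasGrad_potP' hd hθ.prim hf.lap 0))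

/-! ### Momentum equation -/

theorem hasLap_potA (hd : 1 ≤ d) (hf : HeatDecay (d + 1) f) {j : ℕ} (hj : j ≤ 1) :
    HasLap (potA j f) (fun _ => 0) :=
  (hasLap_pot (admA hd j) hf le_rfl).congr (fun _ _ => rfl) fun _ hp =>
    potA_harmonic hj (admA hd (j + 2)) hf (admA hd j) (lap_heatDecay hf.toIsBump) hp

theorem hasLap_potA_one (hd : 1 ≤ d) (hf : IsBump f) : HasLap (potA 1 f) (fun _ => 0) :=
  (hasLap_pot (admA' hd 0) hf.heatDecay (by omega)).congr (fun _ _ => rfl) fun _ hp =>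
    potA_harmonic le_rfl (admA' hd 2) hf.heatDecay (admA' hd 0) hf.lap.heatDecay hp

theorem hasLap_potP (hd : 1 ≤ d) (hθ : TimeProfile θ) (hf : HeatDecay (d + 1) f) {j : ℕ}
    (hj : j ≤ 1) : HasLap (potP θ t j f) (fun _ => 0) :=
  (hasLap_pot (admP hd hθ t j) hf le_rfl).congr (fun _ _ => rfl) fun _ hp =>
    potP_harmonic hj (admA hd (j + 2)) hf (admA hd j) (lap_heatDecay hf.toIsBump) hθ t hp

theorem hasLap_potC (hθ : TimeProfile θ) (ht : t ≤ 2) (hf : IsBump f) {j : ℕ} (hj : j ≤ 1) :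
    HasLap (potC (prim θ) t j f) (potC θ t j f) :=
  (hasLap_pot (admC hθ.prim t j d) hf.heatDecay (by omega)).congr (fun _ _ => rfl) fun _ hp =>
    potC_heat hj hf hθ ht hp

theorem hasLap_potD (hd : 1 ≤ d) (hθ : TimeProfile θ) (ht : t ≤ 2) (hf : HeatDecay (d + 1) f)
    {j : ℕ} (hj : j ≤ 1) : HasLap (potD (prim θ) t j f) (potD θ t j f) :=
  (hasLap_pot (admD hd hθ.prim t j) hf le_rfl).congr (fun _ _ => rfl) fun _ hp =>
    potD_heat hd hj hf hθ ht hp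

/-- The field built from the primitive of `θ` is the time primitive of the velocity. Its harmonic
blocks have zero Laplacian and each caloric block returns the same block with `θ` restored, so the
Laplacian is precisely the caloric part of the velocity. -/
theorem hasLap_solT (hd : 1 ≤ d) (hθ : TimeProfile θ) (ht : t ≤ 2) (hf : IsBump f) (i : Fin d) :
    HasLap (solT (prim θ) f i t) (fun p =>
      -(potD θ t 1 (pd i f) p - potD (prim θ) t 1 (pd i (lap f)) p)
        + (potC θ t 0 (pd i f) p - potC (prim θ) t 0 (pd i (lap f)) p)) := by
  have h1 := hf.heatDecay_pd i
  have h2 := hf.lap.heatDecay_pd i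
  have := (((((hasLap_potA hd h1 zero_le_one).const_mul (prim θ t)).sub
    ((hasLap_potA hd h2 zero_le_one).const_mul (prim (prim θ) t))).neg.add
    ((hasLap_potP (t := t) hd hθ.prim h1 le_rfl).sub
      (hasLap_potP (t := t) hd hθ.prim.prim h2 le_rfl))).sub
    ((hasLap_potD hd hθ ht h1 le_rfl).sub (hasLap_potD hd hθ.prim ht h2 le_rfl))).add
    ((hasLap_potC hθ ht h1.toIsBump zero_le_one).sub
      (hasLap_potC hθ.prim ht h2.toIsBump zero_le_one))
  exact this.congr (fun _ _ => rfl) fun p _ => by ring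

theorem hasLap_solN (hd : 1 ≤ d) (hθ : TimeProfile θ) (ht : t ≤ 2) (hf : IsBump f) :
    HasLap (solN (prim θ) f t) (fun p =>
      (potD θ t 0 (lap f) p - potD (prim θ) t 0 (lap (lap f)) p) - potC (prim θ) t 1 (lap f) p) := by
  have h1 := lap_heatDecay hf
  have h2 := lap_heatDecay hf.lap
  have := (((((hasLap_potA_one hd hf).const_mul (prim θ t)).sub
    ((hasLap_potA hd h1 le_rfl).const_mul (prim (prim θ) t))).neg.sub
    ((hasLap_potP (t := t) hd hθ.prim h1 zero_le_one).sub
      (hasLap_potP (t := t) hd hθ.prim.prim h2 zero_le_one))).add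
    ((hasLap_potD hd hθ ht h1 zero_le_one).sub (hasLap_potD hd hθ.prim ht h2 zero_le_one))).sub
    (hasLap_potC hθ.prim ht h1.toIsBump le_rfl)
  exact this.congr (fun _ _ => rfl) fun p _ => by ring

/-- After subtraction of the Laplacian only the harmonic blocks of the velocity remain, and these
are minus the tangential derivative of the pressure primitive. -/
theorem momentum_tangential (hd : 1 ≤ d) (hθ : TimeProfile θ) (ht : t ≤ 2) (hf : IsBump f)
    (i : Fin d) {p : Space d} (hp : p ∈ halfSpace d) :
    solT θ f i t p - slap (solT (prim θ) f i t) p + fderiv ℝ (prs θ f t) p (tangent i) = 0 := by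
  rw [(hasLap_solT hd hθ ht hf i).slap_eq p hp, (hasGrad_prs hd hθ hf p hp).fderiv,
    gradL_tangent, solT, tang]
  ring

/-- As for the tangential components, except that the pressure contributes two normal derivatives of
`potP`; harmonicity exchanges them for minus a tangential Laplacian, which is the form used in the
normal velocity. -/
theorem momentum_normal (hd : 1 ≤ d) (hθ : TimeProfile θ) (ht : t ≤ 2) (hf : IsBump f)
    {p : Space d} (hp : p ∈ halfSpace d) :
    solN θ f t p - slap (solN (prim θ) f t) p + fderiv ℝ (prs θ f t) p (normal d) = 0 := by
  have h1 := potP_harmonic (j := 0) (by omega) (admA' hd 1) hf.heatDecay (admA hd 0)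
    (lap_heatDecay hf) hθ t hp
  have h2 := potP_harmonic (j := 0) (by omega) (admA' hd 1) hf.lap.heatDecay (admA hd 0)
    (lap_heatDecay hf.lap) hθ.prim t hp
  rw [(hasLap_solN hd hθ ht hf).slap_eq p hp, (hasGrad_prs hd hθ hf p hp).fderiv,
    gradL_normal, solN, nrm]
  simp only [zero_add] at h1 h2 ⊢
  linear_combination -h1 + h2

theorem contDiffOn_prs (hd : 1 ≤ d) (hθ : TimeProfile θ) (hf : IsBump f) :
    ContDiffOn ℝ 1 (prs θ f t) (halfSpace d) := by
  have hA0 : ∀ g : Bdry d → ℝ, HeatDecay (d + 1) g → ContDiffOn ℝ (0 : ℕ) (potA 0 g) (halfSpace d) :=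
    fun g hg p hp => (contDiffOn_pot le_rfl 0 (admA hd 0) hg) p hp
  have hA1 : ∀ g : Bdry d → ℝ, IsBump g → ContDiffOn ℝ (0 : ℕ) (potA 1 g) (halfSpace d) :=
    fun g hg p hp => (contDiffOn_pot (by omega) 0 (admA' hd 0) hg.heatDecay) p hp
  have hP : ∀ (θ : ℝ → ℝ) (_ : TimeProfile θ) (j : ℕ) (g : Bdry d → ℝ), IsBump g →
      ContDiffOn ℝ (0 : ℕ) (potP θ t (j + 1) g) (halfSpace d) :=
    fun θ hθ j g hg p hp => (contDiffOn_pot (by omega) 0 (admP' hd hθ t j) hg.heatDecay) p hp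
  refine contDiffOn_succ_of_gradL (n := 0) (fun i => ?_) ?_ (hasGrad_prs hd hθ hf)
  · exact ((contDiffOn_const.mul (hA0 _ (hf.heatDecay_pd i))).sub
      (contDiffOn_const.mul (hA0 _ (hf.lap.heatDecay_pd i)))).sub
      ((hP θ hθ 0 _ (hf.pd i)).sub (hP _ hθ.prim 0 _ (hf.lap.pd i)))
  · exact ((contDiffOn_const.mul (hA1 _ hf)).sub
      (contDiffOn_const.mul (hA1 _ hf.lap))).sub
      ((hP θ hθ 1 _ hf).sub (hP _ hθ.prim 1 _ hf.lap))

/-! ### Dependence on time -/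

theorem continuous_potC_time (hθ : TimeProfile θ) (hf : IsBump f) (j : ℕ) {p : Space d}
    (hp : p ∈ halfSpace d) : Continuous fun t => potC θ t j f p :=
  continuous_pot_time (adm_two j d) sq_measurable (sq_nonneg_ae _) hθ hf.heatDecay hp

theorem continuous_potP_time (hd : 1 ≤ d) (hθ : TimeProfile θ) (hf : HeatDecay (d + 1) f) (j : ℕ)
    {p : Space d} (hp : p ∈ halfSpace d) : Continuous fun t => potP θ t j f p :=
  continuous_pot_time (adm_strip_snd (admA hd j)) fst_sq_measurable (fst_sq_nonneg_ae _) hθ hf hp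

theorem continuous_potD_time (hd : 1 ≤ d) (hθ : TimeProfile θ) (hf : HeatDecay (d + 1) f) (j : ℕ)
    {p : Space d} (hp : p ∈ halfSpace d) : Continuous fun t => potD θ t j f p := by
  have := (adm_strip_fst (adm_harm_zero hd)).le j
  rw [zero_add] at this
  exact continuous_pot_time this fst_sq_measurable (fst_sq_nonneg_ae _) hθ hf hp

theorem hasDerivAt_potC_time (hθ : TimeProfile θ) (hf : IsBump f) (j : ℕ) {p : Space d}
    (hp : p ∈ halfSpace d) (t : ℝ) :
    HasDerivAt (fun t => potC (prim θ) t j f p) (potC θ t j f p) t :=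
  hasDerivAt_pot_time (adm_two j d) sq_measurable (sq_nonneg_ae _) hθ hf.heatDecay hp t

theorem hasDerivAt_potP_time (hd : 1 ≤ d) (hθ : TimeProfile θ) (hf : HeatDecay (d + 1) f) (j : ℕ)
    {p : Space d} (hp : p ∈ halfSpace d) (t : ℝ) :
    HasDerivAt (fun t => potP (prim θ) t j f p) (potP θ t j f p) t :=
  hasDerivAt_pot_time (adm_strip_snd (admA hd j)) fst_sq_measurable (fst_sq_nonneg_ae _) hθ hf hp t

theorem hasDerivAt_potD_time (hd : 1 ≤ d) (hθ : TimeProfile θ) (hf : HeatDecay (d + 1) f) (j : ℕ)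
    {p : Space d} (hp : p ∈ halfSpace d) (t : ℝ) :
    HasDerivAt (fun t => potD (prim θ) t j f p) (potD θ t j f p) t := by
  have := (adm_strip_fst (adm_harm_zero hd)).le j
  rw [zero_add] at this
  exact hasDerivAt_pot_time this fst_sq_measurable (fst_sq_nonneg_ae _) hθ hf hp t

theorem continuous_solT (hd : 1 ≤ d) (hθ : TimeProfile θ) (hf : IsBump f) (i : Fin d)
    {p : Space d} (hp : p ∈ halfSpace d) : Continuous fun t => solT θ f i t p := by
  have h1 := hf.heatDecay_pd i
  have h2 := hf.lap.heatDecay_pd i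
  exact ((((hθ.continuous.mul continuous_const).sub
    (hθ.prim.continuous.mul continuous_const)).neg.add
    ((continuous_potP_time hd hθ h1 1 hp).sub (continuous_potP_time hd hθ.prim h2 1 hp))).sub
    ((continuous_potD_time hd hθ h1 1 hp).sub (continuous_potD_time hd hθ.prim h2 1 hp))).add
    ((continuous_potC_time hθ h1.toIsBump 0 hp).sub
      (continuous_potC_time hθ.prim h2.toIsBump 0 hp))

theorem continuous_solN (hd : 1 ≤ d) (hθ : TimeProfile θ) (hf : IsBump f)
    {p : Space d} (hp : p ∈ halfSpace d) : Continuous fun t => solN θ f t p := by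
  have h1 := lap_heatDecay hf
  have h2 := lap_heatDecay hf.lap
  exact ((((hθ.continuous.mul continuous_const).sub
    (hθ.prim.continuous.mul continuous_const)).neg.sub
    ((continuous_potP_time hd hθ h1 0 hp).sub (continuous_potP_time hd hθ.prim h2 0 hp))).add
    ((continuous_potD_time hd hθ h1 0 hp).sub (continuous_potD_time hd hθ.prim h2 0 hp))).sub
    (continuous_potC_time hθ.prim h1.toIsBump 1 hp)

theorem hasDerivAt_solT (hd : 1 ≤ d) (hθ : TimeProfile θ) (hf : IsBump f) (i : Fin d)
    {p : Space d} (hp : p ∈ halfSpace d) (t : ℝ) :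
    HasDerivAt (fun t => solT (prim θ) f i t p) (solT θ f i t p) t := by
  have h1 := hf.heatDecay_pd i
  have h2 := hf.lap.heatDecay_pd i
  exact (((((hθ.hasDerivAt_prim t).mul_const _).sub
    ((hθ.prim.hasDerivAt_prim t).mul_const _)).neg.add
    ((hasDerivAt_potP_time hd hθ h1 1 hp t).sub (hasDerivAt_potP_time hd hθ.prim h2 1 hp t))).sub
    ((hasDerivAt_potD_time hd hθ h1 1 hp t).sub (hasDerivAt_potD_time hd hθ.prim h2 1 hp t))).add
    ((hasDerivAt_potC_time hθ h1.toIsBump 0 hp t).sub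
      (hasDerivAt_potC_time hθ.prim h2.toIsBump 0 hp t))

theorem hasDerivAt_solN (hd : 1 ≤ d) (hθ : TimeProfile θ) (hf : IsBump f)
    {p : Space d} (hp : p ∈ halfSpace d) (t : ℝ) :
    HasDerivAt (fun t => solN (prim θ) f t p) (solN θ f t p) t := by
  have h1 := lap_heatDecay hf
  have h2 := lap_heatDecay hf.lap
  exact (((((hθ.hasDerivAt_prim t).mul_const _).sub
    ((hθ.prim.hasDerivAt_prim t).mul_const _)).neg.sub
    ((hasDerivAt_potP_time hd hθ h1 0 hp t).sub (hasDerivAt_potP_time hd hθ.prim h2 0 hp t))).add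
    ((hasDerivAt_potD_time hd hθ h1 0 hp t).sub (hasDerivAt_potD_time hd hθ.prim h2 0 hp t))).sub
    (hasDerivAt_potC_time hθ.prim h1.toIsBump 1 hp t)

theorem prim_eq_zero {t : ℝ} (hθ : TimeProfile θ) (ht : ∀ s ≤ t, θ s = 0) :
    ∀ s ≤ t, prim θ s = 0 := by
  intro s hs
  rcases le_total s 0 with h | h
  · exact hθ.prim.eq_zero s h
  · rw [prim, intervalIntegral.integral_of_le h]
    exact setIntegral_eq_zero_of_forall_eq_zero fun r hr => ht r (hr.2.trans hs)

theorem solT_eq_zero (hθ : TimeProfile θ) (ht : ∀ s ≤ t, θ s = 0) (i : Fin d) (p : Space d) :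
    solT θ f i t p = 0 := by
  have h := prim_eq_zero hθ ht
  simp only [solT, tang, potC, potP, potD, ht t le_rfl, h t le_rfl,
    pot_time_eq_zero (fst_sq_nonneg_ae _) ht, pot_time_eq_zero (fst_sq_nonneg_ae _) h,
    pot_time_eq_zero (sq_nonneg_ae _) ht, pot_time_eq_zero (sq_nonneg_ae _) h]
  simp

theorem solN_eq_zero (hθ : TimeProfile θ) (ht : ∀ s ≤ t, θ s = 0) (p : Space d) :
    solN θ f t p = 0 := by
  have h := prim_eq_zero hθ ht
  simp only [solN, nrm, potC, potP, potD, ht t le_rfl, h t le_rfl,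
    pot_time_eq_zero (fst_sq_nonneg_ae _) ht, pot_time_eq_zero (fst_sq_nonneg_ae _) h,
    pot_time_eq_zero (sq_nonneg_ae _) h]
  simp

end Field

end HalfSpaceStokes

namespace HalfSpaceStokes

/-! ### Uniform bounds for the potentials -/

section Bounds

variable {d : ℕ} {Ω : Type*} {f g : Bdry d → ℝ} {j e : ℕ}

theorem div_mul_inv_le {a b x r : ℝ} (ha : 0 < a) (hab : a ≤ b) (hx : 0 < x) (hr : 0 ≤ r) :
    a / (a + x) * (1 + b + r)⁻¹ ≤ (1 + b + x + r)⁻¹ := by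
  have hb : 0 < b := ha.trans_le hab
  rw [← div_eq_mul_inv, div_div, ← one_div, div_le_div_iff₀ (by positivity) (by positivity)]
  nlinarith [mul_le_mul_of_nonneg_right hab hx.le, mul_nonneg hx.le hr]

theorem pow_div_mul_le {a b x r : ℝ} (e : ℕ) (ha : 0 < a) (hab : a ≤ b) (hx : 0 < x) (hr : 0 ≤ r) :
    a ^ e / (a + x) ^ e * ((1 + b + r) ^ e)⁻¹ ≤ ((1 + b + x + r) ^ e)⁻¹ := by
  have hb : 0 < b := ha.trans_le hab
  rw [← inv_pow, ← inv_pow, ← div_pow, ← mul_pow]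
  exact pow_le_pow_left₀ (by positivity) (div_mul_inv_le ha hab hx hr) e

/-- Choosing `m = e` in the kernel bound gives the factor `(α/(α+x_n))^e`. Together with `α ≤ β` it
upgrades the decay of the heat evolution in the tangential variable to decay in the full distance.
-/
theorem abs_potInt_le (hf : HeatDecay e f) (j : ℕ) : ∃ C, 0 ≤ C ∧
    ∀ {Ω : Type} (c α β : Ω → ℝ) (p : Space d) (o : Ω), 0 < α o → α o ≤ β o → 0 < p.2 →
      |potInt c α β j f p o| ≤
        C * |c o| * (((α o + p.2) ^ j)⁻¹ * ((1 + β o + p.2 + ‖p.1‖) ^ e)⁻¹) := by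
  obtain ⟨C, hC, hk⟩ := abs_ker_le j e
  obtain ⟨C', hC', hd⟩ := hf.decay
  refine ⟨C * C', by positivity, fun c α β p o h1 h2 hp => ?_⟩
  have h3 := hk p.2 (α o) h1
  rw [abs_of_pos hp] at h3
  have h4 := hd (β o) p.1 (h1.le.trans h2)
  have h5 := pow_div_mul_le e h1 h2 hp (norm_nonneg p.1)
  have hb : 0 < β o := h1.trans_le h2
  rw [potInt, abs_mul, abs_mul]
  calc |c o| * |ker j p.2 (α o)| * |heat f (β o) p.1|
      ≤ |c o| * (C * (α o) ^ e / (α o + p.2) ^ (e + j)) * (C' / (1 + β o + ‖p.1‖) ^ e) := by gcongr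
    _ = C * C' * |c o| * (((α o + p.2) ^ j)⁻¹ *
        ((α o) ^ e / (α o + p.2) ^ e * ((1 + β o + ‖p.1‖) ^ e)⁻¹)) := by
      rw [pow_add]; field_simp
    _ ≤ _ := by gcongr

theorem abs_potInt_one_le (hf : HeatDecay e f) : ∃ C, 0 ≤ C ∧
    ∀ {Ω : Type} (c α β : Ω → ℝ) (p : Space d) (o : Ω), 0 < α o → α o ≤ β o → 0 < p.2 →
      |potInt c α β 1 f p o| ≤
        C * |c o| * (p.2 / (α o + p.2) ^ 2 * ((1 + β o + p.2 + ‖p.1‖) ^ e)⁻¹) := by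
  obtain ⟨C, hC, hk⟩ := abs_ker_one_le e
  obtain ⟨C', hC', hd⟩ := hf.decay
  refine ⟨C * C', by positivity, fun c α β p o h1 h2 hp => ?_⟩
  have h3 := hk p.2 (α o) h1
  rw [abs_of_pos hp] at h3
  have h4 := hd (β o) p.1 (h1.le.trans h2)
  have h5 := pow_div_mul_le e h1 h2 hp (norm_nonneg p.1)
  have hb : 0 < β o := h1.trans_le h2
  rw [potInt, abs_mul, abs_mul]
  calc |c o| * |ker 1 p.2 (α o)| * |heat f (β o) p.1|
      ≤ |c o| * (C * (p.2 * (α o) ^ e / (α o + p.2) ^ (e + 2))) * (C' / (1 + β o + ‖p.1‖) ^ e) := by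
        gcongr
    _ = C * C' * |c o| * (p.2 / (α o + p.2) ^ 2 *
        ((α o) ^ e / (α o + p.2) ^ e * ((1 + β o + ‖p.1‖) ^ e)⁻¹)) := by
      rw [pow_add]; field_simp
    _ ≤ _ := by gcongr

theorem integral_div_sq {s : ℝ} (hs : 0 < s) :
    IntegrableOn (fun v => s / (v + s) ^ 2) (Ioi 0) ∧ ∫ v in Ioi 0, s / (v + s) ^ 2 = 1 := by
  have hd : ∀ v ∈ Ici (0 : ℝ), HasDerivAt (fun v => -s * (v + s)⁻¹) (s / (v + s) ^ 2) v := by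
    intro v hv
    have hv : 0 ≤ v := hv
    have h1 : HasDerivAt (fun v : ℝ => v + s) 1 v := (hasDerivAt_id v).add_const s
    refine ((h1.inv (by positivity)).const_mul (-s)).congr_deriv ?_
    field_simp
  have hl : Tendsto (fun v => -s * (v + s)⁻¹) atTop (𝓝 0) := by
    simpa using (tendsto_inv_atTop_zero.comp (tendsto_atTop_add_const_right atTop s tendsto_id)).const_mul (-s)
  have h0 : ∀ v ∈ Ioi (0 : ℝ), 0 ≤ s / (v + s) ^ 2 := fun v hv => by positivity
  refine ⟨integrableOn_Ioi_deriv_of_nonneg' hd h0 hl, ?_⟩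
  rw [integral_Ioi_of_hasDerivAt_of_nonneg' hd h0 hl]
  field_simp; simp

theorem integral_inv_pow_le (hd : 1 ≤ d) {s : ℝ} (hs : 0 < s) :
    IntegrableOn (fun v => ((v + s) ^ (d + 1))⁻¹) (Ioi 0) ∧
      ∫ v in Ioi 0, ((v + s) ^ (d + 1))⁻¹ ≤ (s ^ d)⁻¹ := by
  obtain ⟨h1, h2⟩ := integral_div_sq hs
  have hle : ∀ v ∈ Ioi (0 : ℝ), ((v + s) ^ (d + 1))⁻¹ ≤ (s ^ d)⁻¹ * (s / (v + s) ^ 2) := by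
    intro v hv
    have hv : 0 < v := hv
    obtain ⟨k, rfl⟩ : ∃ k, d = k + 1 := ⟨d - 1, by omega⟩
    have : (s ^ (k + 1))⁻¹ * (s / (v + s) ^ 2) = (s ^ k * (v + s) ^ 2)⁻¹ := by
      rw [pow_succ]; field_simp
    rw [this, show k + 1 + 1 = k + 2 by rfl, pow_add]
    gcongr
    linarith
  have hi := h1.const_mul (s ^ d)⁻¹
  have hi' : IntegrableOn (fun v => ((v + s) ^ (d + 1))⁻¹) (Ioi 0) := by
    refine Integrable.mono' hi (Measurable.aestronglyMeasurable (by fun_prop)) ?_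
    filter_upwards [ae_volPos] with v hv
    rw [Real.norm_of_nonneg (by positivity)]
    exact hle v hv
  refine ⟨hi', ?_⟩
  calc _ ≤ ∫ v in Ioi 0, (s ^ d)⁻¹ * (s / (v + s) ^ 2) :=
        setIntegral_mono_on hi' hi measurableSet_Ioi hle
    _ = _ := by rw [integral_const_mul, h2, mul_one]

theorem abs_pot_le {Ω : Type*} [MeasurableSpace Ω] {μ : Measure Ω} {c α β : Ω → ℝ} {p : Space d}
    {G : Ω → ℝ} (hG : Integrable G μ) (h : ∀ᵐ o ∂μ, |potInt c α β j f p o| ≤ G o) :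
    |pot μ c α β j f p| ≤ ∫ o, G o ∂μ := by
  rw [← Real.norm_eq_abs]
  exact norm_integral_le_of_norm_le hG h

theorem inv_pow_le_of_halfSpace {p : Space d} (hp : p ∈ halfSpace d) :
    ((1 + p.2 + ‖p.1‖) ^ d)⁻¹ ≤ ((1 + ‖p‖) ^ d)⁻¹ := by
  have hp : 0 < p.2 := hp
  have : ‖p‖ ≤ p.2 + ‖p.1‖ := by
    rw [Prod.norm_def]
    refine max_le (by linarith) ?_
    rw [Real.norm_of_nonneg hp.le]
    linarith [norm_nonneg p.1]
  gcongr ?_⁻¹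
  exact pow_le_pow_left₀ (by positivity) (by linarith) d

/-- Potentials with weight bounded by `B` are bounded by `C B (1 + |p|)^{-d}`. -/
def PotBound {Ω : Type} [MeasurableSpace Ω] (μ : Measure Ω) (α β : Ω → ℝ) (j : ℕ)
    (f : Bdry d → ℝ) : Prop :=
  ∃ C, 0 ≤ C ∧ ∀ (c : Ω → ℝ) (B : ℝ), (∀ᵐ o ∂μ, |c o| ≤ B) → 0 ≤ B → ∀ p ∈ halfSpace d,
    |pot μ c α β j f p| ≤ C * B / (1 + ‖p‖) ^ d

/-- Decay of a potential is reduced to a scalar majorant: a function of the integration variable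
whose integral is of order `(1 + x_n + |x'|)^{-d}`. The weight enters only through its supremum, so
that the bound becomes uniform in time. -/
theorem potBound_of {Ω : Type} [MeasurableSpace Ω] {μ : Measure Ω} {α β : Ω → ℝ}
    {g : Space d → Ω → ℝ} {C k : ℝ} (hC : 0 ≤ C) (hk : 0 ≤ k)
    (hg : ∀ p ∈ halfSpace d, Integrable (g p) μ ∧
      ∫ o, g p o ∂μ ≤ k * ((1 + p.2 + ‖p.1‖) ^ d)⁻¹)
    (hg0 : ∀ p ∈ halfSpace d, ∀ᵐ o ∂μ, 0 ≤ g p o)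
    (h : ∀ c : Ω → ℝ, ∀ p ∈ halfSpace d, ∀ᵐ o ∂μ, |potInt c α β j f p o| ≤ C * |c o| * g p o) :
    PotBound μ α β j f := by
  refine ⟨C * k, by positivity, fun c B hc hB p hp => ?_⟩
  calc |pot μ c α β j f p| ≤ ∫ o, C * B * g p o ∂μ := by
        refine abs_pot_le ((hg p hp).1.const_mul _) ?_
        filter_upwards [h c p hp, hg0 p hp, hc] with o h1 h2 h3
        refine h1.trans ?_
        gcongr
    _ = C * B * ∫ o, g p o ∂μ := integral_const_mul _ _
    _ ≤ C * B * (k * ((1 + ‖p‖) ^ d)⁻¹) := by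
        have h1 := (hg p hp).2
        have h2 := inv_pow_le_of_halfSpace hp
        gcongr
        exact h1.trans (mul_le_mul_of_nonneg_left h2 hk)
    _ = _ := by rw [div_eq_mul_inv]; ring

theorem potBound_pos_zero (hd : 1 ≤ d) (hf : HeatDecay (d + 1) f) :
    PotBound volPos id id 0 f := by
  obtain ⟨C, hC, h⟩ := abs_potInt_le hf 0
  refine potBound_of (g := fun p v => ((v + (1 + p.2 + ‖p.1‖)) ^ (d + 1))⁻¹) hC zero_le_one ?_ ?_ ?_
  · intro p hp
    have hp : 0 < p.2 := hp
    rw [one_mul]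
    exact integral_inv_pow_le hd (by positivity)
  · intro p hp
    have hp : 0 < p.2 := hp
    filter_upwards [ae_volPos] with v hv
    positivity
  · intro c p hp
    filter_upwards [ae_volPos] with v hv
    have := h c id id p v hv le_rfl hp
    simp only [pow_zero, inv_one, one_mul, id] at this
    convert this using 4
    ring

theorem potBound_pos_one (hf : HeatDecay d f) : PotBound volPos id id 1 f := by
  obtain ⟨C, hC, h⟩ := abs_potInt_one_le hf
  refine potBound_of (g := fun p v => p.2 / (v + p.2) ^ 2 * ((1 + p.2 + ‖p.1‖) ^ d)⁻¹) hC
    zero_le_one ?_ ?_ ?_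
  · intro p hp
    obtain ⟨h1, h2⟩ := integral_div_sq hp
    refine ⟨h1.mul_const _, ?_⟩
    rw [integral_mul_const, h2]
  · intro p hp
    have hp : 0 < p.2 := hp
    filter_upwards [ae_volPos] with v hv
    positivity
  · intro c p hp
    filter_upwards [ae_volPos] with v hv
    have h1 := h c id id p v hv le_rfl hp
    have hp : 0 < p.2 := hp
    refine h1.trans ?_
    simp only [id]
    gcongr
    linarith

theorem potBound_two_zero (hf : HeatDecay d f) : PotBound volTwo id id 0 f := by
  obtain ⟨C, hC, h⟩ := abs_potInt_le hf 0
  refine potBound_of (g := fun p v => ((1 + p.2 + ‖p.1‖) ^ d)⁻¹) hC zero_le_two ?_ ?_ ?_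
  · intro p hp
    refine ⟨integrable_const _, ?_⟩
    simp [Measure.real]
  · intro p hp
    have hp : 0 < p.2 := hp
    filter_upwards with v
    positivity
  · intro c p hp
    filter_upwards [ae_volTwo] with v hv
    have h1 := h c id id p v hv.1 le_rfl hp
    have hp : 0 < p.2 := hp
    have := hv.1
    refine h1.trans ?_
    simp only [pow_zero, inv_one, one_mul, id]
    gcongr
    linarith

theorem potBound_two_one (hf : HeatDecay d f) : PotBound volTwo id id 1 f := by
  obtain ⟨C, hC, h⟩ := abs_potInt_one_le hf
  refine potBound_of (g := fun p v => p.2 / (v + p.2) ^ 2 * ((1 + p.2 + ‖p.1‖) ^ d)⁻¹) hC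
    zero_le_one ?_ ?_ ?_
  · intro p hp
    obtain ⟨h1, h2⟩ := integral_div_sq hp
    have hs : Ioo (0 : ℝ) 2 ⊆ Ioi 0 := Ioo_subset_Ioi_self
    have hp : 0 < p.2 := hp
    refine ⟨(h1.mono_set hs).mul_const _, ?_⟩
    rw [integral_mul_const]
    gcongr
    rw [← h2]
    refine setIntegral_mono_set h1 ?_ hs.eventuallyLE
    filter_upwards [ae_volPos] with v hv
    simp only [Pi.zero_apply]
    positivity
  · intro p hp
    have hp : 0 < p.2 := hp
    filter_upwards with v
    positivity
  · intro c p hp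
    filter_upwards [ae_volTwo] with v hv
    have h1 := h c id id p v hv.1 le_rfl hp
    have hp : 0 < p.2 := hp
    have := hv.1
    refine h1.trans ?_
    simp only [id]
    gcongr
    linarith

theorem volTwo_integral_one : ∫ _ : ℝ, (1 : ℝ) ∂volTwo = 2 := by simp [Measure.real]

theorem strip_snd_bound (hd : 1 ≤ d) {p : Space d} (hp : p ∈ halfSpace d) :
    Integrable (fun o : ℝ × ℝ => ((o.2 + (1 + p.2 + ‖p.1‖)) ^ (d + 1))⁻¹) volStrip ∧
      ∫ o, ((o.2 + (1 + p.2 + ‖p.1‖)) ^ (d + 1))⁻¹ ∂volStrip ≤ 2 * ((1 + p.2 + ‖p.1‖) ^ d)⁻¹ := by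
  have hp : 0 < p.2 := hp
  obtain ⟨h1, h2⟩ := integral_inv_pow_le hd (s := 1 + p.2 + ‖p.1‖) (by positivity)
  refine ⟨Integrable.comp_snd h1 volTwo, ?_⟩
  have := integral_prod_mul (μ := volTwo) (ν := volPos) (fun _ : ℝ => (1 : ℝ))
    (fun v => ((v + (1 + p.2 + ‖p.1‖)) ^ (d + 1))⁻¹)
  rw [volTwo_integral_one] at this
  simp only [one_mul] at this
  rw [this]
  gcongr

theorem potBound_snd_zero (hd : 1 ≤ d) (hf : HeatDecay (d + 1) f) :
    PotBound volStrip Prod.snd rad 0 f := by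
  obtain ⟨C, hC, h⟩ := abs_potInt_le hf 0
  refine potBound_of (g := fun p o => ((o.2 + (1 + p.2 + ‖p.1‖)) ^ (d + 1))⁻¹) hC zero_le_two
    (fun p hp => strip_snd_bound hd hp) ?_ ?_
  · intro p hp
    have hp : 0 < p.2 := hp
    filter_upwards [ae_volStrip] with o ho
    have := ho.2
    positivity
  · intro c p hp
    filter_upwards [ae_volStrip] with o ho
    refine (h c Prod.snd rad p o ho.2 (snd_le_rad o) hp).trans ?_
    have hp : 0 < p.2 := hp
    have := ho.2
    have := snd_le_rad o
    simp only [pow_zero, inv_one, one_mul]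
    gcongr C * |c o| * (?_ ^ (d + 1))⁻¹
    linarith

theorem potBound_fst_zero (hd : 1 ≤ d) (hf : HeatDecay (d + 1) f) :
    PotBound volStrip Prod.fst rad 0 f := by
  obtain ⟨C, hC, h⟩ := abs_potInt_le hf 0
  refine potBound_of (g := fun p o => ((o.2 + (1 + p.2 + ‖p.1‖)) ^ (d + 1))⁻¹) hC zero_le_two
    (fun p hp => strip_snd_bound hd hp) ?_ ?_
  · intro p hp
    have hp : 0 < p.2 := hp
    filter_upwards [ae_volStrip] with o ho
    have := ho.2
    positivity
  · intro c p hp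
    filter_upwards [ae_volStrip] with o ho
    refine (h c Prod.fst rad p o ho.1.1 (fst_le_rad o) hp).trans ?_
    have hp : 0 < p.2 := hp
    have := ho.2
    have := snd_le_rad o
    simp only [pow_zero, inv_one, one_mul]
    gcongr C * |c o| * (?_ ^ (d + 1))⁻¹
    linarith

theorem potBound_snd_one (hf : HeatDecay d f) : PotBound volStrip Prod.snd rad 1 f := by
  obtain ⟨C, hC, h⟩ := abs_potInt_one_le hf
  refine potBound_of (g := fun p o => p.2 / (o.2 + p.2) ^ 2 * ((1 + p.2 + ‖p.1‖) ^ d)⁻¹) hC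
    zero_le_two ?_ ?_ ?_
  · intro p hp
    obtain ⟨h1, h2⟩ := integral_div_sq hp
    refine ⟨(Integrable.comp_snd h1 volTwo).mul_const _, ?_⟩
    have := integral_prod_mul (μ := volTwo) (ν := volPos) (fun _ : ℝ => (1 : ℝ))
      (fun v => p.2 / (v + p.2) ^ 2)
    rw [volTwo_integral_one] at this
    simp only [one_mul] at this
    rw [integral_mul_const, this, h2, mul_one]
  · intro p hp
    have hp : 0 < p.2 := hp
    filter_upwards with v
    positivity
  · intro c p hp
    filter_upwards [ae_volStrip] with o ho
    refine (h c Prod.snd rad p o ho.2 (snd_le_rad o) hp).trans ?_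
    have hp : 0 < p.2 := hp
    have := ho.2
    have := rad_nonneg o
    gcongr
    linarith

/-- The majorant is a product: an approximate identity of mass at most one in the first coordinate,
and a tail integral in the second that lowers the exponent from `d + 1` to `d`. -/
theorem potBound_fst_one (hd : 1 ≤ d) (hf : HeatDecay (d + 1) f) :
    PotBound volStrip Prod.fst rad 1 f := by
  obtain ⟨C, hC, h⟩ := abs_potInt_one_le hf
  refine potBound_of (g := fun p o => p.2 / (o.1 + p.2) ^ 2 *
    ((o.2 + (1 + p.2 + ‖p.1‖)) ^ (d + 1))⁻¹) hC zero_le_one ?_ ?_ ?_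
  · intro p hp
    obtain ⟨h1, h2⟩ := integral_div_sq hp
    have hs : Ioo (0 : ℝ) 2 ⊆ Ioi 0 := Ioo_subset_Ioi_self
    have hp : 0 < p.2 := hp
    obtain ⟨h3, h4⟩ := integral_inv_pow_le hd (s := 1 + p.2 + ‖p.1‖) (by positivity)
    have h5 : ∫ v in Ioo 0 2, p.2 / (v + p.2) ^ 2 ≤ 1 := by
      rw [← h2]
      refine setIntegral_mono_set h1 ?_ hs.eventuallyLE
      filter_upwards [ae_volPos] with v hv
      simp only [Pi.zero_apply]
      positivity
    refine ⟨Integrable.mul_prod (f := fun v => p.2 / (v + p.2) ^ 2)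
      (g := fun v => ((v + (1 + p.2 + ‖p.1‖)) ^ (d + 1))⁻¹) (h1.mono_set hs) h3, ?_⟩
    rw [integral_prod_mul (μ := volTwo) (ν := volPos) (fun v => p.2 / (v + p.2) ^ 2)
      (fun v => ((v + (1 + p.2 + ‖p.1‖)) ^ (d + 1))⁻¹)]
    refine mul_le_mul h5 h4 ?_ zero_le_one
    refine setIntegral_nonneg measurableSet_Ioi fun v hv => ?_
    have hv : 0 < v := hv
    positivity
  · intro p hp
    have hp : 0 < p.2 := hp
    filter_upwards [ae_volStrip] with o ho
    have := ho.2
    positivity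
  · intro c p hp
    filter_upwards [ae_volStrip] with o ho
    refine (h c Prod.fst rad p o ho.1.1 (fst_le_rad o) hp).trans ?_
    have hp : 0 < p.2 := hp
    have := ho.2
    have := snd_le_rad o
    gcongr C * |c o| * (p.2 / (o.1 + p.2) ^ 2 * (?_ ^ (d + 1))⁻¹)
    linarith

/-! ### Families bounded uniformly in time -/

/-- `V t` decays like `|p|^{-d}` uniformly for `t ≤ 2`. -/
def UnifDecay (V : ℝ → Space d → ℝ) : Prop :=
  ∃ C, 0 ≤ C ∧ ∀ t ≤ 2, ∀ p ∈ halfSpace d, |V t p| ≤ C / (1 + ‖p‖) ^ d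

theorem UnifDecay.add {V W : ℝ → Space d → ℝ} (hV : UnifDecay V) (hW : UnifDecay W) :
    UnifDecay fun t p => V t p + W t p := by
  obtain ⟨C, hC, h⟩ := hV
  obtain ⟨C', hC', h'⟩ := hW
  refine ⟨C + C', by positivity, fun t ht p hp => ?_⟩
  rw [add_div]
  exact (abs_add_le _ _).trans (add_le_add (h t ht p hp) (h' t ht p hp))

theorem UnifDecay.neg {V : ℝ → Space d → ℝ} (hV : UnifDecay V) : UnifDecay fun t p => -V t p := by
  obtain ⟨C, hC, h⟩ := hV
  exact ⟨C, hC, fun t ht p hp => by rw [abs_neg]; exact h t ht p hp⟩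

theorem UnifDecay.sub {V W : ℝ → Space d → ℝ} (hV : UnifDecay V) (hW : UnifDecay W) :
    UnifDecay fun t p => V t p - W t p := by
  simpa only [sub_eq_add_neg] using hV.add hW.neg

theorem UnifDecay.congr {V W : ℝ → Space d → ℝ} (hV : UnifDecay V)
    (h : ∀ t ≤ 2, ∀ p ∈ halfSpace d, W t p = V t p) : UnifDecay W := by
  obtain ⟨C, hC, h'⟩ := hV
  exact ⟨C, hC, fun t ht p hp => by rw [h t ht p hp]; exact h' t ht p hp⟩

variable {θ Θ : ℝ → ℝ}

theorem PotBound.unifDecay_mul (h : PotBound volPos id id j f) (hθ : TimeProfile θ) :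
    UnifDecay fun t p => θ t * potA j f p := by
  obtain ⟨C, hC, h⟩ := h
  obtain ⟨B, hB, hb⟩ := hθ.exists_bound 2
  refine ⟨B * C, by positivity, fun t ht p hp => ?_⟩
  rw [abs_mul, mul_div_assoc]
  have := h (fun _ => 1) 1 (by simp) zero_le_one p hp
  rw [mul_one] at this
  gcongr
  · exact hb t ht
  · exact this

theorem PotBound.unifDecay_time {Ω : Type} [MeasurableSpace Ω] {μ : Measure Ω} {α β T : Ω → ℝ}
    (h : PotBound μ α β j f) (hT0 : ∀ᵐ o ∂μ, 0 ≤ T o) {k : ℝ} (hk : 0 ≤ k)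
    (hθ : TimeProfile θ) :
    UnifDecay fun t => pot μ (timeWeight (fun _ => k) T θ t) α β j f := by
  obtain ⟨C, hC, h⟩ := h
  obtain ⟨B, hB, hb⟩ := hθ.exists_bound 2
  refine ⟨C * (k * B), by positivity, fun t ht p hp => h _ _ ?_ (by positivity) p hp⟩
  filter_upwards [hT0] with o ho
  rw [timeWeight, abs_mul, abs_of_nonneg hk]
  gcongr
  exact hb _ (by linarith)

theorem unifDecay_potC_zero (hθ : TimeProfile θ) (hf : IsBump f) :
    UnifDecay fun t => potC θ t 0 f :=
  (potBound_two_zero hf.heatDecay).unifDecay_time (sq_nonneg_ae _) zero_le_one hθ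

theorem unifDecay_potC_one (hθ : TimeProfile θ) (hf : IsBump f) :
    UnifDecay fun t => potC θ t 1 f :=
  (potBound_two_one hf.heatDecay).unifDecay_time (sq_nonneg_ae _) zero_le_one hθ

theorem unifDecay_potP_zero (hd : 1 ≤ d) (hθ : TimeProfile θ) (hf : HeatDecay (d + 1) f) :
    UnifDecay fun t => potP θ t 0 f :=
  (potBound_snd_zero hd hf).unifDecay_time (fst_sq_nonneg_ae _) (by positivity) hθ

theorem unifDecay_potP_one (hθ : TimeProfile θ) (hf : IsBump f) :
    UnifDecay fun t => potP θ t 1 f :=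
  (potBound_snd_one hf.heatDecay).unifDecay_time (fst_sq_nonneg_ae _) (by positivity) hθ

theorem unifDecay_potD_zero (hd : 1 ≤ d) (hθ : TimeProfile θ) (hf : HeatDecay (d + 1) f) :
    UnifDecay fun t => potD θ t 0 f :=
  (potBound_fst_zero hd hf).unifDecay_time (fst_sq_nonneg_ae _) (by positivity) hθ

theorem unifDecay_potD_one (hd : 1 ≤ d) (hθ : TimeProfile θ) (hf : HeatDecay (d + 1) f) :
    UnifDecay fun t => potD θ t 1 f :=
  (potBound_fst_one hd hf).unifDecay_time (fst_sq_nonneg_ae _) (by positivity) hθ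

/-- By harmonicity two normal derivatives are minus a tangential Laplacian, so no estimate of the
second-order kernel is required. -/
theorem unifDecay_potP_two (hd : 1 ≤ d) (hθ : TimeProfile θ) (hf : IsBump f) :
    UnifDecay fun t => potP θ t 2 f :=
  (unifDecay_potP_zero hd hθ (lap_heatDecay hf)).neg.congr fun t _ p hp => by
    have := potP_harmonic (j := 0) (by omega) (admA' hd 1) hf.heatDecay (admA hd 0)
      (lap_heatDecay hf) hθ t hp
    rw [zero_add] at this
    linarith

theorem unifDecay_tang (hd : 1 ≤ d) (hθ : TimeProfile θ) (hΘ : TimeProfile Θ)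
    (hf : HeatDecay (d + 1) f) (hg : HeatDecay (d + 1) g) :
    UnifDecay fun t => tang θ Θ t 0 f g :=
  ((((potBound_pos_zero hd hf).unifDecay_mul hθ).sub
    ((potBound_pos_zero hd hg).unifDecay_mul hΘ)).neg.add
    ((unifDecay_potP_one hθ hf.toIsBump).sub (unifDecay_potP_one hΘ hg.toIsBump))).sub
    ((unifDecay_potD_one hd hθ hf).sub (unifDecay_potD_one hd hΘ hg)) |>.add
    ((unifDecay_potC_zero hθ hf.toIsBump).sub (unifDecay_potC_zero hΘ hg.toIsBump))

theorem unifDecay_nrm (hd : 1 ≤ d) (hθ : TimeProfile θ) (hΘ : TimeProfile Θ)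
    {f₀ f₁ f₂ : Bdry d → ℝ}
    (hf₀ : IsBump f₀) (hf₁ : HeatDecay (d + 1) f₁) (hf₂ : HeatDecay (d + 1) f₂) :
    UnifDecay fun t => nrm θ Θ t 0 f₀ f₁ f₂ :=
  ((((potBound_pos_one hf₀.heatDecay).unifDecay_mul hθ).sub
    ((potBound_pos_one hf₁.toIsBump.heatDecay).unifDecay_mul hΘ)).neg.sub
    ((unifDecay_potP_zero hd hθ hf₁).sub (unifDecay_potP_zero hd hΘ hf₂))).add
    ((unifDecay_potD_zero hd hθ hf₁).sub (unifDecay_potD_zero hd hΘ hf₂)) |>.sub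
    (unifDecay_potC_one hΘ hf₁.toIsBump)

/-- Every first derivative of the pressure decays. -/
theorem unifDecay_prs (hd : 1 ≤ d) (hθ : TimeProfile θ) (hf : IsBump f) :
    (∀ i, UnifDecay fun t p => fderiv ℝ (prs θ f t) p (tangent i)) ∧
      UnifDecay fun t p => fderiv ℝ (prs θ f t) p (normal d) := by
  refine ⟨fun i => ?_, ?_⟩
  · refine ((((potBound_pos_zero hd (hf.heatDecay_pd i)).unifDecay_mul hθ).sub
      ((potBound_pos_zero hd (hf.lap.heatDecay_pd i)).unifDecay_mul hθ.prim)).sub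
      ((unifDecay_potP_one hθ (hf.pd i)).sub (unifDecay_potP_one hθ.prim (hf.lap.pd i)))).congr
      fun t _ p hp => ?_
    rw [(hasGrad_prs hd hθ hf p hp).fderiv, gradL_tangent]
  · refine ((((potBound_pos_one hf.heatDecay).unifDecay_mul hθ).sub
      ((potBound_pos_one hf.lap.heatDecay).unifDecay_mul hθ.prim)).sub
      ((unifDecay_potP_two hd hθ hf).sub (unifDecay_potP_two hd hθ.prim hf.lap))).congr
      fun t _ p hp => ?_
    rw [(hasGrad_prs hd hθ hf p hp).fderiv, gradL_normal]

end Bounds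

end HalfSpaceStokes

namespace HalfSpaceStokes

/-! ### The potentials as integrals over the half-line -/

section Iterated

variable {d : ℕ} {f g : Bdry d → ℝ} {θ Θ : ℝ → ℝ} {t : ℝ}

/-- The half-integral `2π^{-1/2} ∫_0^∞ e^{(v²+η²)Δ'} f dη`. -/
noncomputable def halfInt (f : Bdry d → ℝ) (v : ℝ) (y : Bdry d) : ℝ :=
  2 / √Real.pi * ∫ η in Ioi 0, heat f (rad (v, η)) y

/-- The time half-integral `2π^{-1/2} ∫_0^2 θ(t-u²) e^{(u²+v²)Δ'} f du`. -/
noncomputable def timeInt (θ : ℝ → ℝ) (t : ℝ) (f : Bdry d → ℝ) (v : ℝ) (y : Bdry d) : ℝ :=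
  2 / √Real.pi * ∫ u in Ioo 0 2, θ (t - u ^ 2) * heat f (rad (u, v)) y

theorem setIntegral_Ioo_two_eq {G : ℝ → ℝ} (hG : ∀ v, 2 ≤ v → G v = 0) :
    ∫ v in Ioo 0 2, G v = ∫ v in Ioi 0, G v := by
  refine (setIntegral_eq_of_subset_of_forall_sdiff_eq_zero measurableSet_Ioi Ioo_subset_Ioi_self
    fun v hv => hG v ?_).symm
  by_contra h
  exact hv.2 ⟨hv.1, not_le.1 h⟩

theorem TimeProfile.eq_zero_of_two_le (hθ : TimeProfile θ) (ht : t ≤ 2) {v : ℝ} (hv : 2 ≤ v) :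
    θ (t - v ^ 2) = 0 := hθ.eq_zero _ (by nlinarith)

theorem potD_eq (hd : 1 ≤ d) (hθ : TimeProfile θ) (ht : t ≤ 2) (hf : HeatDecay (d + 1) f) (j : ℕ)
    {p : Space d} (hp : p ∈ halfSpace d) :
    potD θ t j f p = ∫ v in Ioi 0, ker j p.2 v * (θ (t - v ^ 2) * halfInt f v p.1) := by
  rw [← setIntegral_Ioo_two_eq fun v hv => by rw [hθ.eq_zero_of_two_le ht hv]; simp]
  rw [potD, pot, integral_prod _ ((admD hd hθ t j).integrable_potInt hf hp)]
  refine integral_congr_ae (ae_of_all _ fun v => ?_)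
  simp only [potInt, timeWeight, halfInt]
  rw [integral_const_mul]
  ring

theorem potP_eq (hd : 1 ≤ d) (hθ : TimeProfile θ) (hf : HeatDecay (d + 1) f) (j : ℕ)
    {p : Space d} (hp : p ∈ halfSpace d) :
    potP θ t j f p = ∫ v in Ioi 0, ker j p.2 v * timeInt θ t f v p.1 := by
  rw [potP, pot, integral_prod_symm _ ((admP hd hθ t j).integrable_potInt hf hp)]
  refine integral_congr_ae (ae_of_all _ fun v => ?_)
  simp only [potInt, timeWeight, timeInt]
  rw [mul_left_comm, ← integral_const_mul, ← integral_const_mul]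
  exact integral_congr_ae (ae_of_all _ fun u => by ring)

theorem potC_eq (hθ : TimeProfile θ) (ht : t ≤ 2) (j : ℕ) (p : Space d) :
    potC θ t j f p = ∫ v in Ioi 0, ker j p.2 v * (θ (t - v ^ 2) * heat f v p.1) := by
  rw [← setIntegral_Ioo_two_eq fun v hv => by rw [hθ.eq_zero_of_two_le ht hv]; simp]
  rw [potC, pot]
  refine integral_congr_ae (ae_of_all _ fun v => ?_)
  simp only [potInt, timeWeight, id]
  ring

theorem potA_eq (j : ℕ) (p : Space d) :
    potA j f p = ∫ v in Ioi 0, ker j p.2 v * heat f v p.1 := by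
  simp [potA, pot, potInt]

theorem abs_heat_rad_le {e : ℕ} (hf : HeatDecay e f) : ∃ C, 0 ≤ C ∧ ∀ v η : ℝ, 0 < η → ∀ y,
    |heat f (rad (v, η)) y| ≤ C * ((η + (1 + ‖y‖)) ^ e)⁻¹ := by
  obtain ⟨C, hC, h⟩ := hf.decay
  refine ⟨C, hC, fun v η hη y => (h _ y (rad_nonneg _)).trans ?_⟩
  have := snd_le_rad (v, η)
  rw [div_eq_mul_inv]
  gcongr C * (?_ ^ e)⁻¹
  simp only at this
  linarith

theorem heat_rad_integrable (hd : 1 ≤ d) (hf : HeatDecay (d + 1) f) (v : ℝ) (y : Bdry d) :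
    IntegrableOn (fun η => heat f (rad (v, η)) y) (Ioi 0) := by
  obtain ⟨C, hC, h⟩ := abs_heat_rad_le hf
  refine ((integral_inv_pow_le hd (s := 1 + ‖y‖) (by positivity)).1.const_mul C).mono' ?_ ?_
  · have h1 := continuous_heat hf.toIsBump
    have h2 := continuous_rad
    exact Continuous.aestronglyMeasurable (h1.comp
      ((h2.comp (continuous_const.prodMk continuous_id)).prodMk continuous_const))
  · filter_upwards [ae_volPos] with η hη
    exact h v η hη y

theorem abs_halfInt_le (hd : 1 ≤ d) (hf : HeatDecay (d + 1) f) : ∃ C, 0 ≤ C ∧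
    ∀ v y, |halfInt f v y| ≤ C / (1 + ‖y‖) ^ d := by
  obtain ⟨C, hC, h⟩ := abs_heat_rad_le hf
  refine ⟨2 / √Real.pi * C, by positivity, fun v y => ?_⟩
  obtain ⟨h1, h2⟩ := integral_inv_pow_le hd (s := 1 + ‖y‖) (by positivity)
  rw [halfInt, abs_mul, abs_of_pos (by positivity), mul_div_assoc, div_eq_mul_inv C]
  gcongr
  calc |∫ η in Ioi 0, heat f (rad (v, η)) y| ≤ ∫ η in Ioi 0, C * ((η + (1 + ‖y‖)) ^ (d + 1))⁻¹ := by
        rw [← Real.norm_eq_abs]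
        refine norm_integral_le_of_norm_le (h1.const_mul C) ?_
        filter_upwards [ae_volPos] with η hη
        exact h v η hη y
    _ ≤ _ := by
        rw [integral_const_mul]
        gcongr

theorem continuous_halfInt (hd : 1 ≤ d) (hf : HeatDecay (d + 1) f) (y : Bdry d) :
    Continuous fun v => halfInt f v y := by
  obtain ⟨C, hC, h⟩ := abs_heat_rad_le hf
  refine continuous_const.mul (continuous_of_dominated
    (bound := fun η => C * ((η + (1 + ‖y‖)) ^ (d + 1))⁻¹)
    (fun v => (heat_rad_integrable hd hf v y).aestronglyMeasurable) (fun v => ?_)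
    ((integral_inv_pow_le hd (s := 1 + ‖y‖) (by positivity)).1.const_mul C)
    (ae_of_all _ fun η => ?_))
  · filter_upwards [ae_volPos] with η hη
    exact h v η hη y
  · exact (continuous_heat hf.toIsBump).comp
      ((continuous_rad.comp (continuous_id.prodMk continuous_const)).prodMk continuous_const)

/-- Mean value theorem in `v` for fixed `η`: the derivative is `2v` times the evolution of the
Laplacian, whose decay has exponent `d + 2`. Integration in `η` costs one power. -/
theorem abs_halfInt_sub_le (hd : 1 ≤ d) (hf : HeatDecay (d + 1) f) : ∃ C, 0 ≤ C ∧
    ∀ v, 0 < v → ∀ y, |halfInt f v y - halfInt f 0 y| ≤ C * v ^ 2 / (1 + ‖y‖) ^ (d + 1) := by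
  obtain ⟨C, hC, h⟩ := abs_heat_rad_le hf.toIsBump.heatDecay_lap
  refine ⟨2 / √Real.pi * (2 * C), by positivity, fun v hv y => ?_⟩
  obtain ⟨h1, h2⟩ := integral_inv_pow_le (d := d + 1) (by omega) (s := 1 + ‖y‖) (by positivity)
  rw [halfInt, halfInt, ← mul_sub, abs_mul, abs_of_pos (by positivity), mul_assoc, mul_div_assoc,
    ← integral_sub (heat_rad_integrable hd hf v y) (heat_rad_integrable hd hf 0 y),
    div_eq_mul_inv (2 * C * v ^ 2)]
  gcongr
  calc _ ≤ ∫ η in Ioi 0, 2 * C * v ^ 2 * ((η + (1 + ‖y‖)) ^ (d + 1 + 1))⁻¹ := by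
        rw [← Real.norm_eq_abs]
        refine norm_integral_le_of_norm_le (h1.const_mul _) ?_
        filter_upwards [ae_volPos] with η hη
        obtain ⟨c, hc, he⟩ := exists_hasDerivAt_eq_slope (fun s => heat f (rad (s, η)) y)
          (fun s => 2 * s * heat (lap f) (rad (s, η)) y) hv
          (((continuous_heat hf.toIsBump).comp ((continuous_rad.comp
            (continuous_id.prodMk continuous_const)).prodMk continuous_const)).continuousOn)
          (fun s hs => hasDerivAt_heat_rad hf.toIsBump η y hs.1)
        rw [sub_zero, eq_div_iff hv.ne'] at he
        have hc1 := hc.1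
        rw [← he, Real.norm_eq_abs, abs_mul, abs_mul, abs_of_pos hv, abs_of_pos (by positivity)]
        calc 2 * c * |heat (lap f) (rad (c, η)) y| * v
            ≤ 2 * v * (C * ((η + (1 + ‖y‖)) ^ (d + 1 + 1))⁻¹) * v := by
              gcongr
              · exact hc.2.le
              · exact h c η hη y
          _ = _ := by ring
    _ ≤ _ := by
        rw [integral_const_mul]
        gcongr

theorem timeInt_bound (hθ : TimeProfile θ) (hf : IsBump f) (ht : t ≤ 2) : ∃ C, 0 ≤ C ∧
    ∀ v u y, |θ (t - u ^ 2) * heat f (rad (u, v)) y| ≤ C := by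
  obtain ⟨C, hC, h⟩ := abs_heat_le hf
  obtain ⟨B, hB, hb⟩ := hθ.exists_bound 2
  refine ⟨B * C, by positivity, fun v u y => ?_⟩
  rw [abs_mul]
  gcongr
  · exact hb _ (by nlinarith [sq_nonneg u])
  · exact h _ _

theorem continuous_timeInt (hθ : TimeProfile θ) (hf : IsBump f) (ht : t ≤ 2) (y : Bdry d) :
    Continuous fun v => timeInt θ t f v y := by
  obtain ⟨C, hC, h⟩ := timeInt_bound hθ hf ht
  have h1 := continuous_heat hf
  have h2 := continuous_rad
  have h3 := hθ.continuous
  refine continuous_const.mul (continuous_of_dominated (bound := fun _ => C)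
    (fun v => Continuous.aestronglyMeasurable ?_) (fun v => ae_of_all _ fun u => h v u y)
    (integrable_const C) (ae_of_all _ fun u => ?_))
  · exact (h3.comp (by fun_prop)).mul (h1.comp
      ((h2.comp (continuous_id.prodMk continuous_const)).prodMk continuous_const))
  · exact continuous_const.mul (h1.comp
      ((h2.comp (continuous_const.prodMk continuous_id)).prodMk continuous_const))

theorem abs_timeInt_le (hθ : TimeProfile θ) (hf : IsBump f) (ht : t ≤ 2) (y : Bdry d) : ∃ C,
    ∀ v, |timeInt θ t f v y| ≤ C := by
  obtain ⟨C, hC, h⟩ := timeInt_bound hθ hf ht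
  refine ⟨2 / √Real.pi * (C * 2), fun v => ?_⟩
  rw [timeInt, abs_mul, abs_of_pos (by positivity)]
  gcongr
  have := norm_setIntegral_le_of_norm_le_const (μ := volume) (s := Ioo (0 : ℝ) 2) (by simp)
    (f := fun u => θ (t - u ^ 2) * heat f (rad (u, v)) y) (fun u _ => h v u y)
  simpa [Measure.real] using this

theorem rad_zero_left {η : ℝ} (hη : 0 < η) : rad (0, η) = η := by simp [rad, hη.le]

theorem rad_zero_right {η : ℝ} (hη : 0 < η) : rad (η, 0) = η := by simp [rad, hη.le]

/-! ### Boundary limits -/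

theorem tendsto_ker_zero {v : ℝ} : Tendsto (fun x => ker 0 x v) (𝓝[>] 0) (𝓝 (2 / √Real.pi)) := by
  have : ContinuousAt (fun x => ker 0 x v) 0 := (hasDerivAt_ker 0 0 v).continuousAt
  have h := this.tendsto
  rw [ker_zero] at h
  simp only [zero_div, ne_eq, OfNat.ofNat_ne_zero, not_false_eq_true, zero_pow, mul_zero,
    Real.exp_zero, mul_one] at h
  exact h.mono_left nhdsWithin_le_nhds

theorem tendsto_pot_zero {Ω : Type*} [MeasurableSpace Ω] {μ : Measure Ω} {c α β : Ω → ℝ} {e : ℕ}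
    (h : Adm μ c α β 0 e) (hf : HeatDecay e f) (y : Bdry d) :
    Tendsto (fun x => pot μ c α β 0 f (y, x)) (𝓝[>] 0)
      (𝓝 (2 / √Real.pi * ∫ o, c o * heat f (β o) y ∂μ)) := by
  obtain ⟨C', hC', hd⟩ := hf.decay
  rw [← integral_const_mul]
  refine tendsto_integral_filter_of_dominated_convergence
    (fun o => 2 / √Real.pi * C' * (|c o| * ((α o + 1) ^ 0)⁻¹ * ((1 + β o) ^ e)⁻¹))
    (Eventually.of_forall fun x =>
      (h.measurable_potInt 0 hf.toIsBump (y, x)).aestronglyMeasurable) ?_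
    ((h.integrable 1 one_pos).const_mul _) ?_
  · refine Eventually.of_forall fun x => ?_
    filter_upwards [h.pos] with o ho
    have h2 := ho.2
    rw [potInt, Real.norm_eq_abs, abs_mul, abs_mul, abs_of_nonneg (ker_zero_nonneg _ _)]
    calc |c o| * ker 0 x (α o) * |heat f (β o) y| ≤
          |c o| * (2 / √Real.pi) * (C' / (1 + β o) ^ e) := by
          gcongr
          · exact ker_zero_le _ _
          · refine (hd _ _ ho.2).trans ?_
            gcongr C' / ?_ ^ e
            linarith [norm_nonneg y]
      _ = _ := by rw [pow_zero, inv_one, div_eq_mul_inv C']; ring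
  · refine ae_of_all _ fun o => ?_
    have := (tendsto_ker_zero (v := α o)).const_mul (c o) |>.mul_const (heat f (β o) y)
    rw [mul_comm (c o), mul_assoc] at this
    exact this

theorem tendsto_potA_zero (hd : 1 ≤ d) (hf : HeatDecay (d + 1) f) (y : Bdry d) :
    Tendsto (fun x => potA 0 f (y, x)) (𝓝[>] 0) (𝓝 (halfInt f 0 y)) := by
  refine (tendsto_pot_zero (admA hd 0) hf y).trans_eq (congrArg 𝓝 ?_)
  rw [halfInt]
  congr 1
  refine setIntegral_congr_fun measurableSet_Ioi fun η hη => ?_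
  simp [rad_zero_left hη]

theorem tendsto_potC_zero (hθ : TimeProfile θ) (hf : IsBump f) (y : Bdry d) :
    Tendsto (fun x => potC θ t 0 f (y, x)) (𝓝[>] 0) (𝓝 (timeInt θ t f 0 y)) := by
  refine (tendsto_pot_zero (admC hθ t 0 d) hf.heatDecay y).trans_eq (congrArg 𝓝 ?_)
  rw [timeInt]
  congr 1
  refine setIntegral_congr_fun measurableSet_Ioo fun η hη => ?_
  simp [rad_zero_right hη.1, timeWeight]

/-- At the wall the kernel loses its dependence on `v`, and the two potentials become the same
integral over the strip. -/
theorem tendsto_potP_sub_potD_zero (hd : 1 ≤ d) (hθ : TimeProfile θ) (hf : HeatDecay (d + 1) f)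
    (y : Bdry d) :
    Tendsto (fun x => potP θ t 0 f (y, x) - potD θ t 0 f (y, x)) (𝓝[>] 0) (𝓝 0) := by
  have := (tendsto_pot_zero (admP hd hθ t 0) hf y).sub (tendsto_pot_zero (admD hd hθ t 0) hf y)
  rwa [sub_self] at this

theorem tendsto_potA_one (hf : IsBump f) (y : Bdry d) :
    Tendsto (fun x => potA 1 f (y, x)) (𝓝[>] 0) (𝓝 (-f y)) := by
  obtain ⟨B, _, hB⟩ := abs_heat_le hf
  have h1 : Continuous fun v => heat f v y :=
    (continuous_heat hf).comp (continuous_id.prodMk continuous_const)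
  simp only [potA_eq]
  refine tendsto_integral_ker_one h1.continuousOn (fun v _ => hB v y) ?_
  have := h1.tendsto 0
  rw [heat_zero] at this
  exact this.mono_left nhdsWithin_le_nhds

theorem continuous_comp_sub_sq (hθ : TimeProfile θ) (t : ℝ) : Continuous fun v => θ (t - v ^ 2) := by
  have := hθ.continuous
  fun_prop

theorem tendsto_potC_one (hθ : TimeProfile θ) (ht : t ≤ 2) (hf : IsBump f) (y : Bdry d) :
    Tendsto (fun x => potC θ t 1 f (y, x)) (𝓝[>] 0) (𝓝 (-(θ t * f y))) := by
  obtain ⟨B, _, hB⟩ := abs_heat_le hf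
  obtain ⟨B', hB'0, hB'⟩ := hθ.exists_bound 2
  have h1 : Continuous fun v => θ (t - v ^ 2) * heat f v y :=
    (continuous_comp_sub_sq hθ t).mul
      ((continuous_heat hf).comp (continuous_id.prodMk continuous_const))
  simp only [potC_eq hθ ht]
  refine tendsto_integral_ker_one (B := B' * B) h1.continuousOn (fun v _ => ?_) ?_
  · rw [abs_mul]
    gcongr
    · exact hB' _ (by nlinarith [sq_nonneg v])
    · exact hB v y
  · have := h1.tendsto 0
    simp only [heat_zero, ne_eq, OfNat.ofNat_ne_zero, not_false_eq_true, zero_pow, sub_zero] at this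
    exact this.mono_left nhdsWithin_le_nhds

theorem tendsto_potP_one (hd : 1 ≤ d) (hθ : TimeProfile θ) (ht : t ≤ 2) (hf : HeatDecay (d + 1) f)
    (y : Bdry d) :
    Tendsto (fun x => potP θ t 1 f (y, x)) (𝓝[>] 0) (𝓝 (-timeInt θ t f 0 y)) := by
  obtain ⟨B, hB⟩ := abs_timeInt_le hθ hf.toIsBump ht y
  have h1 := continuous_timeInt hθ hf.toIsBump ht y
  refine (tendsto_integral_ker_one h1.continuousOn (fun v _ => hB v)
    ((h1.tendsto 0).mono_left nhdsWithin_le_nhds)).congr' ?_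
  filter_upwards [self_mem_nhdsWithin] with x hx
  rw [potP_eq hd hθ hf 1 (p := (y, x)) hx]

theorem tendsto_potD_one (hd : 1 ≤ d) (hθ : TimeProfile θ) (ht : t ≤ 2) (hf : HeatDecay (d + 1) f)
    (y : Bdry d) :
    Tendsto (fun x => potD θ t 1 f (y, x)) (𝓝[>] 0) (𝓝 (-(θ t * halfInt f 0 y))) := by
  obtain ⟨B, hB0, hB⟩ := abs_halfInt_le hd hf
  obtain ⟨B', hB'0, hB'⟩ := hθ.exists_bound 2
  have h1 : Continuous fun v => θ (t - v ^ 2) * halfInt f v y :=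
    (continuous_comp_sub_sq hθ t).mul (continuous_halfInt hd hf y)
  have h2 := (h1.tendsto 0).mono_left (nhdsWithin_le_nhds (s := Ioi 0))
  simp only [ne_eq, OfNat.ofNat_ne_zero, not_false_eq_true, zero_pow, sub_zero] at h2
  refine (tendsto_integral_ker_one (B := B' * (B / (1 + ‖y‖) ^ d)) h1.continuousOn
    (fun v _ => ?_) h2).congr' ?_
  · rw [abs_mul]
    gcongr
    · exact hB' _ (by nlinarith [sq_nonneg v])
    · exact hB v y
  · filter_upwards [self_mem_nhdsWithin] with x hx
    rw [potD_eq hd hθ ht hf 1 (p := (y, x)) hx]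

/-- The eight boundary limits cancel in pairs: `potA` against `potD` through the half-integral in
space, `potP` against `potC` through the half-integral in time. -/
theorem tendsto_tang (hd : 1 ≤ d) (hθ : TimeProfile θ) (hΘ : TimeProfile Θ) (ht : t ≤ 2)
    (hf : HeatDecay (d + 1) f) (hg : HeatDecay (d + 1) g) (y : Bdry d) :
    Tendsto (fun x => tang θ Θ t 0 f g (y, x)) (𝓝[>] 0) (𝓝 0) := by
  have := ((((((tendsto_potA_zero hd hf y).const_mul (θ t)).sub
    ((tendsto_potA_zero hd hg y).const_mul (Θ t))).neg.add
    ((tendsto_potP_one hd hθ ht hf y).sub (tendsto_potP_one hd hΘ ht hg y))).sub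
    ((tendsto_potD_one hd hθ ht hf y).sub (tendsto_potD_one hd hΘ ht hg y))).add
    ((tendsto_potC_zero (t := t) hθ hf.toIsBump y).sub
      (tendsto_potC_zero (t := t) hΘ hg.toIsBump y)))
  unfold tang
  simp only [zero_add]
  convert this using 2
  ring

/-- The `potA` terms give `θψ - ΘΔ'ψ`, the `potP` and `potD` terms cancel, and the last caloric term
restores `ΘΔ'ψ`. -/
theorem tendsto_solN (hd : 1 ≤ d) (hθ : TimeProfile θ) (ht : t ≤ 2) (hf : IsBump f) (y : Bdry d) :
    Tendsto (fun x => solN θ f t (y, x)) (𝓝[>] 0) (𝓝 (θ t * f y)) := by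
  have h1 := lap_heatDecay hf
  have h2 := lap_heatDecay hf.lap
  have := (((((tendsto_potA_one hf y).const_mul (θ t)).sub
    ((tendsto_potA_one hf.lap y).const_mul (prim θ t))).neg.sub
    (tendsto_potP_sub_potD_zero (t := t) hd hθ h1 y)).add
    (tendsto_potP_sub_potD_zero (t := t) hd hθ.prim h2 y)).sub
    (tendsto_potC_one hθ.prim ht hf.lap y)
  unfold solN nrm
  simp only [zero_add]
  convert this using 2
  · ring
  · ring

end Iterated

end HalfSpaceStokes

namespace HalfSpaceStokes

/-! ### The normal derivative of the tangential velocity near the boundary -/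

section Defect

variable {d : ℕ} {f g : Bdry d → ℝ} {θ Θ : ℝ → ℝ} {t α C₀ : ℝ}

/-- Hölder continuity with exponent `(1 + α) / 2`, in the variable `v = √τ`. -/
def HalfHolder (θ : ℝ → ℝ) (α C : ℝ) : Prop :=
  ∀ t < 2, ∀ v > 0, |θ t - θ (t - v ^ 2)| ≤ C * v ^ (1 + α)

/-- The difference `θ(t) ρ(0) - θ(t - v²) ρ(v)`, where `ρ` is the half-integral of `f`. -/
noncomputable def defect (θ : ℝ → ℝ) (f : Bdry d → ℝ) (t : ℝ) (y : Bdry d) (v : ℝ) : ℝ :=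
  θ t * halfInt f 0 y - θ (t - v ^ 2) * halfInt f v y

/-- An integrable function that is `v^{α-1}` near `0` and `v^{-2}` near `∞`. -/
noncomputable def holderDom (α v : ℝ) : ℝ :=
  (Ioc 0 1).indicator (fun v => v ^ (α - 1)) v + (Ioi 1).indicator (fun v => v ^ (-2 : ℝ)) v

theorem integrable_holderDom (hα : 0 < α) : Integrable (holderDom α) := by
  refine Integrable.add ?_ ?_
  · rw [integrable_indicator_iff measurableSet_Ioc,
      ← intervalIntegrable_iff_integrableOn_Ioc_of_le zero_le_one]
    exact intervalIntegral.intervalIntegrable_rpow' (by linarith)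
  · rw [integrable_indicator_iff measurableSet_Ioi]
    exact integrableOn_Ioi_rpow_of_lt (by norm_num) one_pos

theorem holderDom_of_le {v : ℝ} (hv : 0 < v) (hv1 : v ≤ 1) : holderDom α v = v ^ (α - 1) := by
  rw [holderDom, indicator_of_mem (show v ∈ Ioc (0 : ℝ) 1 from ⟨hv, hv1⟩),
    indicator_of_notMem (by simpa using hv1), add_zero]

theorem holderDom_of_lt {v : ℝ} (hv1 : 1 < v) : holderDom α v = (v ^ 2)⁻¹ := by
  rw [holderDom, indicator_of_notMem (by simp [hv1]), indicator_of_mem (show v ∈ Ioi (1 : ℝ) from hv1),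
    zero_add, Real.rpow_neg (by linarith)]
  norm_cast

/-- This is where the Hölder exponent above `1/2` enters: after division by `v²` the increment is
`O(v^{α-1})`, integrable at zero, while boundedness gives `v^{-2}` at infinity. -/
theorem abs_diff_le_holderDom (hα1 : α < 1) {G : ℝ → ℝ} {A B : ℝ} (hA : 0 ≤ A) (hB : 0 ≤ B)
    (h1 : ∀ v, 0 < v → |G v| ≤ A * v ^ (1 + α) + A * v ^ 2) (h2 : ∀ v, 0 < v → |G v| ≤ B) {v : ℝ}
    (hv : 0 < v) : (v ^ 2)⁻¹ * |G v| ≤ (2 * A + B) * holderDom α v := by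
  rcases le_or_gt v 1 with hv1 | hv1
  · rw [holderDom_of_le hv hv1]
    have e : v ^ (1 + α) = v ^ 2 * v ^ (α - 1) := by
      rw [← Real.rpow_natCast, ← Real.rpow_add hv]; congr 1; push_cast; ring
    have e2 : 1 ≤ v ^ (α - 1) := Real.one_le_rpow_of_pos_of_le_one_of_nonpos hv hv1 (by linarith)
    rw [inv_mul_le_iff₀ (by positivity)]
    refine (h1 v hv).trans ?_
    rw [e]
    have : A * v ^ 2 * 1 ≤ A * v ^ 2 * v ^ (α - 1) := by gcongr
    have : 0 ≤ B * (v ^ 2 * v ^ (α - 1)) := by positivity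
    nlinarith
  · rw [holderDom_of_lt hv1, mul_comm]
    gcongr
    linarith [h2 v hv]

theorem defect_eq (v : ℝ) (y : Bdry d) : defect θ f t y v =
    (θ t - θ (t - v ^ 2)) * halfInt f 0 y - θ (t - v ^ 2) * (halfInt f v y - halfInt f 0 y) := by
  rw [defect]; ring

theorem abs_defect_le (hd : 1 ≤ d) (hθ : TimeProfile θ) (hα1 : α < 1) (hC₀ : 0 ≤ C₀)
    (hH : HalfHolder θ α C₀) (hf : HeatDecay (d + 1) f) : ∃ C, 0 ≤ C ∧ ∀ t < 2, ∀ y, ∀ v > 0,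
      (v ^ 2)⁻¹ * |defect θ f t y v| ≤ C * holderDom α v := by
  obtain ⟨B, hB, hb⟩ := hθ.exists_bound 2
  obtain ⟨C, hC, h⟩ := abs_halfInt_le hd hf
  obtain ⟨C', hC', h'⟩ := abs_halfInt_sub_le hd hf
  have hy : ∀ (e : ℕ) (y : Bdry d) (C : ℝ), 0 ≤ C → C / (1 + ‖y‖) ^ e ≤ C := fun e y C hC =>
    div_le_self hC (one_le_pow₀ (by linarith [norm_nonneg y]))
  refine ⟨_, ?_, fun t ht y v hv => abs_diff_le_holderDom (A := C₀ * C + B * C') (B := B * C + B * C) hα1 (by positivity)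
    (by positivity) (fun v hv => ?_) (fun v hv => ?_) hv⟩
  · positivity
  · rw [defect_eq]
    refine (abs_sub _ _).trans ?_
    rw [abs_mul, abs_mul]
    have h1 : |θ t - θ (t - v ^ 2)| * |halfInt f 0 y| ≤ C₀ * v ^ (1 + α) * C := by
      gcongr
      · exact hH t ht v hv
      · exact (h 0 y).trans (hy _ _ _ hC)
    have h2 : |θ (t - v ^ 2)| * |halfInt f v y - halfInt f 0 y| ≤ B * (C' * v ^ 2) := by
      gcongr
      · exact hb _ (by nlinarith [sq_nonneg v])
      · exact (h' v hv y).trans (hy _ _ _ (by positivity))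
    have : 0 ≤ v ^ (1 + α) := by positivity
    have h3 : 0 ≤ B * C' * v ^ (1 + α) := by positivity
    have h4 : 0 ≤ C₀ * C * v ^ 2 := by positivity
    nlinarith
  · rw [defect]
    refine (abs_sub _ _).trans ?_
    rw [abs_mul, abs_mul]
    gcongr
    · exact hb t ht.le
    · exact (h 0 y).trans (hy _ _ _ hC)
    · exact hb _ (by nlinarith [sq_nonneg v])
    · exact (h v y).trans (hy _ _ _ hC)

theorem continuous_defect (hd : 1 ≤ d) (hθ : TimeProfile θ) (hf : HeatDecay (d + 1) f) (t : ℝ)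
    (y : Bdry d) : Continuous (defect θ f t y) :=
  continuous_const.sub ((continuous_comp_sub_sq hθ t).mul (continuous_halfInt hd hf y))

theorem integrable_ker_two {x : ℝ} (hx : 0 < x) : IntegrableOn (fun v => ker 2 x v) (Ioi 0) := by
  obtain ⟨C, hC, h⟩ := abs_ker_le 2 0
  refine (((integral_div_sq hx).1).const_mul (C / x)).mono'
    ((measurable_ker 2).comp (measurable_const.prodMk measurable_id)).aestronglyMeasurable ?_
  filter_upwards [ae_volPos] with v hv
  refine (h x v hv).trans (le_of_eq ?_)
  rw [abs_of_pos hx]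
  field_simp

/-- The case of constant `h` in the integration by parts. It permits subtracting the value at `v =
0` in the singular block. -/
theorem integral_ker_two {x : ℝ} (hx : 0 < x) : ∫ v in Ioi 0, ker 2 x v = 0 := by
  have := integral_ker_harmonic (j := 0) (by omega) hx (h := fun _ => 1) (h₁ := fun _ => 0) (B := 1)
    (fun v _ => by simpa using hasDerivAt_const v (1 : ℝ)) (by simp)
    (by simpa using integrable_ker_two hx)
  simpa using this

/-- Since the kernel has mean zero, the integrand may be replaced by its increment from `v = 0`. The
Hölder bound on the increment then compensates the `v^{-2}` singularity uniformly up to the wall. -/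
theorem potD_two_eq (hd : 1 ≤ d) (hθ : TimeProfile θ) (ht : t ≤ 2) (hf : HeatDecay (d + 1) f)
    {p : Space d} (hp : p ∈ halfSpace d) :
    potD θ t 2 f p = -∫ v in Ioi 0, ker 2 p.2 v * defect θ f t p.1 v := by
  have hk := integrable_ker_two hp
  obtain ⟨B, hB, hb⟩ := hθ.exists_bound 2
  obtain ⟨C, hC, h⟩ := abs_halfInt_le hd hf
  have hc : Continuous fun v => θ (t - v ^ 2) * halfInt f v p.1 :=
    (continuous_comp_sub_sq hθ t).mul (continuous_halfInt hd hf p.1)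
  have hi : IntegrableOn (fun v => ker 2 p.2 v * (θ (t - v ^ 2) * halfInt f v p.1)) (Ioi 0) := by
    refine hk.mul_bdd (c := B * (C / (1 + ‖p.1‖) ^ d)) hc.aestronglyMeasurable (ae_of_all _ fun v => ?_)
    rw [norm_mul]
    gcongr
    · exact hb _ (by nlinarith [sq_nonneg v])
    · exact h v p.1
  simp only [defect, mul_sub]
  rw [integral_sub (hk.mul_const _) hi, integral_mul_const, integral_ker_two hp,
    potD_eq hd hθ ht hf 2 hp]
  ring

theorem abs_ker_two_le : ∃ C, 0 ≤ C ∧ ∀ x v : ℝ, 0 < v → |ker 2 x v| ≤ C * (v ^ 2)⁻¹ := by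
  obtain ⟨C, hC, h⟩ := abs_ker_le 2 0
  refine ⟨C, hC, fun x v hv => (h x v hv).trans ?_⟩
  rw [pow_zero, mul_one, zero_add, div_eq_mul_inv]
  gcongr
  linarith [abs_nonneg x]

theorem abs_potD_two_le (hd : 1 ≤ d) (hθ : TimeProfile θ) (hα : 0 < α) (hα1 : α < 1) (hC₀ : 0 ≤ C₀)
    (hH : HalfHolder θ α C₀) (hf : HeatDecay (d + 1) f) : ∃ C, ∀ t < 2, ∀ p ∈ halfSpace d,
      |potD θ t 2 f p| ≤ C := by
  obtain ⟨C, hC, h⟩ := abs_defect_le hd hθ hα1 hC₀ hH hf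
  obtain ⟨C', hC', h'⟩ := abs_ker_two_le
  refine ⟨∫ v in Ioi 0, C' * C * holderDom α v, fun t ht p hp => ?_⟩
  rw [potD_two_eq hd hθ ht.le hf hp, abs_neg, ← Real.norm_eq_abs]
  refine norm_integral_le_of_norm_le ((integrable_holderDom hα).integrableOn.const_mul _) ?_
  filter_upwards [ae_volPos] with v hv
  rw [norm_mul, Real.norm_eq_abs, Real.norm_eq_abs]
  calc |ker 2 p.2 v| * |defect θ f t p.1 v| ≤ C' * (v ^ 2)⁻¹ * |defect θ f t p.1 v| := by
        gcongr; exact h' _ _ hv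
    _ = C' * ((v ^ 2)⁻¹ * |defect θ f t p.1 v|) := by ring
    _ ≤ C' * (C * holderDom α v) := mul_le_mul_of_nonneg_left (h t ht p.1 v hv) hC'
    _ = _ := by ring

/-- The boundary value of `-∂_n` of the singular part of the tangential velocity. -/
noncomputable def wallShear (θ : ℝ → ℝ) (f : Bdry d → ℝ) (t : ℝ) (y : Bdry d) : ℝ :=
  -(1 / √Real.pi * ∫ v in Ioi 0, (v ^ 2)⁻¹ * defect θ f t y v)

/-- Dominated convergence: at `x_n = 0` the kernel equals `-π^{-1/2} v^{-2}`, and the product with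
the increment has an integrable majorant independent of `x_n`. -/
theorem tendsto_potD_two (hd : 1 ≤ d) (hθ : TimeProfile θ) (hα : 0 < α) (hα1 : α < 1) (hC₀ : 0 ≤ C₀)
    (hH : HalfHolder θ α C₀) (hf : HeatDecay (d + 1) f) (ht : t < 2) (y : Bdry d) :
    Tendsto (fun x => -potD θ t 2 f (y, x)) (𝓝[>] 0) (𝓝 (wallShear θ f t y)) := by
  obtain ⟨C, hC, h⟩ := abs_defect_le hd hθ hα1 hC₀ hH hf
  obtain ⟨C', hC', h'⟩ := abs_ker_two_le
  have key : Tendsto (fun x => ∫ v in Ioi 0, ker 2 x v * defect θ f t y v) (𝓝[>] 0)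
      (𝓝 (∫ v in Ioi 0, -(1 / √Real.pi) * ((v ^ 2)⁻¹ * defect θ f t y v))) := by
    refine tendsto_integral_filter_of_dominated_convergence (fun v => C' * C * holderDom α v)
      (Eventually.of_forall fun x => ?_) (Eventually.of_forall fun x => ?_)
      ((integrable_holderDom hα).integrableOn.const_mul _) ?_
    · exact ((measurable_ker 2).comp (measurable_const.prodMk measurable_id)).aestronglyMeasurable.mul
        (continuous_defect hd hθ hf t y).aestronglyMeasurable
    · filter_upwards [ae_volPos] with v hv
      rw [norm_mul, Real.norm_eq_abs, Real.norm_eq_abs]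
      calc |ker 2 x v| * |defect θ f t y v| ≤ C' * (v ^ 2)⁻¹ * |defect θ f t y v| := by
            gcongr; exact h' _ _ hv
        _ = C' * ((v ^ 2)⁻¹ * |defect θ f t y v|) := by ring
        _ ≤ C' * (C * holderDom α v) := mul_le_mul_of_nonneg_left (h t ht y v hv) hC'
        _ = _ := by ring
    · filter_upwards [ae_volPos] with v hv
      have h1 : Tendsto (fun x => ker 2 x v) (𝓝 0) (𝓝 (ker 2 0 v)) :=
        (hasDerivAt_ker 2 0 v).continuousAt
      have h2 := (h1.mono_left (nhdsWithin_le_nhds (s := Ioi 0))).mul_const (defect θ f t y v)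
      refine h2.trans_eq (congrArg 𝓝 ?_)
      rw [ker_two, ker_zero]
      simp
      field_simp
  refine (key.congr' ?_).trans_eq (congrArg 𝓝 ?_)
  · filter_upwards [self_mem_nhdsWithin] with x hx
    rw [potD_two_eq hd hθ ht.le hf (p := (y, x)) hx, neg_neg]
  · rw [integral_const_mul, wallShear]; ring

/-! ### The remainder of the normal derivative -/

/-- The regular part of `∂_n` of the tangential velocity. -/
noncomputable def regPart (θ : ℝ → ℝ) (f : Bdry d → ℝ) (t : ℝ) (p : Space d) : ℝ :=
  -(θ t * potA 1 f p - prim θ t * potA 1 (lap f) p)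
    - (potP θ t 0 (lap f) p - potP (prim θ) t 0 (lap (lap f)) p)
    + (potD θ t 0 (lap f) p - potD (prim θ) t 0 (lap (lap f)) p)
    + (potC θ t 1 f p - potC (prim θ) t 1 (lap f) p)

/-- The harmonic identity removes both second-order `potP` terms, and the caloric identity removes
the second-order `potD` term with the primitive profile. Only the one with `θ` itself remains
singular at the wall. -/
theorem tang_one_eq (hd : 1 ≤ d) (hθ : TimeProfile θ) (ht : t ≤ 2) (hf : HeatDecay (d + 1) f)
    {p : Space d} (hp : p ∈ halfSpace d) :
    tang θ (prim θ) t 1 f (lap f) p = -potD θ t 2 f p + regPart θ f t p := by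
  have h1 := potP_harmonic (j := 0) (by omega) (admA hd 2) hf (admA hd 0)
    (lap_heatDecay hf.toIsBump) hθ t hp
  have h2 := potP_harmonic (j := 0) (by omega) (admA hd 2) (lap_heatDecay hf.toIsBump) (admA hd 0)
    (lap_heatDecay hf.lap) hθ.prim t hp
  have h3 := potD_heat hd (j := 0) (by omega) (lap_heatDecay hf.toIsBump) hθ ht hp
  rw [tang, regPart]
  simp only [zero_add, Nat.reduceAdd] at h1 h2 h3 ⊢
  linear_combination h1 - h2 + h3

theorem unifDecay_regPart (hd : 1 ≤ d) (hθ : TimeProfile θ) (hf : IsBump f) :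
    UnifDecay fun t => regPart θ f t :=
  have h1 := lap_heatDecay hf
  have h2 := lap_heatDecay hf.lap
  (((((potBound_pos_one hf.heatDecay).unifDecay_mul hθ).sub
    ((potBound_pos_one hf.lap.heatDecay).unifDecay_mul hθ.prim)).neg.sub
    ((unifDecay_potP_zero hd hθ h1).sub (unifDecay_potP_zero hd hθ.prim h2))).add
    ((unifDecay_potD_zero hd hθ h1).sub (unifDecay_potD_zero hd hθ.prim h2))).add
    ((unifDecay_potC_one hθ hf).sub (unifDecay_potC_one hθ.prim hf.lap))

theorem exists_bound_tang_one (hd : 1 ≤ d) (hθ : TimeProfile θ) (hα : 0 < α) (hα1 : α < 1) (hC₀ : 0 ≤ C₀)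
    (hH : HalfHolder θ α C₀) (hf : HeatDecay (d + 1) f) : ∃ C, ∀ t < 2, ∀ p ∈ halfSpace d,
      |tang θ (prim θ) t 1 f (lap f) p| ≤ C := by
  obtain ⟨C, h⟩ := abs_potD_two_le hd hθ hα hα1 hC₀ hH hf
  obtain ⟨C', hC', h'⟩ := unifDecay_regPart hd hθ hf.toIsBump
  refine ⟨C + C', fun t ht p hp => ?_⟩
  rw [tang_one_eq hd hθ ht.le hf hp]
  refine (abs_add_le _ _).trans (add_le_add ?_ ((h' t ht.le p hp).trans ?_))
  · rw [abs_neg]; exact h t ht p hp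
  · exact div_le_self hC' (one_le_pow₀ (by linarith [norm_nonneg p]))

end Defect

end HalfSpaceStokes

namespace HalfSpaceStokes

/-! ### Vector fields by components -/

section Components

variable {d : ℕ}

theorem norm_le_sum_coord (z : Space d) : ‖z‖ ≤ ∑ i, |z.1 i| + |z.2| := by
  have h0 : 0 ≤ ∑ i, |z.1 i| := Finset.sum_nonneg fun _ _ => abs_nonneg _
  rw [Prod.norm_def]
  refine max_le ?_ ?_
  · have hv : z.1 = ∑ i, z.1 i • (EuclideanSpace.single i 1 : Bdry d) := by
      ext j; simp [Pi.single_apply]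
    have : ‖z.1‖ ≤ ∑ i, |z.1 i| := by
      conv_lhs => rw [hv]
      refine (norm_sum_le _ _).trans (Finset.sum_le_sum fun i _ => ?_)
      rw [norm_smul]; simp
    linarith [abs_nonneg z.2]
  · rw [Real.norm_eq_abs]; linarith

/-- The coordinate functional `u ↦ u_i`. -/
noncomputable def coordT (i : Fin d) : Space d →L[ℝ] ℝ :=
  (EuclideanSpace.proj i : Bdry d →L[ℝ] ℝ).comp (ContinuousLinearMap.fst ℝ (Bdry d) ℝ)

/-- The coordinate functional `u ↦ u_n`. -/
noncomputable def coordN (d : ℕ) : Space d →L[ℝ] ℝ := ContinuousLinearMap.snd ℝ (Bdry d) ℝ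

theorem coordT_apply (i : Fin d) (z : Space d) : coordT i z = z.1 i := rfl

theorem coordN_apply (z : Space d) : coordN d z = z.2 := rfl

theorem space_ext {z z' : Space d} (h1 : ∀ i, z.1 i = z'.1 i) (h2 : z.2 = z'.2) : z = z' :=
  Prod.ext (PiLp.ext h1) h2

theorem fderiv_comp_coord {u : Space d → Space d} {p : Space d} (hu : DifferentiableAt ℝ u p)
    (L : Space d →L[ℝ] ℝ) (v : Space d) : L (fderiv ℝ u p v) = fderiv ℝ (fun x => L (u x)) p v := by
  have := (L.hasFDerivAt.comp p hu.hasFDerivAt).fderiv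
  change fderiv ℝ (fun x => L (u x)) p = _ at this
  rw [this]; rfl

theorem divergence_eq {u : Space d → Space d} {p : Space d} (hu : DifferentiableAt ℝ u p) :
    divergence u p = (∑ i, fderiv ℝ (fun x => (u x).1 i) p (tangent i)) +
      fderiv ℝ (fun x => (u x).2) p (normal d) := by
  rw [divergence]
  congr 1
  · exact Finset.sum_congr rfl fun i _ => fderiv_comp_coord hu (coordT i) _
  · exact fderiv_comp_coord hu (coordN d) _

theorem coord_vectorLaplacian {u : Space d → Space d} {p : Space d} (hu : ContDiffAt ℝ 2 u p)
    (L : Space d →L[ℝ] ℝ) : L (vectorLaplacian u p) = slap (fun x => L (u x)) p := by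
  have h := L.iteratedFDeriv_comp_left hu (i := 2) le_rfl
  change iteratedFDeriv ℝ 2 (fun x => L (u x)) p = _ at h
  rw [vectorLaplacian, slap, h, map_add, map_sum]
  rfl

theorem contDiffOn_space {n : WithTop ℕ∞} {u : Space d → Space d} {S : Set (Space d)}
    (h1 : ∀ i, ContDiffOn ℝ n (fun x => (u x).1 i) S) (h2 : ContDiffOn ℝ n (fun x => (u x).2) S) :
    ContDiffOn ℝ n u S :=
  ContDiffOn.prodMk (contDiffOn_euclidean.2 h1) h2

theorem differentiableAt_space {u : Space d → Space d} {p : Space d}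
    (h1 : ∀ i, DifferentiableAt ℝ (fun x => (u x).1 i) p)
    (h2 : DifferentiableAt ℝ (fun x => (u x).2) p) : DifferentiableAt ℝ u p :=
  DifferentiableAt.prodMk (differentiableAt_euclidean.2 h1) h2

theorem HasGrad.lipschitz {F : Space d → ℝ} {a : Fin d → Space d → ℝ} {b : Space d → ℝ}
    (h : HasGrad F a b) {K : Fin d → ℝ} {K' : ℝ} (ha : ∀ i, ∀ p ∈ halfSpace d, |a i p| ≤ K i)
    (hb : ∀ p ∈ halfSpace d, |b p| ≤ K') {p q : Space d} (hp : p ∈ halfSpace d)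
    (hq : q ∈ halfSpace d) : |F p - F q| ≤ (∑ i, K i + K') * ‖p - q‖ := by
  have hconv : Convex ℝ (halfSpace d) :=
    convex_halfSpace_gt (LinearMap.snd ℝ (Bdry d) ℝ).isLinear 0
  refine Convex.norm_image_sub_le_of_norm_hasFDerivWithin_le
    (fun x hx => (h x hx).hasFDerivWithinAt) (fun x hx => ?_) hconv hq hp
  exact (norm_gradL_le _ _).trans (add_le_add (Finset.sum_le_sum fun i _ => ha i x hx) (hb x hx))

theorem tendsto_shift {V : Space d → Space d} {K : ℝ}
    (h : ∀ p ∈ halfSpace d, ∀ q ∈ halfSpace d, ‖V p - V q‖ ≤ K * ‖p - q‖)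
    (hlim : ∀ y, Tendsto (fun x => V (y, x)) (𝓝[>] 0) (𝓝 (V (y, 0)))) {p : Space d}
    (hp : p ∈ closedHalfSpace d) :
    Tendsto (fun x => V (p.1, p.2 + x)) (𝓝[>] 0) (𝓝 (V p)) := by
  have hp : 0 ≤ p.2 := hp
  rcases hp.eq_or_lt with h0 | h0
  · have e : p = (p.1, 0) := Prod.ext rfl h0.symm
    simp only [← h0, zero_add]
    rw [e]
    exact hlim p.1
  · rw [tendsto_iff_norm_sub_tendsto_zero]
    have h1 : Tendsto (fun x : ℝ => K * ‖((p.1, p.2 + x) : Space d) - p‖) (𝓝[>] 0) (𝓝 0) := by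
      have : Continuous fun x : ℝ => K * ‖((p.1, p.2 + x) : Space d) - p‖ := by fun_prop
      have := this.tendsto 0
      simp only [add_zero, Prod.mk.eta, sub_self, norm_zero, mul_zero] at this
      exact this.mono_left nhdsWithin_le_nhds
    refine squeeze_zero' (Eventually.of_forall fun _ => norm_nonneg _) ?_ h1
    filter_upwards [self_mem_nhdsWithin] with x hx
    exact h _ (show 0 < p.2 + x from add_pos h0 hx) _ h0

/-- Both points are lifted by the same small height, which does not change their difference; the
estimate in the open half-space then passes to the limit. -/
theorem lipschitz_closed {V : Space d → Space d} {K : ℝ}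
    (h : ∀ p ∈ halfSpace d, ∀ q ∈ halfSpace d, ‖V p - V q‖ ≤ K * ‖p - q‖)
    (hlim : ∀ y, Tendsto (fun x => V (y, x)) (𝓝[>] 0) (𝓝 (V (y, 0)))) {p q : Space d}
    (hp : p ∈ closedHalfSpace d) (hq : q ∈ closedHalfSpace d) :
    ‖V p - V q‖ ≤ K * ‖p - q‖ := by
  have hp' : 0 ≤ p.2 := hp
  have hq' : 0 ≤ q.2 := hq
  refine le_of_tendsto ((tendsto_shift h hlim hp).sub (tendsto_shift h hlim hq)).norm ?_
  filter_upwards [self_mem_nhdsWithin] with x hx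
  have hx : 0 < x := hx
  have e : ((p.1, p.2 + x) : Space d) - (q.1, q.2 + x) = p - q := by ext <;> simp
  rw [← e]
  exact h _ (show 0 < p.2 + x by linarith) _ (show 0 < q.2 + x by linarith)

end Components

/-! ### The temporal profile -/

/-- Data extracted from the temporal profile `φ`: a continuous extension `θ` to all times. -/
theorem IsTemporalProfile.exists_extension {φ : ℝ → ℝ} (hφ : IsTemporalProfile φ) :
    ∃ θ : ℝ → ℝ, TimeProfile θ ∧ (∀ t < 2, θ t = φ t) ∧
      ∃ α C : ℝ, 0 < α ∧ α < 1 ∧ 0 ≤ C ∧ HalfHolder θ α C := by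
  obtain ⟨α, hα, hα1, C, hC⟩ := hφ.holder
  have hr : 0 < 1 / 2 + α / 2 := by linarith
  have hC0 : 0 ≤ C := by
    have := (abs_nonneg _).trans (hC 0 (by norm_num) 1 (by norm_num))
    simpa using this
  have hH : ∀ s t, s < 2 → t < 2 → s ≤ t → |φ t - φ s| ≤ C * (t - s) ^ (1 / 2 + α / 2) := by
    intro s t hs ht hst
    rcases lt_or_ge t 0 with ht0 | ht0
    · rw [hφ.eq_zero_of_neg t ht0, hφ.eq_zero_of_neg s (by linarith), sub_zero, abs_zero]
      have : 0 ≤ t - s := by linarith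
      positivity
    rcases lt_or_ge s 0 with hs0 | hs0
    · have h1 := hC t ⟨ht0, ht⟩ 0 (by norm_num)
      rw [hφ.zero, sub_zero, sub_zero, abs_of_nonneg ht0] at h1
      rw [hφ.eq_zero_of_neg s hs0, sub_zero]
      refine h1.trans ?_
      gcongr
      linarith
    · have h1 := hC t ⟨ht0, ht⟩ s ⟨hs0, hs⟩
      rwa [abs_of_nonneg (sub_nonneg.2 hst)] at h1
  have hcont : ∀ t < 2, ContinuousAt φ t := by
    intro t ht
    rw [ContinuousAt, tendsto_iff_norm_sub_tendsto_zero]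
    have h1 : Tendsto (fun s => C * |s - t| ^ (1 / 2 + α / 2)) (𝓝 t) (𝓝 0) := by
      have : Continuous fun s : ℝ => C * |s - t| ^ (1 / 2 + α / 2) :=
        continuous_const.mul (((continuous_id.sub continuous_const).abs).rpow_const
          fun _ => Or.inr hr.le)
      have h2 := this.tendsto t
      simp only [sub_self, abs_zero, Real.zero_rpow hr.ne', mul_zero] at h2
      exact h2
    refine squeeze_zero' (Eventually.of_forall fun _ => norm_nonneg _) ?_ h1
    filter_upwards [Iio_mem_nhds ht] with s hs
    rcases le_total s t with h | h
    · rw [norm_sub_rev, abs_sub_comm, abs_of_nonneg (sub_nonneg.2 h)]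
      exact hH s t hs ht h
    · rw [abs_of_nonneg (sub_nonneg.2 h)]
      exact hH t s ht hs h
  have hbdd : BddBelow (φ '' Ioo 1 2) := by
    refine ⟨-(C * 2 ^ (1 / 2 + α / 2)), ?_⟩
    rintro _ ⟨s, hs, rfl⟩
    have h1 := hH 0 s (by norm_num) hs.2 (by linarith [hs.1])
    rw [hφ.zero, sub_zero, sub_zero] at h1
    have h2 : C * s ^ (1 / 2 + α / 2) ≤ C * 2 ^ (1 / 2 + α / 2) := by
      have := hs.1
      have := hs.2
      gcongr
    linarith [neg_le_of_abs_le h1]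
  -- The extension beyond time 2 is the constant left limit, which exists because `φ` is monotone
  -- and bounded on `(1, 2)`. Its only purpose is global continuity.
  have hL := hφ.antitoneOn.tendsto_nhdsWithin_Ioo_left (by simp) hbdd
  set L := sInf (φ '' Ioo 1 2) with hLdef
  refine ⟨fun t => if t < 2 then φ t else L, ⟨?_, ?_⟩, fun t ht => if_pos ht, α, C, hα, hα1, hC0, ?_⟩
  · refine continuous_iff_continuousAt.2 fun t => ?_
    rcases lt_trichotomy t 2 with ht | rfl | ht
    · refine (hcont t ht).congr ?_
      filter_upwards [Iio_mem_nhds ht] with s hs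
      exact (if_pos hs).symm
    · rw [ContinuousAt, if_neg (lt_irrefl _), ← nhdsLT_sup_nhdsGE]
      refine Tendsto.sup ?_ ?_
      · refine hL.congr' ?_
        filter_upwards [self_mem_nhdsWithin] with s hs
        exact (if_pos hs).symm
      · refine tendsto_const_nhds.congr' ?_
        filter_upwards [self_mem_nhdsWithin] with s hs
        exact (if_neg (not_lt.2 hs)).symm
    · refine continuousAt_const (y := L) |>.congr ?_
      filter_upwards [Ioi_mem_nhds ht] with s hs
      exact (if_neg (not_lt.2 (le_of_lt hs))).symm
  · intro s hs
    rw [if_pos (by linarith)]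
    rcases hs.eq_or_lt with rfl | h
    · exact hφ.zero
    · exact hφ.eq_zero_of_neg s h
  · intro t ht v hv
    have h1 : t - v ^ 2 < 2 := by nlinarith
    simp only [if_pos ht, if_pos h1]
    refine (hH _ t h1 ht (by nlinarith)).trans (le_of_eq ?_)
    rw [sub_sub_cancel, ← Real.rpow_natCast, ← Real.rpow_mul hv.le]
    congr 2
    push_cast
    ring

/-! ### Existence -/

section Existence

variable {d : ℕ} {θ : ℝ → ℝ} {f : Bdry d → ℝ} {α C₀ : ℝ}

/-- The velocity field in the open half-space. -/
noncomputable def velIn (a : ℝ) (θ : ℝ → ℝ) (f : Bdry d → ℝ) (t : ℝ) (p : Space d) : Space d :=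
  (WithLp.toLp 2 fun i => a * solT θ f i t p, a * solN θ f t p)

/-- The velocity field, extended by its boundary values. -/
noncomputable def vel (a : ℝ) (θ : ℝ → ℝ) (f : Bdry d → ℝ) (t : ℝ) (p : Space d) : Space d :=
  if 0 < p.2 then velIn a θ f t p else (a * f p.1 * θ t) • normal d

theorem vel_of_mem {a t : ℝ} {p : Space d} (hp : p ∈ halfSpace d) :
    vel a θ f t p = velIn a θ f t p := if_pos hp

theorem vel_boundary {a t : ℝ} (y : Bdry d) : vel a θ f t (y, 0) = (a * f y * θ t) • normal d :=
  if_neg (lt_irrefl _)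

theorem vel_eventuallyEq {a t : ℝ} {p : Space d} (hp : p ∈ halfSpace d) :
    vel a θ f t =ᶠ[𝓝 p] velIn a θ f t :=
  eventually_of_mem (isOpen_halfSpace.mem_nhds hp) fun _ h => vel_of_mem h

theorem hasGrad_solT (hd : 1 ≤ d) (hθ : TimeProfile θ) (hf : IsBump f) (i : Fin d) (t : ℝ) :
    HasGrad (solT θ f i t) (fun j => tang θ (prim θ) t 0 (pd j (pd i f)) (pd j (pd i (lap f))))
      (tang θ (prim θ) t 1 (pd i f) (pd i (lap f))) :=
  hasGrad_tang hd hθ hθ.prim (hf.heatDecay_pd i) (hf.lap.heatDecay_pd i) 0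

theorem hasGrad_solN (hd : 1 ≤ d) (hθ : TimeProfile θ) (hf : IsBump f) (t : ℝ) :
    HasGrad (solN θ f t) (fun j => nrm θ (prim θ) t 0 (pd j f) (pd j (lap f)) (pd j (lap (lap f))))
      (nrm θ (prim θ) t 1 f (lap f) (lap (lap f))) :=
  hasGrad_nrm hd hθ hθ.prim hf (lap_heatDecay hf) (lap_heatDecay hf.lap) 0

theorem UnifDecay.exists_bound {V : ℝ → Space d → ℝ} (h : UnifDecay V) :
    ∃ C, ∀ t ≤ 2, ∀ p ∈ halfSpace d, |V t p| ≤ C := by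
  obtain ⟨C, hC, h⟩ := h
  exact ⟨C, fun t ht p hp => (h t ht p hp).trans
    (div_le_self hC (one_le_pow₀ (by linarith [norm_nonneg p])))⟩

theorem solT_lipschitz (hd : 1 ≤ d) (hθ : TimeProfile θ) (hα : 0 < α) (hα1 : α < 1) (hC₀ : 0 ≤ C₀)
    (hH : HalfHolder θ α C₀) (hf : IsBump f) (i : Fin d) : ∃ K, ∀ t < 2, ∀ p ∈ halfSpace d,
      ∀ q ∈ halfSpace d, |solT θ f i t p - solT θ f i t q| ≤ K * ‖p - q‖ := by
  choose K hK using fun j => (unifDecay_tang hd hθ hθ.prim ((hf.pd i).heatDecay_pd j)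
    ((hf.lap.pd i).heatDecay_pd j)).exists_bound
  obtain ⟨K', hK'⟩ := exists_bound_tang_one hd hθ hα hα1 hC₀ hH (hf.heatDecay_pd i)
  refine ⟨∑ j, K j + K', fun t ht p hp q hq => (hasGrad_solT hd hθ hf i t).lipschitz
    (fun j p hp => hK j t ht.le p hp) (fun p hp => ?_) hp hq⟩
  rw [pd_lap i hf]
  exact hK' t ht p hp

/-- The normal derivative is read off from the divergence-free condition: it is minus a bounded
tangential block, so neither the Hölder condition nor the singular kernel is involved. -/
theorem solN_lipschitz (hd : 1 ≤ d) (hθ : TimeProfile θ) (hf : IsBump f) :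
    ∃ K, ∀ t < 2, ∀ p ∈ halfSpace d, ∀ q ∈ halfSpace d,
      |solN θ f t p - solN θ f t q| ≤ K * ‖p - q‖ := by
  choose K hK using fun j => (unifDecay_nrm hd hθ hθ.prim (hf.pd j) (hf.lap.heatDecay_pd j)
    (hf.lap.lap.heatDecay_pd j)).exists_bound
  obtain ⟨K', hK'⟩ := (unifDecay_tang hd hθ hθ.prim (lap_heatDecay hf)
    (lap_heatDecay hf.lap)).exists_bound
  refine ⟨∑ j, K j + K', fun t ht p hp q hq => (hasGrad_solN hd hθ hf t).lipschitz
    (fun j p hp => hK j t ht.le p hp) (fun p hp => ?_) hp hq⟩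
  rw [eq_neg_of_add_eq_zero_right (tang_add_nrm hd hθ ht.le hf hp), abs_neg]
  exact hK' t ht.le p hp

theorem velIn_lipschitz (hd : 1 ≤ d) (hθ : TimeProfile θ) (hα : 0 < α) (hα1 : α < 1) (hC₀ : 0 ≤ C₀)
    (hH : HalfHolder θ α C₀) (hf : IsBump f) (a : ℝ) : ∃ K, 0 ≤ K ∧ ∀ t < 2, ∀ p ∈ halfSpace d,
      ∀ q ∈ halfSpace d, ‖vel a θ f t p - vel a θ f t q‖ ≤ K * ‖p - q‖ := by
  choose K hK using solT_lipschitz hd hθ hα hα1 hC₀ hH hf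
  obtain ⟨K', hK'⟩ := solN_lipschitz hd hθ hf
  refine ⟨|∑ i, |a| * K i + |a| * K'|, abs_nonneg _, fun t ht p hp q hq => ?_⟩
  rw [vel_of_mem hp, vel_of_mem hq]
  refine (norm_le_sum_coord _).trans ?_
  have h1 : ∀ i, |(velIn a θ f t p - velIn a θ f t q).1 i| ≤ |a| * K i * ‖p - q‖ := by
    intro i
    have : (velIn a θ f t p - velIn a θ f t q).1 i = a * (solT θ f i t p - solT θ f i t q) := by
      simp [velIn, mul_sub]
    rw [this, abs_mul, mul_assoc]
    exact mul_le_mul_of_nonneg_left (hK i t ht p hp q hq) (abs_nonneg a)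
  have h2 : |(velIn a θ f t p - velIn a θ f t q).2| ≤ |a| * K' * ‖p - q‖ := by
    have : (velIn a θ f t p - velIn a θ f t q).2 = a * (solN θ f t p - solN θ f t q) := by
      simp [velIn, mul_sub]
    rw [this, abs_mul, mul_assoc]
    exact mul_le_mul_of_nonneg_left (hK' t ht p hp q hq) (abs_nonneg a)
  refine (add_le_add (Finset.sum_le_sum fun i _ => h1 i) h2).trans ?_
  rw [← Finset.sum_mul, ← add_mul]
  gcongr
  exact le_abs_self _

theorem tendsto_vel (hd : 1 ≤ d) (hθ : TimeProfile θ) (hf : IsBump f) (a : ℝ) {t : ℝ} (ht : t ≤ 2)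
    (y : Bdry d) : Tendsto (fun x => vel a θ f t (y, x)) (𝓝[>] 0) (𝓝 (vel a θ f t (y, 0))) := by
  have h : Tendsto (fun x => velIn a θ f t (y, x)) (𝓝[>] 0) (𝓝 (vel a θ f t (y, 0))) := by
    have e : vel a θ f t (y, 0) = (WithLp.toLp 2 fun _ => a * 0, a * (θ t * f y)) := by
      rw [vel_boundary]
      refine space_ext (fun i => by simp [normal]) ?_
      simp [normal]; ring
    rw [e]
    refine Tendsto.prodMk_nhds ?_ ((tendsto_solN hd hθ ht hf y).const_mul a)
    refine ((PiLp.continuous_toLp 2 _).tendsto _).comp (tendsto_pi_nhds.2 fun i => ?_)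
    exact (tendsto_tang hd hθ hθ.prim ht (hf.heatDecay_pd i) (hf.lap.heatDecay_pd i) y).const_mul a
  refine h.congr' ?_
  filter_upwards [self_mem_nhdsWithin] with x hx
  exact (vel_of_mem (p := (y, x)) hx).symm

theorem vel_decay (hd : 1 ≤ d) (hθ : TimeProfile θ) (hf : IsBump f) (a : ℝ) :
    ∃ C, ∀ t ≤ 2, ∀ p ∈ halfSpace d, ‖vel a θ f t p‖ ≤ C / (1 + ‖p‖) ^ d := by
  choose C hC hT using fun i => unifDecay_tang hd hθ hθ.prim (hf.heatDecay_pd i)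
    (hf.lap.heatDecay_pd i)
  obtain ⟨C', hC', hN⟩ := unifDecay_nrm hd hθ hθ.prim hf (lap_heatDecay hf) (lap_heatDecay hf.lap)
  refine ⟨∑ i, |a| * C i + |a| * C', fun t ht p hp => ?_⟩
  rw [vel_of_mem hp, add_div, Finset.sum_div]
  refine (norm_le_sum_coord _).trans (add_le_add (Finset.sum_le_sum fun i _ => ?_) ?_)
  · have : (velIn a θ f t p).1 i = a * solT θ f i t p := rfl
    rw [this, abs_mul, mul_div_assoc]
    exact mul_le_mul_of_nonneg_left (hT i t ht p hp) (abs_nonneg a)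
  · have : (velIn a θ f t p).2 = a * solN θ f t p := rfl
    rw [this, abs_mul, mul_div_assoc]
    exact mul_le_mul_of_nonneg_left (hN t ht p hp) (abs_nonneg a)

/-- The construction is linear in the profile and commutes with time integration, so the time
primitive of the velocity is the same field with `θ` replaced by its primitive. This makes it twice
differentiable in space and its Laplacian computable. -/
theorem timePrimitive_vel (hd : 1 ≤ d) (hθ : TimeProfile θ) (hf : IsBump f) (a t : ℝ)
    {p : Space d} (hp : p ∈ halfSpace d) :
    timePrimitive (vel a θ f) t p = velIn a (prim θ) f t p := by
  have hder : ∀ s, HasDerivAt (fun s => velIn a (prim θ) f s p) (velIn a θ f s p) s := by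
    intro s
    refine HasDerivAt.prodMk ?_ ((hasDerivAt_solN hd hθ hf hp s).const_mul a)
    have h1 : HasDerivAt (fun s => fun i => a * solT (prim θ) f i s p)
        (fun i => a * solT θ f i s p) s :=
      hasDerivAt_pi.2 fun i => (hasDerivAt_solT hd hθ hf i hp s).const_mul a
    exact ((PiLp.continuousLinearEquiv 2 ℝ (fun _ : Fin d => ℝ)).symm.hasFDerivAt).comp_hasDerivAt s h1
  have hcont : Continuous fun s => velIn a θ f s p := by
    refine Continuous.prodMk ?_ (continuous_const.mul (continuous_solN hd hθ hf hp))
    exact (PiLp.continuous_toLp 2 _).comp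
      (continuous_pi fun i => continuous_const.mul (continuous_solT hd hθ hf i hp))
  have h0 : velIn a (prim θ) f 0 p = 0 := by
    have hz := hθ.prim.eq_zero
    refine space_ext (fun i => ?_) ?_
    · change a * solT (prim θ) f i 0 p = 0
      rw [solT_eq_zero hθ.prim hz, mul_zero]
    · change a * solN (prim θ) f 0 p = 0
      rw [solN_eq_zero hθ.prim hz, mul_zero]
  rw [timePrimitive]
  simp only [vel_of_mem hp]
  rw [intervalIntegral.integral_eq_sub_of_hasDerivAt (fun s _ => hder s)
    (hcont.intervalIntegrable _ _), h0, sub_zero]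

theorem isStokesSolution_vel (hd : 1 ≤ d) (hθ : TimeProfile θ) (hα : 0 < α) (hα1 : α < 1)
    (hC₀ : 0 ≤ C₀) (hH : HalfHolder θ α C₀) (hf : IsBump f) (a : ℝ) {g : ℝ → Bdry d → Space d}
    (hg : ∀ t ∈ Ico (0 : ℝ) 2, ∀ y, g t y = (a * f y * θ t) • normal d) :
    IsStokesSolution 2 g (vel a θ f) := by
  obtain ⟨K, hK0, hK⟩ := velIn_lipschitz hd hθ hα hα1 hC₀ hH hf a
  have hlip : ∀ t < 2, LipschitzOnWith ⟨K, hK0⟩ (vel a θ f t) (closedHalfSpace d) := by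
    intro t ht
    refine LipschitzOnWith.of_dist_le_mul fun p hp q hq => ?_
    rw [dist_eq_norm, dist_eq_norm]
    exact lipschitz_closed (hK t ht) (fun y => tendsto_vel hd hθ hf a ht.le y) hp hq
  have hprim : ∀ t, EqOn (timePrimitive (vel a θ f) t) (velIn a (prim θ) f t) (halfSpace d) :=
    fun t p hp => timePrimitive_vel hd hθ hf a t hp
  have hC2 : ∀ t ≤ 2, ContDiffOn ℝ 2 (velIn a (prim θ) f t) (halfSpace d) := fun t ht =>
    contDiffOn_space (fun i => contDiffOn_const.mul (hasLap_solT hd hθ ht hf i).contDiffOn)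
      (contDiffOn_const.mul (hasLap_solN hd hθ ht hf).contDiffOn)
  have hdiff : ∀ t, ∀ p ∈ halfSpace d, DifferentiableAt ℝ (velIn a θ f t) p := fun t p hp =>
    differentiableAt_space
      (fun i => ((hasGrad_solT hd hθ hf i t p hp).differentiableAt.const_mul a))
      ((hasGrad_solN hd hθ hf t p hp).differentiableAt.const_mul a)
  refine
    { continuousOn := ?_
      lipschitzOn := ⟨⟨K, hK0⟩, fun t ht => hlip t ht.2⟩
      differentiableOn := ?_
      contDiffOn_timePrimitive := fun t ht => (hC2 t ht.2.le).congr (hprim t)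
      momentum := ?_
      div_eq_zero := ?_
      initial := ?_
      boundary := fun t ht y => by rw [vel_boundary, hg t ht]
      decay := ?_ }
  -- Joint continuity follows from continuity in time at each fixed point and the spatial Lipschitz
  -- bound, uniform in time.
  · refine continuousOn_prod_of_continuousOn_lipschitzOnWith' (fun z => vel a θ f z.1 z.2) ⟨K, hK0⟩
      (fun t ht => hlip t ht.2) (fun p hp => Continuous.continuousOn ?_)
    have hp : 0 ≤ p.2 := hp
    rcases hp.eq_or_lt with h0 | h0
    · have e : p = (p.1, 0) := Prod.ext rfl h0.symm
      have := hθ.continuous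
      rw [e]
      simp only [vel_boundary]
      fun_prop
    · simp only [vel_of_mem (p := p) h0]
      refine Continuous.prodMk ?_ (continuous_const.mul (continuous_solN hd hθ hf h0))
      exact (PiLp.continuous_toLp 2 _).comp
        (continuous_pi fun i => continuous_const.mul (continuous_solT hd hθ hf i h0))
  · intro t _ p hp
    exact ((hdiff t p hp).congr_of_eventuallyEq (vel_eventuallyEq hp)).differentiableWithinAt
  · have hgr : ∀ t ≤ 2, ∀ p ∈ halfSpace d, DifferentiableAt ℝ (prs θ f t) p := fun t ht p hp =>
      (hasGrad_prs hd hθ hf p hp).differentiableAt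
    refine ⟨fun t p => a * prs θ f t p, fun t _ => contDiffOn_const.mul (contDiffOn_prs hd hθ hf), ?_, ?_⟩
    · obtain ⟨h1, C', hC', h2⟩ := unifDecay_prs hd hθ hf
      choose C hC h1 using h1
      refine ⟨∑ i, |a| * C i + |a| * C', fun t ht p hp => ?_⟩
      rw [add_div, Finset.sum_div]
      have e : fderiv ℝ (fun p => a * prs θ f t p) p = a • fderiv ℝ (prs θ f t) p :=
        fderiv_const_mul (hgr t ht.2.le p hp) a
      refine (norm_le_sum_coord _).trans (add_le_add (Finset.sum_le_sum fun i _ => ?_) ?_)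
      · simp only [grad, e, smul_apply, smul_eq_mul]
        rw [abs_mul, mul_div_assoc]
        exact mul_le_mul_of_nonneg_left (h1 i t ht.2.le p hp) (abs_nonneg a)
      · simp only [grad, e, smul_apply, smul_eq_mul]
        rw [abs_mul, mul_div_assoc]
        exact mul_le_mul_of_nonneg_left (h2 t ht.2.le p hp) (abs_nonneg a)
    · intro t ht p hp
      have e : fderiv ℝ (fun p => a * prs θ f t p) p = a • fderiv ℝ (prs θ f t) p :=
        fderiv_const_mul (hgr t ht.2.le p hp) a
      have hC := (hC2 t ht.2.le).contDiffAt (isOpen_halfSpace.mem_nhds hp)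
      have hev : timePrimitive (vel a θ f) t =ᶠ[𝓝 p] velIn a (prim θ) f t :=
        eventually_of_mem (isOpen_halfSpace.mem_nhds hp) (hprim t)
      have hC' := hC.congr_of_eventuallyEq hev
      have hsl : ∀ L : Space d →L[ℝ] ℝ, L (vectorLaplacian (timePrimitive (vel a θ f) t) p) =
          slap (fun x => L (velIn a (prim θ) f t x)) p := by
        intro L
        rw [coord_vectorLaplacian hC']
        have : (fun x => L (timePrimitive (vel a θ f) t x)) =ᶠ[𝓝 p]
            fun x => L (velIn a (prim θ) f t x) := hev.fun_comp L
        rw [slap, slap, (this.iteratedFDeriv ℝ 2).eq_of_nhds]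
      rw [vel_of_mem hp]
      refine space_ext (fun i => ?_) ?_
      · have h1 := hsl (coordT i)
        have h2 := ((hasLap_solT hd hθ ht.2.le hf i).const_mul a).slap_eq p hp
        have h3 := (hasLap_solT hd hθ ht.2.le hf i).slap_eq p hp
        have h4 := momentum_tangential hd hθ ht.2.le hf i hp
        change _ = slap (fun p => a * solT (prim θ) f i t p) p at h1
        rw [h2, ← h3] at h1
        change a * solT θ f i t p - coordT i (vectorLaplacian (timePrimitive (vel a θ f) t) p)
          + fderiv ℝ (fun p => a * prs θ f t p) p (tangent i) = 0
        rw [h1, e, smul_apply, smul_eq_mul]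
        linear_combination a * h4
      · have h1 := hsl (coordN d)
        have h2 := ((hasLap_solN hd hθ ht.2.le hf).const_mul a).slap_eq p hp
        have h3 := (hasLap_solN hd hθ ht.2.le hf).slap_eq p hp
        have h4 := momentum_normal hd hθ ht.2.le hf hp
        change _ = slap (fun p => a * solN (prim θ) f t p) p at h1
        rw [h2, ← h3] at h1
        change a * solN θ f t p - coordN d (vectorLaplacian (timePrimitive (vel a θ f) t) p)
          + fderiv ℝ (fun p => a * prs θ f t p) p (normal d) = 0
        rw [h1, e, smul_apply, smul_eq_mul]
        linear_combination a * h4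
  · intro t ht p hp
    have hev := vel_eventuallyEq (θ := θ) (f := f) (a := a) (t := t) hp
    have : divergence (vel a θ f t) p = divergence (velIn a θ f t) p := by
      rw [divergence, divergence, hev.fderiv_eq]
    rw [this, divergence_eq (hdiff t p hp)]
    have e1 : ∀ i, fderiv ℝ (fun x => (velIn a θ f t x).1 i) p (tangent i) =
        a * tang θ (prim θ) t 0 (pd i (pd i f)) (pd i (pd i (lap f))) p := by
      intro i
      change fderiv ℝ (fun x => a * solT θ f i t x) p (tangent i) = _
      rw [((hasGrad_solT hd hθ hf i t).const_mul a p hp).fderiv, gradL_tangent]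
    have e2 : fderiv ℝ (fun x => (velIn a θ f t x).2) p (normal d) =
        a * nrm θ (prim θ) t 1 f (lap f) (lap (lap f)) p := by
      change fderiv ℝ (fun x => a * solN θ f t x) p (normal d) = _
      rw [((hasGrad_solN hd hθ hf t).const_mul a p hp).fderiv, gradL_normal]
    simp only [e1, e2]
    rw [← Finset.mul_sum, sum_tang hd hθ hθ.prim 0 hf hf.lap hp, ← mul_add,
      tang_add_nrm hd hθ ht.2.le hf hp, mul_zero]
  · intro p hp
    have hp : 0 ≤ p.2 := hp
    rcases hp.eq_or_lt with h0 | h0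
    · have e : p = (p.1, 0) := Prod.ext rfl h0.symm
      rw [e, vel_boundary, hθ.eq_zero 0 le_rfl]
      simp
    · rw [vel_of_mem h0]
      refine space_ext (fun i => ?_) ?_
      · change a * solT θ f i 0 p = 0
        rw [solT_eq_zero hθ hθ.eq_zero, mul_zero]
      · change a * solN θ f 0 p = 0
        rw [solN_eq_zero hθ hθ.eq_zero, mul_zero]
  -- The decay estimate is known in the open half-space; vertical limits carry it to the wall.
  · obtain ⟨C, hC⟩ := vel_decay hd hθ hf a
    refine ⟨C, fun t ht p hp => ?_⟩
    have hp' : 0 ≤ p.2 := hp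
    have h1 := (tendsto_shift (hK t ht.2) (fun y => tendsto_vel hd hθ hf a ht.2.le y) hp).norm
    have h2 : Tendsto (fun x : ℝ => C / (1 + ‖((p.1, p.2 + x) : Space d)‖) ^ d) (𝓝[>] 0)
        (𝓝 (C / (1 + ‖p‖) ^ d)) := by
      have : Continuous fun x : ℝ => C / (1 + ‖((p.1, p.2 + x) : Space d)‖) ^ d := by
        refine continuous_const.div (by fun_prop) fun x => ?_
        positivity
      have := this.tendsto 0
      simp only [add_zero, Prod.mk.eta] at this
      exact this.mono_left nhdsWithin_le_nhds
    refine le_of_tendsto_of_tendsto h1 h2 ?_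
    filter_upwards [self_mem_nhdsWithin] with x hx
    have hx : 0 < x := hx
    exact hC t ht.2.le _ (show 0 < p.2 + x by linarith)

end Existence

end HalfSpaceStokes

namespace HalfSpaceStokes

/-! ### Localized energy identity -/

section Energy

variable {d : ℕ}

instance : (volume : Measure (Space d)).IsAddHaarMeasure :=
  inferInstanceAs ((volume : Measure (Bdry d)).prod (volume : Measure ℝ)).IsAddHaarMeasure

/-- The `k`-th coordinate functional; `none` stands for the normal coordinate. -/
noncomputable def coord : Option (Fin d) → Space d →L[ℝ] ℝ
  | none => coordN d
  | some i => coordT i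

/-- The `k`-th coordinate vector; `none` stands for the normal vector. -/
noncomputable def dir : Option (Fin d) → Space d
  | none => normal d
  | some i => tangent i

theorem abs_coord_le_norm (k : Option (Fin d)) (z : Space d) : |coord k z| ≤ ‖z‖ := by
  cases k with
  | none => exact norm_snd_le z
  | some i => exact (abs_coord_le z.1 i).trans (norm_fst_le z)

theorem norm_dir_le (k : Option (Fin d)) : ‖(dir k : Space d)‖ ≤ 1 := by
  cases k with
  | none => simp [dir, normal, Prod.norm_def]
  | some i => simp [dir, tangent, Prod.norm_def]

/-- The derivative in a fixed direction. -/
noncomputable def dd (e : Space d) (F : Space d → ℝ) (p : Space d) : ℝ := fderiv ℝ F p e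

theorem divergence_eq_sum {u : Space d → Space d} {p : Space d} (hu : DifferentiableAt ℝ u p) :
    divergence u p = ∑ k, dd (dir k) (fun x => coord k (u x)) p := by
  rw [divergence_eq hu, Fintype.sum_option, add_comm]
  rfl

theorem coord_grad (k : Option (Fin d)) (q : Space d → ℝ) (p : Space d) :
    coord k (grad q p) = dd (dir k) q p := by
  cases k <;> rfl

theorem slap_eq_sum {F : Space d → ℝ} {p : Space d} (hF : ContDiffOn ℝ 2 F (halfSpace d))
    (hp : p ∈ halfSpace d) : slap F p = ∑ k, dd (dir k) (dd (dir k) F) p := by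
  have key : ∀ e : Space d, iteratedFDeriv ℝ 2 F p ![e, e] = dd e (dd e F) p := by
    intro e
    have hc : ContDiffAt ℝ 2 F p := hF.contDiffAt (isOpen_halfSpace.mem_nhds hp)
    have h3 : DifferentiableAt ℝ (fderiv ℝ F) p :=
      (hc.fderiv_right (m := 1) (by norm_num)).differentiableAt (by simp)
    exact iteratedFDeriv_two_eq hc (Eventually.of_forall fun x => rfl)
      (h3.clm_apply (differentiableAt_const e)).hasFDerivAt
  rw [slap, Fintype.sum_option, add_comm]
  simp only [key]
  rfl

theorem contDiffOn_dd {F : Space d → ℝ} {n : ℕ} (hF : ContDiffOn ℝ (n + 1 : ℕ) F (halfSpace d))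
    (e : Space d) : ContDiffOn ℝ n (dd e F) (halfSpace d) := by
  have := (hF.fderiv_of_isOpen isOpen_halfSpace (m := n) (by norm_cast)).clm_apply
    (contDiffOn_const (c := e))
  exact this

theorem contDiff_dd {F : Space d → ℝ} {n : ℕ} (hF : ContDiff ℝ (n + 1 : ℕ) F) (e : Space d) :
    ContDiff ℝ n (dd e F) :=
  (hF.fderiv_right (m := n) (by norm_cast)).clm_apply contDiff_const

/-- A test function supported in the open half-space. -/
structure IsTest (n : ℕ) (χ : Space d → ℝ) : Prop where
  contDiff : ContDiff ℝ n χ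
  compact : HasCompactSupport χ
  subset : tsupport χ ⊆ halfSpace d

variable {χ : Space d → ℝ}

theorem IsTest.mono {n m : ℕ} (h : IsTest n χ) (hm : m ≤ n) : IsTest m χ :=
  ⟨h.contDiff.of_le (by exact_mod_cast hm), h.compact, h.subset⟩

theorem IsTest.dd {n : ℕ} (h : IsTest (n + 1) χ) (e : Space d) : IsTest n (dd e χ) :=
  ⟨contDiff_dd h.contDiff e, h.compact.fderiv_apply ℝ e,
    (tsupport_fderiv_apply_subset ℝ e).trans h.subset⟩

theorem IsTest.mul {n : ℕ} (h : IsTest n χ) {F : Space d → ℝ}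
    (hF : ContDiffOn ℝ n F (halfSpace d)) : IsTest n (fun p => χ p * F p) := by
  have hs : tsupport (fun p => χ p * F p) ⊆ tsupport χ := tsupport_mul_subset_left
  refine ⟨contDiff_iff_contDiffAt.2 fun x => ?_, h.compact.mul_right, hs.trans h.subset⟩
  by_cases hx : x ∈ tsupport (fun p => χ p * F p)
  · exact h.contDiff.contDiffAt.mul
      (hF.contDiffAt (isOpen_halfSpace.mem_nhds (h.subset (hs hx))))
  · exact contDiffAt_const.congr_of_eventuallyEq (notMem_tsupport_iff_eventuallyEq.1 hx)

theorem IsTest.integrable (h : IsTest 0 χ) : Integrable χ :=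
  h.contDiff.continuous.integrable_of_hasCompactSupport h.compact

theorem IsTest.integrable_mul (h : IsTest 0 χ) {F : Space d → ℝ}
    (hF : ContinuousOn F (halfSpace d)) : Integrable fun p => χ p * F p :=
  (h.mul (by rw [Nat.cast_zero]; exact contDiffOn_zero.2 hF)).integrable

theorem IsTest.parts (h : IsTest 1 χ) {F : Space d → ℝ} (hF : ContDiffOn ℝ 1 F (halfSpace d))
    (e : Space d) : ∫ p, χ p * HalfSpaceStokes.dd e F p = -∫ p, HalfSpaceStokes.dd e χ p * F p := by
  have hF' : ContDiffOn ℝ (0 + 1 : ℕ) F (halfSpace d) := by simpa using hF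
  refine integral_mul_fderiv_eq_neg_fderiv_mul_of_integrable
    ((h.dd e).integrable_mul hF.continuousOn)
    ((h.mono zero_le_one).integrable_mul (contDiffOn_dd hF' e).continuousOn)
    ((h.mono zero_le_one).integrable_mul hF.continuousOn)
    (fun x _ => h.contDiff.differentiable (by simp) x)
    (fun x hx => (hF.contDiffAt (isOpen_halfSpace.mem_nhds (h.subset hx))).differentiableAt
      (by simp))

/-- Two integrations by parts give the identity with the extra term `-2∫ χ (∂V)²`, which is dropped
by sign. Every integration by parts is legitimate because `χ` has compact support in the open
half-space. -/
theorem IsTest.energy (h : IsTest 2 χ) (h0 : ∀ p, 0 ≤ χ p) {V : Space d → ℝ}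
    (hV : ContDiffOn ℝ 2 V (halfSpace d)) (e : Space d) :
    2 * ∫ p, χ p * V p * HalfSpaceStokes.dd e (HalfSpaceStokes.dd e V) p ≤
      ∫ p, HalfSpaceStokes.dd e (HalfSpaceStokes.dd e χ) p * V p ^ 2 := by
  have hV1 : ContDiffOn ℝ 1 V (halfSpace d) := hV.of_le (by norm_num)
  have hdV : ContDiffOn ℝ 1 (HalfSpaceStokes.dd e V) (halfSpace d) := by
    simpa using contDiffOn_dd (n := 1) (by simpa using hV) e
  have hχV : IsTest 1 (fun p => χ p * V p) := (h.mono one_le_two).mul (by simpa using hV1)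
  have h1 := hχV.parts hdV e
  have h2 := (h.dd e).parts (F := fun p => V p ^ 2) (hV1.pow 2) e
  have hmem : ∀ p, p ∉ halfSpace d → χ p = 0 ∧ HalfSpaceStokes.dd e χ p = 0 := fun p hp =>
    ⟨image_eq_zero_of_notMem_tsupport fun hx => hp (h.subset hx),
      image_eq_zero_of_notMem_tsupport fun hx => hp ((h.dd e).subset hx)⟩
  have e1 : ∀ p, HalfSpaceStokes.dd e (fun p => χ p * V p) p * HalfSpaceStokes.dd e V p =
      χ p * HalfSpaceStokes.dd e V p ^ 2
        + HalfSpaceStokes.dd e χ p * (V p * HalfSpaceStokes.dd e V p) := by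
    intro p
    by_cases hp : p ∈ halfSpace d
    · have hd1 : DifferentiableAt ℝ χ p := h.contDiff.differentiable (by simp) p
      have hd2 : DifferentiableAt ℝ V p :=
        (hV.contDiffAt (isOpen_halfSpace.mem_nhds hp)).differentiableAt (by simp)
      have : HalfSpaceStokes.dd e (fun p => χ p * V p) p =
          χ p * HalfSpaceStokes.dd e V p + V p * HalfSpaceStokes.dd e χ p := by
        simp only [HalfSpaceStokes.dd, fderiv_fun_mul hd1 hd2]
        simp
      rw [this]; ring
    · have h3 : HalfSpaceStokes.dd e (fun p => χ p * V p) p = 0 :=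
        image_eq_zero_of_notMem_tsupport fun hx => hp ((hχV.dd e).subset hx)
      rw [h3, (hmem p hp).1, (hmem p hp).2]; ring
  have e2 : ∀ p, HalfSpaceStokes.dd e χ p * HalfSpaceStokes.dd e (fun p => V p ^ 2) p =
      2 * (HalfSpaceStokes.dd e χ p * (V p * HalfSpaceStokes.dd e V p)) := by
    intro p
    by_cases hp : p ∈ halfSpace d
    · have hd2 : DifferentiableAt ℝ V p :=
        (hV.contDiffAt (isOpen_halfSpace.mem_nhds hp)).differentiableAt (by simp)
      have : HalfSpaceStokes.dd e (fun p => V p ^ 2) p = 2 * (V p * HalfSpaceStokes.dd e V p) := by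
        simp only [HalfSpaceStokes.dd]
        rw [(hd2.hasFDerivAt.pow 2).fderiv]
        simp; ring
      rw [this]; ring
    · rw [(hmem p hp).2]; ring
  have i1 : Integrable fun p => χ p * HalfSpaceStokes.dd e V p ^ 2 :=
    (h.mono (by omega)).integrable_mul (hdV.continuousOn.pow 2)
  have i2 : Integrable fun p => HalfSpaceStokes.dd e χ p * (V p * HalfSpaceStokes.dd e V p) :=
    ((h.dd e).mono (by omega)).integrable_mul (hV.continuousOn.mul hdV.continuousOn)
  simp only [e1] at h1
  rw [integral_add i1 i2] at h1
  simp only [e2] at h2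
  rw [integral_const_mul] at h2
  have i3 : 0 ≤ ∫ p, χ p * HalfSpaceStokes.dd e V p ^ 2 :=
    integral_nonneg fun p => mul_nonneg (h0 p) (sq_nonneg _)
  linarith

/-- The Euclidean square of a vector. -/
noncomputable def nsq (z : Space d) : ℝ := ∑ k, coord k z ^ 2

theorem nsq_nonneg (z : Space d) : 0 ≤ nsq z := Finset.sum_nonneg fun _ _ => sq_nonneg _

theorem nsq_le (z : Space d) : nsq z ≤ (d + 1) * ‖z‖ ^ 2 := by
  calc nsq z ≤ ∑ _k : Option (Fin d), ‖z‖ ^ 2 :=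
        Finset.sum_le_sum fun k _ => by
          rw [← sq_abs]
          exact pow_le_pow_left₀ (abs_nonneg _) (abs_coord_le_norm k z) 2
    _ = _ := by simp

theorem continuous_nsq : Continuous (nsq : Space d → ℝ) := by unfold nsq; fun_prop

theorem eq_zero_of_nsq {z : Space d} (h : nsq z = 0) : z = 0 := by
  have h1 := (Finset.sum_eq_zero_iff_of_nonneg fun k _ => sq_nonneg (coord k z)).1 h
  refine space_ext (fun i => ?_) ?_
  · exact pow_eq_zero_iff (two_ne_zero) |>.1 (h1 (some i) (Finset.mem_univ _))
  · exact pow_eq_zero_iff (two_ne_zero) |>.1 (h1 none (Finset.mem_univ _))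

/-- The sum of the pure second derivatives. -/
noncomputable def ddSum (χ : Space d → ℝ) (p : Space d) : ℝ := ∑ k, dd (dir k) (dd (dir k) χ) p

/-- The local energy inequality for `u = ΔU - ∇q`, `div U = 0`. -/
theorem IsTest.local_energy (h : IsTest 2 χ) (h0 : ∀ p, 0 ≤ χ p) {U u : Space d → Space d}
    {q : Space d → ℝ} (hU : ContDiffOn ℝ 2 U (halfSpace d)) (hq : ContDiffOn ℝ 1 q (halfSpace d))
    (hdiv : ∀ p ∈ halfSpace d, divergence U p = 0)
    (hmom : ∀ p ∈ halfSpace d, u p - vectorLaplacian U p + grad q p = 0) (c : ℝ) :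
    ∫ p, χ p * (2 * ∑ k, coord k (U p) * coord k (u p)) ≤
      ∫ p, (ddSum χ p * nsq (U p) +
        2 * ((q p - c) * ∑ k, HalfSpaceStokes.dd (dir k) χ p * coord k (U p))) := by
  have hUk : ∀ k, ContDiffOn ℝ 2 (fun p => coord k (U p)) (halfSpace d) := fun k =>
    (coord k).contDiff.comp_contDiffOn hU
  have hUk1 : ∀ k, ContDiffOn ℝ 1 (fun p => coord k (U p)) (halfSpace d) := fun k =>
    (hUk k).of_le (by norm_num)
  have hqc : ContDiffOn ℝ 1 (fun p => q p - c) (halfSpace d) := hq.sub contDiffOn_const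
  have hχU : ∀ k, IsTest 1 (fun p => χ p * coord k (U p)) := fun k =>
    (h.mono one_le_two).mul (by simpa using hUk1 k)
  have hdd2 : ∀ k l, ContinuousOn (HalfSpaceStokes.dd (dir l)
      (HalfSpaceStokes.dd (dir l) fun p => coord k (U p))) (halfSpace d) := fun k l =>
    (contDiffOn_dd (n := 0) (contDiffOn_dd (n := 1) (by simpa using hUk k) _) _).continuousOn
  have hddq : ∀ l, ContinuousOn (HalfSpaceStokes.dd (dir l) fun p => q p - c) (halfSpace d) :=
    fun l => (contDiffOn_dd (n := 0) (by simpa using hqc) _).continuousOn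
  have hχ0 : ∀ p, p ∉ halfSpace d → χ p = 0 := fun p hp =>
    image_eq_zero_of_notMem_tsupport fun hx => hp (h.subset hx)
  -- substitution of the equation
  have e1 : ∀ p, χ p * (2 * ∑ k, coord k (U p) * coord k (u p)) =
      ∑ k, ∑ l, 2 * (χ p * coord k (U p) * HalfSpaceStokes.dd (dir l)
        (HalfSpaceStokes.dd (dir l) fun p => coord k (U p)) p)
      - 2 * ∑ k, χ p * coord k (U p) * HalfSpaceStokes.dd (dir k) (fun p => q p - c) p := by
    intro p
    by_cases hp : p ∈ halfSpace d
    · have hu : ∀ k, coord k (u p) = ∑ l, HalfSpaceStokes.dd (dir l)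
          (HalfSpaceStokes.dd (dir l) fun p => coord k (U p)) p
          - HalfSpaceStokes.dd (dir k) (fun p => q p - c) p := by
        intro k
        have h1 : u p = vectorLaplacian U p - grad q p := by
          have := hmom p hp
          rw [sub_add] at this
          exact sub_eq_zero.1 this
        rw [h1, map_sub, coord_vectorLaplacian (hU.contDiffAt (isOpen_halfSpace.mem_nhds hp)),
          slap_eq_sum (hUk k) hp, coord_grad]
        simp only [HalfSpaceStokes.dd, fderiv_sub_const]
      simp only [hu, ← Finset.mul_sum, mul_sub, Finset.sum_sub_distrib, mul_assoc]
      ring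
    · simp [hχ0 p hp]
  have i1 : ∀ k l, Integrable fun p => 2 * (χ p * coord k (U p) * HalfSpaceStokes.dd (dir l)
        (HalfSpaceStokes.dd (dir l) fun p => coord k (U p)) p) := fun k l =>
    (((hχU k).mono zero_le_one).integrable_mul (hdd2 k l)).const_mul 2
  have i2 : ∀ k, Integrable fun p => χ p * coord k (U p) *
      HalfSpaceStokes.dd (dir k) (fun p => q p - c) p := fun k =>
    ((hχU k).mono zero_le_one).integrable_mul (hddq k)
  have i3 : ∀ k l, Integrable fun p => HalfSpaceStokes.dd (dir l) (HalfSpaceStokes.dd (dir l) χ) p *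
      coord k (U p) ^ 2 := fun k l =>
    ((h.dd (dir l)).dd (dir l)).integrable_mul ((hUk k).continuousOn.pow 2)
  have i4 : ∀ k, Integrable fun p => HalfSpaceStokes.dd (dir k) (fun p => χ p * coord k (U p)) p *
      (q p - c) := fun k => ((hχU k).dd (dir k)).integrable_mul hqc.continuousOn
  -- the divergence-free condition
  have e2 : ∀ p, ∑ k, HalfSpaceStokes.dd (dir k) (fun p => χ p * coord k (U p)) p * (q p - c) =
      (q p - c) * ∑ k, HalfSpaceStokes.dd (dir k) χ p * coord k (U p) := by
    intro p
    by_cases hp : p ∈ halfSpace d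
    · have hdU : DifferentiableAt ℝ U p :=
        (hU.contDiffAt (isOpen_halfSpace.mem_nhds hp)).differentiableAt (by simp)
      have hd1 : DifferentiableAt ℝ χ p := h.contDiff.differentiable (by simp) p
      have h3 : ∀ k, HalfSpaceStokes.dd (dir k) (fun p => χ p * coord k (U p)) p =
          χ p * HalfSpaceStokes.dd (dir k) (fun p => coord k (U p)) p
          + HalfSpaceStokes.dd (dir k) χ p * coord k (U p) := by
        intro k
        have hd2 : DifferentiableAt ℝ (fun p => coord k (U p)) p :=
          (coord k).differentiableAt.comp p hdU
        simp only [HalfSpaceStokes.dd, fderiv_fun_mul hd1 hd2]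
        simp; ring
      have h4 := hdiv p hp
      rw [divergence_eq_sum hdU] at h4
      simp only [h3]
      rw [← Finset.sum_mul, Finset.sum_add_distrib, ← Finset.mul_sum, h4]
      ring
    · have h3 : ∀ k, HalfSpaceStokes.dd (dir k) (fun p => χ p * coord k (U p)) p = 0 := fun k =>
        image_eq_zero_of_notMem_tsupport fun hx => hp (((hχU k).dd (dir k)).subset hx)
      have h4 : ∀ k, HalfSpaceStokes.dd (dir k) χ p = 0 := fun k =>
        image_eq_zero_of_notMem_tsupport fun hx => hp ((h.dd (dir k)).subset hx)
      simp [h3, h4]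
  have e3 : ∀ p, ddSum χ p * nsq (U p) +
        2 * ((q p - c) * ∑ k, HalfSpaceStokes.dd (dir k) χ p * coord k (U p)) =
      ∑ k, ∑ l, HalfSpaceStokes.dd (dir l) (HalfSpaceStokes.dd (dir l) χ) p * coord k (U p) ^ 2
      + 2 * ∑ k, HalfSpaceStokes.dd (dir k) (fun p => χ p * coord k (U p)) p * (q p - c) := by
    intro p
    rw [e2, ddSum, nsq, Finset.sum_mul_sum, Finset.sum_comm]
  simp only [e1, e3]
  rw [integral_sub (integrable_finsetSum _ fun k _ => integrable_finsetSum _ fun l _ => i1 k l)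
      ((integrable_finsetSum _ fun k _ => i2 k).const_mul 2),
    integral_add (integrable_finsetSum _ fun k _ => integrable_finsetSum _ fun l _ => i3 k l)
      ((integrable_finsetSum _ fun k _ => i4 k).const_mul 2),
    integral_const_mul, integral_const_mul, integral_finsetSum _ fun k _ => i2 k,
    integral_finsetSum _ fun k _ => i4 k,
    integral_finsetSum _ fun k _ => integrable_finsetSum _ fun l _ => i1 k l,
    integral_finsetSum _ fun k _ => integrable_finsetSum _ fun l _ => i3 k l]
  simp only [fun k => (hχU k).parts hqc (dir k), Finset.sum_neg_distrib]
  rw [mul_neg, sub_neg_eq_add]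
  refine add_le_add (Finset.sum_le_sum fun k _ => ?_) le_rfl
  rw [integral_finsetSum _ fun l _ => i1 k l, integral_finsetSum _ fun l _ => i3 k l]
  refine Finset.sum_le_sum fun l _ => ?_
  rw [integral_const_mul]
  exact h.energy h0 (hUk k) (dir l)

end Energy

end HalfSpaceStokes

namespace HalfSpaceStokes

/-! ### Cutoff functions -/

section Cutoff

variable {d : ℕ}

/-- A radial cutoff, equal to `1` on the unit ball and to `0` off the ball of radius `2`. -/
noncomputable def ballCut (d : ℕ) : ContDiffBump (0 : Space d) := ⟨1, 2, one_pos, one_lt_two⟩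

/-- A cutoff that vanishes for `x_n ≤ 1` and is `1` for `x_n ≥ 2`. -/
noncomputable def wallCut (p : Space d) : ℝ := Real.smoothTransition (p.2 - 1)

/-- The cutoff at distance `R` from the origin and `ε` from the wall. -/
noncomputable def cut (R ε : ℝ) (p : Space d) : ℝ := ballCut d (R⁻¹ • p) * wallCut (ε⁻¹ • p)

theorem contDiff_wallCut {n : ℕ} : ContDiff ℝ n (wallCut : Space d → ℝ) :=
  Real.smoothTransition.contDiff.comp (contDiff_snd.sub contDiff_const)

theorem contDiff_ballCut {n : ℕ} : ContDiff ℝ n (ballCut d) := (ballCut d).contDiff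

theorem hasFDerivAt_comp_smul {f : Space d → ℝ} (hf : Differentiable ℝ f) (r : ℝ) (p : Space d) :
    HasFDerivAt (fun p => f (r • p)) (r • fderiv ℝ f (r • p)) p := by
  have h1 : HasFDerivAt (fun p : Space d => r • p) (r • ContinuousLinearMap.id ℝ (Space d)) p :=
    (hasFDerivAt_id p).const_smul r
  refine ((hf (r • p)).hasFDerivAt.comp p h1).congr_fderiv ?_
  ext <;> simp

theorem dd_comp_smul {f : Space d → ℝ} (hf : Differentiable ℝ f) (r : ℝ) (e p : Space d) :
    dd e (fun p => f (r • p)) p = r * dd e f (r • p) := by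
  rw [dd, (hasFDerivAt_comp_smul hf r p).fderiv]; rfl

theorem dd_mul {f g : Space d → ℝ} (hf : Differentiable ℝ f) (hg : Differentiable ℝ g)
    (e p : Space d) : dd e (fun p => f p * g p) p = dd e f p * g p + f p * dd e g p := by
  simp only [dd, fderiv_fun_mul (hf p) (hg p)]
  simp; ring

theorem dd_const_mul {f : Space d → ℝ} (hf : Differentiable ℝ f) (r : ℝ)
    (e p : Space d) : dd e (fun p => r * f p) p = r * dd e f p := by
  simp only [dd, fderiv_const_mul (hf p)]
  simp

theorem dd_add {f g : Space d → ℝ} (hf : Differentiable ℝ f) (hg : Differentiable ℝ g)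
    (e p : Space d) : dd e (fun p => f p + g p) p = dd e f p + dd e g p := by
  simp only [dd, fderiv_fun_add (hf p) (hg p)]
  simp

theorem differentiable_comp_smul {f : Space d → ℝ} (hf : Differentiable ℝ f) (r : ℝ) :
    Differentiable ℝ (fun p => f (r • p)) := fun p =>
  (hasFDerivAt_comp_smul hf r p).differentiableAt

theorem dd_cut {f g : Space d → ℝ} (hf : ContDiff ℝ 2 f) (hg : ContDiff ℝ 2 g) (r s : ℝ)
    (e p : Space d) :
    dd e (fun p => f (r • p) * g (s • p)) p =
      r * dd e f (r • p) * g (s • p) + s * (f (r • p) * dd e g (s • p)) ∧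
    dd e (dd e (fun p => f (r • p) * g (s • p))) p =
      r ^ 2 * dd e (dd e f) (r • p) * g (s • p)
      + 2 * (r * s) * (dd e f (r • p) * dd e g (s • p))
      + s ^ 2 * (f (r • p) * dd e (dd e g) (s • p)) := by
  have hf1 : Differentiable ℝ f := hf.differentiable (by simp)
  have hg1 : Differentiable ℝ g := hg.differentiable (by simp)
  have hf2 : Differentiable ℝ (dd e f) :=
    (contDiff_dd (n := 1) (by simpa using hf) e).differentiable (by simp)
  have hg2 : Differentiable ℝ (dd e g) :=
    (contDiff_dd (n := 1) (by simpa using hg) e).differentiable (by simp)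
  have h1 : dd e (fun p => f (r • p) * g (s • p)) = fun p =>
      r * (dd e f (r • p) * g (s • p)) + s * (f (r • p) * dd e g (s • p)) := by
    funext p
    rw [dd_mul (differentiable_comp_smul hf1 r) (differentiable_comp_smul hg1 s),
      dd_comp_smul hf1, dd_comp_smul hg1]
    ring
  refine ⟨by rw [h1]; ring, ?_⟩
  have hA : Differentiable ℝ fun p => dd e f (r • p) * g (s • p) :=
    (differentiable_comp_smul hf2 r).mul (differentiable_comp_smul hg1 s)
  have hB : Differentiable ℝ fun p => f (r • p) * dd e g (s • p) :=
    (differentiable_comp_smul hf1 r).mul (differentiable_comp_smul hg2 s)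
  rw [h1, dd_add (hA.const_mul r) (hB.const_mul s), dd_const_mul hA, dd_const_mul hB,
    dd_mul (differentiable_comp_smul hf2 r) (differentiable_comp_smul hg1 s),
    dd_mul (differentiable_comp_smul hf1 r) (differentiable_comp_smul hg2 s),
    dd_comp_smul hf1, dd_comp_smul hg1, dd_comp_smul hf2, dd_comp_smul hg2]
  ring

theorem dd_eq_zero_of_eventuallyEq {f : Space d → ℝ} {c : ℝ} {p : Space d}
    (h : f =ᶠ[𝓝 p] fun _ => c) (e : Space d) : dd e f p = 0 ∧ dd e (dd e f) p = 0 := by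
  have h1 : dd e f =ᶠ[𝓝 p] fun _ => 0 := by
    filter_upwards [h.eventuallyEq_nhds] with x hx
    rw [dd, hx.fderiv_eq]; simp
  refine ⟨h1.eq_of_nhds, ?_⟩
  rw [dd, h1.fderiv_eq]; simp

theorem dd_ballCut {p : Space d} (hp : ‖p‖ < 1 ∨ 2 < ‖p‖) (e : Space d) :
    dd e (ballCut d) p = 0 ∧ dd e (dd e (ballCut d)) p = 0 := by
  rcases hp with hp | hp
  · refine dd_eq_zero_of_eventuallyEq (c := 1) ?_ e
    filter_upwards [(isOpen_lt continuous_norm continuous_const).mem_nhds hp] with x hx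
    exact (ballCut d).one_of_mem_closedBall (by simpa [ballCut] using le_of_lt hx)
  · refine dd_eq_zero_of_eventuallyEq (c := 0) ?_ e
    filter_upwards [(isOpen_lt continuous_const continuous_norm).mem_nhds hp] with x hx
    exact (ballCut d).zero_of_le_dist (by simpa [ballCut] using le_of_lt hx)

theorem dd_wallCut {p : Space d} (hp : p.2 < 1 ∨ 2 < p.2) (e : Space d) :
    dd e wallCut p = 0 ∧ dd e (dd e wallCut) p = 0 := by
  rcases hp with hp | hp
  · refine dd_eq_zero_of_eventuallyEq (c := 0) ?_ e
    filter_upwards [(isOpen_lt continuous_snd continuous_const).mem_nhds hp] with x hx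
    have hx : x.2 < 1 := hx
    exact Real.smoothTransition.zero_of_nonpos (by linarith)
  · refine dd_eq_zero_of_eventuallyEq (c := 1) ?_ e
    filter_upwards [(isOpen_lt continuous_const continuous_snd).mem_nhds hp] with x hx
    have hx : 2 < x.2 := hx
    exact Real.smoothTransition.one_of_one_le (by linarith)

theorem exists_bound_ballCut (d : ℕ) : ∃ C, 0 ≤ C ∧ ∀ (k : Option (Fin d)) (p : Space d),
    |dd (dir k) (ballCut d) p| ≤ C ∧ |dd (dir k) (dd (dir k) (ballCut d)) p| ≤ C := by
  have h1 : ∀ k : Option (Fin d), ∃ C, ∀ p : Space d, ‖dd (dir k) (ballCut d) p‖ ≤ C := fun k =>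
    ((ballCut d).hasCompactSupport.fderiv_apply ℝ (dir k)).exists_bound_of_continuous
      (contDiff_dd (n := 0) contDiff_ballCut _).continuous
  have h2 : ∀ k : Option (Fin d), ∃ C, ∀ p : Space d,
      ‖dd (dir k) (dd (dir k) (ballCut d)) p‖ ≤ C := fun k =>
    (((ballCut d).hasCompactSupport.fderiv_apply ℝ (dir k)).fderiv_apply ℝ
      (dir k)).exists_bound_of_continuous
      (contDiff_dd (n := 0) (contDiff_dd (n := 1) contDiff_ballCut _) _).continuous
  choose C1 hC1 using h1
  choose C2 hC2 using h2
  refine ⟨∑ k, (|C1 k| + |C2 k|), by positivity, fun k p => ?_⟩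
  have h3 : |C1 k| + |C2 k| ≤ ∑ k, (|C1 k| + |C2 k|) :=
    Finset.single_le_sum (f := fun k => |C1 k| + |C2 k|) (fun k _ => by positivity)
      (Finset.mem_univ k)
  have h4 := (hC1 k p).trans (le_abs_self _)
  have h5 := (hC2 k p).trans (le_abs_self _)
  rw [Real.norm_eq_abs] at h4 h5
  exact ⟨by linarith [abs_nonneg (C2 k)], by linarith [abs_nonneg (C1 k)]⟩

theorem exists_bound_wallCut (d : ℕ) : ∃ C, 0 ≤ C ∧ ∀ (k : Option (Fin d)) (p : Space d),
    |dd (dir k) wallCut p| ≤ C ∧ |dd (dir k) (dd (dir k) wallCut) p| ≤ C := by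
  have hs : ContDiff ℝ 2 Real.smoothTransition := Real.smoothTransition.contDiff
  have hs1 : ContDiff ℝ 1 (deriv Real.smoothTransition) :=
    (hs.iterate_deriv' 1 1)
  have hs2 : Continuous (deriv (deriv Real.smoothTransition)) :=
    hs1.continuous_deriv (by simp)
  have z1 : ∀ x, x ∉ Icc (0 : ℝ) 1 → deriv Real.smoothTransition =ᶠ[𝓝 x] fun _ => 0 := by
    intro x hx
    have : Real.smoothTransition =ᶠ[𝓝 x] fun _ => Real.smoothTransition x := by
      rcases lt_or_ge x 0 with h | h
      · filter_upwards [Iio_mem_nhds h] with y hy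
        rw [Real.smoothTransition.zero_of_nonpos (le_of_lt hy),
          Real.smoothTransition.zero_of_nonpos h.le]
      · have h1 : 1 < x := by by_contra h2; exact hx ⟨h, not_lt.1 h2⟩
        filter_upwards [Ioi_mem_nhds h1] with y hy
        rw [Real.smoothTransition.one_of_one_le (le_of_lt hy),
          Real.smoothTransition.one_of_one_le h1.le]
    filter_upwards [this.eventuallyEq_nhds] with y hy
    rw [hy.deriv_eq]; simp
  obtain ⟨C1, hC1⟩ := (HasCompactSupport.intro isCompact_Icc
    fun x hx => (z1 x hx).eq_of_nhds).exists_bound_of_continuous hs1.continuous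
  obtain ⟨C2, hC2⟩ := (HasCompactSupport.intro isCompact_Icc
    fun x hx => by rw [(z1 x hx).deriv_eq]; simp).exists_bound_of_continuous hs2
  have key : ∀ (g : ℝ → ℝ), Differentiable ℝ g → ∀ e p : Space d,
      dd e (fun p => g (p.2 - 1)) p = e.2 * deriv g (p.2 - 1) := by
    intro g hg e p
    have h1 : HasFDerivAt (fun p : Space d => p.2 - 1) (ContinuousLinearMap.snd ℝ (Bdry d) ℝ) p :=
      hasFDerivAt_snd.sub_const 1
    have := (hg (p.2 - 1)).hasDerivAt.comp_hasFDerivAt p h1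
    rw [dd]
    change fderiv ℝ (g ∘ fun p : Space d => p.2 - 1) p e = _
    rw [this.fderiv]
    simp [mul_comm]
  have k1 : ∀ e : Space d, dd e wallCut = fun p => e.2 * deriv Real.smoothTransition (p.2 - 1) :=
    fun e => funext fun p => key _ (hs.differentiable (by simp)) e p
  have hdir : ∀ k : Option (Fin d), |(dir k : Space d).2| ≤ 1 := fun k =>
    (norm_snd_le _).trans (norm_dir_le k)
  refine ⟨|C1| + |C2|, by positivity, fun k p => ⟨?_, ?_⟩⟩
  · rw [k1, abs_mul]
    have := (hC1 (p.2 - 1)).trans (le_abs_self _)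
    rw [Real.norm_eq_abs] at this
    calc _ ≤ 1 * |C1| := by gcongr; exact hdir k
      _ ≤ _ := by linarith [abs_nonneg C2]
  · rw [k1]
    have hg : Differentiable ℝ fun p : Space d => deriv Real.smoothTransition (p.2 - 1) :=
      (hs1.differentiable (by simp)).comp (differentiable_snd.sub_const 1)
    rw [dd_const_mul hg, key _ (hs1.differentiable (by simp)), abs_mul, abs_mul]
    have := (hC2 (p.2 - 1)).trans (le_abs_self _)
    rw [Real.norm_eq_abs] at this
    calc _ ≤ 1 * (1 * |C2|) := by gcongr <;> exact hdir k
      _ ≤ _ := by linarith [abs_nonneg C1]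

/-- The region where the cutoff varies radially. -/
def shell (d : ℕ) (R ε : ℝ) : Set (Space d) := {p | R ≤ ‖p‖ ∧ ‖p‖ ≤ 2 * R ∧ ε ≤ p.2}

/-- The region where the cutoff varies near the wall. -/
def slab (d : ℕ) (R ε : ℝ) : Set (Space d) := {p | ‖p‖ ≤ 2 * R ∧ ε ≤ p.2 ∧ p.2 ≤ 2 * ε}

theorem isCompact_shell (R ε : ℝ) : IsCompact (shell d R ε) := by
  refine (isCompact_closedBall (0 : Space d) (2 * R)).of_isClosed_subset ?_ fun p hp => ?_
  · exact (isClosed_le continuous_const continuous_norm).inter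
      ((isClosed_le continuous_norm continuous_const).inter
        (isClosed_le continuous_const continuous_snd))
  · rw [mem_closedBall_zero_iff]; exact hp.2.1

theorem isCompact_slab (R ε : ℝ) : IsCompact (slab d R ε) := by
  refine (isCompact_closedBall (0 : Space d) (2 * R)).of_isClosed_subset ?_ fun p hp => ?_
  · exact (isClosed_le continuous_norm continuous_const).inter
      ((isClosed_le continuous_const continuous_snd).inter
        (isClosed_le continuous_snd continuous_const))
  · rw [mem_closedBall_zero_iff]; exact hp.1

variable {R ε : ℝ}

theorem norm_inv_smul (hR : 0 < R) (p : Space d) : ‖R⁻¹ • p‖ = ‖p‖ / R := by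
  rw [norm_smul, norm_inv, Real.norm_of_nonneg hR.le, inv_mul_eq_div]

theorem snd_inv_smul (p : Space d) : (ε⁻¹ • p).2 = p.2 / ε := by
  rw [Prod.smul_snd, smul_eq_mul, inv_mul_eq_div]

theorem wallCut_mem (p : Space d) : 0 ≤ wallCut p ∧ wallCut p ≤ 1 :=
  ⟨Real.smoothTransition.nonneg _, Real.smoothTransition.le_one _⟩

theorem cut_nonneg (p : Space d) : 0 ≤ cut R ε p :=
  mul_nonneg (ballCut d).nonneg (wallCut_mem _).1

theorem cut_eq_one (hR : 0 < R) (hε : 0 < ε) {p : Space d} (hp : ‖p‖ ≤ R) (hp2 : 2 * ε ≤ p.2) :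
    cut R ε p = 1 := by
  have h1 : ballCut d (R⁻¹ • p) = 1 := (ballCut d).one_of_mem_closedBall (by
    rw [mem_closedBall_zero_iff, norm_inv_smul hR]
    exact (div_le_one hR).2 hp)
  have h2 : wallCut (ε⁻¹ • p) = 1 := Real.smoothTransition.one_of_one_le (by
    rw [snd_inv_smul, le_sub_iff_add_le, le_div_iff₀ hε]; linarith)
  rw [cut, h1, h2, one_mul]

theorem cut_support (hR : 0 < R) (hε : 0 < ε) {p : Space d} (hp : cut R ε p ≠ 0) :
    ‖p‖ ≤ 2 * R ∧ ε ≤ p.2 := by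
  constructor
  · by_contra h
    refine hp ?_
    rw [cut, (ballCut d).zero_of_le_dist, zero_mul]
    rw [dist_zero_right, norm_inv_smul hR]
    exact (le_div_iff₀ hR).2 (not_le.1 h).le
  · by_contra h
    refine hp ?_
    have h2 : wallCut (ε⁻¹ • p) = 0 := Real.smoothTransition.zero_of_nonpos (by
      rw [snd_inv_smul, sub_nonpos, div_le_one hε]; linarith)
    rw [cut, h2, mul_zero]

theorem isTest_cut (hR : 0 < R) (hε : 0 < ε) (n : ℕ) : IsTest n (cut R ε : Space d → ℝ) := by
  have hs : tsupport (cut R ε : Space d → ℝ) ⊆ {p | ‖p‖ ≤ 2 * R ∧ ε ≤ p.2} :=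
    closure_minimal (fun p hp => cut_support hR hε hp)
      ((isClosed_le continuous_norm continuous_const).inter
        (isClosed_le continuous_const continuous_snd))
  refine ⟨(contDiff_ballCut.comp (contDiff_const_smul _)).mul
    (contDiff_wallCut.comp (contDiff_const_smul _)), ?_, fun p hp => hε.trans_le (hs hp).2⟩
  refine (isCompact_closedBall (0 : Space d) (2 * R)).of_isClosed_subset (isClosed_tsupport _)
    fun p hp => ?_
  rw [mem_closedBall_zero_iff]; exact (hs hp).1

/-- Pointwise bounds for the derivatives of the cutoff. -/
theorem exists_bound_cut (d : ℕ) : ∃ C, 0 ≤ C ∧ ∀ R ε : ℝ, 0 < ε → ε ≤ R →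
    ∀ (k : Option (Fin d)) (p : Space d),
      |dd (dir k) (cut R ε) p| ≤ (shell d R ε).indicator (fun _ => C / R) p
        + (slab d R ε).indicator (fun _ => C / ε) p ∧
      |dd (dir k) (dd (dir k) (cut R ε)) p| ≤ (shell d R ε).indicator (fun _ => C / R ^ 2) p
        + (slab d R ε).indicator (fun _ => C / ε ^ 2) p := by
  obtain ⟨C1, hC1, h1⟩ := exists_bound_ballCut d
  obtain ⟨C2, hC2, h2⟩ := exists_bound_wallCut d
  refine ⟨C1 + C2 + 2 * (C1 * C2), by positivity, fun R ε hε hεR k p => ?_⟩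
  have hR : 0 < R := hε.trans_le hεR
  have hC12 : 0 ≤ C1 * C2 := by positivity
  obtain ⟨e1, e2⟩ := dd_cut (contDiff_ballCut (d := d) (n := 2)) (contDiff_wallCut (n := 2))
    R⁻¹ ε⁻¹ (dir k) p
  have t1 : ∀ X C : ℝ, |X| ≤ C → 0 ≤ C → ((‖R⁻¹ • p‖ < 1 ∨ 2 < ‖R⁻¹ • p‖) → X = 0) →
      ∀ r : ℝ, 0 ≤ r →
      |r * X * wallCut (ε⁻¹ • p)| ≤ (shell d R ε).indicator (fun _ => C * r) p := by
    intro X C hX hC hX0 r hr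
    by_cases hp : p ∈ shell d R ε
    · rw [indicator_of_mem hp, abs_mul, abs_mul, abs_of_nonneg hr, abs_of_nonneg (wallCut_mem _).1]
      calc r * |X| * wallCut (ε⁻¹ • p) ≤ r * C * 1 := by
            gcongr
            · exact (wallCut_mem _).1
            · exact (wallCut_mem _).2
        _ = _ := by ring
    · rw [indicator_of_notMem hp]
      have : X = 0 ∨ wallCut (ε⁻¹ • p) = 0 := by
        by_cases h3 : p.2 < ε
        · right
          exact Real.smoothTransition.zero_of_nonpos (by
            rw [snd_inv_smul, sub_nonpos, div_le_one hε]; exact h3.le)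
        · left
          refine hX0 ?_
          rw [norm_inv_smul hR, div_lt_one hR, lt_div_iff₀ hR]
          by_contra h4
          push Not at h4
          exact hp ⟨h4.1, h4.2, not_lt.1 h3⟩
      rcases this with h | h <;> simp [h]
  have t2 : ∀ X Y C : ℝ, |X| ≤ C → |Y| ≤ 1 → 0 ≤ C → ((p.2 / ε < 1 ∨ 2 < p.2 / ε) → X = 0) →
      (2 < ‖R⁻¹ • p‖ → Y = 0) → ∀ r : ℝ, 0 ≤ r →
      |r * (Y * X)| ≤ (slab d R ε).indicator (fun _ => C * r) p := by
    intro X Y C hX hY hC hX0 hY0 r hr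
    by_cases hp : p ∈ slab d R ε
    · rw [indicator_of_mem hp, abs_mul, abs_mul, abs_of_nonneg hr]
      calc r * (|Y| * |X|) ≤ r * (1 * C) := by gcongr
        _ = _ := by ring
    · rw [indicator_of_notMem hp]
      have : X = 0 ∨ Y = 0 := by
        by_cases h3 : 2 * R < ‖p‖
        · right
          exact hY0 (by rw [norm_inv_smul hR, lt_div_iff₀ hR]; exact h3)
        · left
          refine hX0 ?_
          rw [div_lt_one hε, lt_div_iff₀ hε]
          by_contra h4
          push Not at h4
          exact hp ⟨not_lt.1 h3, h4.1, h4.2⟩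
      rcases this with h | h <;> simp [h]
  have hb1 : |ballCut d (R⁻¹ • p)| ≤ 1 := by
    rw [abs_of_nonneg (ballCut d).nonneg]; exact (ballCut d).le_one
  have hb0 : 2 < ‖R⁻¹ • p‖ → ballCut d (R⁻¹ • p) = 0 := fun h =>
    (ballCut d).zero_of_le_dist (by rw [dist_zero_right]; exact h.le)
  have hw : (p.2 / ε < 1 ∨ 2 < p.2 / ε) → dd (dir k) wallCut (ε⁻¹ • p) = 0 ∧
      dd (dir k) (dd (dir k) wallCut) (ε⁻¹ • p) = 0 := fun h =>
    dd_wallCut (by rw [snd_inv_smul]; exact h) _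
  have mono : ∀ (s : Set (Space d)) (a b : ℝ), a ≤ b →
      s.indicator (fun _ => a) p ≤ s.indicator (fun _ => b) p := fun s a b hab =>
    indicator_le_indicator hab
  constructor
  · change |dd (dir k) (fun p => ballCut d (R⁻¹ • p) * wallCut (ε⁻¹ • p)) p| ≤ _
    rw [e1]
    refine (abs_add_le _ _).trans (add_le_add ?_ ?_)
    · refine (t1 _ C1 (h1 k _).1 hC1 (fun h => (dd_ballCut h _).1) _ (by positivity)).trans
        (mono _ _ _ ?_)
      rw [div_eq_mul_inv]; gcongr; linarith
    · refine (t2 _ _ C2 (h2 k _).1 hb1 hC2 (fun h => (hw h).1) hb0 _ (by positivity)).trans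
        (mono _ _ _ ?_)
      rw [div_eq_mul_inv]; gcongr; linarith
  · change |dd (dir k) (dd (dir k) fun p => ballCut d (R⁻¹ • p) * wallCut (ε⁻¹ • p)) p| ≤ _
    rw [e2, add_assoc]
    refine (abs_add_le _ _).trans (add_le_add ?_ ?_)
    · refine (t1 _ C1 (h1 k _).2 hC1 (fun h => (dd_ballCut h _).2) _ (by positivity)).trans
        (mono _ _ _ ?_)
      rw [div_eq_mul_inv, inv_pow]; gcongr; linarith
    · have q1 := t2 _ _ C2 (h2 k (ε⁻¹ • p)).2 hb1 hC2 (fun h => (hw h).2) hb0 (ε⁻¹ ^ 2) (by positivity)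
      -- The mixed derivative term is charged to the slab. The derivative of the radial cutoff is
      -- rescaled to be bounded by one only to invoke `t2`, which shows that the product vanishes
      -- off the slab.
      have hY : |(1 + C1)⁻¹ * dd (dir k) (ballCut d) (R⁻¹ • p)| ≤ 1 := by
        rw [abs_mul, abs_of_nonneg (by positivity), inv_mul_le_iff₀ (by positivity)]
        linarith [(h1 k (R⁻¹ • p)).1]
      have q2 : |2 * (R⁻¹ * ε⁻¹) * (dd (dir k) (ballCut d) (R⁻¹ • p) * dd (dir k) wallCut (ε⁻¹ • p))| ≤
          (slab d R ε).indicator (fun _ => 2 * (C1 * C2) * (R⁻¹ * ε⁻¹)) p := by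
        by_cases hp : p ∈ slab d R ε
        · rw [indicator_of_mem hp, abs_mul, abs_of_nonneg (a := 2 * (R⁻¹ * ε⁻¹)) (by positivity),
            abs_mul]
          calc 2 * (R⁻¹ * ε⁻¹) * (|dd (dir k) (ballCut d) (R⁻¹ • p)| * |dd (dir k) wallCut (ε⁻¹ • p)|)
              ≤ 2 * (R⁻¹ * ε⁻¹) * (C1 * C2) := by
                gcongr
                · exact (h1 k _).1
                · exact (h2 k _).1
            _ = _ := by ring
        · have := t2 _ _ C2 (h2 k (ε⁻¹ • p)).1 hY hC2 (fun h => (hw h).1)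
            (fun h => by rw [(dd_ballCut (Or.inr h) _).1, mul_zero]) 1 zero_le_one
          rw [indicator_of_notMem hp] at this ⊢
          have h0 := abs_nonpos_iff.1 this
          rw [one_mul, mul_assoc] at h0
          have h0' := (mul_eq_zero.1 h0).resolve_left (by positivity)
          rw [h0']; simp
      refine (abs_add_le _ _).trans ((add_le_add q2 q1).trans ?_)
      rw [← Pi.add_apply, ← indicator_add']
      refine mono _ _ _ ?_
      have hRε : R⁻¹ ≤ ε⁻¹ := inv_anti₀ hε hεR
      have : R⁻¹ * ε⁻¹ ≤ ε⁻¹ ^ 2 := by rw [sq]; gcongr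
      rw [div_eq_mul_inv, ← inv_pow]
      have h5 : 2 * (C1 * C2) * (R⁻¹ * ε⁻¹) ≤ 2 * (C1 * C2) * ε⁻¹ ^ 2 := by gcongr
      have h6 : 0 ≤ C1 * ε⁻¹ ^ 2 := by positivity
      change 2 * (C1 * C2) * (R⁻¹ * ε⁻¹) + C2 * ε⁻¹ ^ 2 ≤ _
      linarith

end Cutoff

end HalfSpaceStokes

namespace HalfSpaceStokes

/-! ### Uniqueness -/

section Uniqueness

variable {d : ℕ}

theorem finrank_space (d : ℕ) : Module.finrank ℝ (Space d) = d + 1 := by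
  simp [Space, Bdry]

theorem exists_measureReal_shell_le (d : ℕ) : ∃ V : ℝ, 0 ≤ V ∧ ∀ R ε : ℝ, 0 ≤ R →
    volume.real (shell d R ε) ≤ V * R ^ (d + 1) := by
  refine ⟨2 ^ (d + 1) * volume.real (Metric.ball (0 : Space d) 1), by positivity,
    fun R ε hR => ?_⟩
  have h1 : shell d R ε ⊆ Metric.closedBall 0 (2 * R) := fun p hp => by
    rw [mem_closedBall_zero_iff]; exact hp.2.1
  refine (measureReal_mono h1 (isCompact_closedBall _ _).measure_lt_top.ne).trans_eq ?_
  rw [Measure.real, Measure.addHaar_closedBall _ _ (by positivity), finrank_space,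
    ENNReal.toReal_mul, ENNReal.toReal_ofReal (by positivity), mul_pow]
  rw [Measure.real]; ring

/-- The volume of order `ε` is what remains near the wall after the `ε^{-2}` of the cutoff has been
absorbed by `|U|² = O(ε²)`. -/
theorem measureReal_slab_le (R : ℝ) {ε : ℝ} (hε : 0 ≤ ε) :
    volume.real (slab d R ε) ≤ volume.real (Metric.closedBall (0 : Bdry d) (2 * R)) * ε := by
  have h1 : slab d R ε ⊆ Metric.closedBall (0 : Bdry d) (2 * R) ×ˢ Icc ε (2 * ε) := fun p hp => by
    refine ⟨?_, hp.2⟩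
    rw [mem_closedBall_zero_iff]; exact (norm_fst_le p).trans hp.1
  have h2 : volume.real (Metric.closedBall (0 : Bdry d) (2 * R) ×ˢ Icc ε (2 * ε)) =
      volume.real (Metric.closedBall (0 : Bdry d) (2 * R)) * ε := by
    rw [Measure.volume_eq_prod, measureReal_prod_prod, Real.volume_real_Icc_of_le (by linarith)]
    ring
  refine (measureReal_mono h1 ?_).trans_eq h2
  exact ((isCompact_closedBall _ _).prod isCompact_Icc).measure_lt_top.ne

theorem sum_abs_coord_le {R : ℝ} (c : Option (Fin d) → ℝ) (z : Space d) (hR : ∀ k, |c k| ≤ R) :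
    |∑ k, c k * coord k z| ≤ ∑ k, R * |coord k z| := by
  refine (Finset.abs_sum_le_sum_abs _ _).trans (Finset.sum_le_sum fun k _ => ?_)
  rw [abs_mul]
  exact mul_le_mul_of_nonneg_right (hR k) (abs_nonneg _)

set_option maxHeartbeats 1000000 in
/-- The right-hand side of the local energy inequality for the cutoff `cut R ε`. -/
theorem exists_cut_energy_le (d : ℕ) : ∃ D : ℝ, 0 ≤ D ∧ ∀ (R ε l K Q Γ c : ℝ)
    (U : Space d → Space d) (q : Space d → ℝ), 0 < ε → ε ≤ R → 1 ≤ R → 0 < l → 0 ≤ K → 0 ≤ Q →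
    ContinuousOn U (halfSpace d) → ContinuousOn q (halfSpace d) →
    (∀ p ∈ halfSpace d, ‖U p‖ ≤ K * p.2) →
    (∀ p ∈ halfSpace d, ‖p‖ ≤ 2 * R → |q p - c| ≤ Q) →
    (∀ p ∈ halfSpace d, R ≤ ‖p‖ → ‖p‖ ≤ 2 * R → |q p - c| ≤ Γ) →
    ∫ p, (ddSum (cut R ε) p * nsq (U p) +
        2 * ((q p - c) * ∑ k, dd (dir k) (cut R ε) p * coord k (U p))) ≤
      D * (K ^ 2 + Q * K) * volume.real (Metric.closedBall (0 : Bdry d) (2 * R)) * ε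
      + (l + D) * (∫ p in shell d R ε, nsq (U p))
      + D / l * ((Γ / R) ^ 2 * R ^ (d + 1)) := by
  obtain ⟨C, hC, hb⟩ := exists_bound_cut d
  obtain ⟨V, hV, hvol⟩ := exists_measureReal_shell_le d
  set n : ℝ := d + 1 with hn
  have hn0 : 0 ≤ n := by positivity
  refine ⟨n * C + 4 * n ^ 2 * C + 4 * n * C + n * C ^ 2 * V, by positivity,
    fun R ε l K Q Γ c U q hε hεR hR hl hK hQ hU hq hwall hqQ hqΓ => ?_⟩
  set D := n * C + 4 * n ^ 2 * C + 4 * n * C + n * C ^ 2 * V with hD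
  have hR0 : 0 < R := by linarith
  set A := 4 * n ^ 2 * C * K ^ 2 + 4 * n * C * (Q * K) with hA
  set B := n * C ^ 2 * (Γ / R) ^ 2 / l with hB
  have hA0 : 0 ≤ A := by positivity
  have hB0 : 0 ≤ B := by positivity
  have hH : ∀ p, p ∈ shell d R ε ∨ p ∈ slab d R ε → p ∈ halfSpace d := by
    rintro p (hp | hp)
    · exact hε.trans_le hp.2.2
    · exact hε.trans_le hp.2.1
  have hcard : ((Finset.univ : Finset (Option (Fin d))).card : ℝ) = n := by simp [hn]
  have pw : ∀ p, ddSum (cut R ε) p * nsq (U p) +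
        2 * ((q p - c) * ∑ k, dd (dir k) (cut R ε) p * coord k (U p)) ≤
      (shell d R ε).indicator (fun p => (l + n * C) * nsq (U p) + B) p
        + (slab d R ε).indicator (fun _ => A) p := by
    intro p
    set s1 : ℝ := (shell d R ε).indicator (fun _ => (1 : ℝ)) p with hs1
    set s2 : ℝ := (slab d R ε).indicator (fun _ => (1 : ℝ)) p with hs2
    have hind : ∀ (S : Set (Space d)) (a : ℝ), S.indicator (fun _ => a) p =
        S.indicator (fun _ => (1 : ℝ)) p * a := fun S a => by
      by_cases h : p ∈ S <;> simp [h]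
    have hb1 : ∀ k, |dd (dir k) (cut R ε) p| ≤ s1 * (C / R) + s2 * (C / ε) := fun k => by
      rw [hs1, hs2, ← hind, ← hind]; exact (hb R ε hε hεR k p).1
    have hb2 : ∀ k, |dd (dir k) (dd (dir k) (cut R ε)) p| ≤ s1 * (C / R ^ 2) + s2 * (C / ε ^ 2) :=
      fun k => by
        rw [hs1, hs2, ← hind, ← hind]; exact (hb R ε hε hεR k p).2
    have hN := nsq_nonneg (U p)
    have m1 : ddSum (cut R ε) p * nsq (U p) ≤
        s1 * (n * C * nsq (U p)) + s2 * (4 * n ^ 2 * C * K ^ 2) := by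
      have h1 : ddSum (cut R ε) p ≤ n * (s1 * (C / R ^ 2) + s2 * (C / ε ^ 2)) := by
        rw [ddSum, ← hcard, ← nsmul_eq_mul]
        exact Finset.sum_le_card_nsmul _ _ _ fun k _ => (le_abs_self _).trans (hb2 k)
      refine (mul_le_mul_of_nonneg_right h1 hN).trans ?_
      have h2 : s1 * (C / R ^ 2) ≤ s1 * C := by
        have : C / R ^ 2 ≤ C := div_le_self hC (one_le_pow₀ hR)
        have h3 : 0 ≤ s1 := indicator_nonneg (fun _ _ => zero_le_one) _
        gcongr
      -- On the slab `x_n ≤ 2ε`, so the linear vanishing of `U` at the wall cancels the factor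
      -- `ε^{-2}`.
      have h3 : s2 * (C / ε ^ 2) * nsq (U p) ≤ s2 * (4 * n * C * K ^ 2) := by
        by_cases hp : p ∈ slab d R ε
        · have : s2 = 1 := by simp [hs2, hp]
          rw [this, one_mul, one_mul]
          have h4 : ‖U p‖ ≤ 2 * K * ε :=
            (hwall p (hH p (Or.inr hp))).trans (by nlinarith [hp.2.2])
          have h5 : nsq (U p) ≤ n * (2 * K * ε) ^ 2 := (nsq_le _).trans (by rw [hn]; gcongr)
          calc C / ε ^ 2 * nsq (U p) ≤ C / ε ^ 2 * (n * (2 * K * ε) ^ 2) := by gcongr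
            _ = _ := by field_simp; ring
        · simp [hs2, hp]
      have h6 := mul_le_mul_of_nonneg_right h2 hN
      nlinarith
    have m2 : 2 * ((q p - c) * ∑ k, dd (dir k) (cut R ε) p * coord k (U p)) ≤
        s1 * (l * nsq (U p) + B) + s2 * (4 * n * C * (Q * K)) := by
      have h1 := sum_abs_coord_le _ (U p) hb1
      have h2 : 2 * ((q p - c) * ∑ k, dd (dir k) (cut R ε) p * coord k (U p)) ≤
          2 * (|q p - c| * ∑ k, (s1 * (C / R) + s2 * (C / ε)) * |coord k (U p)|) := by
        refine mul_le_mul_of_nonneg_left ((le_abs_self _).trans ?_) zero_le_two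
        rw [abs_mul]; gcongr
      refine h2.trans ?_
      have h3 : 2 * (|q p - c| * ∑ k, (s1 * (C / R) + s2 * (C / ε)) * |coord k (U p)|) =
          s1 * ∑ k, 2 * (|q p - c| * (C / R)) * |coord k (U p)|
          + s2 * ∑ k, 2 * (|q p - c| * (C / ε)) * |coord k (U p)| := by
        simp only [Finset.mul_sum, ← Finset.sum_add_distrib]
        exact Finset.sum_congr rfl fun k _ => by ring
      rw [h3]
      refine add_le_add ?_ ?_
      · by_cases hp : p ∈ shell d R ε
        · have : s1 = 1 := by simp [hs1, hp]
          rw [this, one_mul, one_mul]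
          have hq1 := hqΓ p (hH p (Or.inl hp)) hp.1 hp.2.1
          -- Weighted Young inequality on the shell: `l` times the local energy plus `1/l` times the
          -- squared pressure oscillation. The parameter `l` stays free, since the uniqueness
          -- argument lets it tend to infinity.
          have h4 : ∀ k : Option (Fin d), 2 * (|q p - c| * (C / R)) * |coord k (U p)| ≤
              l * coord k (U p) ^ 2 + (C * (Γ / R)) ^ 2 / l := by
            intro k
            have h5 : |q p - c| * (C / R) ≤ C * (Γ / R) := by
              calc |q p - c| * (C / R) ≤ Γ * (C / R) := by gcongr
                _ = _ := by ring
            have h6 : 2 * (C * (Γ / R)) * |coord k (U p)| ≤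
                l * coord k (U p) ^ 2 + (C * (Γ / R)) ^ 2 / l := by
              have h7 : 0 ≤ (l * |coord k (U p)| - C * (Γ / R)) ^ 2 / l := by positivity
              have h8 : (l * |coord k (U p)| - C * (Γ / R)) ^ 2 / l =
                  l * |coord k (U p)| ^ 2 - 2 * (C * (Γ / R)) * |coord k (U p)|
                    + (C * (Γ / R)) ^ 2 / l := by field_simp; ring
              rw [sq_abs] at h8
              linarith
            refine le_trans ?_ h6
            have := abs_nonneg (coord k (U p))
            nlinarith
          refine (Finset.sum_le_sum fun k _ => h4 k).trans_eq ?_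
          rw [Finset.sum_add_distrib, ← Finset.mul_sum, Finset.sum_const, nsmul_eq_mul, hcard, nsq,
            hB]
          ring
        · simp [hs1, hp]
      · by_cases hp : p ∈ slab d R ε
        · have : s2 = 1 := by simp [hs2, hp]
          rw [this, one_mul, one_mul]
          have h4 : ‖U p‖ ≤ 2 * K * ε :=
            (hwall p (hH p (Or.inr hp))).trans (by nlinarith [hp.2.2])
          have hq1 := hqQ p (hH p (Or.inr hp)) hp.1
          have h5 : ∀ k : Option (Fin d), 2 * (|q p - c| * (C / ε)) * |coord k (U p)| ≤
              4 * C * (Q * K) := by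
            intro k
            calc 2 * (|q p - c| * (C / ε)) * |coord k (U p)|
                ≤ 2 * (Q * (C / ε)) * (2 * K * ε) := by
                  gcongr
                  exact (abs_coord_le_norm k _).trans h4
              _ = _ := by field_simp; ring
          refine (Finset.sum_le_card_nsmul _ _ _ fun k _ => h5 k).trans_eq ?_
          rw [nsmul_eq_mul, hcard]; ring
        · simp [hs2, hp]
    have e1 : (shell d R ε).indicator (fun p => (l + n * C) * nsq (U p) + B) p =
        s1 * ((l + n * C) * nsq (U p) + B) := by
      by_cases h : p ∈ shell d R ε <;> simp [hs1, h]
    rw [e1, hind _ A, ← hs2, hA]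
    nlinarith
  have hsm := (isCompact_shell (d := d) R ε).measurableSet
  have hlm := (isCompact_slab (d := d) R ε).measurableSet
  have hsub : shell d R ε ⊆ halfSpace d := fun p hp => hH p (Or.inl hp)
  have iN : IntegrableOn (fun p => nsq (U p)) (shell d R ε) :=
    ((continuous_nsq.comp_continuousOn hU).mono hsub).integrableOn_compact (isCompact_shell R ε)
  have iB : IntegrableOn (fun _ : Space d => B) (shell d R ε) :=
    integrableOn_const (isCompact_shell R ε).measure_lt_top.ne
  have iA : IntegrableOn (fun _ : Space d => A) (slab d R ε) :=
    integrableOn_const (isCompact_slab R ε).measure_lt_top.ne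
  have ht := isTest_cut (d := d) hR0 hε 2
  have iL : Integrable fun p => ddSum (cut R ε) p * nsq (U p) +
        2 * ((q p - c) * ∑ k, dd (dir k) (cut R ε) p * coord k (U p)) := by
    have h1 : ∀ k : Option (Fin d), Integrable fun p =>
        dd (dir k) (dd (dir k) (cut R ε)) p * nsq (U p) := fun k =>
      ((ht.dd (dir k)).dd (dir k)).integrable_mul (continuous_nsq.comp_continuousOn hU)
    have h2 : ∀ k : Option (Fin d), Integrable fun p =>
        dd (dir k) (cut R ε) p * (2 * ((q p - c) * coord k (U p))) := fun k =>
      ((ht.dd (dir k)).mono (by omega)).integrable_mul (continuousOn_const.mul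
        ((hq.sub continuousOn_const).mul ((coord k).continuous.comp_continuousOn hU)))
    refine ((integrable_finsetSum Finset.univ fun k _ => h1 k).add
      (integrable_finsetSum Finset.univ fun k _ => h2 k)).congr (Eventually.of_forall fun p => ?_)
    simp only [ddSum, Pi.add_apply, Finset.sum_mul, Finset.mul_sum]
    congr 1
    exact Finset.sum_congr rfl fun k _ => by ring
  have iS : IntegrableOn (fun p => (l + n * C) * nsq (U p) + B) (shell d R ε) :=
    (iN.const_mul (l + n * C)).add iB
  have step := integral_mono iL
    ((iS.integrable_indicator hsm).add (iA.integrable_indicator hlm)) pw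
  refine step.trans ?_
  simp only [Pi.add_apply]
  rw [integral_add (iS.integrable_indicator hsm)
    (iA.integrable_indicator hlm), integral_indicator hsm, integral_indicator hlm]
  have e2 : ∫ p in shell d R ε, ((l + n * C) * nsq (U p) + B) =
      (l + n * C) * (∫ p in shell d R ε, nsq (U p)) + volume.real (shell d R ε) * B := by
    rw [integral_add (iN.const_mul (l + n * C)) iB, integral_const_mul, setIntegral_const,
      smul_eq_mul]
  have e3 : ∫ _p in slab d R ε, A = volume.real (slab d R ε) * A := by
    rw [setIntegral_const, smul_eq_mul]
  rw [e2, e3]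
  set W := volume.real (Metric.closedBall (0 : Bdry d) (2 * R))
  have hW : 0 ≤ W := measureReal_nonneg
  have hint : 0 ≤ ∫ p in shell d R ε, nsq (U p) := integral_nonneg fun p => nsq_nonneg _
  have f1 : volume.real (slab d R ε) * A ≤ D * (K ^ 2 + Q * K) * W * ε := by
    have h1 : A ≤ D * (K ^ 2 + Q * K) := by
      have : D * (K ^ 2 + Q * K) - A =
          (n * C + 4 * n * C + n * C ^ 2 * V) * K ^ 2
          + (n * C + 4 * n ^ 2 * C + n * C ^ 2 * V) * (Q * K) := by rw [hD, hA]; ring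
      have h2 : 0 ≤ D * (K ^ 2 + Q * K) - A := by rw [this]; positivity
      linarith
    calc volume.real (slab d R ε) * A ≤ (W * ε) * (D * (K ^ 2 + Q * K)) := by
          gcongr
          exact measureReal_slab_le R hε.le
      _ = _ := by ring
  have f2 : (l + n * C) * (∫ p in shell d R ε, nsq (U p)) ≤
      (l + D) * ∫ p in shell d R ε, nsq (U p) := by
    have : n * C ≤ D := by
      have : 0 ≤ 4 * n ^ 2 * C + 4 * n * C + n * C ^ 2 * V := by positivity
      rw [hD]; linarith
    gcongr
  have f3 : volume.real (shell d R ε) * B ≤ D / l * ((Γ / R) ^ 2 * R ^ (d + 1)) := by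
    calc volume.real (shell d R ε) * B ≤ (V * R ^ (d + 1)) * B := by
          gcongr
          exact hvol R ε hR0.le
      _ = (n * C ^ 2 * V) / l * ((Γ / R) ^ 2 * R ^ (d + 1)) := by rw [hB]; ring
      _ ≤ _ := by
          gcongr
          have : 0 ≤ n * C + 4 * n ^ 2 * C + 4 * n * C := by positivity
          rw [hD]; linarith
  linarith

end Uniqueness

end HalfSpaceStokes

namespace HalfSpaceStokes

section NullFlow

/-! ### The difference of two solutions and its localized energy. -/

variable {d : ℕ}

theorem eq_sum_coord_dir (v : Space d) : v = ∑ k, coord k v • dir k := by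
  rw [Fintype.sum_option]
  refine space_ext (fun i => ?_) ?_
  · simp only [coord, dir, normal, tangent, coordT_apply, Prod.fst_sum, Prod.fst_add, Prod.smul_fst,
      smul_zero, zero_add, WithLp.ofLp_sum, Finset.sum_apply]
    simp [Finset.sum_ite_eq]
  · simp [coord, dir, normal, tangent, coordN_apply, Prod.snd_sum]

theorem norm_fderiv_le_grad (q : Space d → ℝ) (p : Space d) :
    ‖fderiv ℝ q p‖ ≤ (d + 1) * ‖grad q p‖ := by
  refine ContinuousLinearMap.opNorm_le_bound _ (by positivity) fun v => ?_
  have h1 : fderiv ℝ q p v = ∑ k, coord k v * coord k (grad q p) := by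
    conv_lhs => rw [eq_sum_coord_dir v]
    simp only [map_sum, map_smul, smul_eq_mul, coord_grad, dd]
  rw [h1, Real.norm_eq_abs]
  calc |∑ k, coord k v * coord k (grad q p)| ≤ ∑ _k : Option (Fin d), ‖v‖ * ‖grad q p‖ := by
        refine (Finset.abs_sum_le_sum_abs _ _).trans (Finset.sum_le_sum fun k _ => ?_)
        rw [abs_mul]
        exact mul_le_mul (abs_coord_le_norm k v) (abs_coord_le_norm k _) (abs_nonneg _)
          (norm_nonneg _)
    _ = _ := by simp; ring

/-- Oscillation of a function in a half-annulus, along a path that first moves away from the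
wall. -/
theorem abs_sub_le_of_fderiv {q : Space d → ℝ} (hq : ContDiffOn ℝ 1 q (halfSpace d)) {G ρ R : ℝ}
    (hR : 0 < R) (hρ : ρ ≤ 3 * R)
    (hG : ∀ p ∈ halfSpace d, ρ ≤ ‖p‖ → ‖fderiv ℝ q p‖ ≤ G) {p : Space d} (hp : p ∈ halfSpace d)
    (h1 : ρ ≤ ‖p‖) (h2 : ‖p‖ ≤ 2 * R) : |q p - q (0, 3 * R)| ≤ 5 * R * G := by
  have hp0 : 0 < p.2 := hp
  have key : ∀ a b : Space d, a ∈ halfSpace d → b ∈ halfSpace d →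
      (∀ x ∈ segment ℝ a b, ρ ≤ ‖x‖) → |q b - q a| ≤ G * ‖b - a‖ := by
    intro a b ha hb hs
    have hH : ∀ x ∈ segment ℝ a b, x ∈ halfSpace d := fun x hx =>
      (convex_halfSpace_gt (f := fun p : Space d => p.2) ⟨fun _ _ => rfl, fun _ _ => rfl⟩
        0).segment_subset ha hb hx
    exact Convex.norm_image_sub_le_of_norm_fderiv_le
      (fun x hx => (hq.contDiffAt (isOpen_halfSpace.mem_nhds (hH x hx))).differentiableAt (by simp))
      (fun x hx => hG x (hH x hx) (hs x hx)) (convex_segment a b) (left_mem_segment ℝ a b)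
      (right_mem_segment ℝ a b)
  have hseg : ∀ a b x : Space d, x ∈ segment ℝ a b → min a.2 b.2 ≤ x.2 ∧ (a.1 = b.1 → x.1 = a.1) := by
    rintro a b x ⟨s, t, hs, ht, hst, rfl⟩
    refine ⟨?_, fun h => ?_⟩
    · change _ ≤ s * a.2 + t * b.2
      have e : min a.2 b.2 = s * min a.2 b.2 + t * min a.2 b.2 := by rw [← add_mul, hst, one_mul]
      rw [e]
      gcongr
      · exact min_le_left _ _
      · exact min_le_right _ _
    · change s • a.1 + t • b.1 = a.1
      rw [← h, ← add_smul, hst, one_smul]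
  set m : Space d := (p.1, p.2 + 3 * R) with hm
  have hm0 : m ∈ halfSpace d := by change 0 < p.2 + 3 * R; positivity
  have h0 : ((0, 3 * R) : Space d) ∈ halfSpace d := by change 0 < 3 * R; positivity
  -- The norm is the maximum of `|x'|` and `|x_n|`, so moving vertically away from the wall never
  -- decreases it; the second leg stays at height at least `3R`.
  have k1 := key m p hm0 hp (fun x hx => by
    obtain ⟨h3, h4⟩ := hseg _ _ _ hx
    rw [min_eq_right (by change p.2 ≤ p.2 + 3 * R; linarith)] at h3
    have h5 : x.1 = p.1 := h4 rfl
    refine h1.trans ?_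
    rw [Prod.norm_def, Prod.norm_def, h5, Real.norm_of_nonneg hp0.le,
      Real.norm_of_nonneg (hp0.le.trans h3)]
    exact max_le_max le_rfl h3)
  have k2 := key (0, 3 * R) m h0 hm0 (fun x hx => by
    obtain ⟨h3, -⟩ := hseg _ _ _ hx
    rw [min_eq_left (by change 3 * R ≤ p.2 + 3 * R; linarith)] at h3
    exact hρ.trans (h3.trans ((le_abs_self _).trans (norm_snd_le x))))
  have hG0 : 0 ≤ G := (norm_nonneg _).trans (hG p hp h1)
  have n1 : ‖p - m‖ ≤ 3 * R := by
    rw [Prod.norm_def]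
    refine max_le ?_ ?_
    · rw [Prod.fst_sub, hm, sub_self, norm_zero]; positivity
    · rw [Prod.snd_sub, hm, Real.norm_eq_abs, sub_add_cancel_left, abs_neg, abs_of_pos (by positivity)]
  have n2 : ‖m - (0, 3 * R)‖ ≤ 2 * R := by
    have : m - (0, 3 * R) = p := by rw [hm]; ext <;> simp
    rwa [this]
  calc |q p - q (0, 3 * R)| = |(q p - q m) + (q m - q (0, 3 * R))| := by ring_nf
    _ ≤ G * (3 * R) + G * (2 * R) := (abs_add_le _ _).trans (add_le_add
        (k1.trans (by gcongr)) (k2.trans (by gcongr)))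
    _ = _ := by ring

/-- The difference of two solutions of the same Stokes problem. -/
structure NullFlow (u : ℝ → Space d → Space d) (q : ℝ → Space d → ℝ) (K C : ℝ) : Prop where
  continuousOn : ContinuousOn (fun z : ℝ × Space d => u z.1 z.2) (Ico 0 2 ×ˢ closedHalfSpace d)
  lipschitz : ∀ t ∈ Ico (0 : ℝ) 2, ∀ x ∈ closedHalfSpace d, ∀ y ∈ closedHalfSpace d,
    ‖u t x - u t y‖ ≤ K * ‖x - y‖
  differentiableOn : ∀ t ∈ Ico (0 : ℝ) 2, DifferentiableOn ℝ (u t) (halfSpace d)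
  contDiffOn : ∀ t ∈ Ico (0 : ℝ) 2, ContDiffOn ℝ 2 (timePrimitive u t) (halfSpace d)
  contDiffOn_pressure : ∀ t ∈ Ico (0 : ℝ) 2, ContDiffOn ℝ 1 (q t) (halfSpace d)
  grad_le : ∀ t ∈ Ico (0 : ℝ) 2, ∀ x ∈ halfSpace d, ‖grad (q t) x‖ ≤ C / (1 + ‖x‖) ^ d
  momentum : ∀ t ∈ Ico (0 : ℝ) 2, ∀ x ∈ halfSpace d,
      u t x - vectorLaplacian (timePrimitive u t) x + grad (q t) x = 0
  div_eq_zero : ∀ t ∈ Ico (0 : ℝ) 2, ∀ x ∈ halfSpace d, divergence (u t) x = 0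
  boundary : ∀ t ∈ Ico (0 : ℝ) 2, ∀ x' : Bdry d, u t (x', 0) = 0
  decay : ∀ t ∈ Ico (0 : ℝ) 2, ∀ x ∈ closedHalfSpace d, ‖u t x‖ ≤ C / (1 + ‖x‖) ^ d

variable {u : ℝ → Space d → Space d} {q : ℝ → Space d → ℝ} {K C : ℝ}

theorem halfSpace_subset : halfSpace d ⊆ closedHalfSpace d := fun p hp =>
  le_of_lt (show 0 < p.2 from hp)

namespace NullFlow

theorem nonneg (h : NullFlow u q K C) : 0 ≤ C := by
  have h1 := h.decay 0 (by simp) 0 (by simp [closedHalfSpace])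
  have h2 := (norm_nonneg _).trans h1
  simpa using h2

theorem continuousOn_time (h : NullFlow u q K C) {p : Space d} (hp : p ∈ closedHalfSpace d) :
    ContinuousOn (fun s => u s p) (Ico 0 2) :=
  h.continuousOn.comp (f := fun s : ℝ => (s, p)) (by fun_prop) fun s hs => ⟨hs, hp⟩

theorem intervalIntegrable (h : NullFlow u q K C) {p : Space d} (hp : p ∈ closedHalfSpace d)
    {t : ℝ} (ht : t ∈ Ico (0 : ℝ) 2) : IntervalIntegrable (fun s => u s p) volume 0 t := by
  refine ContinuousOn.intervalIntegrable ((h.continuousOn_time hp).mono ?_)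
  rw [uIcc_of_le ht.1]
  exact fun s hs => ⟨hs.1, hs.2.trans_lt ht.2⟩

theorem _root_.HalfSpaceStokes.norm_timePrimitive_le {p : Space d} {B : ℝ}
    (hB : ∀ s ∈ Ico (0 : ℝ) 2, ‖u s p‖ ≤ B) {t : ℝ} (ht : t ∈ Ico (0 : ℝ) 2) :
    ‖timePrimitive u t p‖ ≤ B * t := by
  have := intervalIntegral.norm_integral_le_of_norm_le_const (f := fun s => u s p) (a := 0) (b := t)
    (C := B) fun s hs => by
      rw [uIoc_of_le ht.1] at hs
      exact hB s ⟨hs.1.le, hs.2.trans_lt ht.2⟩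
  rwa [sub_zero, abs_of_nonneg ht.1] at this

theorem wall (h : NullFlow u q K C) {p : Space d} (hp : p ∈ closedHalfSpace d) {t : ℝ}
    (ht : t ∈ Ico (0 : ℝ) 2) : ‖u t p‖ ≤ K * p.2 := by
  have h1 := h.lipschitz t ht p hp (p.1, 0) (by simp [closedHalfSpace])
  rw [h.boundary t ht, sub_zero] at h1
  refine h1.trans_eq ?_
  congr 1
  have h2 : p - (p.1, 0) = (0, p.2) := by ext <;> simp
  have h3 : 0 ≤ p.2 := hp
  rw [h2, Prod.norm_def]
  simp [h3]

theorem lipschitz_nonneg (h : NullFlow u q K C) : 0 ≤ K := by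
  have := (norm_nonneg _).trans (h.wall (p := (0, 1)) (by simp [closedHalfSpace]) (t := 0) (by simp))
  simpa using this

theorem hasDerivAt_timePrimitive (h : NullFlow u q K C) {p : Space d} (hp : p ∈ closedHalfSpace d)
    {t : ℝ} (ht : t ∈ Ioo (0 : ℝ) 2) : HasDerivAt (fun s => timePrimitive u s p) (u t p) t := by
  have hc := h.continuousOn_time hp
  have hn : Ico (0 : ℝ) 2 ∈ 𝓝 t := Ico_mem_nhds ht.1 ht.2
  exact intervalIntegral.integral_hasDerivAt_right
    (h.intervalIntegrable hp ⟨ht.1.le, ht.2⟩)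
    ⟨Ico 0 2, hn, hc.aestronglyMeasurable measurableSet_Ico⟩ (hc.continuousAt hn)

/-- The spatial derivatives of `u` are not assumed continuous or even measurable in time, so the
divergence is expressed as a limit of difference quotients with step `1/n`. The Lipschitz constant
dominates them, and the limit passes through the time integral. -/
theorem divergence_timePrimitive (h : NullFlow u q K C) {t : ℝ} (ht : t ∈ Ico (0 : ℝ) 2)
    {p : Space d} (hp : p ∈ halfSpace d) : divergence (timePrimitive u t) p = 0 := by
  have hp0 : 0 < p.2 := hp
  have hU := ((h.contDiffOn t ht).contDiffAt (isOpen_halfSpace.mem_nhds hp)).differentiableAt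
    (by simp)
  have hmem : ∀ (n : ℕ) (k : Option (Fin d)),
      p + ((n : ℝ))⁻¹ • dir k ∈ closedHalfSpace d := by
    intro n k
    have : 0 ≤ (dir k : Space d).2 := by cases k <;> simp [dir, normal, tangent]
    change 0 ≤ p.2 + (n : ℝ)⁻¹ * (dir k : Space d).2
    positivity
  have hpc := halfSpace_subset hp
  have hK := h.lipschitz_nonneg
  have hlim : Tendsto (fun n : ℕ => ‖(n : ℝ)‖) atTop atTop := by
    simpa using tendsto_natCast_atTop_atTop (R := ℝ)
  have l1 : ∀ (F : Space d → Space d), DifferentiableAt ℝ F p → Tendsto (fun n : ℕ =>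
      ∑ k, coord k ((n : ℝ) • (F (p + (n : ℝ)⁻¹ • dir k) - F p))) atTop (𝓝 (divergence F p)) := by
    intro F hF
    rw [divergence_eq_sum hF]
    refine tendsto_finsetSum _ fun k _ => ?_
    have h1 := ((coord k).continuous.tendsto _).comp (hF.hasFDerivAt.lim (dir k) hlim)
    have h2 : dd (dir k) (fun x => coord k (F x)) p = coord k (fderiv ℝ F p (dir k)) := by
      have h3 : HasFDerivAt (fun x => coord k (F x)) ((coord k).comp (fderiv ℝ F p)) p :=
        (coord k).hasFDerivAt.comp p hF.hasFDerivAt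
      rw [dd, h3.fderiv]
      rfl
    rw [h2]; exact h1
  have l2 : Tendsto (fun n : ℕ => ∫ s in (0 : ℝ)..t,
      ∑ k, coord k ((n : ℝ) • (u s (p + (n : ℝ)⁻¹ • dir k) - u s p))) atTop
      (𝓝 (∫ s in (0 : ℝ)..t, (0 : ℝ))) := by
    refine intervalIntegral.tendsto_integral_filter_of_dominated_convergence
      (fun _ => ∑ _k : Option (Fin d), K) (Eventually.of_forall fun n => ?_)
      (Eventually.of_forall fun n => Eventually.of_forall fun s hs => ?_) intervalIntegrable_const
      (Eventually.of_forall fun s hs => ?_)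
    · have hsub : uIoc 0 t ⊆ Ico (0 : ℝ) 2 := by
        rw [uIoc_of_le ht.1]; exact fun s hs => ⟨hs.1.le, hs.2.trans_lt ht.2⟩
      refine ContinuousOn.aestronglyMeasurable ?_ measurableSet_uIoc
      refine continuousOn_finsetSum _ fun k _ => (coord k).continuous.comp_continuousOn ?_
      have h1 := ((h.continuousOn_time (hmem n k)).sub (h.continuousOn_time hpc)).mono hsub
      exact h1.const_smul (n : ℝ)
    · rw [uIoc_of_le ht.1] at hs
      have hs' : s ∈ Ico (0 : ℝ) 2 := ⟨hs.1.le, hs.2.trans_lt ht.2⟩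
      refine (norm_sum_le _ _).trans (Finset.sum_le_sum fun k _ => ?_)
      rw [Real.norm_eq_abs]
      refine (abs_coord_le_norm k _).trans ?_
      rw [norm_smul]
      have h1 := h.lipschitz s hs' _ (hmem n k) p hpc
      rw [add_sub_cancel_left, norm_smul, norm_inv] at h1
      rcases eq_or_ne n 0 with rfl | hn
      · simpa using hK
      · have hn0 : 0 < ‖(n : ℝ)‖ := by simpa using Nat.pos_of_ne_zero hn
        calc ‖(n : ℝ)‖ * ‖u s (p + (n : ℝ)⁻¹ • dir k) - u s p‖
            ≤ ‖(n : ℝ)‖ * (K * (‖(n : ℝ)‖⁻¹ * 1)) := by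
              gcongr
              exact h1.trans (by gcongr; exact norm_dir_le k)
          _ = K := by field_simp
    · rw [uIoc_of_le ht.1] at hs
      have hs' : s ∈ Ico (0 : ℝ) 2 := ⟨hs.1.le, hs.2.trans_lt ht.2⟩
      have := l1 (u s) ((h.differentiableOn s hs').differentiableAt (isOpen_halfSpace.mem_nhds hp))
      rwa [h.div_eq_zero s hs' p hp] at this
  have e : ∀ n : ℕ, ∑ k, coord k ((n : ℝ) • (timePrimitive u t (p + (n : ℝ)⁻¹ • dir k)
        - timePrimitive u t p)) =
      ∫ s in (0 : ℝ)..t, ∑ k, coord k ((n : ℝ) • (u s (p + (n : ℝ)⁻¹ • dir k) - u s p)) := by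
    intro n
    have hi : ∀ k : Option (Fin d), IntervalIntegrable (fun s =>
        (n : ℝ) • (u s (p + (n : ℝ)⁻¹ • dir k) - u s p)) volume 0 t := fun k =>
      ((h.intervalIntegrable (hmem n k) ht).sub (h.intervalIntegrable hpc ht)).smul (n : ℝ)
    rw [intervalIntegral.integral_finsetSum fun k _ => ?_]
    · refine Finset.sum_congr rfl fun k _ => ?_
      rw [ContinuousLinearMap.intervalIntegral_comp_comm _ (hi k), intervalIntegral.integral_smul,
        intervalIntegral.integral_sub (h.intervalIntegrable (hmem n k) ht)
        (h.intervalIntegrable hpc ht)]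
      rfl
    · exact ⟨(coord k).integrable_comp (hi k).1, (coord k).integrable_comp (hi k).2⟩
  have l3 := l1 _ hU
  simp only [e] at l3
  have := tendsto_nhds_unique l3 l2
  simpa using this

theorem continuousOn_space (h : NullFlow u q K C) {t : ℝ} (ht : t ∈ Ico (0 : ℝ) 2) :
    ContinuousOn (u t) (halfSpace d) :=
  h.continuousOn.comp (f := fun p : Space d => (t, p)) (by fun_prop)
    fun p hp => ⟨ht, halfSpace_subset hp⟩

/-- The localized energy. -/
noncomputable def _root_.HalfSpaceStokes.energy (u : ℝ → Space d → Space d) (R ε t : ℝ) : ℝ :=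
  ∫ p, cut R ε p * nsq (timePrimitive u t p)

theorem hasDerivAt_energy (h : NullFlow u q K C) {R ε t : ℝ} (hR : 0 < R) (hε : 0 < ε)
    (ht : t ∈ Ioo (0 : ℝ) 2) : HasDerivAt (energy u R ε)
      (∫ p, cut R ε p * (2 * ∑ k, coord k (timePrimitive u t p) * coord k (u t p))) t := by
  have hT := isTest_cut (d := d) hR hε 2
  have hn : Ioo (0 : ℝ) 2 ∈ 𝓝 t := Ioo_mem_nhds ht.1 ht.2
  have hC := h.nonneg
  have hi : ∀ s ∈ Ioo (0 : ℝ) 2, Integrable fun p => cut R ε p * nsq (timePrimitive u s p) :=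
    fun s hs => (hT.mono (by omega)).integrable_mul
      (continuous_nsq.comp_continuousOn (h.contDiffOn s ⟨hs.1.le, hs.2⟩).continuousOn)
  have hsupp : ∀ p, cut R ε p ≠ 0 → p ∈ closedHalfSpace d := fun p hp =>
    hε.le.trans (cut_support hR hε hp).2
  refine (hasDerivAt_integral_of_dominated_loc_of_deriv_le
    (F := fun s p => cut R ε p * nsq (timePrimitive u s p))
    (F' := fun s p => cut R ε p * (2 * ∑ k, coord k (timePrimitive u s p) * coord k (u s p)))
    (bound := fun p => cut R ε p * (2 * ∑ _k : Option (Fin d), (C * 2) * C)) hn ?_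
    (hi t ht) ?_ ?_ ?_ ?_).2
  · filter_upwards [hn] with s hs using (hi s hs).aestronglyMeasurable
  · refine ((hT.mono (Nat.zero_le 2)).integrable_mul ?_).aestronglyMeasurable
    refine continuousOn_const.mul (continuousOn_finsetSum _ fun k _ => ?_)
    exact ((coord k).continuous.comp_continuousOn
      (h.contDiffOn t ⟨ht.1.le, ht.2⟩).continuousOn).mul
      ((coord k).continuous.comp_continuousOn (h.continuousOn_space ⟨ht.1.le, ht.2⟩))
  · refine Eventually.of_forall fun p s hs => ?_
    rw [norm_mul, Real.norm_of_nonneg (cut_nonneg p)]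
    by_cases hp : cut R ε p = 0
    · simp [hp]
    have hp := hsupp p hp
    refine mul_le_mul_of_nonneg_left ?_ (cut_nonneg p)
    rw [norm_mul, Real.norm_two]
    refine mul_le_mul_of_nonneg_left ((norm_sum_le _ _).trans (Finset.sum_le_sum fun k _ => ?_))
      zero_le_two
    have b1 : ∀ s ∈ Ico (0 : ℝ) 2, ‖u s p‖ ≤ C := fun s hs =>
      (h.decay s hs p hp).trans (div_le_self hC (one_le_pow₀ (by linarith [norm_nonneg p])))
    have b2 := norm_timePrimitive_le b1 ⟨hs.1.le, hs.2⟩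
    rw [norm_mul]
    refine mul_le_mul ((abs_coord_le_norm k _).trans (b2.trans ?_))
      ((abs_coord_le_norm k _).trans (b1 s ⟨hs.1.le, hs.2⟩)) (norm_nonneg _) (by positivity)
    exact mul_le_mul_of_nonneg_left hs.2.le hC
  · exact (hT.mono (Nat.zero_le 2)).integrable_mul continuousOn_const
  · refine Eventually.of_forall fun p s hs => ?_
    by_cases hp : cut R ε p = 0
    · simp only [hp, zero_mul]; exact hasDerivAt_const _ _
    have hp := hsupp p hp
    refine HasDerivAt.const_mul _ ?_
    have h1 : ∀ k : Option (Fin d), HasDerivAt (fun s => coord k (timePrimitive u s p) ^ 2)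
        (2 * (coord k (timePrimitive u s p) * coord k (u s p))) s := fun k => by
      have := ((coord k).hasFDerivAt.comp_hasDerivAt s (h.hasDerivAt_timePrimitive hp hs)).pow 2
      refine this.congr_deriv ?_
      simp; ring
    have h2 := HasDerivAt.fun_sum (u := Finset.univ) fun k _ => h1 k
    rw [Finset.mul_sum]
    exact h2

/-- Serves only to show that the localized energy is `O(s²)` as `s → 0`, which fixes the initial
value in the integration in time. -/
theorem energy_le (h : NullFlow u q K C) {R ε t : ℝ} (hR : 0 < R) (hε : 0 < ε)
    (ht : t ∈ Ico (0 : ℝ) 2) :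
    energy u R ε t ≤ (∫ p : Space d, cut R ε p) * ((d + 1) * C ^ 2) * t ^ 2 := by
  have hC := h.nonneg
  have hT := isTest_cut (d := d) hR hε 0
  rw [energy, mul_assoc, ← integral_mul_const]
  refine integral_mono (hT.integrable_mul
      (continuous_nsq.comp_continuousOn (h.contDiffOn t ht).continuousOn))
    (hT.integrable_mul continuousOn_const) fun p => ?_
  by_cases hp : cut R ε p = 0
  · simp [hp]
  have hp : p ∈ closedHalfSpace d := hε.le.trans (cut_support hR hε hp).2
  have b1 : ∀ s ∈ Ico (0 : ℝ) 2, ‖u s p‖ ≤ C := fun s hs =>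
    (h.decay s hs p hp).trans (div_le_self hC (one_le_pow₀ (by linarith [norm_nonneg p])))
  have b2 := norm_timePrimitive_le b1 ht
  refine mul_le_mul_of_nonneg_left ((nsq_le _).trans ?_) (cut_nonneg p)
  calc ((d : ℝ) + 1) * ‖timePrimitive u t p‖ ^ 2 ≤ (d + 1) * (C * t) ^ 2 := by gcongr
    _ = _ := by ring

/-- Integration of a bound for the time derivative of a finite sum of localized energies. -/
theorem sum_energy_le (h : NullFlow u q K C) {ι : Type*} (J : Finset ι) {R : ι → ℝ} {ε B : ℝ}
    (hR : ∀ j, 0 < R j) (hε : 0 < ε)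
    (hB : ∀ s ∈ Ioo (0 : ℝ) 2, ∑ j ∈ J, ∫ p, cut (R j) ε p *
      (2 * ∑ k, coord k (timePrimitive u s p) * coord k (u s p)) ≤ B)
    {t : ℝ} (ht : t ∈ Ioo (0 : ℝ) 2) : ∑ j ∈ J, energy u (R j) ε t ≤ B * t := by
  set A := ∑ j ∈ J, (∫ p : Space d, cut (R j) ε p) * ((d + 1) * C ^ 2)
  have hD : ∀ s ∈ Ioo (0 : ℝ) 2, HasDerivAt (fun s => ∑ j ∈ J, energy u (R j) ε s)
      (∑ j ∈ J, ∫ p, cut (R j) ε p *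
        (2 * ∑ k, coord k (timePrimitive u s p) * coord k (u s p))) s := fun s hs =>
    HasDerivAt.fun_sum fun j _ => h.hasDerivAt_energy (hR j) hε hs
  -- The derivative bound holds only for positive times, so the growth estimate starts at some `s >
  -- 0` and `s` is then sent to zero.
  have h1 : ∀ s ∈ Ioo (0 : ℝ) t, ∑ j ∈ J, energy u (R j) ε t ≤ A * s ^ 2 + B * (t - s) := by
    intro s hs
    have hsub : Icc s t ⊆ Ioo (0 : ℝ) 2 := fun r hr => ⟨hs.1.trans_le hr.1, hr.2.trans_lt ht.2⟩
    have h2 := (convex_Icc s t).image_sub_le_mul_sub_of_deriv_le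
      (f := fun s => ∑ j ∈ J, energy u (R j) ε s) (C := B)
      (fun r hr => (hD r (hsub hr)).continuousAt.continuousWithinAt)
      (fun r hr => (hD r (hsub (interior_subset hr))).differentiableAt.differentiableWithinAt)
      (fun r hr => by
        have hr' := hsub (interior_subset hr)
        rw [(hD r hr').deriv]; exact hB r hr')
      s ⟨le_rfl, hs.2.le⟩ t ⟨hs.2.le, le_rfl⟩ hs.2.le
    have h3 : ∑ j ∈ J, energy u (R j) ε s ≤ A * s ^ 2 := by
      rw [Finset.sum_mul]
      exact Finset.sum_le_sum fun j _ => h.energy_le (hR j) hε ⟨hs.1.le, hs.2.trans ht.2⟩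
    linarith
  have l : Tendsto (fun s : ℝ => A * s ^ 2 + B * (t - s)) (𝓝[>] 0) (𝓝 (B * t)) := by
    have : Continuous fun s : ℝ => A * s ^ 2 + B * (t - s) := by fun_prop
    have := this.tendsto 0
    simp only [sub_zero, ne_eq, OfNat.ofNat_ne_zero, not_false_eq_true, zero_pow, mul_zero,
      zero_add] at this
    exact this.mono_left nhdsWithin_le_nhds
  exact ge_of_tendsto l (by filter_upwards [Ioo_mem_nhdsGT ht.1] with s hs using h1 s hs)

end NullFlow

end NullFlow

end HalfSpaceStokes

namespace HalfSpaceStokes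

section UniquenessTheorem

/-! ### Vanishing of the difference flow by summation over dyadic shells. -/

variable {d : ℕ} {u : ℝ → Space d → Space d} {q : ℝ → Space d → ℝ} {K C : ℝ}

/-- The decisive count: shell volume `R^{d+1}` against the square of the decay `(1+R)^{-d}`. For `d
= 1` it is borderline, hence bounded and not small, which is why a single cutoff does not give
uniqueness. -/
theorem pow_div_le_one (hd : 1 ≤ d) {R : ℝ} (hR : 0 ≤ R) :
    R ^ (d + 1) / ((1 + R) ^ d) ^ 2 ≤ 1 := by
  rw [div_le_one (by positivity), ← pow_mul]
  calc R ^ (d + 1) ≤ (1 + R) ^ (d + 1) := by gcongr; linarith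
    _ ≤ _ := pow_le_pow_right₀ (by linarith) (by omega)

/-- The part of a ball at distance at least `ε` from the wall. -/
def innerBall (d : ℕ) (R ε : ℝ) : Set (Space d) := {p | ‖p‖ ≤ R ∧ ε ≤ p.2}

theorem isCompact_innerBall (R ε : ℝ) : IsCompact (innerBall d R ε) := by
  refine (isCompact_closedBall (0 : Space d) R).of_isClosed_subset ?_ fun p hp => ?_
  · exact (isClosed_le continuous_norm continuous_const).inter
        (isClosed_le continuous_const continuous_snd)
  · rw [mem_closedBall_zero_iff]; exact hp.1

namespace NullFlow

theorem continuousOn_nsq (h : NullFlow u q K C) {s : ℝ} (hs : s ∈ Ico (0 : ℝ) 2) :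
    ContinuousOn (fun p => nsq (timePrimitive u s p)) (halfSpace d) :=
  continuous_nsq.comp_continuousOn (h.contDiffOn s hs).continuousOn

theorem integrableOn_innerBall (h : NullFlow u q K C) {s : ℝ} (hs : s ∈ Ico (0 : ℝ) 2) {R ε : ℝ}
    (hε : 0 < ε) : IntegrableOn (fun p => nsq (timePrimitive u s p)) (innerBall d R ε) :=
  ((h.continuousOn_nsq hs).mono fun _ hp => hε.trans_le hp.2).integrableOn_compact
    (isCompact_innerBall R ε)

/-- The order of quantifiers is essential. The wall error constant `A` may depend on `R`, since `ε`
is chosen afterwards to absorb it; the shell constant `D` may not, since many radii are summed. -/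
theorem exists_deriv_le (hd : 1 ≤ d) (h : NullFlow u q K C) : ∃ D, 0 ≤ D ∧ ∀ R : ℝ, 1 ≤ R →
    ∃ A, 0 ≤ A ∧ ∀ ε l : ℝ, 0 < ε → ε ≤ R → 0 < l → ∀ s ∈ Ioo (0 : ℝ) 2,
      ∫ p, cut R ε p * (2 * ∑ k, coord k (timePrimitive u s p) * coord k (u s p)) ≤
        A * ε + (l + D) * (∫ p in shell d R ε, nsq (timePrimitive u s p)) + D / l := by
  obtain ⟨D, hD, hmain⟩ := exists_cut_energy_le d
  have hC := h.nonneg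
  have hK := h.lipschitz_nonneg
  set n : ℝ := d + 1 with hn
  have hn0 : 0 ≤ n := by positivity
  refine ⟨D + D * (5 * (n * C)) ^ 2, by positivity, fun R hR => ?_⟩
  have hR0 : 0 < R := by linarith
  refine ⟨D * ((2 * K) ^ 2 + 5 * R * (n * C) * (2 * K)) *
    volume.real (Metric.closedBall (0 : Bdry d) (2 * R)), by positivity,
    fun ε l hε hεR hl s hs => ?_⟩
  have hs' : s ∈ Ico (0 : ℝ) 2 := ⟨hs.1.le, hs.2⟩
  have hG : ∀ ρ : ℝ, 0 ≤ ρ → ∀ p ∈ halfSpace d, ρ ≤ ‖p‖ →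
      ‖fderiv ℝ (q s) p‖ ≤ n * (C / (1 + ρ) ^ d) := by
    intro ρ hρ p hp hρp
    refine (norm_fderiv_le_grad _ _).trans ?_
    gcongr
    exact (h.grad_le s hs' p hp).trans (by gcongr)
  have h1 := (isTest_cut (d := d) hR0 hε 2).local_energy cut_nonneg (h.contDiffOn s hs')
    (h.contDiffOn_pressure s hs') (fun p hp => h.divergence_timePrimitive hs' hp)
    (h.momentum s hs') (q s (0, 3 * R))
  -- The wall constant is `2K` because `t < 2`. On the shell the pressure oscillation is `R` times
  -- the gradient bound at radius `R`; on the slab only the crude bound at radius 0 is available,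
  -- and it suffices there.
  have h2 := hmain R ε l (2 * K) (5 * R * (n * C)) (5 * R * (n * (C / (1 + R) ^ d)))
    (q s (0, 3 * R)) (timePrimitive u s) (q s) hε hεR hR hl (by positivity) (by positivity)
    (h.contDiffOn s hs').continuousOn (h.contDiffOn_pressure s hs').continuousOn
    (fun p hp => by
      have hp0 : 0 < p.2 := hp
      refine (norm_timePrimitive_le (fun r hr => h.wall (halfSpace_subset hp) hr) hs').trans ?_
      nlinarith [hs.2, mul_nonneg hK hp0.le])
    (fun p hp hp2 => by
      have := abs_sub_le_of_fderiv (h.contDiffOn_pressure s hs') hR0 (by positivity) (hG 0 le_rfl) hp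
        (norm_nonneg p) hp2
      simpa using this)
    (fun p hp hp1 hp2 => abs_sub_le_of_fderiv (h.contDiffOn_pressure s hs') hR0 (by linarith)
      (hG R hR0.le) hp hp1 hp2)
  refine h1.trans (h2.trans ?_)
  have hint : 0 ≤ ∫ p in shell d R ε, nsq (timePrimitive u s p) :=
    integral_nonneg fun p => nsq_nonneg _
  have h3 : (5 * R * (n * (C / (1 + R) ^ d)) / R) ^ 2 * R ^ (d + 1) =
      (5 * (n * C)) ^ 2 * (R ^ (d + 1) / ((1 + R) ^ d) ^ 2) := by field_simp
  have h4 : D / l * ((5 * R * (n * (C / (1 + R) ^ d)) / R) ^ 2 * R ^ (d + 1)) ≤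
      (D + D * (5 * (n * C)) ^ 2) / l := by
    rw [h3]
    calc D / l * ((5 * (n * C)) ^ 2 * (R ^ (d + 1) / ((1 + R) ^ d) ^ 2))
        ≤ D / l * ((5 * (n * C)) ^ 2 * 1) := by
          gcongr
          exact pow_div_le_one hd hR0.le
      _ = (D * (5 * (n * C)) ^ 2) / l := by ring
      _ ≤ _ := by gcongr; linarith
  have h5 : (l + D) * (∫ p in shell d R ε, nsq (timePrimitive u s p)) ≤
      (l + (D + D * (5 * (n * C)) ^ 2)) * ∫ p in shell d R ε, nsq (timePrimitive u s p) := by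
    have : 0 ≤ D * (5 * (n * C)) ^ 2 := by positivity
    gcongr
    linarith
  linarith

theorem exists_shell_le (hd : 1 ≤ d) (h : NullFlow u q K C) : ∃ S, 0 ≤ S ∧
    ∀ R ε : ℝ, 1 ≤ R → 0 < ε → ∀ s ∈ Ioo (0 : ℝ) 2,
      ∫ p in shell d R ε, nsq (timePrimitive u s p) ≤ S := by
  obtain ⟨V, hV, hvol⟩ := exists_measureReal_shell_le d
  have hC := h.nonneg
  refine ⟨((d + 1) * (2 * C) ^ 2) * V, by positivity, fun R ε hR hε s hs => ?_⟩
  have hs' : s ∈ Ico (0 : ℝ) 2 := ⟨hs.1.le, hs.2⟩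
  have hR0 : 0 < R := by linarith
  have hH : ∀ p ∈ shell d R ε, p ∈ halfSpace d := fun p hp => hε.trans_le hp.2.2
  have h1 : ∀ p ∈ shell d R ε, nsq (timePrimitive u s p) ≤
      (d + 1) * (2 * (C / (1 + R) ^ d)) ^ 2 := by
    intro p hp
    have h2 := norm_timePrimitive_le (fun r hr => (h.decay r hr p (halfSpace_subset (hH p hp))).trans
      (show C / (1 + ‖p‖) ^ d ≤ C / (1 + R) ^ d by gcongr; exact hp.1)) hs'
    have h3 : C / (1 + R) ^ d * s ≤ 2 * (C / (1 + R) ^ d) := by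
      rw [mul_comm]
      gcongr
      exact hs.2.le
    refine (nsq_le _).trans ?_
    gcongr
    exact h2.trans h3
  have h4 : ∫ p in shell d R ε, nsq (timePrimitive u s p) ≤
      ∫ _p in shell d R ε, ((d + 1) * (2 * (C / (1 + R) ^ d)) ^ 2 : ℝ) :=
    setIntegral_mono_on
      (((h.continuousOn_nsq hs').mono hH).integrableOn_compact (isCompact_shell R ε))
      (integrableOn_const (isCompact_shell R ε).measure_lt_top.ne)
      (isCompact_shell R ε).measurableSet h1
  refine h4.trans ?_
  rw [setIntegral_const, smul_eq_mul]
  calc volume.real (shell d R ε) * ((d + 1) * (2 * (C / (1 + R) ^ d)) ^ 2)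
      ≤ (V * R ^ (d + 1)) * ((d + 1) * (2 * (C / (1 + R) ^ d)) ^ 2) := by
        gcongr
        exact hvol R ε hR0.le
    _ = ((d + 1) * (2 * C) ^ 2) * V * (R ^ (d + 1) / ((1 + R) ^ d) ^ 2) := by field_simp
    _ ≤ ((d + 1) * (2 * C) ^ 2) * V * 1 := by
        gcongr
        exact pow_div_le_one hd hR0.le
    _ = _ := by ring

theorem integral_innerBall_le_energy (h : NullFlow u q K C) {s : ℝ} (hs : s ∈ Ico (0 : ℝ) 2)
    {R R' ε ε' : ℝ} (hR : 0 < R') (hRR : R ≤ R') (hε : 0 < ε') (hε2 : 2 * ε' ≤ ε) :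
    ∫ p in innerBall d R ε, nsq (timePrimitive u s p) ≤ energy u R' ε' s := by
  have hm := (isCompact_innerBall (d := d) R ε).measurableSet
  rw [energy, ← integral_indicator hm]
  refine integral_mono ((h.integrableOn_innerBall hs (by linarith)).integrable_indicator hm)
    ((isTest_cut hR hε 0).integrable_mul (h.continuousOn_nsq hs)) fun p => ?_
  by_cases hp : p ∈ innerBall d R ε
  · rw [indicator_of_mem hp, cut_eq_one hR hε (hp.1.trans hRR) (hε2.trans hp.2), one_mul]
  · rw [indicator_of_notMem hp]
    exact mul_nonneg (cut_nonneg p) (nsq_nonneg _)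

/-- The time primitive is square integrable, uniformly in time. -/
theorem exists_innerBall_le (hd : 1 ≤ d) (h : NullFlow u q K C) : ∃ S, 0 ≤ S ∧
    ∀ R ε : ℝ, 1 ≤ R → 0 < ε → ∀ s ∈ Ioo (0 : ℝ) 2,
      ∫ p in innerBall d R ε, nsq (timePrimitive u s p) ≤ S := by
  obtain ⟨D, hD, hder⟩ := h.exists_deriv_le hd
  obtain ⟨S, hS, hshell⟩ := h.exists_shell_le hd
  refine ⟨(1 + (1 + D) * S + D) * 2, by positivity, fun R ε hR hε s hs => ?_⟩
  obtain ⟨A, hA, hder⟩ := hder R hR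
  have hR0 : 0 < R := by linarith
  -- Small enough that the wall error is at most 1 and that the cutoff equals 1 at height `ε`.
  set ε' := min (min (ε / 2) 1) (A + 1)⁻¹ with hε'
  have hε0 : 0 < ε' := by positivity
  have h1 : ε' ≤ ε / 2 := (min_le_left _ _).trans (min_le_left _ _)
  have h2 : ε' ≤ 1 := (min_le_left _ _).trans (min_le_right _ _)
  have h3 : A * ε' ≤ 1 := by
    calc A * ε' ≤ (A + 1) * (A + 1)⁻¹ := by
          gcongr
          · linarith
          · exact min_le_right _ _
      _ = 1 := mul_inv_cancel₀ (by positivity)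
  refine (h.integral_innerBall_le_energy ⟨hs.1.le, hs.2⟩ hR0 le_rfl hε0 (by linarith)).trans ?_
  have h4 := h.sum_energy_le (J := {()}) (R := fun _ => R) (ε := ε') (B := 1 + (1 + D) * S + D)
    (fun _ => hR0) hε0 (fun r hr => by
      rw [Finset.sum_singleton]
      refine (hder ε' 1 hε0 (h2.trans hR) one_pos r hr).trans ?_
      have := hshell R ε' hR hε0 r hr
      have h5 : (1 + D) * (∫ p in shell d R ε', nsq (timePrimitive u r p)) ≤ (1 + D) * S := by
        gcongr
      rw [div_one]
      linarith) hs
  rw [Finset.sum_singleton] at h4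
  exact h4.trans (mul_le_mul_of_nonneg_left hs.2.le (by positivity))

/-- Each of `N` cutoffs at radii `R 4^j` bounds the same inner energy `I`, while the shell terms,
over disjoint shells, sum to at most the total energy, already known to be finite. Hence `N I ≤ 2 (1
+ (l+D) S + N D/l)`, and `N = n²`, `l = n` forces `I = O(1/n)`. -/
theorem integral_innerBall_eq_zero (hd : 1 ≤ d) (h : NullFlow u q K C) {R ε : ℝ} (hR : 1 ≤ R)
    (hε : 0 < ε) {t : ℝ} (ht : t ∈ Ioo (0 : ℝ) 2) :
    ∫ p in innerBall d R ε, nsq (timePrimitive u t p) = 0 := by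
  obtain ⟨D, hD, hder⟩ := h.exists_deriv_le hd
  obtain ⟨S, hS, hinner⟩ := h.exists_innerBall_le hd
  set I := ∫ p in innerBall d R ε, nsq (timePrimitive u t p) with hI
  have hI0 : 0 ≤ I := integral_nonneg fun p => nsq_nonneg _
  have hRj : ∀ j : ℕ, R ≤ R * 4 ^ j := fun j =>
    le_mul_of_one_le_right (by linarith) (one_le_pow₀ (by norm_num))
  have hRj0 : ∀ j : ℕ, 0 < R * 4 ^ j := fun j => by linarith [hRj j]
  choose A hA hder using fun j : ℕ => hder (R * 4 ^ j) (hR.trans (hRj j))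
  have key : ∀ (N : ℕ) (l : ℝ), 0 < l → N * I ≤ (1 + (l + D) * S + N * (D / l)) * 2 := by
    intro N l hl
    set AA := ∑ j ∈ Finset.range N, A j with hAA
    have hAA0 : 0 ≤ AA := Finset.sum_nonneg fun j _ => hA j
    set ε' := min (min (ε / 2) 1) (AA + 1)⁻¹ with hε'
    have hε0 : 0 < ε' := by positivity
    have h1 : ε' ≤ ε / 2 := (min_le_left _ _).trans (min_le_left _ _)
    have h2 : ε' ≤ 1 := (min_le_left _ _).trans (min_le_right _ _)
    have h3 : AA * ε' ≤ 1 := by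
      calc AA * ε' ≤ (AA + 1) * (AA + 1)⁻¹ := by
            gcongr
            · linarith
            · exact min_le_right _ _
        _ = 1 := mul_inv_cancel₀ (by positivity)
    have h4 : N * I ≤ ∑ j ∈ Finset.range N, energy u (R * 4 ^ j) ε' t := by
      have := Finset.card_nsmul_le_sum (Finset.range N) (fun j => energy u (R * 4 ^ j) ε' t) I
        fun j _ => h.integral_innerBall_le_energy ⟨ht.1.le, ht.2⟩ (hRj0 j) (hRj j) hε0
          (by linarith)
      simpa using this
    refine h4.trans ?_
    have h5 := h.sum_energy_le (J := Finset.range N) (R := fun j => R * 4 ^ j) (ε := ε')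
      (B := 1 + (l + D) * S + N * (D / l)) hRj0 hε0 (fun s hs => by
        have hs' : s ∈ Ico (0 : ℝ) 2 := ⟨hs.1.le, hs.2⟩
        refine (Finset.sum_le_sum fun j _ =>
          hder j ε' l hε0 (h2.trans (hR.trans (hRj j))) hl s hs).trans ?_
        rw [Finset.sum_add_distrib, Finset.sum_add_distrib, ← Finset.sum_mul, ← Finset.mul_sum,
          Finset.sum_const, Finset.card_range, nsmul_eq_mul]
        have hsub : ∀ j ∈ Finset.range N, shell d (R * 4 ^ j) ε' ⊆
            innerBall d (2 * (R * 4 ^ N)) ε' := fun j hj p hp => by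
          refine ⟨hp.2.1.trans ?_, hp.2.2⟩
          have := (Finset.mem_range.1 hj).le
          gcongr
          norm_num
        have hi := h.integrableOn_innerBall hs' (R := 2 * (R * 4 ^ N)) hε0
        have h6 : ∑ j ∈ Finset.range N, ∫ p in shell d (R * 4 ^ j) ε', nsq (timePrimitive u s p)
            ≤ S := by
          rw [← integral_biUnion_finset _ (fun j _ => (isCompact_shell _ _).measurableSet) ?_
            fun j hj => hi.mono_set (hsub j hj)]
          · refine (setIntegral_mono_set hi (Eventually.of_forall fun p => nsq_nonneg _)
              (iUnion₂_subset hsub).eventuallyLE).trans ?_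
            exact hinner _ _ (by linarith [hRj N]) hε0 s hs
          -- Ratio 4 between consecutive radii leaves a gap, as each shell only reaches twice its
          -- inner radius.
          · have : ∀ i j : ℕ, i < j → Disjoint (shell d (R * 4 ^ i) ε') (shell d (R * 4 ^ j) ε') := by
              intro i j hij
              rw [Set.disjoint_left]
              intro p hp hp'
              have h7 := hp'.1.trans hp.2.1
              have h8 : R * 4 ^ (i + 1) ≤ R * 4 ^ j := by
                gcongr
                · norm_num
                · omega
              have h9 := hRj0 i
              rw [pow_succ] at h8
              linarith
            intro i _ j _ hij
            rcases lt_or_gt_of_ne hij with h' | h'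
            · exact this i j h'
            · exact (this j i h').symm
        have h7 : (l + D) * (∑ j ∈ Finset.range N,
            ∫ p in shell d (R * 4 ^ j) ε', nsq (timePrimitive u s p)) ≤ (l + D) * S := by gcongr
        linarith) ht
    exact h5.trans (mul_le_mul_of_nonneg_left ht.2.le (by positivity))
  have key2 : ∀ n : ℕ, 0 < n → I ≤ ((1 + (1 + D) * S + D) * 2) / n := by
    intro n hn
    have hn1 : (1 : ℝ) ≤ n := by exact_mod_cast hn
    have h1 := key (n ^ 2) n (by linarith)
    push_cast at h1
    have h2 : (n : ℝ) ^ 2 * (D / n) = n * D := by field_simp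
    rw [h2] at h1
    rw [le_div_iff₀ (by linarith)]
    have h3 : (1 + (n + D) * S + n * D) * 2 ≤ n * ((1 + (1 + D) * S + D) * 2) := by
      nlinarith [mul_nonneg hD hS, mul_nonneg (mul_nonneg hD hS) (sub_nonneg.2 hn1)]
    have h4 : (n : ℝ) * (I * n) ≤ n * ((1 + (1 + D) * S + D) * 2) := by nlinarith
    exact le_of_mul_le_mul_left h4 (by linarith)
  refine le_antisymm (ge_of_tendsto 
    (tendsto_const_div_atTop_nhds_zero_nat ((1 + (1 + D) * S + D) * 2)) ?_) hI0
  filter_upwards [eventually_gt_atTop 0] with n hn using key2 n hn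

theorem timePrimitive_eq_zero (hd : 1 ≤ d) (h : NullFlow u q K C) {t : ℝ}
    (ht : t ∈ Ioo (0 : ℝ) 2) {p : Space d} (hp : p ∈ halfSpace d) : timePrimitive u t p = 0 := by
  have hp0 : 0 < p.2 := hp
  have ht' : t ∈ Ico (0 : ℝ) 2 := ⟨ht.1.le, ht.2⟩
  set R := ‖p‖ + 1 with hR
  set ε := p.2 / 2 with hε
  have hε0 : 0 < ε := by positivity
  have h1 := h.integral_innerBall_eq_zero hd (R := R) (by linarith [norm_nonneg p]) hε0 ht
  rw [setIntegral_eq_zero_iff_of_nonneg_ae (Eventually.of_forall fun p => nsq_nonneg _)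
    (h.integrableOn_innerBall ht' hε0)] at h1
  set W : Set (Space d) := {p | ‖p‖ < R ∧ ε < p.2} with hW
  have hWo : IsOpen W := (isOpen_lt continuous_norm continuous_const).inter
    (isOpen_lt continuous_const continuous_snd)
  have hsub : W ⊆ innerBall d R ε := fun p hp => ⟨hp.1.le, hp.2.le⟩
  have h2 := ae_restrict_of_ae_restrict_of_subset hsub h1
  have h3 := Measure.eqOn_open_of_ae_eq h2 hWo
    ((h.continuousOn_nsq ht').mono fun p hp => hε0.trans hp.2) continuousOn_const
  exact eq_zero_of_nsq (h3 (show p ∈ W from ⟨by rw [hR]; linarith, by rw [hε]; linarith⟩))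

theorem eq_zero (hd : 1 ≤ d) (h : NullFlow u q K C) {t : ℝ}
    (ht : t ∈ Ioo (0 : ℝ) 2) {p : Space d} (hp : p ∈ halfSpace d) : u t p = 0 := by
  have h1 := h.hasDerivAt_timePrimitive (halfSpace_subset hp) ht
  have h2 : (fun s => timePrimitive u s p) =ᶠ[𝓝 t] fun _ => 0 := by
    filter_upwards [Ioo_mem_nhds ht.1 ht.2] with s hs using h.timePrimitive_eq_zero hd hs hp
  exact h1.unique ((hasDerivAt_const t (0 : Space d)).congr_of_eventuallyEq h2)

end NullFlow

theorem vectorLaplacian_sub {F G : Space d → Space d} {p : Space d} (hF : ContDiffAt ℝ 2 F p)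
    (hG : ContDiffAt ℝ 2 G p) :
    vectorLaplacian (F - G) p = vectorLaplacian F p - vectorLaplacian G p := by
  simp only [vectorLaplacian, iteratedFDeriv_sub_apply (i := 2) (by exact_mod_cast hF)
    (by exact_mod_cast hG), sub_apply, Finset.sum_sub_distrib]
  abel

theorem vectorLaplacian_congr {F G : Space d → Space d} {p : Space d} (h : F =ᶠ[𝓝 p] G) :
    vectorLaplacian F p = vectorLaplacian G p := by
  have : iteratedFDeriv ℝ 2 F p = iteratedFDeriv ℝ 2 G p := (h.iteratedFDeriv ℝ 2).eq_of_nhds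
  simp only [vectorLaplacian, this]

theorem grad_sub {F G : Space d → ℝ} {p : Space d} (hF : DifferentiableAt ℝ F p)
    (hG : DifferentiableAt ℝ G p) : grad (F - G) p = grad F p - grad G p := by
  refine space_ext (fun i => ?_) ?_ <;> simp [grad, fderiv_sub hF hG]

theorem divergence_sub {F G : Space d → Space d} {p : Space d} (hF : DifferentiableAt ℝ F p)
    (hG : DifferentiableAt ℝ G p) : divergence (F - G) p = divergence F p - divergence G p := by
  simp only [divergence, fderiv_sub hF hG]
  simp only [sub_apply, Prod.fst_sub, Prod.snd_sub, PiLp.sub_apply,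
    Finset.sum_sub_distrib]
  ring

theorem IsStokesSolution.intervalIntegrable {g : ℝ → Bdry d → Space d} {w : ℝ → Space d → Space d}
    (h : IsStokesSolution 2 g w) {t : ℝ} (ht : t ∈ Ico (0 : ℝ) 2) {p : Space d}
    (hp : p ∈ closedHalfSpace d) : IntervalIntegrable (fun s => w s p) volume 0 t := by
  have h1 : ContinuousOn (fun s => w s p) (Ico 0 2) :=
    h.continuousOn.comp (f := fun s : ℝ => (s, p)) (by fun_prop) fun s hs => ⟨hs, hp⟩
  refine ContinuousOn.intervalIntegrable (h1.mono ?_)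
  rw [uIcc_of_le ht.1]
  exact fun s hs => ⟨hs.1, hs.2.trans_lt ht.2⟩

/-- Uniqueness for the Stokes problem in the half-space. -/
theorem IsStokesSolution.eq (hd : 1 ≤ d) {g : ℝ → Bdry d → Space d} {w w' : ℝ → Space d → Space d}
    (h : IsStokesSolution 2 g w) (h' : IsStokesSolution 2 g w') {t : ℝ} (ht : t ∈ Ioo (0 : ℝ) 2)
    {p : Space d} (hp : p ∈ halfSpace d) : w t p = w' t p := by
  obtain ⟨K, hK⟩ := h.lipschitzOn
  obtain ⟨K', hK'⟩ := h'.lipschitzOn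
  obtain ⟨q, hq, ⟨C1, hC1⟩, hm⟩ := h.momentum
  obtain ⟨q', hq', ⟨C1', hC1'⟩, hm'⟩ := h'.momentum
  obtain ⟨C2, hC2⟩ := h.decay
  obtain ⟨C2', hC2'⟩ := h'.decay
  have hH : ∀ x ∈ halfSpace d, halfSpace d ∈ 𝓝 x := fun x hx => isOpen_halfSpace.mem_nhds hx
  have hprim : ∀ t ∈ Ico (0 : ℝ) 2, EqOn (timePrimitive (w - w') t)
      (timePrimitive w t - timePrimitive w' t) (halfSpace d) := fun t ht x hx =>
    intervalIntegral.integral_sub (h.intervalIntegrable ht (halfSpace_subset hx))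
      (h'.intervalIntegrable ht (halfSpace_subset hx))
  have hdec : ∀ (x : Space d) (a b : Space d) (A A' B B' : ℝ), ‖a‖ ≤ A / (1 + ‖x‖) ^ d →
      ‖b‖ ≤ A' / (1 + ‖x‖) ^ d → ‖a - b‖ ≤ (|A| + |A'| + (|B| + |B'|)) / (1 + ‖x‖) ^ d := by
    intro x a b A A' B B' ha hb
    refine (norm_sub_le _ _).trans ((add_le_add ha hb).trans ?_)
    rw [← add_div]
    refine div_le_div_of_nonneg_right ?_ (by positivity)
    linarith [le_abs_self A, le_abs_self A', abs_nonneg B, abs_nonneg B']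
  -- One constant has to serve both the decay of the velocity and that of the pressure gradient,
  -- hence the sum of all four.
  have hN : NullFlow (w - w') (q - q') (K + K') (|C1| + |C1'| + (|C2| + |C2'|)) := by
    refine ⟨h.continuousOn.sub h'.continuousOn, fun t ht x hx y hy => ?_, fun t ht =>
      (h.differentiableOn t ht).sub (h'.differentiableOn t ht), fun t ht => ?_,
      fun t ht => (hq t ht).sub (hq' t ht), fun t ht x hx => ?_, fun t ht x hx => ?_,
      fun t ht x hx => ?_, fun t ht y => ?_, fun t ht x hx => ?_⟩
    · have e1 := (hK t ht).norm_sub_le hx hy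
      have e2 := (hK' t ht).norm_sub_le hx hy
      calc ‖(w t x - w' t x) - (w t y - w' t y)‖ = ‖(w t x - w t y) - (w' t x - w' t y)‖ := by
            congr 1; abel
        _ ≤ _ := (norm_sub_le _ _).trans ((add_le_add e1 e2).trans_eq (by ring))
    · exact ((h.contDiffOn_timePrimitive t ht).sub (h'.contDiffOn_timePrimitive t ht)).congr
        (hprim t ht)
    · change ‖grad (q t - q' t) x‖ ≤ _
      rw [grad_sub (((hq t ht).contDiffAt (hH x hx)).differentiableAt (by simp))
        (((hq' t ht).contDiffAt (hH x hx)).differentiableAt (by simp))]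
      exact hdec _ _ _ _ _ _ _ (hC1 t ht x hx) (hC1' t ht x hx)
    · change (w t x - w' t x) - _ + grad (q t - q' t) x = 0
      rw [grad_sub (((hq t ht).contDiffAt (hH x hx)).differentiableAt (by simp))
        (((hq' t ht).contDiffAt (hH x hx)).differentiableAt (by simp)),
        vectorLaplacian_congr ((hprim t ht).eventuallyEq_of_mem (hH x hx)),
        vectorLaplacian_sub ((h.contDiffOn_timePrimitive t ht).contDiffAt (hH x hx))
          ((h'.contDiffOn_timePrimitive t ht).contDiffAt (hH x hx))]
      have e1 := hm t ht x hx
      have e2 := hm' t ht x hx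
      rw [← sub_zero (0 : Space d)]
      nth_rewrite 1 [← e1]
      rw [← e2]
      abel
    · change divergence (w t - w' t) x = 0
      rw [divergence_sub ((h.differentiableOn t ht).differentiableAt (hH x hx))
        ((h'.differentiableOn t ht).differentiableAt (hH x hx)), h.div_eq_zero t ht x hx,
        h'.div_eq_zero t ht x hx, sub_zero]
    · change w t (y, 0) - w' t (y, 0) = 0
      rw [h.boundary t ht, h'.boundary t ht, sub_self]
    · have := hdec x _ _ _ _ C1 C1' (hC2 t ht x hx) (hC2' t ht x hx)
      rwa [add_comm] at this
  exact sub_eq_zero.1 (hN.eq_zero hd ht hp)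

end UniquenessTheorem

end HalfSpaceStokes

namespace HalfSpaceStokes

/-! ### The half-integral far from the support -/

section Far

variable {d : ℕ} {f : Bdry d → ℝ} {κ : ℝ} {i : Fin d}

/-- A nonnegative bump that exceeds `1` near the origin. -/
structure IsFatBump (f : Bdry d → ℝ) : Prop extends IsBump f where
  nonneg : ∀ y, 0 ≤ f y
  one_le : ∀ y, ‖y‖ < 1 / 2 → 1 ≤ f y

theorem const_mul_le_integral {F : ℝ → ℝ} {a b c : ℝ} (ha : 0 ≤ a) (hab : a ≤ b)
    (hF : IntegrableOn F (Ioi 0)) (h0 : ∀ v, 0 < v → 0 ≤ F v) (hc : ∀ v ∈ Ioc a b, c ≤ F v) :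
    c * (b - a) ≤ ∫ v in Ioi 0, F v := by
  have hsub : Ioc a b ⊆ Ioi 0 := fun v hv => ha.trans_lt hv.1
  have h1 := setIntegral_ge_of_const_le_real measurableSet_Ioc measure_Ioc_lt_top.ne hc
    (hF.mono_set hsub)
  rw [Real.volume_real_Ioc_of_le hab] at h1
  exact h1.trans (setIntegral_mono_set hF
    ((ae_restrict_iff' measurableSet_Ioi).2 (Eventually.of_forall h0)) hsub.eventuallyLE)

/-- The derivative is moved onto the Gaussian, where it becomes the factor `-z_i/2`. On the support
of the bump `v z_i ≥ y_i - 1`, so in the region `y_i ≥ 1` the integrand has a sign. -/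
theorem neg_heat_pd_eq (hf : IsBump f) {v : ℝ} (hv : 0 < v) (y : Bdry d) :
    -heat (pd i f) v y = (2 * v)⁻¹ * ∫ z, z i * gauss z * f (y - v • z) := by
  rw [heat_pd hf i hv, avg, ← integral_const_mul, ← integral_const_mul, ← integral_neg]
  refine integral_congr_ae (Eventually.of_forall fun z => ?_)
  simp only [pd_gauss]
  field_simp

theorem integrable_coord_gauss (hf : IsBump f) (v : ℝ) (y : Bdry d) :
    Integrable fun z => z i * gauss z * f (y - v • z) := by
  obtain ⟨B, -, hB⟩ := hf.exists_bound
  refine ((integrable_avg (gaussBound_pd_gauss i) hf.continuous hB v y).const_mul (-2)).congr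
    (Eventually.of_forall fun z => ?_)
  simp only [pd_gauss]; ring

theorem coord_le_of_ne_zero (hf : IsBump f) {v : ℝ} {y z : Bdry d} (h : f (y - v • z) ≠ 0) :
    y i - 1 ≤ v * z i := by
  have h1 : ‖y - v • z‖ < 1 := by
    by_contra h2
    exact h (hf.eq_zero (not_lt.1 h2))
  have h2 := (abs_coord_le (y - v • z) i).trans h1.le
  have h3 : (y - v • z) i = y i - v * z i := by simp
  rw [h3] at h2
  linarith [le_abs_self (y i - v * z i)]

theorem coord_gauss_nonneg (hf : IsFatBump f) {v : ℝ} (hv : 0 < v) {y : Bdry d} (hy : 1 ≤ y i)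
    (z : Bdry d) : 0 ≤ z i * gauss z * f (y - v • z) := by
  by_cases h : f (y - v • z) = 0
  · rw [h, mul_zero]
  · have h1 := coord_le_of_ne_zero (i := i) hf.toIsBump h
    have h2 : 0 ≤ z i := by
      by_contra h3
      nlinarith
    exact mul_nonneg (mul_nonneg h2 (gauss_pos z).le) (hf.nonneg _)

theorem neg_heat_pd_nonneg (hf : IsFatBump f) {v : ℝ} (hv : 0 < v) {y : Bdry d} (hy : 1 ≤ y i) :
    0 ≤ -heat (pd i f) v y := by
  rw [neg_heat_pd_eq hf.toIsBump hv]
  exact mul_nonneg (by positivity) (integral_nonneg fun z => coord_gauss_nonneg hf hv hy z)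

/-- The lower bound for the tangential derivative of the heat evolution at times of order
`|y|²`. -/
theorem exists_le_neg_heat_pd (hf : IsFatBump f) (i : Fin d) (hκ : 1 < κ) : ∃ c, 0 < c ∧
    ∀ (y : Bdry d) (v : ℝ), 2 * κ ≤ ‖y‖ → ‖y‖ ≤ κ * y i → ‖y‖ ≤ v → v ≤ 2 * ‖y‖ →
      c / ‖y‖ ^ (d + 1) ≤ -heat (pd i f) v y := by
  set V := volume.real (Metric.ball (0 : Bdry d) 1) with hV
  have hV0 : 0 < V := ENNReal.toReal_pos (Metric.measure_ball_pos _ _ one_pos).ne'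
    measure_ball_lt_top.ne
  set g : ℝ := Real.exp (-1) / gaussMass d with hg
  have hg0 : 0 < g := div_pos (Real.exp_pos _) gaussMass_pos
  -- The integral is bounded below on the ball of radius `1/(4v)` about `y/v`: there `f ≥ 1`, `z_i ≥
  -- 1/(4κ)` and `|z| ≤ 2`, so the Gaussian is at least `g`. The factors `1/4` and `(1/8)^d` come
  -- from `v ≤ 2|y|` in the prefactor and in the volume.
  refine ⟨(4 * κ)⁻¹ * g * V * (1 / 4) * (1 / 8) ^ d, by positivity, fun y v h1 h2 h3 h4 => ?_⟩
  have hy0 : 0 < ‖y‖ := by linarith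
  have hv : 0 < v := by linarith
  have hyi : 1 ≤ y i := by
    by_contra h
    nlinarith
  rw [neg_heat_pd_eq hf.toIsBump hv]
  set S := Metric.closedBall (v⁻¹ • y) (1 / (4 * v)) with hS
  have hvol : volume.real S = (1 / (4 * v)) ^ d * V := by
    rw [hS, Measure.addHaar_real_closedBall _ _ (by positivity)]; simp [hV]
  have hi := integrable_coord_gauss (i := i) hf.toIsBump v y
  have hlow : ∀ z ∈ S, (4 * κ)⁻¹ * g ≤ z i * gauss z * f (y - v • z) := by
    intro z hz
    have e1 : ‖y - v • z‖ ≤ 1 / 4 := by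
      have : y - v • z = v • (v⁻¹ • y - z) := by
        rw [smul_sub, smul_smul, mul_inv_cancel₀ hv.ne', one_smul]
      rw [this, norm_smul, Real.norm_of_nonneg hv.le, ← dist_eq_norm, dist_comm]
      calc v * dist z (v⁻¹ • y) ≤ v * (1 / (4 * v)) := by gcongr; exact Metric.mem_closedBall.1 hz
        _ = 1 / 4 := by field_simp
    have e2 : 1 ≤ f (y - v • z) := hf.one_le _ (by linarith)
    have e3 : (4 * κ)⁻¹ ≤ z i := by
      have h5 := coord_le_of_ne_zero (i := i) hf.toIsBump (y := y) (v := v) (z := z)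
        (by linarith)
      have h6 : ‖y‖ / (2 * κ) ≤ y i - 1 := by
        rw [div_le_iff₀ (by linarith)]
        nlinarith
      have h7 : v * (4 * κ)⁻¹ ≤ v * z i := by
        refine le_trans ?_ (h6.trans h5)
        rw [← div_eq_mul_inv, div_le_div_iff₀ (by linarith) (by linarith)]
        nlinarith
      exact le_of_mul_le_mul_left h7 hv
    have e4 : g ≤ gauss z := by
      rw [hg, gauss]
      refine div_le_div_of_nonneg_right (Real.exp_le_exp.2 ?_) gaussMass_pos.le
      have h5 : ‖z‖ ≤ 2 := by
        have h6 : v * ‖z‖ ≤ v * 2 := by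
          calc v * ‖z‖ = ‖y - (y - v • z)‖ := by
                rw [sub_sub_cancel, norm_smul, Real.norm_of_nonneg hv.le]
            _ ≤ ‖y‖ + ‖y - v • z‖ := norm_sub_le _ _
            _ ≤ v * 2 := by linarith
        exact le_of_mul_le_mul_left h6 hv
      nlinarith [norm_nonneg z]
    have e5 : 0 ≤ (4 * κ)⁻¹ := by positivity
    calc (4 * κ)⁻¹ * g = (4 * κ)⁻¹ * g * 1 := (mul_one _).symm
      _ ≤ z i * gauss z * f (y - v • z) := by
          exact mul_le_mul (mul_le_mul e3 e4 hg0.le (e5.trans e3)) e2 zero_le_one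
            (mul_nonneg (e5.trans e3) (gauss_pos z).le)
  have h5 := setIntegral_ge_of_const_le_real (μ := volume) Metric.isClosed_closedBall.measurableSet
    (isCompact_closedBall _ _).measure_lt_top.ne hlow hi.integrableOn
  have h6 : ∫ z in S, z i * gauss z * f (y - v • z) ≤ ∫ z, z i * gauss z * f (y - v • z) :=
    setIntegral_le_integral hi (Eventually.of_forall fun z => coord_gauss_nonneg hf hv hyi z)
  rw [hvol] at h5
  have h7 : (4 * ‖y‖)⁻¹ ≤ (2 * v)⁻¹ := inv_anti₀ (by positivity) (by linarith)
  have h8 : 1 / (8 * ‖y‖) ≤ 1 / (4 * v) := one_div_le_one_div_of_le (by positivity) (by linarith)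
  calc (4 * κ)⁻¹ * g * V * (1 / 4) * (1 / 8) ^ d / ‖y‖ ^ (d + 1)
      = (4 * ‖y‖)⁻¹ * ((4 * κ)⁻¹ * g * ((1 / (8 * ‖y‖)) ^ d * V)) := by
        have : 1 / (8 * ‖y‖) = 1 / 8 / ‖y‖ := by field_simp
        rw [this, div_pow (1 / 8), pow_succ ‖y‖ d]
        generalize (1 / 8 : ℝ) ^ d = e
        field_simp
    _ ≤ (2 * v)⁻¹ * ((4 * κ)⁻¹ * g * ((1 / (4 * v)) ^ d * V)) := by gcongr
    _ ≤ _ := by gcongr; exact h5.trans h6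

/-- The tangential derivative of the heat evolution at small times. -/
theorem exists_abs_heat_pd_le (hf : IsBump f) (i : Fin d) : ∃ C, 0 ≤ C ∧
    ∀ (y : Bdry d) (v : ℝ), 2 ≤ ‖y‖ → 0 < v →
      |heat (pd i f) v y| ≤ C * v ^ 2 / ‖y‖ ^ (d + 3) := by
  -- The power 3 is chosen so that, after the factor `v⁻¹`, a `v²` survives to cancel a `v^{-2}`
  -- kernel later, while the decay in `|y|` is one power better than the main term `|y|^{-(d+2)}`.
  obtain ⟨C, hC, h⟩ := abs_avg_le_far (gaussBound_pd_gauss i) hf 3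
  refine ⟨C, hC, fun y v hy hv => ?_⟩
  rw [heat_pd hf i hv, abs_mul, abs_of_nonneg (by positivity)]
  have hy0 : 0 < ‖y‖ := by linarith
  calc v⁻¹ * |avg (pd i gauss) f v y| ≤ v⁻¹ * (C * v ^ 3 / ‖y‖ ^ (d + 3)) := by
        gcongr
        refine (h v y hv hy).trans ?_
        gcongr
        linarith
    _ = _ := by field_simp

/-- Substitution `u = √(v² + η²)`. It compares the half-integrals at `v` and at 0: their integrals
then run over the same argument of `m`, with the densities 1 and `η/u`. -/
theorem integral_rad_eq (m : ℝ → ℝ) {v : ℝ} (hv : 0 < v) :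
    ∫ u in Ioi v, m u = ∫ η in Ioi 0, η / rad (v, η) * m (rad (v, η)) := by
  have hpos : ∀ η : ℝ, 0 < v ^ 2 + η ^ 2 := fun η => by positivity
  have himg : (fun η => rad (v, η)) '' Ioi 0 = Ioi v := by
    ext u
    simp only [mem_image, mem_Ioi, rad]
    constructor
    · rintro ⟨η, hη, rfl⟩
      exact Real.lt_sqrt_of_sq_lt (by nlinarith)
    · intro hu
      refine ⟨√(u ^ 2 - v ^ 2), Real.sqrt_pos.2 (by nlinarith), ?_⟩
      rw [Real.sq_sqrt (by nlinarith), add_sub_cancel, Real.sqrt_sq (by linarith)]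
  have hinj : InjOn (fun η => rad (v, η)) (Ioi 0) := by
    intro a ha b hb hab
    simp only [rad] at hab
    rw [Real.sqrt_inj (hpos a).le (hpos b).le] at hab
    exact (pow_left_inj₀ (le_of_lt ha) (le_of_lt hb) two_ne_zero).1 (by linarith)
  have hder : ∀ η ∈ Ioi (0 : ℝ), HasDerivWithinAt (fun η => rad (v, η)) (η / rad (v, η)) (Ioi 0) η := by
    intro η _
    have h1 : HasDerivAt (fun η : ℝ => v ^ 2 + η ^ 2) (2 * η) η := by
      simpa using (hasDerivAt_pow 2 η).const_add (v ^ 2)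
    refine (h1.sqrt (hpos η).ne').hasDerivWithinAt.congr_deriv ?_
    simp only [rad]
    rw [mul_div_mul_left _ _ two_ne_zero]
  rw [← himg, integral_image_eq_integral_abs_deriv_smul measurableSet_Ioi hder hinj]
  refine setIntegral_congr_fun measurableSet_Ioi fun η hη => ?_
  simp only [smul_eq_mul]
  rw [abs_of_nonneg (div_nonneg (le_of_lt hη) (rad_nonneg _))]

/-- The negative of the half-integral of `∂_i f` is positive and increases with `v`. -/
theorem exists_halfInt_bounds (hd : 1 ≤ d) (hf : IsFatBump f) (i : Fin d) (hκ : 1 < κ) :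
    ∃ c R, 0 < c ∧ 2 * κ ≤ R ∧ ∀ y : Bdry d, R ≤ ‖y‖ → ‖y‖ ≤ κ * y i →
      c / ‖y‖ ^ d ≤ -halfInt (pd i f) 0 y ∧
      (∀ v, 0 < v → v ≤ 2 → c * v ^ 2 / ‖y‖ ^ (d + 2) ≤
        halfInt (pd i f) 0 y - halfInt (pd i f) v y) ∧
      ∀ v, 0 < v → 0 ≤ -halfInt (pd i f) v y := by
  obtain ⟨c, hc, hlow⟩ := exists_le_neg_heat_pd hf i hκ
  obtain ⟨C, hC, hup⟩ := exists_abs_heat_pd_le hf.toIsBump i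
  set P := 2 / √Real.pi with hP
  have hP0 : 0 < P := by positivity
  -- The gain is `c/16` times `v²/|y|^{d+2}`. The requirement `|y| ≥ 64C/c` together with `v ≤ 2`
  -- makes the loss at most half of it.
  refine ⟨P * (c / 32), max (4 * κ) (64 * C / c), by positivity,
    le_max_of_le_left (by linarith), fun y hyR hyκ => ?_⟩
  have hR1 : 4 * κ ≤ ‖y‖ := (le_max_left _ _).trans hyR
  have hR2 : 64 * C / c ≤ ‖y‖ := (le_max_right _ _).trans hyR
  rw [div_le_iff₀ hc] at hR2
  have hy0 : 0 < ‖y‖ := by linarith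
  have hyi : 1 ≤ y i := by
    by_contra h
    nlinarith
  set m : ℝ → ℝ := fun v => -heat (pd i f) v y with hm
  have hm0 : ∀ v, 0 < v → 0 ≤ m v := fun v hv => neg_heat_pd_nonneg hf hv hyi
  have hrad : ∀ v η : ℝ, 0 < η → 0 < rad (v, η) := fun v η hη => hη.trans_le (snd_le_rad (v, η))
  have hI : ∀ v, IntegrableOn (fun η => m (rad (v, η))) (Ioi 0) := fun v =>
    (heat_rad_integrable hd (hf.heatDecay_pd i) v y).neg
  have hH : ∀ v, -halfInt (pd i f) v y = P * ∫ η in Ioi 0, m (rad (v, η)) := fun v => by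
    rw [halfInt, hm, integral_neg]; ring
  have hI0 : IntegrableOn m (Ioi 0) := (hI 0).congr_fun (fun η hη => by
    simp only [rad_zero_left hη]) measurableSet_Ioi
  have hH0 : -halfInt (pd i f) 0 y = P * ∫ η in Ioi 0, m η := by
    rw [hH 0]
    congr 1
    exact setIntegral_congr_fun measurableSet_Ioi fun η hη => by simp only [rad_zero_left hη]
  refine ⟨?_, fun v hv hv2 => ?_, fun v hv => ?_⟩
  · rw [hH0]
    have h1 := const_mul_le_integral hy0.le (by linarith) hI0 hm0
      (fun v hv => hlow y v (by linarith) hyκ hv.1.le hv.2 : ∀ v ∈ Ioc ‖y‖ (2 * ‖y‖), _)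
    have h2 : c / ‖y‖ ^ (d + 1) * (2 * ‖y‖ - ‖y‖) = c / ‖y‖ ^ d := by field_simp; ring
    rw [h2] at h1
    have h3 : P * (c / 32) / ‖y‖ ^ d ≤ P * (c / ‖y‖ ^ d) := by
      rw [mul_div_assoc]
      gcongr
      linarith
    exact h3.trans (by gcongr)
  · have e1 : halfInt (pd i f) 0 y - halfInt (pd i f) v y =
        P * ((∫ η in Ioi 0, m (rad (v, η))) - ∫ η in Ioi 0, m η) := by
      rw [mul_sub, ← hH, ← hH0]; ring
    have hle : ∀ η : ℝ, 0 < η → 0 ≤ η / rad (v, η) ∧ η / rad (v, η) ≤ 1 := fun η hη =>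
      ⟨div_nonneg hη.le (rad_nonneg _), (div_le_one (hrad v η hη)).2 (snd_le_rad (v, η))⟩
    have hcr : Continuous fun η : ℝ => rad (v, η) := continuous_rad.comp (by fun_prop)
    have hI2 : IntegrableOn (fun η => η / rad (v, η) * m (rad (v, η))) (Ioi 0) := by
      refine (hI v).bdd_mul (c := 1) ?_ ?_
      · exact (measurable_id.div hcr.measurable).aestronglyMeasurable
      · filter_upwards [ae_volPos] with η hη
        rw [Real.norm_of_nonneg (hle η hη).1]; exact (hle η hη).2
    have e2 : ∫ η in Ioi 0, m η = (∫ η in Ioc 0 v, m η) + ∫ η in Ioi v, m η := by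
      rw [← Ioc_union_Ioi_eq_Ioi hv.le]
      exact setIntegral_union Ioc_disjoint_Ioi_same measurableSet_Ioi
        (hI0.mono_set fun x hx => hx.1) (hI0.mono_set fun x hx => hv.trans hx)
    -- The increment is a gain `∫ (1 - η/u) m(u) dη` with `u = √(v²+η²)`, minus the missing piece
    -- `∫_0^v m`. The gain is evaluated at `η` of order `|y|`; the missing piece is negligible
    -- because `m` is tiny at small times.
    have e3 : (∫ η in Ioi 0, m (rad (v, η))) - ∫ η in Ioi 0, m η =
        (∫ η in Ioi 0, (m (rad (v, η)) - η / rad (v, η) * m (rad (v, η)))) -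
          ∫ η in Ioc 0 v, m η := by
      rw [integral_sub (hI v) hI2, e2, integral_rad_eq m hv]; ring
    have k1 : c / ‖y‖ ^ (d + 1) * (v ^ 2 / (8 * ‖y‖ ^ 2)) * (3 / 2 * ‖y‖ - ‖y‖) ≤
        ∫ η in Ioi 0, (m (rad (v, η)) - η / rad (v, η) * m (rad (v, η))) := by
      refine const_mul_le_integral hy0.le (by linarith) ((hI v).sub hI2) (fun η hη => ?_)
        fun η hη => ?_
      · have := hm0 _ (hrad v η hη)
        nlinarith [(hle η hη).2]
      · have hη0 : 0 < η := hy0.trans hη.1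
        have hr := hrad v η hη0
        have hr2 : rad (v, η) ^ 2 = v ^ 2 + η ^ 2 := Real.sq_sqrt (by positivity)
        have hr3 : rad (v, η) ≤ 2 * ‖y‖ := by
          refine abs_le_of_sq_le_sq' ?_ (by positivity) |>.2
          rw [hr2]
          nlinarith [hη.2, hη0]
        have a1 := hlow y (rad (v, η)) (by linarith) hyκ (hη.1.le.trans (snd_le_rad (v, η))) hr3
        have a2 : v ^ 2 / (8 * ‖y‖ ^ 2) ≤ 1 - η / rad (v, η) := by
          have a3 : v ^ 2 = (rad (v, η) - η) * (rad (v, η) + η) := by nlinarith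
          have a4 : 1 - η / rad (v, η) = (rad (v, η) - η) / rad (v, η) := by field_simp
          have a5 := snd_le_rad (v, η)
          simp only at a5
          rw [a4, a3, div_le_div_iff₀ (by positivity) hr]
          have a6 : (rad (v, η) + η) * rad (v, η) ≤ 8 * ‖y‖ ^ 2 := by nlinarith
          nlinarith [sub_nonneg.2 a5]
        have a7 : m (rad (v, η)) - η / rad (v, η) * m (rad (v, η)) =
            m (rad (v, η)) * (1 - η / rad (v, η)) := by ring
        rw [a7]
        exact mul_le_mul a1 a2 (by positivity) (hm0 _ hr)
    have k2 : ∫ η in Ioc 0 v, m η ≤ C * v ^ 2 / ‖y‖ ^ (d + 3) * v := by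
      have b1 : ∀ η ∈ Ioc 0 v, m η ≤ C * v ^ 2 / ‖y‖ ^ (d + 3) := fun η hη => by
        refine (le_abs_self _).trans ?_
        rw [hm, abs_neg]
        refine (hup y η (by linarith) hη.1).trans ?_
        have := hη.1.le
        gcongr
        exact hη.2
      refine (setIntegral_mono_on (hI0.mono_set fun x hx => hx.1)
        (integrableOn_const measure_Ioc_lt_top.ne) measurableSet_Ioc b1).trans_eq ?_
      rw [setIntegral_const, Real.volume_real_Ioc_of_le hv.le, smul_eq_mul, sub_zero, mul_comm]
    rw [e1, e3, mul_assoc P, mul_div_assoc]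
    refine mul_le_mul_of_nonneg_left ?_ hP0.le
    have k3 : c / ‖y‖ ^ (d + 1) * (v ^ 2 / (8 * ‖y‖ ^ 2)) * (3 / 2 * ‖y‖ - ‖y‖) =
        c / 16 * v ^ 2 / ‖y‖ ^ (d + 2) := by field_simp; ring
    have k4 : C * v ^ 2 / ‖y‖ ^ (d + 3) * v ≤ c / 32 * v ^ 2 / ‖y‖ ^ (d + 2) := by
      rw [div_mul_eq_mul_div, div_le_div_iff₀ (by positivity) (by positivity), pow_succ ‖y‖ (d + 2)]
      have : C * v ≤ c / 32 * ‖y‖ := by nlinarith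
      calc C * v ^ 2 * v * ‖y‖ ^ (d + 2) = (C * v) * (v ^ 2 * ‖y‖ ^ (d + 2)) := by ring
        _ ≤ (c / 32 * ‖y‖) * (v ^ 2 * ‖y‖ ^ (d + 2)) := by gcongr
        _ = _ := by ring
    have k5 : c / 32 * v ^ 2 / ‖y‖ ^ (d + 2) = c / 16 * v ^ 2 / ‖y‖ ^ (d + 2)
        - c / 32 * v ^ 2 / ‖y‖ ^ (d + 2) := by ring
    rw [k3] at k1
    linarith
  · rw [hH v]
    exact mul_nonneg hP0.le (setIntegral_nonneg measurableSet_Ioi fun η hη => hm0 _ (hrad v η hη))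

end Far

end HalfSpaceStokes

namespace HalfSpaceStokes

/-! ### The wall shear as a functional of the time profile -/

section Shear

variable {θ r : ℝ → ℝ} {t α C₀ A : ℝ}

/-- `r` is continuous, bounded by `A`, and `r(v) = r(0) + O(v²)`. -/
structure Ramp (r : ℝ → ℝ) (A : ℝ) : Prop where
  continuous : Continuous r
  bound : ∀ v, |r v| ≤ A
  sub_le : ∀ v, 0 < v → |r v - r 0| ≤ A * v ^ 2

theorem Ramp.nonneg (h : Ramp r A) : 0 ≤ A := (abs_nonneg _).trans (h.bound 0)

theorem ramp_one : Ramp (fun _ => 1) 1 :=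
  ⟨continuous_const, fun _ => by simp, fun v _ => by simp [sq_nonneg]⟩

/-- The functional `∫ v⁻² (θ(t) r(0) - θ(t - v²) r(v)) dv`. -/
noncomputable def shear (θ r : ℝ → ℝ) (t : ℝ) : ℝ :=
  ∫ v in Ioi 0, (v ^ 2)⁻¹ * (θ t * r 0 - θ (t - v ^ 2) * r v)

/-- The contribution of `r - r(0)` to `shear`. -/
noncomputable def lag (θ r : ℝ → ℝ) (t : ℝ) : ℝ :=
  ∫ v in Ioi 0, (v ^ 2)⁻¹ * (θ (t - v ^ 2) * (r v - r 0))

theorem abs_shear_integrand_le (hθ : TimeProfile θ) (hα1 : α < 1) (hC₀ : 0 ≤ C₀)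
    (hH : HalfHolder θ α C₀) (hr : Ramp r A) : ∃ C, ∀ t < 2, ∀ v, 0 < v →
      |(v ^ 2)⁻¹ * (θ t * r 0 - θ (t - v ^ 2) * r v)| ≤ C * holderDom α v := by
  obtain ⟨B, hB, hb⟩ := hθ.exists_bound 2
  have hA := hr.nonneg
  refine ⟨2 * (C₀ * A + B * A) + (B * A + B * A), fun t ht v hv => ?_⟩
  rw [abs_mul, abs_of_nonneg (by positivity)]
  refine abs_diff_le_holderDom (A := C₀ * A + B * A) (B := B * A + B * A) hα1 (by positivity)
    (by positivity) (G := fun v => θ t * r 0 - θ (t - v ^ 2) * r v) (fun v hv => ?_)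
    (fun v hv => ?_) hv
  · have e : θ t * r 0 - θ (t - v ^ 2) * r v =
        (θ t - θ (t - v ^ 2)) * r 0 - θ (t - v ^ 2) * (r v - r 0) := by ring
    simp only [e]
    refine (abs_sub _ _).trans ?_
    rw [abs_mul, abs_mul]
    have h1 : |θ t - θ (t - v ^ 2)| * |r 0| ≤ C₀ * v ^ (1 + α) * A := by
      gcongr
      · exact hH t ht v hv
      · exact hr.bound 0
    have h2 : |θ (t - v ^ 2)| * |r v - r 0| ≤ B * (A * v ^ 2) := by
      gcongr
      · exact hb _ (by nlinarith [sq_nonneg v])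
      · exact hr.sub_le v hv
    have h3 : 0 ≤ B * A * v ^ (1 + α) := by positivity
    have h4 : 0 ≤ C₀ * A * v ^ 2 := by positivity
    nlinarith
  · refine (abs_sub _ _).trans ?_
    rw [abs_mul, abs_mul]
    gcongr
    · exact hb t ht.le
    · exact hr.bound 0
    · exact hb _ (by nlinarith [sq_nonneg v])
    · exact hr.bound v

theorem measurable_shear_integrand (hθ : TimeProfile θ) (hr : Ramp r A) (t : ℝ) :
    AEStronglyMeasurable (fun v => (v ^ 2)⁻¹ * (θ t * r 0 - θ (t - v ^ 2) * r v))
      (volume.restrict (Ioi 0)) :=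
  ((measurable_id.pow_const 2).inv).aestronglyMeasurable.mul
    (continuous_const.sub ((continuous_comp_sub_sq hθ t).mul hr.continuous)).aestronglyMeasurable

theorem integrableOn_shear (hθ : TimeProfile θ) (hα : 0 < α) (hα1 : α < 1) (hC₀ : 0 ≤ C₀)
    (hH : HalfHolder θ α C₀) (hr : Ramp r A) (ht : t < 2) :
    IntegrableOn (fun v => (v ^ 2)⁻¹ * (θ t * r 0 - θ (t - v ^ 2) * r v)) (Ioi 0) := by
  obtain ⟨C, hC⟩ := abs_shear_integrand_le hθ hα1 hC₀ hH hr
  refine ((integrable_holderDom hα).integrableOn.const_mul C).mono'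
    (measurable_shear_integrand hθ hr t) ?_
  filter_upwards [ae_volPos] with v hv using hC t ht v hv

theorem continuousOn_shear (hθ : TimeProfile θ) (hα : 0 < α) (hα1 : α < 1) (hC₀ : 0 ≤ C₀)
    (hH : HalfHolder θ α C₀) (hr : Ramp r A) : ContinuousOn (shear θ r) (Iio 2) := by
  obtain ⟨C, hC⟩ := abs_shear_integrand_le hθ hα1 hC₀ hH hr
  intro t ht
  refine ContinuousAt.continuousWithinAt ?_
  refine continuousAt_of_dominated (bound := fun v => C * holderDom α v)
    (Eventually.of_forall fun t => measurable_shear_integrand hθ hr t) ?_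
    ((integrable_holderDom hα).integrableOn.const_mul C) (Eventually.of_forall fun v => ?_)
  · filter_upwards [Iio_mem_nhds ht] with t ht
    filter_upwards [ae_volPos] with v hv using hC t ht v hv
  · have := hθ.continuous
    fun_prop

/-- Adding and subtracting `θ(t - v²) r(0)` separates the part proportional to `M` from the part
that feels the variation of `r`. -/
theorem integrableOn_lag (hθ : TimeProfile θ) (hα : 0 < α) (hα1 : α < 1) (hC₀ : 0 ≤ C₀)
    (hH : HalfHolder θ α C₀) (hr : Ramp r A) (ht : t < 2) :
    IntegrableOn (fun v => (v ^ 2)⁻¹ * (θ (t - v ^ 2) * (r v - r 0))) (Ioi 0) ∧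
      shear θ r t = r 0 * shear θ (fun _ => 1) t - lag θ r t := by
  have h1 := (integrableOn_shear hθ hα hα1 hC₀ hH ramp_one ht).const_mul (r 0)
  have h2 := integrableOn_shear hθ hα hα1 hC₀ hH hr ht
  have e : ∀ v, (v ^ 2)⁻¹ * (θ (t - v ^ 2) * (r v - r 0)) =
      r 0 * ((v ^ 2)⁻¹ * (θ t * 1 - θ (t - v ^ 2) * 1))
        - (v ^ 2)⁻¹ * (θ t * r 0 - θ (t - v ^ 2) * r v) := fun v => by ring
  simp only [lag, e]
  refine ⟨h1.sub h2, ?_⟩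
  rw [integral_sub h1 h2, integral_const_mul, shear, shear]
  ring

/-- The factor `v²` in the bound on `r(v) - r(0)` cancels the singular weight, so only the length
`b` of the interval where the profile can be nonzero matters. -/
theorem abs_lag_le {B A' b : ℝ} (hb : 0 < b) (hB : ∀ v, 0 < v → |θ (t - v ^ 2)| ≤ B)
    (h0 : ∀ v, b < v → θ (t - v ^ 2) = 0) (hA : ∀ v, 0 < v → |r v - r 0| ≤ A' * v ^ 2) :
    |lag θ r t| ≤ B * A' * b := by
  have hz : ∀ v ∈ Ioi (0 : ℝ), v ∉ Ioc 0 b → (v ^ 2)⁻¹ * (θ (t - v ^ 2) * (r v - r 0)) = 0 := by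
    intro v hv hvb
    rw [h0 v (by by_contra h; exact hvb ⟨hv, not_lt.1 h⟩)]; simp
  rw [lag, setIntegral_eq_of_subset_of_forall_sdiff_eq_zero measurableSet_Ioi
    (fun v hv => hv.1 : Ioc 0 b ⊆ Ioi 0) (fun v hv => hz v hv.1 hv.2)]
  have := norm_setIntegral_le_of_norm_le_const (μ := volume) (s := Ioc 0 b) (C := B * A')
    (f := fun v => (v ^ 2)⁻¹ * (θ (t - v ^ 2) * (r v - r 0))) measure_Ioc_lt_top fun v hv => ?_
  · rwa [Real.volume_real_Ioc_of_le hb.le, sub_zero] at this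
  · have hv := hv.1
    rw [norm_mul, norm_mul, Real.norm_of_nonneg (by positivity)]
    have hB0 := (abs_nonneg _).trans (hB v hv)
    calc (v ^ 2)⁻¹ * (‖θ (t - v ^ 2)‖ * ‖r v - r 0‖) ≤ (v ^ 2)⁻¹ * (B * (A' * v ^ 2)) := by
          gcongr
          · exact hB v hv
          · exact hA v hv
      _ = B * A' := by field_simp

/-- Substitution `s = t - v²`: the Jacobian `2v` against `(t-s)^{3/2} = v³` leaves `2v^{-2}`. -/
theorem M_eq_shear {φ : ℝ → ℝ} (h : ∀ t < 2, θ t = φ t) (ht : t < 2) :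
    M φ t = 2 * shear θ (fun _ => 1) t := by
  have himg : (fun v : ℝ => t - v ^ 2) '' Ioi 0 = Iio t := by
    ext s
    simp only [mem_image, mem_Ioi, mem_Iio]
    constructor
    · rintro ⟨v, hv, rfl⟩
      nlinarith
    · intro hs
      exact ⟨√(t - s), Real.sqrt_pos.2 (by linarith), by rw [Real.sq_sqrt (by linarith)]; ring⟩
  have hinj : InjOn (fun v : ℝ => t - v ^ 2) (Ioi 0) := by
    intro a ha b hb hab
    simp only at hab
    exact (pow_left_inj₀ (le_of_lt ha) (le_of_lt hb) two_ne_zero).1 (by linarith)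
  have hder : ∀ v ∈ Ioi (0 : ℝ), HasDerivWithinAt (fun v : ℝ => t - v ^ 2) (-(2 * v)) (Ioi 0) v := by
    intro v _
    simpa using ((hasDerivAt_pow 2 v).const_sub t).hasDerivWithinAt
  rw [M, ← himg, integral_image_eq_integral_abs_deriv_smul measurableSet_Ioi hder hinj, shear,
    ← integral_const_mul]
  refine setIntegral_congr_fun measurableSet_Ioi fun v hv => ?_
  have hv : 0 < v := hv
  have e : (v ^ 2) ^ (3 / 2 : ℝ) = v ^ 3 := by
    rw [← Real.rpow_natCast, ← Real.rpow_natCast, ← Real.rpow_mul hv.le]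
    norm_num
  simp only [smul_eq_mul, sub_sub_cancel, e]
  rw [abs_neg, abs_of_pos (by linarith), h t ht, h (t - v ^ 2) (by nlinarith)]
  field_simp

/-- A time profile that increases up to time `1` and decreases afterwards. -/
structure Hump (θ : ℝ → ℝ) : Prop extends TimeProfile θ where
  mono : ∀ s t, s ≤ t → t ≤ 1 → θ s ≤ θ t
  anti : ∀ s t, 1 ≤ s → s ≤ t → t < 2 → θ t ≤ θ s

/-- Monotonicity on the open intervals extends by continuity to the endpoint 1 and across 0, where
the profile vanishes; nonnegativity up to time 1 is part of that. -/
theorem IsTemporalProfile.hump {φ : ℝ → ℝ} (hφ : IsTemporalProfile φ) (hθ : TimeProfile θ)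
    (h : ∀ t < 2, θ t = φ t) : Hump θ := by
  have hc := hθ.continuous
  have h1 : ∀ s t, 0 < s → s ≤ t → t < 1 → θ s ≤ θ t := fun s t hs hst ht => by
    rw [h s (by linarith), h t (by linarith)]
    exact hφ.monotoneOn ⟨hs, by linarith⟩ ⟨by linarith, ht⟩ hst
  have h2 : ∀ t, 0 < t → t < 1 → 0 ≤ θ t := fun t ht ht1 => by
    have l : Tendsto θ (𝓝[>] 0) (𝓝 (θ 0)) := (hc.tendsto 0).mono_left nhdsWithin_le_nhds
    rw [hθ.eq_zero 0 le_rfl] at l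
    refine le_of_tendsto l ?_
    filter_upwards [Ioo_mem_nhdsGT ht] with s hs using h1 s t hs.1 hs.2.le ht1
  have h3 : ∀ s t, s ≤ t → t < 1 → θ s ≤ θ t := fun s t hst ht => by
    rcases le_or_gt s 0 with hs | hs
    · rw [hθ.eq_zero s hs]
      rcases le_or_gt t 0 with ht0 | ht0
      · rw [hθ.eq_zero t ht0]
      · exact h2 t ht0 ht
    · exact h1 s t hs hst ht
  refine ⟨hθ, fun s t hst ht => ?_, fun s t hs hst ht => ?_⟩
  · rcases ht.lt_or_eq with ht | rfl
    · exact h3 s t hst ht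
    · rcases hst.lt_or_eq with hs | rfl
      · refine ge_of_tendsto ((hc.tendsto 1).mono_left (nhdsWithin_le_nhds (s := Iio 1))) ?_
        filter_upwards [Ioo_mem_nhdsLT hs] with r hr using h3 s r hr.1.le hr.2
      · rfl
  · have h4 : ∀ s, 1 < s → s ≤ t → θ t ≤ θ s := fun s hs hst => by
      rw [h s (by linarith), h t ht]
      exact hφ.antitoneOn ⟨hs, by linarith⟩ ⟨by linarith, ht⟩ hst
    rcases hs.lt_or_eq with hs | rfl
    · exact h4 s hs hst
    · rcases hst.lt_or_eq with hs | rfl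
      · refine ge_of_tendsto ((hc.tendsto 1).mono_left (nhdsWithin_le_nhds (s := Ioi 1))) ?_
        filter_upwards [Ioo_mem_nhdsGT hs] with r hr using h4 r hr.1 hr.2.le
      · rfl

theorem Hump.nonneg (h : Hump θ) (ht : t ≤ 1) : 0 ≤ θ t := by
  rcases le_or_gt t 0 with h0 | h0
  · rw [h.eq_zero t h0]
  · rw [← h.eq_zero 0 le_rfl]; exact h.mono 0 t h0.le ht

/-- After time `1`, a positive value stays below all the previous ones. -/
theorem Hump.le_of_sq_le (h : Hump θ) (ht : t < 2) {v : ℝ} (hv : v ^ 2 ≤ t - 1) :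
    θ t ≤ θ (t - v ^ 2) := h.anti _ _ (by linarith) (by nlinarith [sq_nonneg v]) ht

theorem Hump.nonneg_of_nonneg (h : Hump θ) (ht : t < 2) (hθt : 0 ≤ θ t) {s : ℝ} (hs : s ≤ t) :
    0 ≤ θ s := by
  rcases le_or_gt s 1 with h1 | h1
  · exact h.nonneg h1
  · exact hθt.trans (h.anti _ _ h1.le hs ht)

/-- During the increase the shear is positive. -/
theorem Hump.shear_pos (h : Hump θ) (hα : 0 < α) (hα1 : α < 1) (hC₀ : 0 ≤ C₀)
    (hH : HalfHolder θ α C₀) (hr : Ramp r A) {A' : ℝ}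
    (hA : ∀ v, 0 < v → |r v - r 0| ≤ A' * v ^ 2) (hr0 : 4 * A' < r 0) (hA' : 0 ≤ A') (ht1 : t ≤ 1)
    (hθt : 0 < θ t) : 0 < shear θ r t := by
  have hsq : ∀ v : ℝ, t - v ^ 2 ≤ t := fun v => by linarith [sq_nonneg v]
  rw [(integrableOn_lag h.toTimeProfile hα hα1 hC₀ hH hr (by linarith)).2]
  -- Only `v` in `(1, 2]` is used: there `t - v² ≤ 0`, so the integrand is `θ(t)/v² ≥ θ(t)/4`. The
  -- rest is nonnegative by monotonicity.
  have h1 : θ t / 4 * (2 - 1) ≤ shear θ (fun _ => 1) t := by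
    refine const_mul_le_integral zero_le_one one_le_two
      (integrableOn_shear h.toTimeProfile hα hα1 hC₀ hH ramp_one (by linarith))
      (fun v hv => ?_) (fun v hv => ?_)
    · refine mul_nonneg (by positivity) ?_
      linarith [h.mono _ _ (hsq v) ht1]
    · rw [h.eq_zero (t - v ^ 2) (by nlinarith [hv.1]), zero_mul, sub_zero, mul_one,
        div_eq_mul_inv, mul_comm]
      have := hv.1
      gcongr
      nlinarith [hv.2]
  have h2 : |lag θ r t| ≤ θ t * A' * 1 := by
    refine abs_lag_le one_pos (fun v _ => ?_) (fun v hv => h.eq_zero _ (by nlinarith)) hA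
    rw [abs_of_nonneg (h.nonneg ((hsq v).trans ht1))]
    exact h.mono _ _ (hsq v) ht1
  have h3 := le_abs_self (lag θ r t)
  have h4 : r 0 * (θ t / 4) ≤ r 0 * shear θ (fun _ => 1) t :=
    mul_le_mul_of_nonneg_left (by linarith) (by linarith)
  nlinarith

/-- While `θ(t) > 0`, the lag is positive. -/
theorem Hump.lag_pos (h : Hump θ) (hα : 0 < α) (hα1 : α < 1) (hC₀ : 0 ≤ C₀)
    (hH : HalfHolder θ α C₀) (hr : Ramp r A) {c : ℝ} (hc : 0 < c)
    (hlow : ∀ v, 0 < v → v ≤ 2 → c * v ^ 2 ≤ r v - r 0) (ht : t < 2) (hθt : 0 < θ t) :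
    0 < lag θ r t := by
  have hcont : Tendsto (fun v => θ (t - v ^ 2)) (𝓝 0) (𝓝 (θ t)) := by
    have := (continuous_comp_sub_sq h.toTimeProfile t).tendsto 0
    simpa using this
  obtain ⟨η, hη, hη'⟩ := Metric.eventually_nhds_iff.1
    (hcont.eventually (lt_mem_nhds (half_lt_self hθt)))
  have hm : 0 < min (η / 2) 1 := by positivity
  refine lt_of_lt_of_le (b := c * (θ t / 2) * (min (η / 2) 1 - 0)) (by positivity)
    (const_mul_le_integral le_rfl hm.le
      (integrableOn_lag h.toTimeProfile hα hα1 hC₀ hH hr ht).1 (fun v hv => ?_) (fun v hv => ?_))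
  · rcases le_or_gt v 2 with hv2 | hv2
    · have h1 := hlow v hv hv2
      have h2 := h.nonneg_of_nonneg ht hθt.le (s := t - v ^ 2) (by linarith [sq_nonneg v])
      have h3 : 0 ≤ r v - r 0 := le_trans (by positivity) h1
      positivity
    · rw [h.eq_zero_of_two_le ht.le hv2.le]; simp
  · have hv0 := hv.1
    have h1 := hlow v hv0 (hv.2.trans ((min_le_right _ _).trans one_le_two))
    have h2 : θ t / 2 < θ (t - v ^ 2) := hη' (by
      rw [Real.dist_eq, sub_zero, abs_of_pos hv0]
      linarith [hv.2.trans (min_le_left (η / 2) 1)])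
    calc c * (θ t / 2) = (v ^ 2)⁻¹ * (θ t / 2 * (c * v ^ 2)) := by field_simp
      _ ≤ _ := mul_le_mul_of_nonneg_left
        (mul_le_mul h2.le h1 (by positivity) (by linarith)) (by positivity)

/-- Once `θ` has become nonpositive, so has the functional `M`. -/
theorem Hump.shear_one_neg (h : Hump θ) (hα : 0 < α) (hα1 : α < 1) (hC₀ : 0 ≤ C₀)
    (hH : HalfHolder θ α C₀) (h1 : 0 < θ 1) (ht1 : 1 ≤ t) (ht : t < 2) (hθt : θ t ≤ 0) :
    shear θ (fun _ => 1) t < 0 := by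
  have ht1' : 1 < t := by
    rcases ht1.lt_or_eq with h2 | rfl
    · exact h2
    · linarith
  set v₀ := √(t - 1) with hv₀
  have hv0 : 0 < v₀ := Real.sqrt_pos.2 (by linarith)
  have hv1 : v₀ ^ 2 = t - 1 := Real.sq_sqrt (by linarith)
  have hle : ∀ v, θ t ≤ θ (t - v ^ 2) := fun v => by
    rcases le_or_gt (v ^ 2) (t - 1) with h2 | h2
    · exact h.le_of_sq_le ht h2
    · exact hθt.trans (h.nonneg (by linarith))
  have hcont := (continuous_comp_sub_sq h.toTimeProfile t).tendsto v₀
  simp only [hv1, sub_sub_cancel] at hcont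
  obtain ⟨η, hη, hη'⟩ := Metric.eventually_nhds_iff.1
    (hcont.eventually (lt_mem_nhds (half_lt_self h1)))
  -- Strict negativity comes from `v` just above `√(t-1)`, that is, from times just before the
  -- maximum at 1, where the profile exceeds `θ(1)/2 > 0 ≥ θ(t)`.
  set b := v₀ + min (η / 2) 1 with hb
  have hm : 0 < min (η / 2) 1 := by positivity
  have key := const_mul_le_integral (F := fun v => -((v ^ 2)⁻¹ * (θ t * 1 - θ (t - v ^ 2) * 1)))
    (a := v₀) (b := b) (c := (b ^ 2)⁻¹ * (θ 1 / 2)) hv0.le (by linarith)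
    (integrableOn_shear h.toTimeProfile hα hα1 hC₀ hH ramp_one ht).neg (fun v hv => ?_)
    (fun v hv => ?_)
  · rw [integral_neg] at key
    change _ ≤ -shear θ (fun _ => 1) t at key
    have : 0 < (b ^ 2)⁻¹ * (θ 1 / 2) * (b - v₀) := by
      have : 0 < b - v₀ := by rw [hb]; linarith
      positivity
    linarith
  · rw [mul_one, mul_one, ← mul_neg, neg_sub]
    exact mul_nonneg (by positivity) (sub_nonneg.2 (hle v))
  · rw [mul_one, mul_one, ← mul_neg, neg_sub]
    have h2 : θ 1 / 2 < θ (t - v ^ 2) := hη' (by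
      rw [Real.dist_eq, abs_of_pos (by linarith [hv.1])]
      have := hv.2
      rw [hb] at this
      linarith [min_le_left (η / 2) 1])
    have hv' : 0 < v := hv0.trans hv.1
    have := hv.2
    refine mul_le_mul (inv_anti₀ (by positivity) (by gcongr)) (by linarith) (by linarith)
      (by positivity)

/-- On a compact time interval either `θ` or `-M` is bounded below. -/
theorem Hump.exists_dichotomy (h : Hump θ) (hα : 0 < α) (hα1 : α < 1) (hC₀ : 0 ≤ C₀)
    (hH : HalfHolder θ α C₀) (h1 : 0 < θ 1) {t₀ : ℝ} (ht1 : 1 ≤ t₀) (ht₀ : t₀ < 2) :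
    ∃ δ, 0 < δ ∧ ∀ t ∈ Icc 1 t₀, δ ≤ θ t ∨ shear θ (fun _ => 1) t ≤ -δ := by
  have hc : ContinuousOn (fun t => max (θ t) (-shear θ (fun _ => 1) t)) (Icc 1 t₀) :=
    h.continuous.continuousOn.sup ((continuousOn_shear h.toTimeProfile hα hα1 hC₀ hH
      ramp_one).neg.mono fun t ht => ht.2.trans_lt ht₀)
  obtain ⟨t, ht, hmin⟩ := isCompact_Icc.exists_isMinOn (nonempty_Icc.2 ht1) hc
  refine ⟨max (θ t) (-shear θ (fun _ => 1) t), ?_, fun s hs => ?_⟩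
  · rcases lt_or_ge 0 (θ t) with h2 | h2
    · exact lt_max_of_lt_left h2
    · exact lt_max_of_lt_right (by
        linarith [h.shear_one_neg hα hα1 hC₀ hH h1 ht.1 (ht.2.trans_lt ht₀) h2])
  · have h3 : max (θ t) (-shear θ (fun _ => 1) t) ≤ max (θ s) (-shear θ (fun _ => 1) s) := hmin hs
    rcases le_max_iff.1 h3 with h2 | h2
    · exact Or.inl h2
    · exact Or.inr (by linarith)

end Shear

end HalfSpaceStokes

namespace HalfSpaceStokes

/-! ### The tangential velocity near the wall -/

section NearWall

variable {d : ℕ} {f : Bdry d → ℝ} {θ : ℝ → ℝ} {t α C₀ : ℝ} {y : Bdry d} {i : Fin d}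

theorem nonneg_of_deriv {G G' : ℝ → ℝ} {ε : ℝ} (h : ∀ x ∈ Ioo 0 ε, HasDerivAt G (G' x) x)
    (h0 : ∀ x ∈ Ioo 0 ε, 0 ≤ G' x) (hG : Tendsto G (𝓝[>] 0) (𝓝 0)) {x : ℝ} (hx : x ∈ Ioo 0 ε) :
    0 ≤ G x := by
  have hm : MonotoneOn G (Ioo 0 ε) := by
    refine monotoneOn_of_deriv_nonneg (convex_Ioo 0 ε)
      (fun x hx => (h x hx).continuousAt.continuousWithinAt) ?_ ?_
    · rw [interior_Ioo]
      exact fun x hx => (h x hx).differentiableAt.differentiableWithinAt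
    · rw [interior_Ioo]
      exact fun x hx => by rw [(h x hx).deriv]; exact h0 x hx
  refine le_of_tendsto hG ?_
  filter_upwards [Ioo_mem_nhdsGT hx.1] with s hs using hm ⟨hs.1, hs.2.trans hx.2⟩ hx hs.2.le

theorem pos_of_deriv {G G' : ℝ → ℝ} {ε : ℝ} (h : ∀ x ∈ Ioo 0 ε, HasDerivAt G (G' x) x)
    (h0 : ∀ x ∈ Ioo 0 ε, 0 < G' x) (hG : Tendsto G (𝓝[>] 0) (𝓝 0)) {x : ℝ} (hx : x ∈ Ioo 0 ε) :
    0 < G x := by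
  have hm : StrictMonoOn G (Ioo 0 ε) := by
    refine strictMonoOn_of_deriv_pos (convex_Ioo 0 ε)
      (fun x hx => (h x hx).continuousAt.continuousWithinAt) ?_
    rw [interior_Ioo]
    exact fun x hx => by rw [(h x hx).deriv]; exact h0 x hx
  have hx2 : x / 2 ∈ Ioo 0 ε := ⟨by linarith [hx.1], by linarith [hx.1, hx.2]⟩
  exact (nonneg_of_deriv h (fun x hx => (h0 x hx).le) hG hx2).trans_lt
    (hm hx2 hx (by linarith [hx.1]))

theorem HasGrad.hasDerivAt {F : Space d → ℝ} {a : Fin d → Space d → ℝ} {b : Space d → ℝ}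
    (h : HasGrad F a b) (y : Bdry d) {x : ℝ} (hx : 0 < x) :
    HasDerivAt (fun x => F (y, x)) (b (y, x)) x := by
  have h1 : HasDerivAt (fun x : ℝ => ((y, x) : Space d)) (normal d) x :=
    (hasDerivAt_const x y).prodMk (hasDerivAt_id x)
  have := (h (y, x) hx).comp_hasDerivAt x h1
  rwa [gradL_normal] at this

/-- The harmonic and caloric identities recombine the derivative into one second-order caloric term,
small away from the support, and a tangential block, which vanishes at the wall. -/
theorem hasDerivAt_regPart (hd : 1 ≤ d) (hθ : TimeProfile θ) (ht : t ≤ 2)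
    (hf : HeatDecay (d + 1) f) (y : Bdry d) {x : ℝ} (hx : 0 < x) :
    HasDerivAt (fun x => regPart θ f t (y, x))
      (potC θ t 2 f (y, x) - tang θ (prim θ) t 0 (lap f) (lap (lap f)) (y, x)) x := by
  have hf' := hf.toIsBump
  have h1 := lap_heatDecay hf'
  have h2 := lap_heatDecay hf'.lap
  have hp : ((y, x) : Space d) ∈ halfSpace d := hx
  have e1 := potA_harmonic (j := 0) (by omega) (admA hd 2) hf (admA hd 0) h1 hp
  have e2 := potA_harmonic (j := 0) (by omega) (admA hd 2) h1 (admA hd 0) h2 hp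
  have e3 := potC_heat (j := 0) (by omega) hf'.lap hθ ht hp
  refine (((((((hasGrad_potA hd hf 1).hasDerivAt y hx).const_mul (θ t)).sub
    (((hasGrad_potA hd h1 1).hasDerivAt y hx).const_mul (prim θ t))).neg.sub
    (((hasGrad_potP hd hθ h1 0).hasDerivAt y hx).sub
      ((hasGrad_potP hd hθ.prim h2 0).hasDerivAt y hx))).add
    (((hasGrad_potD hd hθ h1 0).hasDerivAt y hx).sub
      ((hasGrad_potD hd hθ.prim h2 0).hasDerivAt y hx))).add
    (((hasGrad_potC hθ hf' 1).hasDerivAt y hx).sub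
      ((hasGrad_potC hθ.prim hf'.lap 1).hasDerivAt y hx))).congr_deriv ?_
  rw [tang]
  simp only [zero_add, Nat.reduceAdd] at e1 e2 e3 ⊢
  linear_combination -θ t * e1 + prim θ t * e2 - e3

/-- Beyond the support all local terms `f` and `Δ'f` vanish, and the remaining potentials cancel in
pairs at the wall. Hence the shear is carried entirely by the singular block. -/
theorem tendsto_regPart (hd : 1 ≤ d) (hθ : TimeProfile θ) (ht : t ≤ 2) (hf : IsBump f)
    (hy : 1 ≤ ‖y‖) : Tendsto (fun x => regPart θ f t (y, x)) (𝓝[>] 0) (𝓝 0) := by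
  have h1 := lap_heatDecay hf
  have h2 := lap_heatDecay hf.lap
  have l := (((((tendsto_potA_one hf y).const_mul (θ t)).sub
    ((tendsto_potA_one hf.lap y).const_mul (prim θ t))).neg.sub
    ((tendsto_potP_sub_potD_zero (t := t) hd hθ h1 y).sub
      (tendsto_potP_sub_potD_zero (t := t) hd hθ.prim h2 y))).add
    ((tendsto_potC_one hθ ht hf y).sub (tendsto_potC_one hθ.prim ht hf.lap y)))
  rw [hf.eq_zero hy, hf.lap.eq_zero hy] at l
  simp only [neg_zero, mul_zero, sub_zero, add_zero] at l
  refine l.congr fun x => ?_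
  rw [regPart]; ring

theorem exists_abs_potC_two_le (hθ : TimeProfile θ) (hf : IsBump f) (i : Fin d) : ∃ C, 0 ≤ C ∧
    ∀ t ≤ 2, ∀ (y : Bdry d) (x : ℝ), 2 ≤ ‖y‖ →
      |potC θ t 2 (pd i f) (y, x)| ≤ C / ‖y‖ ^ (d + 3) := by
  obtain ⟨B, hB, hb⟩ := hθ.exists_bound 2
  obtain ⟨C1, hC1, h1⟩ := abs_ker_two_le
  obtain ⟨C2, hC2, h2⟩ := exists_abs_heat_pd_le hf i
  refine ⟨B * C1 * C2 * 2, by positivity, fun t ht y x hy => ?_⟩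
  have key := norm_integral_le_of_norm_le_const (μ := volTwo) (C := B * C1 * C2 / ‖y‖ ^ (d + 3))
    (f := potInt (wC θ t) id id 2 (pd i f) (y, x)) (by
      filter_upwards [ae_volTwo] with v hv
      have hv := hv.1
      simp only [potInt, wC, timeWeight, id, one_mul]
      rw [norm_mul, norm_mul]
      calc ‖θ (t - v ^ 2)‖ * ‖ker 2 x v‖ * ‖heat (pd i f) v y‖
          ≤ B * (C1 * (v ^ 2)⁻¹) * (C2 * v ^ 2 / ‖y‖ ^ (d + 3)) := by
            gcongr
            · exact hb _ (by nlinarith [sq_nonneg v])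
            · exact h1 x v hv
            · exact h2 y v hy hv
        _ = _ := by field_simp)
  have e : volTwo.real univ = 2 := by
    rw [measureReal_restrict_apply_univ, Real.volume_real_Ioo_of_le (by norm_num)]; norm_num
  rw [e] at key
  refine key.trans_eq ?_
  ring

theorem hasDerivAt_solT_normal (hd : 1 ≤ d) (hθ : TimeProfile θ) (ht : t ≤ 2) (hf : IsBump f)
    (i : Fin d) (y : Bdry d) {x : ℝ} (hx : 0 < x) :
    HasDerivAt (fun x => solT θ f i t (y, x))
      (-potD θ t 2 (pd i f) (y, x) + regPart θ (pd i f) t (y, x)) x := by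
  have h := (hasGrad_solT hd hθ hf i t).hasDerivAt y hx
  rwa [pd_lap i hf, tang_one_eq hd hθ ht (hf.heatDecay_pd i) hx] at h

theorem tendsto_solT (hd : 1 ≤ d) (hθ : TimeProfile θ) (ht : t ≤ 2) (hf : IsBump f) (i : Fin d)
    (y : Bdry d) : Tendsto (fun x => solT θ f i t (y, x)) (𝓝[>] 0) (𝓝 0) :=
  tendsto_tang hd hθ hθ.prim ht (hf.heatDecay_pd i) (hf.lap.heatDecay_pd i) y

theorem tendsto_deriv_solT (hd : 1 ≤ d) (hθ : TimeProfile θ) (hα : 0 < α) (hα1 : α < 1)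
    (hC₀ : 0 ≤ C₀) (hH : HalfHolder θ α C₀) (ht : t < 2) (hf : IsBump f) (i : Fin d)
    (hy : 1 ≤ ‖y‖) :
    Tendsto (fun x => -potD θ t 2 (pd i f) (y, x) + regPart θ (pd i f) t (y, x)) (𝓝[>] 0)
      (𝓝 (wallShear θ (pd i f) t y)) := by
  have := (tendsto_potD_two hd hθ hα hα1 hC₀ hH (hf.heatDecay_pd i) ht y).add
    (tendsto_regPart hd hθ ht.le (hf.pd i) hy)
  rwa [add_zero] at this

theorem exists_solT_pos (hd : 1 ≤ d) (hθ : TimeProfile θ) (hα : 0 < α) (hα1 : α < 1)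
    (hC₀ : 0 ≤ C₀) (hH : HalfHolder θ α C₀) (ht : t < 2) (hf : IsBump f) (hy : 1 ≤ ‖y‖)
    (hw : 0 < wallShear θ (pd i f) t y) :
    ∃ ε > 0, ∀ x, 0 < x → x < ε → 0 < solT θ f i t (y, x) := by
  obtain ⟨ε, hε, h⟩ := mem_nhdsGT_iff_exists_Ioo_subset.1
    ((tendsto_deriv_solT hd hθ hα hα1 hC₀ hH ht hf i hy).eventually (lt_mem_nhds hw))
  exact ⟨ε, hε, fun x hx hxε => pos_of_deriv (G := fun x => solT θ f i t (y, x))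
    (fun x hx => hasDerivAt_solT_normal hd hθ ht.le hf i y hx.1) (fun x hx => h hx)
    (tendsto_solT hd hθ ht.le hf i y) ⟨hx, hxε⟩⟩

theorem exists_solT_neg (hd : 1 ≤ d) (hθ : TimeProfile θ) (hα : 0 < α) (hα1 : α < 1)
    (hC₀ : 0 ≤ C₀) (hH : HalfHolder θ α C₀) (ht : t < 2) (hf : IsBump f) (hy : 1 ≤ ‖y‖)
    (hw : wallShear θ (pd i f) t y < 0) :
    ∃ ε > 0, ∀ x, 0 < x → x < ε → solT θ f i t (y, x) < 0 := by
  obtain ⟨ε, hε, h⟩ := mem_nhdsGT_iff_exists_Ioo_subset.1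
    ((tendsto_deriv_solT hd hθ hα hα1 hC₀ hH ht hf i hy).eventually (gt_mem_nhds hw))
  refine ⟨ε, hε, fun x hx hxε => neg_pos.1 (pos_of_deriv (G := fun x => -solT θ f i t (y, x))
    (fun x hx => (hasDerivAt_solT_normal hd hθ ht.le hf i y hx.1).neg)
    (fun x hx => neg_pos.2 (h hx)) ?_ ⟨hx, hxε⟩)⟩
  simpa using (tendsto_solT hd hθ ht.le hf i y).neg

theorem wallShear_eq (y : Bdry d) :
    wallShear θ f t y = (√Real.pi)⁻¹ * shear θ (fun v => -halfInt f v y) t := by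
  rw [wallShear, shear, one_div, ← mul_neg, ← integral_neg]
  congr 2
  funext v
  rw [defect]; ring

theorem ramp_halfInt (hd : 1 ≤ d) (hf : HeatDecay (d + 1) f) (y : Bdry d) :
    ∃ A, Ramp (fun v => -halfInt f v y) A := by
  obtain ⟨C, hC, h⟩ := abs_halfInt_le hd hf
  obtain ⟨C', hC', h'⟩ := abs_halfInt_sub_le hd hf
  have hy : ∀ (e : ℕ) (C : ℝ), 0 ≤ C → C / (1 + ‖y‖) ^ e ≤ C := fun e C hC =>
    div_le_self hC (one_le_pow₀ (by linarith [norm_nonneg y]))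
  refine ⟨C + C', (continuous_halfInt hd hf y).neg, fun v => ?_, fun v hv => ?_⟩
  · rw [abs_neg]
    linarith [(h v y).trans (hy _ _ hC)]
  · rw [neg_sub_neg, abs_sub_comm]
    refine (h' v hv y).trans ((hy _ _ (by positivity)).trans ?_)
    gcongr
    linarith

/-- With `s = x²/(4v²)` the sum is `π^{-1/2} v^{-2} (1 - (1 - 2s) e^{-s})`. Elementary bounds on the
exponential place the bracket between 0 and `4s`, and above 1 once `s ≥ 1`. This sum is the
deviation of the kernel from its value at the wall. -/
theorem ker_two_add_nonneg {x v : ℝ} (hv : 0 < v) :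
    0 ≤ ker 2 x v + (√Real.pi)⁻¹ * (v ^ 2)⁻¹ ∧
    ker 2 x v + (√Real.pi)⁻¹ * (v ^ 2)⁻¹ ≤ (√Real.pi)⁻¹ * x ^ 2 * (v ^ 4)⁻¹ ∧
    (2 * v ≤ x → (√Real.pi)⁻¹ * (v ^ 2)⁻¹ ≤ ker 2 x v + (√Real.pi)⁻¹ * (v ^ 2)⁻¹) := by
  set s := x ^ 2 / (4 * v ^ 2) with hs
  have hs0 : 0 ≤ s := by positivity
  set E := Real.exp (-s) with hE
  have e : ker 2 x v + (√Real.pi)⁻¹ * (v ^ 2)⁻¹ =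
      (√Real.pi)⁻¹ * (v ^ 2)⁻¹ * (1 - (1 - 2 * s) * E) := by
    have h1 : -(1 / 4) * (x / v) ^ 2 = -s := by rw [hs]; field_simp
    rw [ker_two, ker_zero, h1, ← hE, hs]
    have : √Real.pi ≠ 0 := by positivity
    field_simp
    ring
  have hP : 0 ≤ (√Real.pi)⁻¹ * (v ^ 2)⁻¹ := by positivity
  have hE0 : 0 < E := Real.exp_pos _
  have hE1 : E ≤ 1 := Real.exp_le_one_iff.2 (by linarith)
  have hE2 : 1 - s ≤ E := by have := Real.add_one_le_exp (-s); linarith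
  rw [e]
  refine ⟨mul_nonneg hP (by nlinarith), ?_, fun h => ?_⟩
  · have h1 : (√Real.pi)⁻¹ * x ^ 2 * (v ^ 4)⁻¹ = (√Real.pi)⁻¹ * (v ^ 2)⁻¹ * (4 * s) := by
      rw [hs]; field_simp
    rw [h1]
    refine mul_le_mul_of_nonneg_left ?_ hP
    nlinarith
  · have h1 : 1 ≤ s := by
      rw [hs, le_div_iff₀ (by positivity)]
      nlinarith
    refine le_mul_of_one_le_right hP ?_
    nlinarith

/-- A lower bound for the singular part of the normal derivative near the wall, while the profile
decreases but is still positive. -/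
theorem exists_le_neg_potD_two (hd : 1 ≤ d) (h : Hump θ) (hα : 0 < α) (hα1 : α < 1)
    (hC₀ : 0 ≤ C₀) (hH : HalfHolder θ α C₀) (hf : HeatDecay (d + 1) f) (ht1 : 1 < t) (ht : t < 2)
    (hθt : 0 < θ t) {c : ℝ} (hc : 0 ≤ c)
    (hlow : ∀ v, 0 < v → v ≤ 2 → c * v ^ 2 ≤ halfInt f 0 y - halfInt f v y)
    (hpos : ∀ v, 0 < v → 0 ≤ -halfInt f v y) : ∃ C, ∀ x, 0 < x → x ≤ 2 * √(t - 1) →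
      wallShear θ f t y + (√Real.pi)⁻¹ * (θ t * c) / 4 * x - C * x ^ 2 ≤ -potD θ t 2 f (y, x) := by
  obtain ⟨A, hr⟩ := ramp_halfInt hd hf y
  obtain ⟨B, hB, hb⟩ := h.exists_bound 2
  set τ := √(t - 1) with hτ
  have hτ0 : 0 < τ := Real.sqrt_pos.2 (by linarith)
  have hτ2 : τ ^ 2 = t - 1 := Real.sq_sqrt (by linarith)
  set P := (√Real.pi)⁻¹ with hP
  have hP0 : 0 < P := by positivity
  have hA := hr.nonneg
  have hbd : ∀ v, |defect θ f t y v| ≤ 2 * (B * A) := fun v => by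
    have h1 := hr.bound 0
    have h2 := hr.bound v
    rw [abs_neg] at h1 h2
    refine (abs_sub _ _).trans ?_
    rw [abs_mul, abs_mul, two_mul]
    gcongr
    · exact hb t ht.le
    · exact hb _ (by nlinarith [sq_nonneg v])
  have iD : IntegrableOn (fun v => (v ^ 2)⁻¹ * defect θ f t y v) (Ioi 0) :=
    (integrableOn_shear h.toTimeProfile hα hα1 hC₀ hH hr ht).neg.congr_fun
      (fun v _ => by simp only [Pi.neg_apply, defect]; ring) measurableSet_Ioi
  set Q : ℝ → ℝ := (Ioi τ).indicator fun v => v ^ (-4 : ℝ) with hQ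
  have iQ : IntegrableOn Q (Ioi 0) :=
    ((integrableOn_Ioi_rpow_of_lt (by norm_num) hτ0).integrable_indicator
      measurableSet_Ioi).integrableOn
  -- The quadratic error collects `v > √(t-1)`, where `t - v²` precedes the maximum and the sign of
  -- the increment is unknown; there the kernel deviation is at most of order `x² v^{-4}`.
  refine ⟨P * (2 * (B * A)) * ∫ v in Ioi 0, Q v, fun x hx hxτ => ?_⟩
  obtain ⟨C', hC', hk⟩ := abs_ker_two_le
  have iK : IntegrableOn (fun v => ker 2 x v * defect θ f t y v) (Ioi 0) := by
    have h1 : IntegrableOn (fun v => v ^ 2 * ker 2 x v * ((v ^ 2)⁻¹ * defect θ f t y v))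
        (Ioi 0) := iD.bdd_mul (f := fun v => v ^ 2 * ker 2 x v) (c := C')
      (((measurable_id.pow_const 2).mul ((measurable_ker 2).comp
        (measurable_const.prodMk measurable_id))).aestronglyMeasurable) (by
        filter_upwards [ae_volPos] with v hv
        rw [norm_mul, Real.norm_of_nonneg (by positivity)]
        calc v ^ 2 * ‖ker 2 x v‖ ≤ v ^ 2 * (C' * (v ^ 2)⁻¹) := by gcongr; exact hk x v hv
          _ = C' := by field_simp)
    refine h1.congr_fun (fun v hv => ?_) measurableSet_Ioi
    have hv : 0 < v := hv
    simp only
    field_simp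
  -- For these `v` both effects have the same sign: the earlier profile value is no smaller than
  -- `θ(t)`, and `-halfInt` increases from `v = 0`.
  have hdef : ∀ v, 0 < v → v ≤ τ → θ t * c * v ^ 2 ≤ defect θ f t y v := fun v hv hvτ => by
    have hv2 : v ^ 2 ≤ t - 1 := by rw [← hτ2]; gcongr
    have h1 := h.le_of_sq_le ht hv2
    have h2 := hlow v hv (by nlinarith)
    have h3 := mul_le_mul_of_nonneg_right h1 (hpos v hv)
    have h4 := mul_le_mul_of_nonneg_left h2 hθt.le
    rw [defect]
    nlinarith
  have iS : IntegrableOn (fun v => ker 2 x v * defect θ f t y v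
      + P * ((v ^ 2)⁻¹ * defect θ f t y v)) (Ioi 0) := iK.add (iD.const_mul P)
  -- The linear gain comes from `v` between `x/4` and `x/2`, an interval of length `x/4` on which
  -- the kernel deviation is at least `π^{-1/2} v^{-2}` and cancels the `v²` in the lower bound of
  -- the increment.
  have key := const_mul_le_integral (F := fun v => (ker 2 x v * defect θ f t y v
      + P * ((v ^ 2)⁻¹ * defect θ f t y v)) + P * (2 * (B * A)) * x ^ 2 * Q v)
    (a := x / 4) (b := x / 2) (c := P * (θ t * c)) (by positivity) (by linarith)
    (iS.add (iQ.const_mul _)) (fun v hv => ?_) (fun v hv => ?_)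
  · rw [integral_add iS (iQ.const_mul _), integral_add iK (iD.const_mul P),
      integral_const_mul, integral_const_mul] at key
    have e1 := potD_two_eq hd h.toTimeProfile ht.le hf (p := (y, x)) hx
    simp only at e1
    rw [wallShear, one_div, e1, neg_neg]
    have e2 : P * (θ t * c) * (x / 2 - x / 4) = P * (θ t * c) / 4 * x := by ring
    rw [e2] at key
    linarith
  · obtain ⟨k1, k2, -⟩ := ker_two_add_nonneg (x := x) hv
    have e : ker 2 x v * defect θ f t y v + P * ((v ^ 2)⁻¹ * defect θ f t y v) =
        (ker 2 x v + P * (v ^ 2)⁻¹) * defect θ f t y v := by ring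
    simp only [e]
    rcases le_or_gt v τ with hvτ | hvτ
    · have h1 : 0 ≤ defect θ f t y v := le_trans (by positivity) (hdef v hv hvτ)
      have h2 : Q v = 0 := indicator_of_notMem (by simpa using hvτ) _
      rw [h2, mul_zero, add_zero]
      exact mul_nonneg k1 h1
    · have h2 : Q v = (v ^ 4)⁻¹ := by
        rw [hQ, indicator_of_mem (show v ∈ Ioi τ from hvτ), Real.rpow_neg hv.le]; norm_cast
      rw [h2]
      have h3 := neg_le_of_abs_le (hbd v)
      have h4 : (ker 2 x v + P * (v ^ 2)⁻¹) * (2 * (B * A)) ≤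
          P * x ^ 2 * (v ^ 4)⁻¹ * (2 * (B * A)) := by gcongr
      have h5 := mul_le_mul_of_nonneg_left h3 k1
      linarith
  · have hv0 : 0 < v := lt_of_le_of_lt (by positivity) hv.1
    obtain ⟨k1, -, k3⟩ := ker_two_add_nonneg (x := x) hv0
    have k4 := k3 (by linarith [hv.2])
    have h1 := hdef v hv0 (by linarith [hv.2])
    have h2 : 0 ≤ Q v := indicator_nonneg (fun v hv => Real.rpow_nonneg
      (hτ0.le.trans (le_of_lt hv)) _) v
    have h3 : 0 ≤ P * (2 * (B * A)) * x ^ 2 * Q v := by positivity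
    have h4 : P * (v ^ 2)⁻¹ * (θ t * c * v ^ 2) ≤
        (ker 2 x v + P * (v ^ 2)⁻¹) * defect θ f t y v :=
      mul_le_mul k4 h1 (by positivity) k1
    have h5 : P * (v ^ 2)⁻¹ * (θ t * c * v ^ 2) = P * (θ t * c) := by field_simp
    linarith

/-- The tangential velocity is positive near the wall also when the wall shear vanishes. -/
theorem exists_solT_pos_of_nonneg (hd : 1 ≤ d) (h : Hump θ) (hα : 0 < α) (hα1 : α < 1)
    (hC₀ : 0 ≤ C₀) (hH : HalfHolder θ α C₀) (hf : IsBump f) (ht1 : 1 < t) (ht : t < 2)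
    (hy : 1 ≤ ‖y‖) (hθt : 0 < θ t) {c K : ℝ} (hc : 0 < c)
    (hlow : ∀ v, 0 < v → v ≤ 2 → c * v ^ 2 ≤ halfInt (pd i f) 0 y - halfInt (pd i f) v y)
    (hpos : ∀ v, 0 < v → 0 ≤ -halfInt (pd i f) v y)
    (hK : ∀ x, |potC θ t 2 (pd i f) (y, x)| ≤ K) (hKc : K < (√Real.pi)⁻¹ * (θ t * c) / 16)
    (hw : 0 ≤ wallShear θ (pd i f) t y) :
    ∃ ε > 0, ∀ x, 0 < x → x < ε → 0 < solT θ f i t (y, x) := by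
  set k := (√Real.pi)⁻¹ * (θ t * c) / 4 with hk
  have hk0 : 0 < k := by positivity
  have hθ := h.toTimeProfile
  have hfi := hf.heatDecay_pd i
  obtain ⟨C, hC⟩ := exists_le_neg_potD_two hd h hα hα1 hC₀ hH hfi ht1 ht hθt hc.le hlow hpos
  have hτ0 : 0 < √(t - 1) := Real.sqrt_pos.2 (by linarith)
  have htang := tendsto_tang (t := t) hd hθ hθ.prim ht.le (lap_heatDecay hfi.toIsBump)
    (lap_heatDecay hfi.lap) y
  obtain ⟨ε₁, hε₁, h₁⟩ := mem_nhdsGT_iff_exists_Ioo_subset.1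
    (htang.eventually (gt_mem_nhds (show (0 : ℝ) < k / 4 by positivity)))
  have hε₁ : 0 < ε₁ := hε₁
  -- The regular part vanishes at the wall and its derivative is at least `-k/2` nearby, so it can
  -- consume at most half of the linear gain `k x`.
  have hreg : ∀ x ∈ Ioo 0 ε₁, 0 ≤ regPart θ (pd i f) t (y, x) + k / 2 * x := fun x hx => by
    refine nonneg_of_deriv (G := fun x => regPart θ (pd i f) t (y, x) + k / 2 * x)
      (G' := fun x => potC θ t 2 (pd i f) (y, x)
        - tang θ (prim θ) t 0 (lap (pd i f)) (lap (lap (pd i f))) (y, x) + k / 2)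
      (fun x hx => ?_) (fun x hx => ?_) ?_ hx
    · refine (hasDerivAt_regPart hd hθ ht.le hfi y hx.1).add ?_
      simpa using (hasDerivAt_id x).const_mul (k / 2)
    · have h2 := neg_le_of_abs_le (hK x)
      have h3 : tang θ (prim θ) t 0 (lap (pd i f)) (lap (lap (pd i f))) (y, x) < k / 4 := h₁ hx
      have h4 : K < k / 4 := by rw [hk]; linarith
      linarith
    · have l : Tendsto (fun x : ℝ => k / 2 * x) (𝓝[>] 0) (𝓝 0) := by
        have : Continuous fun x : ℝ => k / 2 * x := by fun_prop
        simpa using (this.tendsto 0).mono_left (nhdsWithin_le_nhds (s := Ioi 0))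
      simpa using (tendsto_regPart hd hθ ht.le (hf.pd i) hy).add l
  set ε := min (min ε₁ (2 * √(t - 1))) (k / (4 * (|C| + 1))) with hε
  have hε0 : 0 < ε := by positivity
  refine ⟨ε, hε0, fun x hx hxε => pos_of_deriv (G := fun x => solT θ f i t (y, x)) (ε := ε)
    (fun x hx => hasDerivAt_solT_normal hd hθ ht.le hf i y hx.1) (fun x hx => ?_)
    (tendsto_solT hd hθ ht.le hf i y) ⟨hx, hxε⟩⟩
  have hx0 := hx.1
  have a1 : x < ε₁ := hx.2.trans_le ((min_le_left _ _).trans (min_le_left _ _))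
  have a2 : x < 2 * √(t - 1) := hx.2.trans_le ((min_le_left _ _).trans (min_le_right _ _))
  have a3 : x < k / (4 * (|C| + 1)) := hx.2.trans_le (min_le_right _ _)
  rw [lt_div_iff₀ (by positivity)] at a3
  have b1 := hreg x ⟨hx0, a1⟩
  have b2 := hC x hx0 a2.le
  rw [← hk] at b2
  have b3 : C * x ≤ |C| * x := by gcongr; exact le_abs_self C
  have b4 : C * x < k / 4 := by nlinarith
  have b5 : C * x ^ 2 < k / 4 * x := by nlinarith
  have b6 : 0 < k * x := by positivity
  linarith

end NearWall

end HalfSpaceStokes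

namespace HalfSpaceStokes

/-! ### Sign of the wall shear far from the support -/

section Sign

variable {d : ℕ} {f : Bdry d → ℝ} {θ : ℝ → ℝ} {t α C₀ B δ η κ c A : ℝ} {y : Bdry d} {i : Fin d}

/-- The bounds at a boundary point far from the support that decide the sign of the wall shear;
`η` measures the smallness of the error terms. -/
structure IsFar (θ : ℝ → ℝ) (f : Bdry d → ℝ) (i : Fin d) (y : Bdry d) (η c A : ℝ) : Prop where
  one_le : 1 ≤ ‖y‖
  c_pos : 0 < c
  A_nonneg : 0 ≤ A
  sub_le : ∀ v, 0 < v → |-halfInt (pd i f) v y - -halfInt (pd i f) 0 y| ≤ A * v ^ 2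
  A_lt : A < η * -halfInt (pd i f) 0 y
  low : ∀ v, 0 < v → v ≤ 2 → c * v ^ 2 ≤ halfInt (pd i f) 0 y - halfInt (pd i f) v y
  nonneg : ∀ v, 0 < v → 0 ≤ -halfInt (pd i f) v y
  abs_potC_le : ∀ t ≤ 2, ∀ x, |potC θ t 2 (pd i f) (y, x)| ≤ η * c

/-- Comparison of powers: the variation of the half-integral is `O(|y|^{-d-1})` against its value of
order at least `|y|^{-d}`, and the second-order caloric term is `O(|y|^{-d-3})` against the slope `c
|y|^{-d-2}`. Each ratio gains one power of `|y|`, which beats any prescribed `η`. -/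
theorem exists_isFar_of_le (hd : 1 ≤ d) (hθ : TimeProfile θ) (hf : IsFatBump f) (hκ : 1 < κ)
    (hη : 0 < η) (i : Fin d) : ∃ R, 1 ≤ R ∧ ∀ y : Bdry d, R ≤ ‖y‖ → ‖y‖ ≤ κ * y i →
      ∃ c A, IsFar θ f i y η c A := by
  obtain ⟨c, R, hc, hR, hb⟩ := exists_halfInt_bounds hd hf i hκ
  obtain ⟨C, hC, hs⟩ := abs_halfInt_sub_le hd (hf.toIsBump.heatDecay_pd i)
  obtain ⟨C', hC', hp⟩ := exists_abs_potC_two_le hθ hf.toIsBump i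
  refine ⟨R + (C + C') / (η * c) + 1, ?_, fun y hy hyi => ?_⟩
  · have : 0 ≤ (C + C') / (η * c) := by positivity
    linarith
  have hq : 0 ≤ (C + C') / (η * c) := by positivity
  have hy2 : 2 ≤ ‖y‖ := by linarith
  have hy0 : 0 < ‖y‖ := by linarith
  have hCy : C + C' < η * c * ‖y‖ := by
    have : (C + C') / (η * c) < ‖y‖ := by linarith
    rw [div_lt_iff₀ (by positivity)] at this
    linarith
  obtain ⟨b1, b2, b3⟩ := hb y (by linarith) hyi
  refine ⟨c / ‖y‖ ^ (d + 2), C / (1 + ‖y‖) ^ (d + 1), by linarith, by positivity, by positivity,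
    fun v hv => ?_, ?_, fun v hv hv2 => ?_, b3, fun t ht x => (hp t ht y x hy2).trans ?_⟩
  · rw [neg_sub_neg, abs_sub_comm, div_mul_eq_mul_div]
    exact hs v hv y
  · calc C / (1 + ‖y‖) ^ (d + 1) ≤ C / ‖y‖ ^ (d + 1) := by gcongr; linarith
      _ < η * (c / ‖y‖ ^ d) := by
        rw [← mul_div_assoc, div_lt_div_iff₀ (by positivity) (by positivity), pow_succ]
        have : 0 < ‖y‖ ^ d := by positivity
        nlinarith
      _ ≤ _ := by gcongr
  · rw [div_mul_eq_mul_div]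
    exact b2 v hv hv2
  · rw [← mul_div_assoc, div_le_div_iff₀ (by positivity) (by positivity), pow_succ ‖y‖ (d + 2)]
    have : 0 < ‖y‖ ^ (d + 2) := by positivity
    nlinarith

theorem exists_isFar (hd : 1 ≤ d) (hθ : TimeProfile θ) (hf : IsFatBump f) (hκ : 1 < κ)
    (hη : 0 < η) : ∃ R, 0 < R ∧ ∀ (i : Fin d) (y : Bdry d), R < ‖y‖ → ‖y‖ < κ * y i →
      ∃ c A, IsFar θ f i y η c A := by
  choose R hR h using exists_isFar_of_le hd hθ hf hκ hη
  have h0 : ∀ i ∈ Finset.univ, 0 ≤ R i := fun i _ => by linarith [hR i]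
  -- The sum over the coordinate directions gives one radius valid for all of them.
  refine ⟨1 + ∑ i, R i, by linarith [Finset.sum_nonneg h0], fun i y hy hyi => h i y ?_ hyi.le⟩
  linarith [Finset.single_le_sum h0 (Finset.mem_univ i)]

theorem IsFar.halfInt_pos (hy : IsFar θ f i y η c A) (hη : 0 < η) :
    0 < -halfInt (pd i f) 0 y :=
  pos_of_mul_pos_right (hy.A_nonneg.trans_lt hy.A_lt) hη.le

theorem IsFar.wallShear_pos (hd : 1 ≤ d) (hf : IsBump f) (h : Hump θ) (hα : 0 < α) (hα1 : α < 1)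
    (hC₀ : 0 ≤ C₀) (hH : HalfHolder θ α C₀) (hy : IsFar θ f i y η c A) (hη : 0 < η)
    (hη4 : η ≤ 1 / 4) (ht : t ≤ 1) (hθt : 0 < θ t) : 0 < wallShear θ (pd i f) t y := by
  obtain ⟨A', hr⟩ := ramp_halfInt hd (hf.heatDecay_pd i) y
  have h0 := hy.halfInt_pos hη
  rw [wallShear_eq]
  refine mul_pos (by positivity) (h.shear_pos hα hα1 hC₀ hH hr hy.sub_le ?_ hy.A_nonneg ht hθt)
  nlinarith [hy.A_lt]

theorem IsFar.abs_lag_le (h : TimeProfile θ) (hy : IsFar θ f i y η c A) (hB : 0 ≤ B)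
    (hb : ∀ s ≤ 2, |θ s| ≤ B) (ht : t < 2) :
    |lag θ (fun v => -halfInt (pd i f) v y) t| ≤ 2 * B * η * -halfInt (pd i f) 0 y := by
  refine (HalfSpaceStokes.abs_lag_le (b := 2) (B := B) two_pos
    (fun v _ => hb _ (by linarith [sq_nonneg v])) (fun v hv => h.eq_zero _ (by nlinarith))
    hy.sub_le).trans ?_
  have := mul_le_mul_of_nonneg_left hy.A_lt.le hB
  linarith

/-- When `M ≤ 0`, a positive `θ(t)` makes the lag strictly positive and hence the shear negative
even if `M = 0`. Otherwise `M` is negative by a definite amount, which exceeds the lag whatever its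
sign. -/
theorem IsFar.wallShear_neg (hd : 1 ≤ d) (hf : IsBump f) (h : Hump θ) (hα : 0 < α) (hα1 : α < 1)
    (hC₀ : 0 ≤ C₀) (hH : HalfHolder θ α C₀) (hy : IsFar θ f i y η c A) (hη : 0 < η)
    (hB : 0 ≤ B) (hb : ∀ s ≤ 2, |θ s| ≤ B) (hδ : 2 * B * η < δ) (ht : t < 2)
    (h0 : shear θ (fun _ => 1) t ≤ 0) (h1 : 0 < θ t ∨ shear θ (fun _ => 1) t ≤ -δ) :
    wallShear θ (pd i f) t y < 0 := by
  obtain ⟨A', hr⟩ := ramp_halfInt hd (hf.heatDecay_pd i) y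
  have hp := hy.halfInt_pos hη
  rw [wallShear_eq, (integrableOn_lag h.toTimeProfile hα hα1 hC₀ hH hr ht).2]
  refine mul_neg_of_pos_of_neg (by positivity) ?_
  rcases h1 with h1 | h1
  · have := h.lag_pos hα hα1 hC₀ hH hr hy.c_pos
      (fun v hv hv2 => (hy.low v hv hv2).trans_eq (by ring)) ht h1
    nlinarith
  · have := (abs_le.1 (hy.abs_lag_le h.toTimeProfile hB hb ht)).1
    nlinarith

theorem IsFar.wallShear_pos_of_lt (hd : 1 ≤ d) (hf : IsBump f) (h : TimeProfile θ) (hα : 0 < α)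
    (hα1 : α < 1) (hC₀ : 0 ≤ C₀) (hH : HalfHolder θ α C₀) (hy : IsFar θ f i y η c A) (hη : 0 < η)
    (hB : 0 ≤ B) (hb : ∀ s ≤ 2, |θ s| ≤ B) (ht : t < 2)
    (h0 : 2 * B * η < shear θ (fun _ => 1) t) : 0 < wallShear θ (pd i f) t y := by
  obtain ⟨A', hr⟩ := ramp_halfInt hd (hf.heatDecay_pd i) y
  have hp := hy.halfInt_pos hη
  rw [wallShear_eq, (integrableOn_lag h hα hα1 hC₀ hH hr ht).2]
  refine mul_pos (by positivity) ?_
  have := (abs_le.1 (hy.abs_lag_le h hB hb ht)).2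
  nlinarith

theorem continuousOn_wallShear (hd : 1 ≤ d) (hf : IsBump f) (h : TimeProfile θ) (hα : 0 < α)
    (hα1 : α < 1) (hC₀ : 0 ≤ C₀) (hH : HalfHolder θ α C₀) (y : Bdry d) (i : Fin d) :
    ContinuousOn (fun t => wallShear θ (pd i f) t y) (Iio 2) := by
  obtain ⟨A', hr⟩ := ramp_halfInt hd (hf.heatDecay_pd i) y
  simp only [wallShear_eq]
  exact continuousOn_const.mul (continuousOn_shear h hα hα1 hC₀ hH hr)

/-- The first time at which a continuous function turns negative. -/
theorem exists_first_neg {F : ℝ → ℝ} {a b : ℝ} (hF : ContinuousOn F (Icc a b)) (hab : a ≤ b)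
    (ha : 0 < F a) (hb : F b < 0) : ∃ s ∈ Ioo a b, (∀ t ∈ Icc a s, 0 ≤ F t) ∧
      ∃ τ : ℕ → ℝ, (∀ k, s < τ k ∧ τ k ≤ b ∧ F (τ k) < 0) ∧ Tendsto τ atTop (𝓝 s) := by
  set S := {t | t ∈ Icc a b ∧ F t < 0} with hS
  have hbS : b ∈ S := ⟨right_mem_Icc.2 hab, hb⟩
  have hbdd : BddBelow S := ⟨a, fun t ht => ht.1.1⟩
  have hglb : IsGLB S (sInf S) := isGLB_csInf ⟨b, hbS⟩ hbdd
  set s := sInf S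
  have has : a ≤ s := hglb.2 fun t ht => ht.1.1
  have hsb : s ≤ b := hglb.1 hbS
  have hlt : ∀ t, a ≤ t → t < s → 0 ≤ F t := fun t hat hts => by
    by_contra hn
    exact hts.not_ge (hglb.1 ⟨⟨hat, hts.le.trans hsb⟩, not_le.1 hn⟩)
  have hs0 : 0 ≤ F s := by
    rcases has.eq_or_lt with h | h
    · rw [← h]; exact ha.le
    · have hc : Tendsto F (𝓝[Ioo a s] s) (𝓝 (F s)) :=
        (hF s ⟨has, hsb⟩).mono fun t ht => ⟨ht.1.le, ht.2.le.trans hsb⟩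
      have : (𝓝[Ioo a s] s).NeBot := by
        rw [nhdsWithin_Ioo_eq_nhdsLT h]; infer_instance
      exact ge_of_tendsto hc (eventually_mem_nhdsWithin.mono fun t ht => hlt t ht.1.le ht.2)
  have hsS : s ∉ S := fun h => h.2.not_ge hs0
  obtain ⟨τ, -, h1, h2, h3⟩ := hglb.exists_seq_strictAnti_tendsto_of_notMem hsS ⟨b, hbS⟩
  refine ⟨s, ⟨has.lt_of_ne fun h => ?_, hsb.lt_of_ne fun h => ?_⟩, fun t ht => ?_, τ,
    fun k => ⟨h1 k, (h3 k).1.2, (h3 k).2⟩, h2⟩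
  · have hc : Tendsto (fun k => F (τ k)) atTop (𝓝 (F s)) :=
      (hF s ⟨has, hsb⟩).tendsto.comp (tendsto_nhdsWithin_iff.2
        ⟨h2, Eventually.of_forall fun k => (h3 k).1⟩)
    have := le_of_tendsto hc (Eventually.of_forall fun k => (h3 k).2.le)
    rw [← h] at this
    linarith
  · rw [h] at hs0; linarith
  · rcases ht.2.eq_or_lt with h | h
    · rw [h]; exact hs0
    · exact hlt t ht.1 h

end Sign

section Transfer

/-! ### Passage from the explicit solution to every solution. -/

variable {d : ℕ} {θ ψ φ : ℝ → ℝ} {t α C₀ a : ℝ} {y : Bdry d} {i : Fin d}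
  {w : ℝ → Space d → Space d}

theorem IsSpatialProfile.isFatBump (hψ : IsSpatialProfile d ψ) :
    IsFatBump fun y : Bdry d => ψ ‖y‖ where
  contDiff := hψ.contDiff
  tsupport_subset := hψ.tsupport_subset
  nonneg := hψ.nonneg
  one_le y hy := (hψ.one_lt y (by simpa using hy)).le

theorem isStokesSolution_boundaryData (hd : 1 ≤ d) (hψ : IsSpatialProfile d ψ)
    (hθ : TimeProfile θ) (hα : 0 < α) (hα1 : α < 1) (hC₀ : 0 ≤ C₀) (hH : HalfHolder θ α C₀)
    (h : ∀ t < 2, θ t = φ t) (a : ℝ) :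
    IsStokesSolution 2 (boundaryData a ψ φ) (vel a θ fun y : Bdry d => ψ ‖y‖) :=
  isStokesSolution_vel hd hθ hα hα1 hC₀ hH hψ.isFatBump.toIsBump a fun t ht y => by
    rw [boundaryData, h t ht.2]

/-- Uniqueness is used here and only here: an arbitrary solution is replaced by the explicit one, so
that constants found for the latter hold for all solutions and, by linearity, for all amplitudes. -/
theorem tangentialComponent_eq (hd : 1 ≤ d) (hψ : IsSpatialProfile d ψ)
    (hθ : TimeProfile θ) (hα : 0 < α) (hα1 : α < 1) (hC₀ : 0 ≤ C₀) (hH : HalfHolder θ α C₀)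
    (h : ∀ t < 2, θ t = φ t) (hw : IsStokesSolution 2 (boundaryData a ψ φ) w)
    (ht : t ∈ Ioo (0 : ℝ) 2) {x : ℝ} (hx : 0 < x) :
    tangentialComponent w i t (y, x) = a * solT θ (fun y : Bdry d => ψ ‖y‖) i t (y, x) := by
  have hp : ((y, x) : Space d) ∈ halfSpace d := hx
  rw [tangentialComponent, hw.eq hd (isStokesSolution_boundaryData hd hψ hθ hα hα1 hC₀ hH h a) ht
    hp, vel_of_mem hp]
  rfl

end Transfer

end HalfSpaceStokes

namespace HalfSpaceStokes

section Separation

/-! ### Separation and its absence. -/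

variable {d : ℕ} {θ ψ φ : ℝ → ℝ} {α C₀ κ : ℝ}

theorem exists_isSeparationPoint (hd : 1 ≤ d) (hψ : IsSpatialProfile d ψ) (hh : Hump θ)
    (hα : 0 < α) (hα1 : α < 1) (hC₀ : 0 ≤ C₀) (hH : HalfHolder θ α C₀)
    (h : ∀ t < 2, θ t = φ t) {t₀ t₁ : ℝ} (ht₀ : 1 < t₀) (ht₁ : t₀ < t₁) (ht₂ : t₁ < 2)
    (hpos : ∀ t ∈ Ioo (0 : ℝ) 1, 0 < φ t) (hM : ∀ t ∈ Ioo t₀ t₁, M φ t < 0) (hκ : 1 < κ) :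
    ∃ cstar : ℝ, 0 < cstar ∧
      ∀ a : ℝ, 0 < a → ∀ w : ℝ → Space d → Space d,
        IsStokesSolution 2 (boundaryData a ψ φ) w →
        ∀ (i : Fin d) (x' : Bdry d), cstar < ‖x'‖ → ‖x'‖ < κ * x' i →
          ∃ tstar ∈ Ioo 1 t₀, IsSeparationPoint (tangentialComponent w i) x' tstar ∧
            PPlus (tangentialComponent w i) x' tstar := by
  have hθ := hh.toTimeProfile
  have hf := hψ.isFatBump
  have h1 : 0 < θ 1 := by
    refine lt_of_lt_of_le ?_ (hh.mono (1 / 2) 1 (by norm_num) le_rfl)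
    rw [h _ (by norm_num)]
    exact hpos _ (by norm_num)
  have hθpos : ∀ t, 0 < t → t ≤ 1 → 0 < θ t := fun t ht ht1 => by
    rcases ht1.eq_or_lt with rfl | ht1
    · exact h1
    · rw [h t (by linarith)]; exact hpos t ⟨ht, ht1⟩
  obtain ⟨δ, hδ, hdich⟩ := hh.exists_dichotomy hα hα1 hC₀ hH h1 ht₀.le (ht₁.trans ht₂)
  obtain ⟨B, hB, hb⟩ := hθ.exists_bound 2
  have hsh0 : shear θ (fun _ => 1) t₀ ≤ 0 := by
    have hc : Tendsto (shear θ fun _ => 1) (𝓝[>] t₀) (𝓝 (shear θ (fun _ => 1) t₀)) :=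
      ((continuousOn_shear hθ hα hα1 hC₀ hH ramp_one).continuousAt
        (Iio_mem_nhds (ht₁.trans ht₂))).mono_left nhdsWithin_le_nhds
    refine le_of_tendsto hc ?_
    filter_upwards [Ioo_mem_nhdsGT ht₁] with t ht
    have := hM t ht
    rw [M_eq_shear h (ht.2.trans ht₂)] at this
    linarith
  set P := (√Real.pi)⁻¹ with hP
  have hP0 : 0 < P := by positivity
  -- Three smallness requirements: `1/4` for positivity of the shear up to time 1, `δ/(2B+1)` so
  -- that the lag cannot beat `-δ`, and `π^{-1/2} δ/16` for the second-order term at a vanishing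
  -- shear.
  obtain ⟨η, hη, hηlt⟩ := exists_between
    (show (0 : ℝ) < min (1 / 4) (min (δ / (2 * B + 1)) (P * δ / 16)) by positivity)
  obtain ⟨hη4, hηlt⟩ := lt_min_iff.1 hηlt
  obtain ⟨hηδ, hηP⟩ := lt_min_iff.1 hηlt
  rw [lt_div_iff₀ (by positivity)] at hηδ
  have hBδ : 2 * B * η < δ := by linarith
  obtain ⟨R, hR, hfar⟩ := exists_isFar hd hθ hf hκ hη
  refine ⟨R, hR, fun a ha w hw i y hyR hyκ => ?_⟩
  obtain ⟨c, A, hy⟩ := hfar i y hyR hyκ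
  set f : Bdry d → ℝ := fun y => ψ ‖y‖ with hfdef
  have hneg : ∀ t ∈ Icc 1 t₀, shear θ (fun _ => 1) t ≤ 0 → wallShear θ (pd i f) t y < 0 :=
    fun t ht hs => hy.wallShear_neg hd hf.toIsBump hh hα hα1 hC₀ hH hη hB hb hBδ
      (by linarith [ht.2]) hs ((hdich t ht).imp_left hδ.trans_le)
  obtain ⟨s, hs, hs0, τ, hτ, hτs⟩ := exists_first_neg
    ((continuousOn_wallShear hd hf.toIsBump hθ hα hα1 hC₀ hH y i).mono
      fun t (ht : t ∈ Icc 1 t₀) => ht.2.trans_lt (ht₁.trans ht₂)) ht₀.le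
    (hy.wallShear_pos hd hf.toIsBump hh hα hα1 hC₀ hH hη hη4.le le_rfl h1)
    (hneg t₀ (right_mem_Icc.2 ht₀.le) hsh0)
  have heq : ∀ t, 0 < t → t ≤ t₀ → ∀ x, 0 < x →
      tangentialComponent w i t (y, x) = a * solT θ f i t (y, x) := fun t ht htt x hx =>
    tangentialComponent_eq hd hψ hθ hα hα1 hC₀ hH h hw ⟨ht, by linarith⟩ hx
  have hplus : ∀ t, 0 < t → t ≤ s → PPlus (tangentialComponent w i) y t := by
    intro t ht hts
    have key : ∃ ε > 0, ∀ x, 0 < x → x < ε → 0 < solT θ f i t (y, x) := by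
      rcases le_or_gt t 1 with ht1 | ht1
      · exact exists_solT_pos hd hθ hα hα1 hC₀ hH (by linarith) hf.toIsBump hy.one_le
          (hy.wallShear_pos hd hf.toIsBump hh hα hα1 hC₀ hH hη hη4.le ht1 (hθpos t ht ht1))
      · have ht0 : t ∈ Icc 1 t₀ := ⟨ht1.le, hts.trans hs.2.le⟩
        have hwn := hs0 t ⟨ht1.le, hts⟩
        -- A nonnegative shear excludes the alternative `shear ≤ -δ` of the dichotomy, since that
        -- would make the shear negative; hence `θ(t)` is bounded below exactly where the
        -- second-order argument needs it.
        have hδt : δ ≤ θ t := (hdich t ht0).resolve_right fun hn =>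
          (hneg t ht0 (by linarith)).not_ge hwn
        refine exists_solT_pos_of_nonneg hd hh hα hα1 hC₀ hH hf.toIsBump ht1
          (by linarith [ht0.2]) hy.one_le (hδ.trans_le hδt) hy.c_pos hy.low hy.nonneg
          (fun x => hy.abs_potC_le t (by linarith [ht0.2]) x) ?_ hwn
        have e1 : P * δ ≤ P * θ t := by gcongr
        have e2 := mul_lt_mul_of_pos_right (show η < P * θ t / 16 by linarith) hy.c_pos
        linarith
    obtain ⟨ε, hε, hk⟩ := key
    refine ⟨ε, hε, fun x hx hxε => ?_⟩
    rw [heq t ht (by linarith [hs.2]) x hx]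
    exact mul_pos ha (hk x hx hxε)
  have hs1 := hs.1
  refine ⟨s, hs, ⟨by linarith, fun t ht hts => hplus t ht hts.le, τ, fun k => (hτ k).1, hτs,
    fun k => ?_⟩, hplus s (by linarith) le_rfl⟩
  obtain ⟨k1, k2, k3⟩ := hτ k
  obtain ⟨ε, hε, hk⟩ := exists_solT_neg hd hθ hα hα1 hC₀ hH (by linarith) hf.toIsBump hy.one_le k3
  refine ⟨ε, hε, fun x hx hxε => ?_⟩
  rw [heq _ (by linarith) k2 x hx]
  exact mul_neg_of_pos_of_neg ha (hk x hx hxε)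

theorem exists_not_isSeparationPoint (hd : 1 ≤ d) (hψ : IsSpatialProfile d ψ) (hh : Hump θ)
    (hα : 0 < α) (hα1 : α < 1) (hC₀ : 0 ≤ C₀) (hH : HalfHolder θ α C₀)
    (h : ∀ t < 2, θ t = φ t) {c₀ : ℝ} (hc₀ : 0 < c₀) (hM : ∀ t ∈ Ioo (1 : ℝ) 2, c₀ < M φ t)
    (hκ : 1 < κ) : ∃ cstar : ℝ, 0 < cstar ∧
      ∀ a : ℝ, 0 < a → ∀ w : ℝ → Space d → Space d,
        IsStokesSolution 2 (boundaryData a ψ φ) w →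
        ∀ (i : Fin d) (x' : Bdry d), cstar < ‖x'‖ → ‖x'‖ < κ * x' i →
          ∀ t ∈ Ioo (0 : ℝ) 2, ¬ IsSeparationPoint (tangentialComponent w i) x' t := by
  have hθ := hh.toTimeProfile
  have hf := hψ.isFatBump
  obtain ⟨B, hB, hb⟩ := hθ.exists_bound 2
  obtain ⟨η, hη, hηlt⟩ := exists_between
    -- The functional `M` is twice the unit shear, so the latter exceeds `c₀/2`, and `η` keeps the
    -- lag below that.
    (show (0 : ℝ) < min (1 / 4) (c₀ / 2 / (2 * B + 1)) by positivity)
  obtain ⟨hη4, hηc⟩ := lt_min_iff.1 hηlt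
  rw [lt_div_iff₀ (by positivity)] at hηc
  obtain ⟨R, hR, hfar⟩ := exists_isFar hd hθ hf hκ hη
  refine ⟨R, hR, fun a ha w hw i y hyR hyκ t ht hsep => ?_⟩
  obtain ⟨c, A, hy⟩ := hfar i y hyR hyκ
  obtain ⟨-, -, τ, hτ, hτt, hm⟩ := hsep
  set f : Bdry d → ℝ := fun y => ψ ‖y‖ with hfdef
  -- Time 1 is excluded because the bound on `M` is assumed only after it and `θ(1)` may vanish.
  -- Nonnegativity, not strict positivity, is all that holds before the profile becomes positive,
  -- where the flow is zero.
  have hnn : ∀ s ∈ Ioo (0 : ℝ) 2, s ≠ 1 →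
      ∃ ε > 0, ∀ x, 0 < x → x < ε → 0 ≤ solT θ f i s (y, x) := by
    intro s hs hs1
    have hpos : 0 < wallShear θ (pd i f) s y →
        ∃ ε > 0, ∀ x, 0 < x → x < ε → 0 ≤ solT θ f i s (y, x) := fun hws => by
      obtain ⟨ε, hε, hk⟩ := exists_solT_pos hd hθ hα hα1 hC₀ hH hs.2 hf.toIsBump hy.one_le hws
      exact ⟨ε, hε, fun x hx hxε => (hk x hx hxε).le⟩
    rcases hs1.lt_or_gt with hs1 | hs1
    · rcases (hh.nonneg hs1.le).eq_or_lt with h0 | h0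
      · refine ⟨1, one_pos, fun x _ _ => (solT_eq_zero hθ (fun r hr => ?_) i _).ge⟩
        exact le_antisymm ((hh.mono r s hr hs1.le).trans h0.ge) (hh.nonneg (hr.trans hs1.le))
      · exact hpos (hy.wallShear_pos hd hf.toIsBump hh hα hα1 hC₀ hH hη hη4.le hs1.le h0)
    · refine hpos (hy.wallShear_pos_of_lt hd hf.toIsBump hθ hα hα1 hC₀ hH hη hB hb hs.2 ?_)
      have := hM s ⟨hs1, hs.2⟩
      rw [M_eq_shear h hs.2] at this
      linarith
  -- A sequence strictly above `t` and tending to `t` eventually stays below 1 when `t < 1`, and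
  -- always exceeds 1 when `t ≥ 1`.
  have hev : ∀ᶠ k in atTop, τ k < 2 ∧ τ k ≠ 1 := by
    rcases lt_or_ge t 1 with ht1 | ht1
    · filter_upwards [hτt.eventually (gt_mem_nhds ht1)] with k hk
      exact ⟨by linarith, hk.ne⟩
    · filter_upwards [hτt.eventually (gt_mem_nhds ht.2)] with k hk
      exact ⟨hk, (ht1.trans_lt (hτ k)).ne'⟩
  obtain ⟨k, hk2, hk1⟩ := hev.exists
  have hτk : τ k ∈ Ioo (0 : ℝ) 2 := ⟨ht.1.trans (hτ k), hk2⟩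
  obtain ⟨ε, hε, hk⟩ := hnn _ hτk hk1
  obtain ⟨ε', hε', hk'⟩ := hm k
  obtain ⟨x, hx, hxε⟩ := exists_between (lt_min hε hε')
  obtain ⟨x1, x2⟩ := lt_min_iff.1 hxε
  have h1 := hk' x hx x2
  rw [tangentialComponent_eq hd hψ hθ hα hα1 hC₀ hH h hw hτk hx] at h1
  exact h1.not_ge (mul_nonneg ha.le (hk x hx x1))

end Separation

end HalfSpaceStokes

theorem theorem1p2 (d : ℕ) (hd : 1 ≤ d) (ψ φ : ℝ → ℝ)
    (hψ : IsSpatialProfile d ψ) (hφ : IsTemporalProfile φ) :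
    (∀ a : ℝ, 0 < a → ∃ w : ℝ → Space d → Space d,
      IsStokesSolution 2 (boundaryData a ψ φ) w) ∧
    (∀ t₀ t₁ : ℝ, 1 < t₀ → t₀ < t₁ → t₁ < 2 →
      (∀ t ∈ Ioo (0 : ℝ) 1, 0 < φ t) →
      (∀ t ∈ Ioo t₀ t₁, M φ t < 0) →
      ∀ κ : ℝ, 1 < κ → ∃ cstar : ℝ, 0 < cstar ∧
        ∀ a : ℝ, 0 < a → ∀ w : ℝ → Space d → Space d,
          IsStokesSolution 2 (boundaryData a ψ φ) w →
          ∀ (i : Fin d) (x' : Bdry d), cstar < ‖x'‖ → ‖x'‖ < κ * x' i →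
            ∃ tstar ∈ Ioo 1 t₀, IsSeparationPoint (tangentialComponent w i) x' tstar ∧
              PPlus (tangentialComponent w i) x' tstar) ∧
    (∀ c₀ : ℝ, 0 < c₀ → (∀ t ∈ Ioo (1 : ℝ) 2, c₀ < M φ t) →
      ∀ κ : ℝ, 1 < κ → ∃ cstar : ℝ, 0 < cstar ∧
        ∀ a : ℝ, 0 < a → ∀ w : ℝ → Space d → Space d,
          IsStokesSolution 2 (boundaryData a ψ φ) w →
          ∀ (i : Fin d) (x' : Bdry d), cstar < ‖x'‖ → ‖x'‖ < κ * x' i →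
            ∀ t ∈ Ioo (0 : ℝ) 2, ¬ IsSeparationPoint (tangentialComponent w i) x' t) := by
  obtain ⟨θ, hθ, h, α, C₀, hα, hα1, hC₀, hH⟩ := hφ.exists_extension
  have hh := hφ.hump hθ h
  refine ⟨fun a _ => ⟨_, isStokesSolution_boundaryData hd hψ hθ hα hα1 hC₀ hH h a⟩,
    fun t₀ t₁ h1 h2 h3 hpos hM κ hκ => ?_, fun c₀ hc₀ hM κ hκ => ?_⟩
  · exact exists_isSeparationPoint hd hψ hh hα hα1 hC₀ hH h h1 h2 h3 hpos hM hκ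
  · exact exists_not_isSeparationPoint hd hψ hh hα hα1 hC₀ hH h hc₀ hM hκ
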